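/- Manifolds are smooth and finite-dimensional, not necessarily Hausdorff, second countable or of constant dimension; $\mathcal S$ is the site of manifolds with the étale topology. Let $X_1\rightrightarrows X_0$ be a Lie groupoid (source $s$ and target $t$ are submersions; $xy$ is defined when $t(x)=s(y)$), and let $\mathfrak X$ be the stack over $\mathcal S$ of right $X_\bullet$-torsors: surjective submersions $P\to S$ with a smooth right action of $X_\bullet$ on $P$ along an anchor map $P\to X_0$ such that $P\times_{X_0}X_1\to P\times_S P$ is a diffeomorphism. The universal trivial torsor ($X_1$, with structure map $s$ and anchor $t$) defines the atlas $X_0\to\mathfrak X$. An *$S^1$-central extension* of $X_1\rightrightarrows X_0$ is a Lie groupoid $R_1\rightrightarrows X_0$ with a morphism of Lie groupoids $\pi:R_1\to X_1$ over $\mathrm{id}_{X_0}$ and a left $S^1$-action on $R_1$ making $\pi$ a principal $S^1$-bundle, such that $(\lambda x)(\mu y)=\lambda\mu\,(xy)$ for composable $x,y$. An isomorphism of extensions is an $S^1$-equivariant isomorphism of Lie groupoids over $X_1\rightrightarrows X_0$. An *$S^1$-gerbe* over $\mathfrak X$ is a stack $\mathfrak R$ over $\mathcal S$ with a morphism $\mathfrak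 R\to\mathfrak X$ such that $\mathfrak R\to\mathfrak X$ and $\mathfrak R\to\mathfrak R\times_{\mathfrak X}\mathfrak R$ are epimorphisms, which is locally on $\mathfrak X$ isomorphic to $BS^1\times\mathfrak X$, and which is endowed with a trivialization of its band, i.e. with isomorphisms $C^\infty(U,S^1)\cong\mathrm{Aut}_{\mathfrak R/\mathfrak X}(r)$ for all manifolds $U$ and objects $r$ of $\mathfrak R$ over $U$, compatible with all arrows of $\mathfrak R$. A *trivialization* of the restriction of $\mathfrak R$ to $X_0$ is an equivalence $BS^1\times X_0\to\mathfrak R\times_{\mathfrak X}X_0$ over $X_0$ compatible with the trivializations of the bands. An isomorphism $\mathfrak R\to\mathfrak R'$ of $S^1$-gerbes with such trivializations is an equivalence of stacks over $\mathfrak X$ (up to a given 2-isomorphism), compatible with the trivializations of the bands and, up to a 2-isomorphism over $X_0$, with the trivializations over $X_0$. **Proposition.** There is a one-to-one correspondence between isomorphism classes of $S^1$-central extensions of $X_1\rightrightarrows X_0$ and isomorphism classes of $S^1$-gerbes $\mathfrak R$ over $\mathfrak X$ endowed with a trivialization of the restriction of $\mathfrak R$ to $X_0$. Under it, the class of an extension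 $R_1\rightrightarrows X_0$ corresponds to the class of $\mathfrak R$ with its trivialization if and only if $R_1\rightrightarrows X_0$ is isomorphic to the groupoid $X_0\times_{\mathfrak R}X_0\rightrightarrows X_0$, where $X_0\to\mathfrak R$ is given by the image of the trivial $S^1$-bundle on $X_0$ under the trivialization, compatibly with the projections to $X_1=X_0\times_{\mathfrak X}X_0$ and with the $S^1$-actions, $S^1$ acting on $X_0\times_{\mathfrak R}X_0$ through the trivialization of the band. Here a map $T\to X_0\times_{\mathfrak R}X_0$ is given by an object $z$ of $\mathfrak R$ over $T$ with two arrows $a,b$ to the object $r_0$ over $X_0$ which defines $X_0\to\mathfrak R$; source, target and product are induced by $(a,b)\mapsto a$, $(a,b)\mapsto b$ and $(a,b)(b,c)=(a,c)$, and $\lambda\in C^\infty(T,S^1)$ sends $(a,b)$ to $(a\circ\lambda,b)$, where $\lambda$ is regarded as an automorphism of $z$. -/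

import Mathlib

open CategoryTheory
open scoped ContDiff

/-! ### The category of smooth manifolds -/

/-- A smooth manifold: a topological space with a smooth atlas of charts onto open subsets of
Euclidean spaces. It need be neither Hausdorff nor second countable, and its dimension may vary
from one component to another. -/
structure Mfd : Type 1 where
  carrier : Type
  [top : TopologicalSpace carrier]
  charts : Set (Σ n : ℕ, OpenPartialHomeomorph carrier (EuclideanSpace ℝ (Fin n)))
  exists_chart : ∀ x : carrier, ∃ c ∈ charts, x ∈ c.2.source
  compat : ∀ c ∈ charts, ∀ d ∈ charts,
    ContDiffOn ℝ ∞ (d.2 ∘ c.2.symm) (c.2.symm.trans d.2).source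

namespace Mfd

instance : CoeSort Mfd Type := ⟨Mfd.carrier⟩

instance (M : Mfd) : TopologicalSpace M := M.top

/-- A map of manifolds is smooth if it is continuous and smooth in charts. -/
def Smooth {M N : Mfd} (f : M → N) : Prop :=
  Continuous f ∧ ∀ x : M, ∀ c ∈ M.charts, x ∈ c.2.source → ∀ d ∈ N.charts, f x ∈ d.2.source →
    ContDiffAt ℝ ∞ (d.2 ∘ f ∘ c.2.symm) (c.2 x)

theorem smooth_id (M : Mfd) : Smooth (fun x : M => x) := by
  refine ⟨continuous_id, fun x c hc hx d hd hd' => ?_⟩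
  refine (M.compat c hc d hd).contDiffAt ((c.2.symm.trans d.2).open_source.mem_nhds ?_)
  simp only [OpenPartialHomeomorph.trans_source, OpenPartialHomeomorph.symm_source,
    Set.mem_inter_iff, Set.mem_preimage]
  exact ⟨c.2.map_source hx, by rwa [c.2.left_inv hx]⟩

theorem Smooth.comp {M N L : Mfd} {g : N → L} {f : M → N} (hg : Smooth g) (hf : Smooth f) :
    Smooth (fun x => g (f x)) := by
  refine ⟨hg.1.comp hf.1, fun x c hc hx e he hex => ?_⟩
  obtain ⟨d, hd, hdx⟩ := N.exists_chart (f x)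
  have h1 := hf.2 x c hc hx d hd hdx
  have h2 := hg.2 (f x) d hd hdx e he hex
  have h3 : (d.2 ∘ f ∘ c.2.symm) (c.2 x) = d.2 (f x) := by simp [c.2.left_inv hx]
  rw [← h3] at h2
  refine (h2.comp _ h1).congr_of_eventuallyEq ?_
  have hc' : ContinuousAt (f ∘ c.2.symm) (c.2 x) :=
    hf.1.continuousAt.comp (c.2.continuousAt_symm (c.2.map_source hx))
  have : ∀ᶠ v in nhds (c.2 x), (f ∘ c.2.symm) v ∈ d.2.source :=
    hc' (d.2.open_source.mem_nhds (by simpa [c.2.left_inv hx] using hdx))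
  filter_upwards [this] with v hv
  simp only [Function.comp_apply] at hv ⊢
  rw [d.2.left_inv hv]

/-- Smooth maps. -/
@[ext]
structure Hom (M N : Mfd) where
  toFun : M → N
  smooth : Smooth toFun

instance : Category Mfd where
  Hom := Hom
  id M := ⟨fun x => x, smooth_id M⟩
  comp f g := ⟨fun x => g.toFun (f.toFun x), g.smooth.comp f.smooth⟩

instance (M N : Mfd) : FunLike (Hom M N) M N where
  coe := Hom.toFun
  coe_injective _ _ h := Hom.ext h

instance : ConcreteCategory Mfd Hom where
  hom f := f
  ofHom f := f

theorem smooth_coe {M N : Mfd} (f : M ⟶ N) : Smooth (fun x : M => f x) := Hom.smooth f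

/-- A submersion: the derivative is surjective at every point. -/
def IsSubmersion {M N : Mfd} (f : M ⟶ N) : Prop :=
  ∀ x : M, ∀ c ∈ M.charts, x ∈ c.2.source → ∀ d ∈ N.charts, f x ∈ d.2.source →
    Function.Surjective (fderiv ℝ (fun v => d.2 (f (c.2.symm v))) (c.2 x))

/-- An étale map: the derivative is bijective at every point. -/
def IsEtale {M N : Mfd} (f : M ⟶ N) : Prop :=
  ∀ x : M, ∀ c ∈ M.charts, x ∈ c.2.source → ∀ d ∈ N.charts, f x ∈ d.2.source →
    Function.Bijective (fderiv ℝ (fun v => d.2 (f (c.2.symm v))) (c.2 x))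

/-- A surjective submersion. -/
def IsSurjSubmersion {M N : Mfd} (f : M ⟶ N) : Prop :=
  IsSubmersion f ∧ Function.Surjective f

/-- A covering family: étale maps which are jointly surjective. -/
def IsCover {ι : Type} {X : Mfd} {U : ι → Mfd} (u : ∀ i, U i ⟶ X) : Prop :=
  (∀ i, IsEtale (u i)) ∧ ∀ x : X, ∃ i, ∃ y : U i, u i y = x

/-- The group of smooth maps from a manifold to the circle (smoothness is tested after the
embedding of the circle in the complex plane). -/
def smoothCircle (U : Mfd) : Subgroup (U → Circle) where
  carrier := {l | ∀ x : U, ∀ c ∈ U.charts, x ∈ c.2.source →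
    ContDiffAt ℝ ∞ (fun v => (l (c.2.symm v) : ℂ)) (c.2 x)}
  one_mem' := fun x c _ _ => by simpa using contDiffAt_const
  mul_mem' := fun {a b} ha hb x c hc hx => by
    simpa using (ha x c hc hx).mul (hb x c hc hx)
  inv_mem' := fun {a} ha x c hc hx => by
    have := Complex.conjCLE.contDiff (n := ∞) |>.contDiffAt.comp _ (ha x c hc hx)
    have h : (fun v => ((a⁻¹) (c.2.symm v) : ℂ)) =
        Complex.conjCLE ∘ fun v => (a (c.2.symm v) : ℂ) := by
      funext v
      exact Circle.coe_inv_eq_conj _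
    rw [h]
    exact this

/-- Pullback of circle-valued functions. -/
def smoothCircle.pullback {V U : Mfd} (f : V ⟶ U) (l : smoothCircle U) : smoothCircle V :=
  ⟨fun x => l.1 (f x), fun x c hc hx => by
    obtain ⟨d, hd, hdx⟩ := U.exists_chart (f x)
    have h1 := (smooth_coe f).2 x c hc hx d hd hdx
    have h2 := l.2 (f x) d hd hdx
    have h3 : (d.2 ∘ (fun x => f x) ∘ c.2.symm) (c.2 x) = d.2 (f x) := by
      simp [c.2.left_inv hx]
    rw [← h3] at h2
    refine (h2.comp _ h1).congr_of_eventuallyEq ?_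
    have hc' : ContinuousAt ((fun x => f x) ∘ c.2.symm) (c.2 x) :=
      (smooth_coe f).1.continuousAt.comp (c.2.continuousAt_symm (c.2.map_source hx))
    have : ∀ᶠ v in nhds (c.2 x), ((fun x => f x) ∘ c.2.symm) v ∈ d.2.source :=
      hc' (d.2.open_source.mem_nhds (by simpa [c.2.left_inv hx] using hdx))
    filter_upwards [this] with v hv
    simp only [Function.comp_apply] at hv ⊢
    rw [d.2.left_inv hv]⟩

end Mfd

open Mfd

/-! ### Lie groupoids and their torsors -/

/-- A Lie groupoid `arr ⇉ M`: a groupoid object in manifolds whose source and target maps are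
submersions. The product `mul g h` is defined when `tgt g = src h`; it is smooth on the manifold
of composable pairs, i.e. on all smooth families of composable pairs. -/
structure LieGroupoid (M : Mfd) where
  arr : Mfd
  src : arr ⟶ M
  tgt : arr ⟶ M
  one : M ⟶ arr
  inv : arr ⟶ arr
  mul : ∀ g h : arr, tgt g = src h → arr
  src_submersion : IsSubmersion src
  tgt_submersion : IsSubmersion tgt
  smooth_mul : ∀ (T : Mfd) (g h : T ⟶ arr) (w : ∀ x, tgt (g x) = src (h x)),
    Smooth fun x => mul (g x) (h x) (w x)
  src_one : ∀ x, src (one x) = x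
  tgt_one : ∀ x, tgt (one x) = x
  src_inv : ∀ g, src (inv g) = tgt g
  tgt_inv : ∀ g, tgt (inv g) = src g
  src_mul : ∀ g h w, src (mul g h w) = src g
  tgt_mul : ∀ g h w, tgt (mul g h w) = tgt h
  one_mul : ∀ g, mul (one (src g)) g (tgt_one _) = g
  mul_one : ∀ g, mul g (one (tgt g)) (src_one _).symm = g
  mul_inv : ∀ g, mul g (inv g) (src_inv g).symm = one (src g)
  inv_mul : ∀ g, mul (inv g) g (tgt_inv g) = one (tgt g)
  mul_assoc : ∀ g h k (w : tgt g = src h) (w' : tgt h = src k),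
    mul (mul g h w) k ((tgt_mul g h w).trans w') = mul g (mul h k w') (w.trans (src_mul h k w').symm)

/-- A (right) `Γ`-torsor: a surjective submersion `proj : total ⟶ base` with a smooth action of
`Γ` along `anchor : total ⟶ M`, simply transitive on the fibres of `proj`, such that the element
of `Γ` carrying one point of a fibre to another depends smoothly on the two points (in other
words `total ×_M Γ → total ×_base total` is a diffeomorphism). -/
structure LieTorsor {M : Mfd} (Γ : LieGroupoid M) where
  base : Mfd
  total : Mfd
  proj : total ⟶ base
  anchor : total ⟶ M
  act : ∀ (p : total) (g : Γ.arr), anchor p = Γ.src g → total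
  proj_surjSubmersion : IsSurjSubmersion proj
  smooth_act : ∀ (T : Mfd) (p : T ⟶ total) (g : T ⟶ Γ.arr) (w : ∀ x, anchor (p x) = Γ.src (g x)),
    Smooth fun x => act (p x) (g x) (w x)
  proj_act : ∀ p g w, proj (act p g w) = proj p
  anchor_act : ∀ p g w, anchor (act p g w) = Γ.tgt g
  act_one : ∀ p, act p (Γ.one (anchor p)) (Γ.src_one _).symm = p
  act_mul : ∀ p g h (w : anchor p = Γ.src g) (w' : Γ.tgt g = Γ.src h),
    act (act p g w) h ((anchor_act p g w).trans w') =
      act p (Γ.mul g h w') (w.trans (Γ.src_mul g h w').symm)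
  simply_transitive : ∀ p p', proj p = proj p' → ∃! g, ∃ w, act p g w = p'
  smooth_div : ∀ (T : Mfd) (p p' : T ⟶ total) (d : T → Γ.arr),
    (∀ x, ∃ w, act (p x) (d x) w = p' x) → Smooth d

namespace LieTorsor

variable {M : Mfd} {Γ : LieGroupoid M}

/-- A morphism of torsors: a commutative square with equivariant upper row. -/
@[ext]
structure Hom (P Q : LieTorsor Γ) where
  base : P.base ⟶ Q.base
  total : P.total ⟶ Q.total
  proj_total : ∀ p, Q.proj (total p) = base (P.proj p)
  anchor_total : ∀ p, Q.anchor (total p) = P.anchor p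
  total_act : ∀ p g w, total (P.act p g w) = Q.act (total p) g ((anchor_total p).trans w)

instance : Category (LieTorsor Γ) where
  Hom := Hom
  id P := ⟨𝟙 _, 𝟙 _, fun _ => rfl, fun _ => rfl, fun _ _ _ => rfl⟩
  comp {P Q R} f g :=
    { base := f.base ≫ g.base
      total := f.total ≫ g.total
      proj_total := fun p => by
        simp only [ConcreteCategory.comp_apply, g.proj_total, f.proj_total]
      anchor_total := fun p => by
        simp only [ConcreteCategory.comp_apply, g.anchor_total, f.anchor_total]
      total_act := fun p x w => by
        simp only [ConcreteCategory.comp_apply, f.total_act, g.total_act] }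

variable (Γ) in
/-- The stack of `Γ`-torsors, as a category over the category of manifolds. -/
abbrev stack : BasedCategory.{0, 1} Mfd where
  obj := LieTorsor Γ
  p := { obj := LieTorsor.base, map := LieTorsor.Hom.base }

end LieTorsor

theorem LieGroupoid.div_eq {M : Mfd} (Γ : LieGroupoid M) {p p' d : Γ.arr} (w : Γ.tgt p = Γ.src d)
    (h : Γ.mul p d w = p') (w' : Γ.tgt (Γ.inv p) = Γ.src p') : d = Γ.mul (Γ.inv p) p' w' := by
  subst h
  rw [← Γ.mul_assoc _ _ _ (Γ.tgt_inv p) w]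
  have : ∀ q (hq : q = Γ.one (Γ.tgt p)) (v : Γ.tgt q = Γ.src d), Γ.mul q d v = d := by
    rintro q rfl v
    have : ∀ y (hy : y = Γ.src d) (v : Γ.tgt (Γ.one y) = Γ.src d), Γ.mul (Γ.one y) d v = d := by
      rintro y rfl v
      exact Γ.one_mul d
    exact this _ w v
  exact (this _ (Γ.inv_mul p) _).symm

/-- The universal trivial torsor over the manifold of objects: the manifold of arrows, with the
source as structure map and the target as anchor. It is the canonical atlas of the stack of
torsors. -/
abbrev LieGroupoid.universalTorsor {M : Mfd} (Γ : LieGroupoid M) : LieTorsor Γ where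
  base := M
  total := Γ.arr
  proj := Γ.src
  anchor := Γ.tgt
  act := Γ.mul
  proj_surjSubmersion := ⟨Γ.src_submersion, fun x => ⟨Γ.one x, Γ.src_one x⟩⟩
  smooth_act := Γ.smooth_mul
  proj_act := Γ.src_mul
  anchor_act := Γ.tgt_mul
  act_one := Γ.mul_one
  act_mul := fun p g h w w' => Γ.mul_assoc p g h w w'
  simply_transitive := fun p p' h => by
    have w' : Γ.tgt (Γ.inv p) = Γ.src p' := (Γ.tgt_inv p).trans h
    have w : Γ.tgt p = Γ.src (Γ.mul (Γ.inv p) p' w') := by rw [Γ.src_mul, Γ.src_inv]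
    refine ⟨Γ.mul (Γ.inv p) p' w', ⟨w, ?_⟩, fun g ⟨v, hg⟩ => Γ.div_eq v hg w'⟩
    rw [← Γ.mul_assoc _ _ _ (Γ.src_inv p).symm w']
    have : ∀ q (hq : q = Γ.one (Γ.src p)) (v : Γ.tgt q = Γ.src p'), Γ.mul q p' v = p' := by
      rintro q rfl v
      have : ∀ y (hy : y = Γ.src p') (v : Γ.tgt (Γ.one y) = Γ.src p'),
          Γ.mul (Γ.one y) p' v = p' := by
        rintro y rfl v
        exact Γ.one_mul p'
      exact this _ h v
    exact this _ (Γ.mul_inv p) _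
  smooth_div := fun T p p' d hd => by
    have w' : ∀ x, Γ.tgt (Γ.inv (p x)) = Γ.src (p' x) := fun x => by
      obtain ⟨w, h⟩ := hd x
      rw [← h, Γ.src_mul, Γ.tgt_inv]
    have : d = fun x => Γ.mul ((p ≫ Γ.inv) x) (p' x) (w' x) := by
      funext x
      obtain ⟨w, h⟩ := hd x
      exact Γ.div_eq w h (w' x)
    rw [this]
    exact Γ.smooth_mul T (p ≫ Γ.inv) p' w'

/-! ### Principal circle bundles -/

/-- The structure of a (left) principal `S¹`-bundle on a map `π`: `π` is a surjective submersion
and `S¹` acts smoothly and simply transitively on its fibres, the element of `S¹` carrying one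
point of a fibre to another depending smoothly on the two points. -/
structure PrincipalCircle {P B : Mfd} (π : P ⟶ B) where
  smul : Circle → P → P
  one_smul : ∀ p, smul 1 p = p
  mul_smul : ∀ a b p, smul (a * b) p = smul a (smul b p)
  proj_smul : ∀ a p, π (smul a p) = π p
  surjSubmersion : IsSurjSubmersion π
  smooth_smul : ∀ (T : Mfd) (l : smoothCircle T) (p : T ⟶ P),
    Smooth fun x => smul (l.1 x) (p x)
  simply_transitive : ∀ p p', π p = π p' → ∃! a, smul a p = p'
  smooth_div : ∀ (T : Mfd) (p p' : T ⟶ P) (l : T → Circle),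
    (∀ x, smul (l x) (p x) = p' x) → l ∈ smoothCircle T

/-- An object of `BS¹`: a principal `S¹`-bundle over a manifold. -/
structure CircleBundle where
  base : Mfd
  total : Mfd
  proj : total ⟶ base
  principal : PrincipalCircle proj

namespace CircleBundle

/-- A morphism of `BS¹`: a commutative square with `S¹`-equivariant upper row. -/
@[ext]
structure Hom (P Q : CircleBundle) where
  base : P.base ⟶ Q.base
  total : P.total ⟶ Q.total
  proj_total : ∀ p, Q.proj (total p) = base (P.proj p)
  total_smul : ∀ a p, total (P.principal.smul a p) = Q.principal.smul a (total p)

instance : Category CircleBundle where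
  Hom := Hom
  id P := ⟨𝟙 _, 𝟙 _, fun _ => rfl, fun _ _ => rfl⟩
  comp {P Q R} f g :=
    { base := f.base ≫ g.base
      total := f.total ≫ g.total
      proj_total := fun p => by
        simp only [ConcreteCategory.comp_apply, g.proj_total, f.proj_total]
      total_smul := fun a p => by
        simp only [ConcreteCategory.comp_apply, f.total_smul, g.total_smul] }

/-- The projection `BS¹ → manifolds`. -/
def toMfd : CircleBundle ⥤ Mfd where
  obj := CircleBundle.base
  map := CircleBundle.Hom.base

/-- The automorphism `p ↦ l(proj p) p` of a principal bundle given by a smooth map `l` from its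
base to `S¹`. -/
def gauge (P : CircleBundle) (l : smoothCircle P.base) : P ⟶ P where
  base := 𝟙 _
  total := ⟨fun p => P.principal.smul (l.1 (P.proj p)) p,
    P.principal.smooth_smul P.total (smoothCircle.pullback P.proj l) (𝟙 _)⟩
  proj_total := fun p => P.principal.proj_smul _ p
  total_smul := fun a p => by
    change P.principal.smul (l.1 (P.proj (P.principal.smul a p))) (P.principal.smul a p) =
      P.principal.smul a (P.principal.smul (l.1 (P.proj p)) p)
    rw [P.principal.proj_smul, ← P.principal.mul_smul, ← P.principal.mul_smul, mul_comm]

end CircleBundle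

/-- The projection `BS¹ × U → U`; manifolds over `U` are the objects of the stack `U`. -/
abbrev circleTimesProj (U : Mfd) : CostructuredArrow CircleBundle.toMfd U ⥤ Over U where
  obj B := Over.mk B.hom
  map f := Over.homMk (CircleBundle.toMfd.map f.left) (CostructuredArrow.w f)

/-- The stack `BS¹ × U` over the manifold `U`: its objects are pairs of a principal `S¹`-bundle
over a manifold `S` and a smooth map `S ⟶ U`. -/
abbrev circleTimes (U : Mfd) : BasedCategory.{0, 1} (Over U) where
  obj := CostructuredArrow CircleBundle.toMfd U
  p := circleTimesProj U

/-- The action of `S¹`-valued functions on the objects of `BS¹ × U`. -/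
def circleTimes.gauge {U : Mfd} (B : CostructuredArrow CircleBundle.toMfd U)
    (l : smoothCircle B.left.base) : B ⟶ B :=
  CostructuredArrow.homMk (CircleBundle.gauge B.left l) (Category.id_comp _)

/-! ### Stacks over the site of manifolds -/

/-- Categories fibered in groupoids: pullbacks exist, and every arrow has the unique lifting
property of a pullback. -/
structure IsFiberedInGroupoids (𝒳 : BasedCategory.{0, 1} Mfd) : Prop where
  exists_pullback : ∀ (x : 𝒳.obj) (V : Mfd) (f : V ⟶ 𝒳.p.obj x),
    ∃ (y : 𝒳.obj) (φ : y ⟶ x), 𝒳.p.IsHomLift f φ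
  cartesian : ∀ {x y : 𝒳.obj} (φ : y ⟶ x), 𝒳.p.IsStronglyCartesian (𝒳.p.map φ) φ

/-- Stacks over the site of manifolds with its étale topology. An isomorphism from `x|V` to `y|V`
is the same as an arrow from a pullback of `x` to `y`; conditions and data on the overlaps
`U i ×_X U j` are expressed on all manifolds mapping to the overlaps. -/
structure IsStack (𝒳 : BasedCategory.{0, 1} Mfd) : Prop extends IsFiberedInGroupoids 𝒳 where
  /-- isomorphisms which agree locally are equal -/
  separated : ∀ {ι : Type} {x y : 𝒳.obj} (φ ψ : x ⟶ y) (z : ι → 𝒳.obj) (e : ∀ i, z i ⟶ x),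
    IsCover (fun i => 𝒳.p.map (e i)) → 𝒳.p.IsHomLift (𝟙 (𝒳.p.obj x)) φ →
    𝒳.p.IsHomLift (𝟙 (𝒳.p.obj x)) ψ → (∀ i, e i ≫ φ = e i ≫ ψ) → φ = ψ
  /-- local isomorphisms `φ i : x|U i → y|U i` which agree on overlaps glue -/
  glue_hom : ∀ {ι : Type} {x y : 𝒳.obj} (h : 𝒳.p.obj x = 𝒳.p.obj y) (z : ι → 𝒳.obj)
    (e : ∀ i, z i ⟶ x) (φ : ∀ i, z i ⟶ y),
    IsCover (fun i => 𝒳.p.map (e i)) →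
    (∀ i, 𝒳.p.map (φ i) = 𝒳.p.map (e i) ≫ eqToHom h) →
    (∀ i j (t : 𝒳.obj) (a : t ⟶ z i) (b : t ⟶ z j), a ≫ e i = b ≫ e j → a ≫ φ i = b ≫ φ j) →
    ∃ ψ : x ⟶ y, 𝒳.p.IsHomLift (𝟙 (𝒳.p.obj x)) ψ ∧ ∀ i, e i ≫ ψ = φ i
  /-- objects `x i` over the members of a covering family of `X` glue along gluing data: `θ i j`
  transports an arrow to `x i` to an arrow to `x j`, over each manifold mapping to the overlap,
  compatibly with pullback and satisfying the cocycle condition -/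
  glue_obj : ∀ {ι : Type} (X : Mfd) (x : ι → 𝒳.obj) (u : ∀ i, 𝒳.p.obj (x i) ⟶ X), IsCover u →
    ∀ θ : ∀ (i j : ι) (t : 𝒳.obj) (a : t ⟶ x i) (b : 𝒳.p.obj t ⟶ 𝒳.p.obj (x j)),
      𝒳.p.map a ≫ u i = b ≫ u j → (t ⟶ x j),
    ∀ lift : ∀ i j t a b w, 𝒳.p.map (θ i j t a b w) = b,
    (∀ i j t t' (c : t' ⟶ t) (a : t ⟶ x i) b w w',
      θ i j t' (c ≫ a) (𝒳.p.map c ≫ b) w' = c ≫ θ i j t a b w) →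
    (∀ i j k t (a : t ⟶ x i) b c w w',
      θ j k t (θ i j t a b w) c (by rw [lift, ← w, w']) = θ i k t a c w') →
    ∃ (y : 𝒳.obj) (e : ∀ i, x i ⟶ y), 𝒳.p.obj y = X ∧ (∀ i, 𝒳.p.IsHomLift (u i) (e i)) ∧
      ∀ i j t (a : t ⟶ x i) b w, θ i j t a b w ≫ e j = a ≫ e i

/-- Epimorphisms of categories fibered in groupoids: after pullback along a surjective
submersion, every object of the target comes from the source. -/
def IsEpimorphism {𝒳 𝒴 : BasedCategory.{0, 1} Mfd} (F : 𝒳 ⥤ᵇ 𝒴) : Prop :=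
  ∀ y : 𝒴.obj, ∃ (x : 𝒳.obj) (φ : F.obj x ⟶ y), IsSurjSubmersion (𝒴.p.map φ)

/-- The (2-)fibered product: objects are triples of an object `x` of `𝒳`, an object `y` of `𝒴`
over the same manifold, and an isomorphism `F x ≅ G y` over the identity. -/
abbrev fiberedProduct {𝒳 𝒴 𝒵 : BasedCategory.{0, 1} Mfd} (F : 𝒳 ⥤ᵇ 𝒵) (G : 𝒴 ⥤ᵇ 𝒵) :
    BasedCategory.{0, 1} Mfd where
  obj := ObjectProperty.FullSubcategory
    fun c : Comma F.toFunctor G.toFunctor =>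
      IsIso c.hom ∧ 𝒵.p.IsHomLift (𝟙 (𝒳.p.obj c.left)) c.hom
  p := (ObjectProperty.ι _ ⋙ Comma.fst _ _ ⋙ 𝒳.p)

/-- The diagonal `𝒳 → 𝒳 ×_𝒴 𝒳`. -/
def diagonal {𝒳 𝒴 : BasedCategory.{0, 1} Mfd} (F : 𝒳 ⥤ᵇ 𝒴) : 𝒳 ⥤ᵇ fiberedProduct F F where
  toFunctor := ObjectProperty.lift _
    { obj := fun x => { left := x, right := x, hom := 𝟙 _ }
      map := fun f => { left := f, right := f, w := by simp } }
    (fun x => ⟨IsIso.id (F.obj x), IsHomLift.id (F.w_obj x)⟩)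
  w := rfl

/-- The projection to `U` of the restriction of `ℛ → 𝒳` to `U`. -/
abbrev restrictionProj {ℛ 𝒳 : BasedCategory.{0, 1} Mfd} (F : ℛ ⥤ᵇ 𝒳) (x : 𝒳.obj) :
    CostructuredArrow F.toFunctor x ⥤ Over (𝒳.p.obj x) where
  obj a := Over.mk (𝒳.p.map a.hom)
  map f := Over.homMk (𝒳.p.map (F.map f.left)) (by
    have := CostructuredArrow.w f
    simp only [Over.mk_hom, ← Functor.map_comp]
    rw [this])
  map_id a := by ext1; simp
  map_comp f g := by ext1; simp

/-- The restriction of `ℛ → 𝒳` to a manifold `U`, along the morphism `U → 𝒳` given by an object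
`x` of `𝒳` over `U`. This is the fibered product of `ℛ` and `U` over `𝒳`: an object over
`f : S ⟶ U` is an object `r` of `ℛ` over `S` with an isomorphism from `F r` to the pullback of `x`
by `f`, i.e. with an arrow `F r ⟶ x` over `f`. -/
abbrev restriction {ℛ 𝒳 : BasedCategory.{0, 1} Mfd} (F : ℛ ⥤ᵇ 𝒳) (x : 𝒳.obj) :
    BasedCategory.{0, 1} (Over (𝒳.p.obj x)) where
  obj := CostructuredArrow F.toFunctor x
  p := restrictionProj F x

theorem restriction_base_eq {ℛ 𝒳 : BasedCategory.{0, 1} Mfd} {F : ℛ ⥤ᵇ 𝒳} {x : 𝒳.obj}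
    (Θ : circleTimes (𝒳.p.obj x) ⥤ᵇ restriction F x)
    (B : CostructuredArrow CircleBundle.toMfd (𝒳.p.obj x)) :
    ℛ.p.obj (Θ.obj B).left = B.left.base :=
  (F.w_obj _).symm.trans (congrArg (fun o : Over (𝒳.p.obj x) => o.left) (Θ.w_obj B))

/-! ### Circle gerbes -/

/-- An `S¹`-gerbe over `𝒳`. -/
structure CircleGerbe (𝒳 : BasedCategory.{0, 1} Mfd) where
  stk : BasedCategory.{0, 1} Mfd
  map : stk ⥤ᵇ 𝒳
  isStack : IsStack stk
  epi : IsEpimorphism map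
  diagonal_epi : IsEpimorphism (diagonal map)
  /-- locally on `𝒳` the gerbe is isomorphic to `BS¹ × 𝒳` -/
  locally_trivial : ∀ x : 𝒳.obj, ∃ (y : 𝒳.obj) (φ : y ⟶ x), IsSurjSubmersion (𝒳.p.map φ) ∧
    ∃ Θ : circleTimes (𝒳.p.obj y) ⥤ᵇ restriction map y, Θ.toFunctor.IsEquivalence
  /-- the trivialization of the band: an identification of the sheaf of groups of smooth maps to
  `S¹` with the sheaf of automorphisms over `𝒳` of each object `r` of the gerbe, compatible with
  all arrows of the gerbe -/
  band : ∀ r : stk.obj, smoothCircle (stk.p.obj r) →* Aut r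
  band_injective : ∀ r, Function.Injective (band r)
  mem_range_band : ∀ (r : stk.obj) (α : Aut r), α ∈ (band r).range ↔ map.map α.hom = 𝟙 (map.obj r)
  band_natural : ∀ {r r' : stk.obj} (ρ : r ⟶ r') (l : smoothCircle (stk.p.obj r')),
    ρ ≫ (band r' l).hom = (band r (smoothCircle.pullback (stk.p.map ρ) l)).hom ≫ ρ

/-- An `S¹`-gerbe over the stack of `X`-torsors with a trivialization of its restriction to the
manifold of objects `M`: an isomorphism over `M` of `S¹`-gerbes (so, compatible with the
trivializations of the bands) from `BS¹ × M` to the restriction. -/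
structure TrivializedGerbe {M : Mfd} (X : LieGroupoid M) extends
    CircleGerbe (LieTorsor.stack X) where
  triv : circleTimes M ⥤ᵇ restriction map X.universalTorsor
  triv_equivalence : triv.toFunctor.IsEquivalence
  triv_band : ∀ (B : CostructuredArrow CircleBundle.toMfd M) (l : smoothCircle B.left.base),
    (triv.map (circleTimes.gauge B l)).left =
      (band (triv.obj B).left
        (smoothCircle.pullback (eqToHom (restriction_base_eq (F := map) (x := X.universalTorsor) triv B)) l)).hom

/-- The functor between restrictions induced by a morphism `K` over `𝒳`. -/
def restrictionMap {ℛ ℛ' 𝒳 : BasedCategory.{0, 1} Mfd} {F : ℛ ⥤ᵇ 𝒳} {F' : ℛ' ⥤ᵇ 𝒳}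
    (K : ℛ ⥤ᵇ ℛ') (κ : K.comp F' ≅ F) (x : 𝒳.obj) :
    CostructuredArrow F.toFunctor x ⥤ CostructuredArrow F'.toFunctor x where
  obj a := CostructuredArrow.mk (Y := K.obj a.left) (κ.hom.toNatTrans.app a.left ≫ a.hom)
  map {a b} f := CostructuredArrow.homMk (K.map f.left) (by
    have h := κ.hom.toNatTrans.naturality f.left
    have w := CostructuredArrow.w f
    exact (Category.assoc _ _ _).symm.trans ((congrArg (· ≫ b.hom) h).trans
      ((Category.assoc _ _ _).trans (congrArg (κ.hom.toNatTrans.app a.left ≫ ·) w))))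

/-- An isomorphism of `S¹`-gerbes with trivializations: an equivalence `K` of stacks over the
stack of `X`-torsors (up to the 2-isomorphism `κ`), compatible with the trivializations of the
bands and, up to the 2-isomorphism `δ` over `M`, with the trivializations over `M`. -/
structure TrivializedGerbe.Iso {M : Mfd} {X : LieGroupoid M} (G G' : TrivializedGerbe X) where
  K : G.stk ⥤ᵇ G'.stk
  equivalence : K.toFunctor.IsEquivalence
  κ : K.comp G'.map ≅ G.map
  band : ∀ (r : G.stk.obj) (l : smoothCircle (G.stk.p.obj r)),
    K.map (G.band r l).hom =
      (G'.band (K.obj r) (smoothCircle.pullback (eqToHom (K.w_obj r)) l)).hom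
  δ : G.triv.toFunctor ⋙ restrictionMap K κ X.universalTorsor ≅ G'.triv.toFunctor
  δ_base : ∀ B : CostructuredArrow CircleBundle.toMfd M,
    G'.stk.p.IsHomLift (𝟙 B.left.base) (δ.hom.app B).left

/-- Isomorphism classes of `S¹`-gerbes with a trivialization over the manifold of objects. -/
def GerbeClass {M : Mfd} (X : LieGroupoid M) : Type 2 :=
  Quot fun G G' : TrivializedGerbe X => Nonempty (G.Iso G')

/-! ### Central extensions -/

/-- An `S¹`-central extension of the Lie groupoid `X`. -/
structure CentralExtension {M : Mfd} (X : LieGroupoid M) where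
  grpd : LieGroupoid M
  π : grpd.arr ⟶ X.arr
  src_π : ∀ g, X.src (π g) = grpd.src g
  tgt_π : ∀ g, X.tgt (π g) = grpd.tgt g
  π_mul : ∀ g h (w : grpd.tgt g = grpd.src h),
    π (grpd.mul g h w) = X.mul (π g) (π h) ((tgt_π g).trans (w.trans (src_π h).symm))
  principal : PrincipalCircle π
  smul_mul_smul : ∀ (a b : Circle) g h (w : grpd.tgt g = grpd.src h)
    (w' : grpd.tgt (principal.smul a g) = grpd.src (principal.smul b h)),
    grpd.mul (principal.smul a g) (principal.smul b h) w' =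
      principal.smul (a * b) (grpd.mul g h w)

/-- An isomorphism of `S¹`-central extensions of `X`: an `S¹`-equivariant isomorphism of Lie
groupoids over `X`. -/
structure CentralExtension.Iso {M : Mfd} {X : LieGroupoid M} (E E' : CentralExtension X) where
  iso : E.grpd.arr ≅ E'.grpd.arr
  π_iso : ∀ g, E'.π (iso.hom g) = E.π g
  iso_smul : ∀ a g, iso.hom (E.principal.smul a g) = E'.principal.smul a (iso.hom g)
  iso_mul : ∀ g h (w : E.grpd.tgt g = E.grpd.src h)
    (w' : E'.grpd.tgt (iso.hom g) = E'.grpd.src (iso.hom h)),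
    iso.hom (E.grpd.mul g h w) = E'.grpd.mul (iso.hom g) (iso.hom h) w'

/-- Isomorphism classes of `S¹`-central extensions of `X`. -/
def ExtensionClass {M : Mfd} (X : LieGroupoid M) : Type 1 :=
  Quot fun E E' : CentralExtension X => Nonempty (E.Iso E')

/-! ### The correspondence -/

/-- The map from the base of an object of the restriction of a gerbe to `M`, to `M`. -/
def TrivializedGerbe.toObjects {M : Mfd} {X : LieGroupoid M} (G : TrivializedGerbe X)
    (a : CostructuredArrow G.map.toFunctor X.universalTorsor) : G.stk.p.obj a.left ⟶ M :=
  eqToHom (G.map.w_obj a.left).symm ≫ (LieTorsor.stack X).p.map a.hom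

/-- The central extension `E` is the one given by the gerbe `ℛ` with its trivialization, i.e.
`E.arr` is the fibered product `M ×_ℛ M`, where the morphism `M → ℛ` is the section of the
restriction of `ℛ` to `M` that corresponds to the trivial `S¹`-bundle on `M`. A morphism
`T ⟶ M ×_ℛ M` is given by an object `z` of `ℛ` over `T` and two arrows `a`, `b` from `z` to the
object of `ℛ` over `M` that defines `M → ℛ`; the corresponding morphism `T ⟶ E.arr` is `Ψ a b`. -/
structure Association {M : Mfd} {X : LieGroupoid M} (E : CentralExtension X)
    (G : TrivializedGerbe X) where
  /-- the trivial `S¹`-bundle on `M` (with base identified with `M`) -/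
  B : CostructuredArrow CircleBundle.toMfd M
  isIso_B : IsIso B.hom
  sec : B.left.base ⟶ B.left.total
  sec_proj : sec ≫ B.left.proj = 𝟙 _
  Ψ : ∀ {z : G.stk.obj} (_ _ : z ⟶ (G.triv.obj B).left), G.stk.p.obj z ⟶ E.grpd.arr
  src_Ψ : ∀ {z} (a b : z ⟶ (G.triv.obj B).left),
    Ψ a b ≫ E.grpd.src = G.stk.p.map a ≫ G.toObjects (G.triv.obj B)
  tgt_Ψ : ∀ {z} (a b : z ⟶ (G.triv.obj B).left),
    Ψ a b ≫ E.grpd.tgt = G.stk.p.map b ≫ G.toObjects (G.triv.obj B)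
  natural : ∀ {z z'} (c : z' ⟶ z) (a b : z ⟶ (G.triv.obj B).left),
    Ψ (c ≫ a) (c ≫ b) = G.stk.p.map c ≫ Ψ a b
  bijective : ∀ {z} (a : z ⟶ (G.triv.obj B).left) (g : G.stk.p.obj z ⟶ E.grpd.arr),
    g ≫ E.grpd.src = G.stk.p.map a ≫ G.toObjects (G.triv.obj B) → ∃! b, Ψ a b = g
  /-- the groupoid structure is the one of `M ×_ℛ M` -/
  mul_Ψ : ∀ {z} (a b c : z ⟶ (G.triv.obj B).left) (x : G.stk.p.obj z),
    ∃ w, E.grpd.mul (Ψ a b x) (Ψ b c x) w = Ψ a c x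
  /-- the projection to `X.arr = M ×_𝔛 M` is induced by the morphism from the gerbe to the stack
  `𝔛` of `X`-torsors -/
  π_Ψ : ∀ {z} (a b : z ⟶ (G.triv.obj B).left) (q : (G.map.obj z).total),
    ∃ w, X.mul (E.π (Ψ a b (eqToHom (G.map.w_obj z) ((G.map.obj z).proj q))))
        (LieTorsor.Hom.total (G.map.map b ≫ (G.triv.obj B).hom) q) w =
      LieTorsor.Hom.total (G.map.map a ≫ (G.triv.obj B).hom) q
  /-- the action of `S¹` is induced by the trivialization of the band -/
  smul_Ψ : ∀ {z} (a b : z ⟶ (G.triv.obj B).left) (l : smoothCircle (G.stk.p.obj z))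
    (x : G.stk.p.obj z),
    Ψ ((G.band z l).hom ≫ a) b x = E.principal.smul (l.1 x) (Ψ a b x)

/-! From an extension to a gerbe. An extension `E` of `X` has a gerbe of liftings of `X`-torsors to
`E`. An object (`LiftDatum`) is an `X`-torsor `Q` over a base `B`, a covering `V` of `B` with a map
`σ` to `Q`, and a cocycle `c` on `V ×_B V` with values in `E` whose projection is the arrow carrying
`σ v` to `σ v'`. This is a torsor under `E` written in local data. In this form the objects lie over
`X`-torsors by construction, and no quotient by the circle has to be formed. Arrows are torsor maps
with a comparison function `h` that is compatible with the cocycles on both sides. Descent for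
torsors and for the cocycles gives the stack property (`LiftDatum.isStack`). Since the circle acts
centrally and simply transitively on the fibres of the projection, automorphisms over the identity
are circle-valued functions (`LiftDatum.exists_gauge`). Liftings of pullbacks of a torsor with a
section are the same as circle bundles (`LiftDatum.trivialization_isEquivalence`). Applied to the
universal torsor and its units, this is the trivialization over `M`; applied to a torsor pulled back
to its own total space, it is local triviality. From a gerbe to an extension. Let `r₀` be the object
over `M` given by the trivial bundle. Pull `r₀` back along the source map to the manifold of arrows
of `X`, and compare it with the trivialization along the target map. The result is a circle bundle
over the arrows of `X` (`StrictGerbe.exists_relative_bundle`), and its total space represents pairs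
of arrows to `r₀` (`StrictGerbe.nonempty_rep`). The rule `(a, b)(b, c) = (a, c)` turns it into a
central extension (`StrictGerbe.Rep.extension`). Hence every gerbe is associated with some
extension. The relation of association is a bijection on classes for the following reasons. Two
extensions associated with one gerbe represent the same functor, hence are isomorphic
(`StrictGerbe.Assoc.nonempty_iso`). A gerbe associated with `E` is isomorphic to the gerbe of
liftings to `E` (`StrictGerbe.Assoc.gerbeIso`): cover an object by one with an arrow to `r₀`; on
overlaps two such arrows form a pair, so they give a cocycle in `E`, and the object yields a
lifting. This comparison respects the bands, and a morphism of banded gerbes is an equivalence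
(`StrictGerbe.isEquivalence_of_band`). The relation is invariant under isomorphisms on both sides
(`StrictGerbe.Assoc.ofIso`, `StrictGerbe.exists_assoc_of_iso`), and `E` is associated with its own
gerbe (`CentralExtension.association`). The differential geometry is reduced to three facts: a map
is a submersion exactly when it has smooth local sections through every point; submersions have base
changes along arbitrary smooth maps (`Mfd.pb`); smoothness descends along jointly surjective
submersions (`Mfd.Smooth.descend`). Functions defined by arbitrary choices are proved smooth by
pulling back to a fibre product on which the chosen point varies smoothly, after showing that the
choice does not matter. -/

/-! ### Smoothness at a point -/

namespace Mfd

open TopologicalSpace Topology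

/-- Bundle a smooth function as a morphism of manifolds. -/
def homMk {M N : Mfd} (f : M → N) (hf : Smooth f) : M ⟶ N := Hom.mk f hf

@[simp]
theorem homMk_apply {M N : Mfd} (f : M → N) (hf : Smooth f) (x : M) : homMk f hf x = f x := rfl

theorem hom_ext {M N : Mfd} {f g : M ⟶ N} (h : ∀ x, f x = g x) : f = g :=
  ConcreteCategory.hom_ext _ _ h

/-- Smoothness at a point: continuity there, and `C^∞` regularity in charts there. -/
def SmoothAt {M N : Mfd} (f : M → N) (x : M) : Prop :=
  ContinuousAt f x ∧ ∀ c ∈ M.charts, x ∈ c.2.source → ∀ d ∈ N.charts, f x ∈ d.2.source →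
    ContDiffAt ℝ ∞ (d.2 ∘ f ∘ c.2.symm) (c.2 x)

theorem smooth_iff {M N : Mfd} {f : M → N} : Smooth f ↔ ∀ x, SmoothAt f x :=
  ⟨fun h x => ⟨h.1.continuousAt, h.2 x⟩,
    fun h => ⟨continuous_iff_continuousAt.2 fun x => (h x).1, fun x => (h x).2⟩⟩

theorem SmoothAt.congr {M N : Mfd} {f g : M → N} {x : M} (hf : SmoothAt f x)
    (h : g =ᶠ[𝓝 x] f) : SmoothAt g x := by
  refine ⟨hf.1.congr h.symm, fun c hc hx d hd hd' => ?_⟩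
  rw [h.eq_of_nhds] at hd'
  refine (hf.2 c hc hx d hd hd').congr_of_eventuallyEq ?_
  have h1 : Filter.Tendsto c.2.symm (𝓝 (c.2 x)) (𝓝 x) := by
    have := c.2.continuousAt_symm (c.2.map_source hx)
    rwa [ContinuousAt, c.2.left_inv hx] at this
  filter_upwards [h1.eventually h] with v hv
  simp [hv]

theorem contDiffAt_chart_change {M : Mfd} {x : M}
    {c d : Σ n : ℕ, OpenPartialHomeomorph M (EuclideanSpace ℝ (Fin n))}
    (hc : c ∈ M.charts) (hx : x ∈ c.2.source) (hd : d ∈ M.charts) (hd' : x ∈ d.2.source) :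
    ContDiffAt ℝ ∞ (d.2 ∘ c.2.symm) (c.2 x) := by
  refine (M.compat c hc d hd).contDiffAt ((c.2.symm.trans d.2).open_source.mem_nhds ?_)
  simp only [OpenPartialHomeomorph.trans_source, OpenPartialHomeomorph.symm_source,
    Set.mem_inter_iff, Set.mem_preimage]
  exact ⟨c.2.map_source hx, by rwa [c.2.left_inv hx]⟩

theorem tendsto_chart_symm {M : Mfd} {x : M}
    {c : Σ n : ℕ, OpenPartialHomeomorph M (EuclideanSpace ℝ (Fin n))} (hx : x ∈ c.2.source) :
    Filter.Tendsto c.2.symm (𝓝 (c.2 x)) (𝓝 x) := by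
  have := c.2.continuousAt_symm (c.2.map_source hx)
  rwa [ContinuousAt, c.2.left_inv hx] at this

/-- Smoothness at a point may be tested in a single pair of charts. -/
theorem SmoothAt.of_chart {M N : Mfd} {f : M → N} {x : M} (hcont : ContinuousAt f x)
    {c : Σ n : ℕ, OpenPartialHomeomorph M (EuclideanSpace ℝ (Fin n))}
    (hc : c ∈ M.charts) (hx : x ∈ c.2.source)
    {d : Σ n : ℕ, OpenPartialHomeomorph N (EuclideanSpace ℝ (Fin n))}
    (hd : d ∈ N.charts) (hd' : f x ∈ d.2.source)
    (h : ContDiffAt ℝ ∞ (d.2 ∘ f ∘ c.2.symm) (c.2 x)) : SmoothAt f x := by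
  refine ⟨hcont, fun c' hc' hx' d' hd1 hd2 => ?_⟩
  have h1 := contDiffAt_chart_change hc' hx' hc hx
  have h2 := contDiffAt_chart_change hd hd' hd1 hd2
  have e1 : (c.2 ∘ c'.2.symm) (c'.2 x) = c.2 x := by simp [c'.2.left_inv hx']
  have e2 : (d.2 ∘ f ∘ c.2.symm) (c.2 x) = d.2 (f x) := by simp [c.2.left_inv hx]
  rw [← e2] at h2
  have h3 := h2.comp _ h
  rw [← e1] at h3
  refine (h3.comp _ h1).congr_of_eventuallyEq ?_
  have t1 := tendsto_chart_symm hx'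
  filter_upwards [t1.eventually (c.2.open_source.mem_nhds hx),
    (hcont.tendsto.comp t1).eventually (d.2.open_source.mem_nhds hd')] with v hv hv'
  simp only [Function.comp_apply] at hv hv' ⊢
  rw [c.2.left_inv hv, d.2.left_inv hv']

theorem SmoothAt.comp {M N L : Mfd} {g : N → L} {f : M → N} {x : M} (hg : SmoothAt g (f x))
    (hf : SmoothAt f x) : SmoothAt (fun x => g (f x)) x := by
  obtain ⟨c, hc, hcx⟩ := M.exists_chart x
  obtain ⟨d, hd, hdx⟩ := N.exists_chart (f x)
  obtain ⟨e, he, hex⟩ := L.exists_chart (g (f x))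
  have h1 := hf.2 c hc hcx d hd hdx
  have h2 := hg.2 d hd hdx e he hex
  have h3 : (d.2 ∘ f ∘ c.2.symm) (c.2 x) = d.2 (f x) := by simp [c.2.left_inv hcx]
  rw [← h3] at h2
  refine SmoothAt.of_chart (ContinuousAt.comp hg.1 hf.1) hc hcx he hex
    ((h2.comp _ h1).congr_of_eventuallyEq ?_)
  filter_upwards [(hf.1.tendsto.comp (tendsto_chart_symm hcx)).eventually
    (d.2.open_source.mem_nhds hdx)] with v hv
  simp only [Function.comp_apply] at hv ⊢
  rw [d.2.left_inv hv]

theorem smoothAt_coe {M N : Mfd} (f : M ⟶ N) (x : M) : SmoothAt (fun x => f x) x :=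
  smooth_iff.1 (smooth_coe f) x

theorem continuous_coe {M N : Mfd} (f : M ⟶ N) : Continuous (fun x => f x) := (smooth_coe f).1

theorem smooth_const (M : Mfd) {N : Mfd} (y : N) : Smooth (fun _ : M => y) :=
  ⟨continuous_const, fun _ _ _ _ _ _ _ => by
    simp only [Function.comp_def]; exact contDiffAt_const⟩

/-! ### Open submanifolds -/

/-- An open subset of a manifold, as a manifold. -/
abbrev restrict (M : Mfd) (U : Opens M) : Mfd where
  carrier := U
  charts := {c | ∃ (h : Nonempty U) (c₀ : _) (_ : c₀ ∈ M.charts),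
    c = ⟨c₀.1, c₀.2.subtypeRestr h⟩}
  exists_chart x := by
    obtain ⟨c, hc, hx⟩ := M.exists_chart x.1
    exact ⟨_, ⟨⟨x⟩, c, hc, rfl⟩, by simpa [OpenPartialHomeomorph.subtypeRestr_source] using hx⟩
  compat := by
    rintro _ ⟨h, c, hc, rfl⟩ _ ⟨_, d, hd, rfl⟩
    refine (M.compat c hc d hd).congr_mono ?_ ?_
    · intro v hv
      simp only [OpenPartialHomeomorph.trans_source, OpenPartialHomeomorph.symm_source] at hv
      simp only [Function.comp_apply, OpenPartialHomeomorph.subtypeRestr_coe,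
        Set.domRestrict_apply]
      congr 1
      have := OpenPartialHomeomorph.subtypeRestr_symm_eqOn (e := c.2) h hv.1
      exact this.symm
    · intro v hv
      simp only [OpenPartialHomeomorph.trans_source, OpenPartialHomeomorph.symm_source,
        Set.mem_inter_iff, Set.mem_preimage] at hv ⊢
      have h1 := OpenPartialHomeomorph.subtypeRestr_symm_eqOn (e := c.2) h hv.1
      simp only [Function.comp_apply] at h1
      refine ⟨OpenPartialHomeomorph.subtypeRestr_target_subset (e := c.2) h hv.1, ?_⟩
      rw [h1]
      have := hv.2
      rwa [OpenPartialHomeomorph.subtypeRestr_source] at this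

/-- The inclusion of an open submanifold. -/
def incl {M : Mfd} (U : Opens M) : M.restrict U → M := fun x => x.1

theorem exists_restrict_chart {M : Mfd} {U : Opens M} (x : M.restrict U) :
    ∃ (h : Nonempty U) (c : _) (_ : c ∈ M.charts), incl U x ∈ c.2.source ∧
      x ∈ (c.2.subtypeRestr h).source := by
  obtain ⟨c, hc, hx⟩ := M.exists_chart x.1
  exact ⟨⟨x⟩, c, hc, hx, by rw [OpenPartialHomeomorph.subtypeRestr_source]; exact hx⟩

theorem continuous_incl {M : Mfd} (U : Opens M) : Continuous (incl U) := continuous_subtype_val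

/-- The inclusion is an open embedding, so it carries neighbourhoods to neighbourhoods, and the
inverse of a restricted chart agrees with the inverse of the original chart on the smaller target.
-/
theorem smoothAt_incl_comp_iff {M N : Mfd} {U : Opens M} {f : M → N} {x : M.restrict U} :
    SmoothAt (fun y => f (incl U y)) x ↔ SmoothAt f (incl U x) := by
  have hopen : Filter.map (incl U) (𝓝 x) = 𝓝 (incl U x) :=
    (U.isOpen.isOpenEmbedding_subtypeVal).map_nhds_eq x
  obtain ⟨h, c, hc, hx, hx'⟩ := exists_restrict_chart x
  have key : (incl U ∘ (c.2.subtypeRestr h).symm) =ᶠ[𝓝 (c.2 (incl U x))] c.2.symm := by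
    filter_upwards [(c.2.subtypeRestr h).open_target.mem_nhds
      ((c.2.subtypeRestr h).map_source hx')] with v hv
    exact (OpenPartialHomeomorph.subtypeRestr_symm_eqOn (e := c.2) h hv).symm
  constructor
  · intro hf
    have hcont : ContinuousAt f (incl U x) := by
      rw [ContinuousAt, ← hopen, Filter.tendsto_map'_iff]; exact hf.1
    obtain ⟨d, hd, hdx⟩ := N.exists_chart (f (incl U x))
    refine SmoothAt.of_chart hcont hc hx hd hdx ?_
    refine (hf.2 _ ⟨h, c, hc, rfl⟩ hx' d hd hdx).congr_of_eventuallyEq ?_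
    change _ =ᶠ[𝓝 (c.2 (incl U x))] _
    filter_upwards [key] with v hv
    exact (congrArg (fun y => d.2 (f y)) hv).symm
  · intro hf
    obtain ⟨d, hd, hdx⟩ := N.exists_chart (f (incl U x))
    refine SmoothAt.of_chart (c := ⟨c.1, c.2.subtypeRestr h⟩)
      (ContinuousAt.comp hf.1 (continuous_incl U).continuousAt) ⟨h, c, hc, rfl⟩ hx' hd hdx ?_
    refine (hf.2 c hc hx d hd hdx).congr_of_eventuallyEq ?_
    filter_upwards [key] with v hv
    exact congrArg (fun y => d.2 (f y)) hv

theorem smoothAt_incl {M : Mfd} {U : Opens M} (x : M.restrict U) : SmoothAt (incl U) x :=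
  smoothAt_incl_comp_iff.2 (smooth_iff.1 (smooth_id M) _)

theorem SmoothAt.of_incl {M N : Mfd} {U : Opens N} {f : M → N.restrict U} {x : M}
    (hf : SmoothAt (fun y => incl U (f y)) x) : SmoothAt f x := by
  have hcont : ContinuousAt f x := (IsInducing.continuousAt_iff (f := f) .subtypeVal).2 hf.1
  obtain ⟨c, hc, hcx⟩ := M.exists_chart x
  obtain ⟨h, d, hd, hdx, hdx'⟩ := exists_restrict_chart (f x)
  exact SmoothAt.of_chart (d := ⟨d.1, d.2.subtypeRestr h⟩) hcont hc hcx ⟨h, d, hd, rfl⟩ hdx'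
    (hf.2 c hc hcx d hd hdx)

/-- The inclusion of an open submanifold, as a morphism. -/
def inclHom {M : Mfd} (U : Opens M) : M.restrict U ⟶ M :=
  homMk (incl U) (smooth_iff.2 smoothAt_incl)

/-- Smoothness is local on the source. -/
theorem Smooth.of_local {M N : Mfd} {f : M → N}
    (h : ∀ x, ∃ U : Opens M, x ∈ U ∧ Smooth (fun y : M.restrict U => f y.1)) : Smooth f := by
  refine smooth_iff.2 fun x => ?_
  obtain ⟨U, hx, hU⟩ := h x
  exact smoothAt_incl_comp_iff.1 (smooth_iff.1 hU ⟨x, hx⟩)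

theorem smooth_restrict {M N : Mfd} {U : Opens M} {f : M → N} (h : ∀ x ∈ U, SmoothAt f x) :
    Smooth (fun y : M.restrict U => f y.1) :=
  smooth_iff.2 fun x => smoothAt_incl_comp_iff.2 (h x.1 x.2)

theorem Smooth.of_incl {M N : Mfd} {U : Opens N} {f : M → N.restrict U}
    (hf : Smooth (fun y => incl U (f y))) : Smooth f :=
  smooth_iff.2 fun x => .of_incl (smooth_iff.1 hf x)

/-! ### Vector spaces and products -/

section Vec

variable (E : Type) [NormedAddCommGroup E] [NormedSpace ℝ E] [FiniteDimensional ℝ E]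

/-- The chart of a finite-dimensional vector space. -/
noncomputable def vecChart : Σ n : ℕ, OpenPartialHomeomorph E (EuclideanSpace ℝ (Fin n)) :=
  ⟨_, (toEuclidean (E := E)).toHomeomorph.toOpenPartialHomeomorph⟩

/-- A finite-dimensional vector space, as a manifold. -/
abbrev vec : Mfd where
  carrier := E
  charts := {vecChart E}
  exists_chart x := ⟨_, rfl, trivial⟩
  compat := by
    rintro _ rfl _ rfl
    exact ((toEuclidean (E := E)).contDiff.comp (toEuclidean (E := E)).symm.contDiff).contDiffOn

variable {E}

/-- The single chart of a vector space is a linear isomorphism, which can be removed. Continuity is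
not needed on the right-hand side: it follows by composing with the chart of `M`. -/
theorem smoothAt_to_vec {M : Mfd} {f : M → vec E} {x : M}
    {c : Σ n : ℕ, OpenPartialHomeomorph M (EuclideanSpace ℝ (Fin n))}
    (hc : c ∈ M.charts) (hx : x ∈ c.2.source) :
    SmoothAt f x ↔ ContDiffAt ℝ ∞ (fun v => (f (c.2.symm v) : E)) (c.2 x) := by
  constructor
  · intro h
    have := h.2 c hc hx (vecChart E) rfl trivial
    have h2 := (toEuclidean (E := E)).symm.contDiff (n := ∞) |>.contDiffAt.comp _ this
    refine h2.congr_of_eventuallyEq (.of_forall fun v => ?_)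
    exact ((toEuclidean (E := E)).symm_apply_apply _).symm
  · intro h
    refine SmoothAt.of_chart ?_ hc hx (d := vecChart E) rfl trivial
      ((toEuclidean (E := E)).contDiff (n := ∞) |>.contDiffAt.comp _ h)
    have h1 : ContinuousAt (fun y => (f (c.2.symm (c.2 y)) : E)) x :=
      ContinuousAt.comp (f := c.2) (g := fun v => (f (c.2.symm v) : E)) h.continuousAt
        (c.2.continuousAt hx)
    refine h1.congr ?_
    filter_upwards [c.2.open_source.mem_nhds hx] with y hy
    rw [c.2.left_inv hy]

theorem smoothAt_vec_iff {F : Type} [NormedAddCommGroup F] [NormedSpace ℝ F]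
    [FiniteDimensional ℝ F] {f : E → F} {x : E} :
    SmoothAt (M := vec E) (N := vec F) f x ↔ ContDiffAt ℝ ∞ f x := by
  rw [smoothAt_to_vec (M := vec E) (c := vecChart E) rfl trivial]
  constructor
  · intro h
    have h' : ContDiffAt ℝ ∞ (f ∘ (toEuclidean (E := E)).symm) (toEuclidean (E := E) x) := h
    refine (h'.comp x (toEuclidean (E := E)).contDiff.contDiffAt).congr_of_eventuallyEq
      (.of_forall fun v => ?_)
    exact congrArg f ((toEuclidean (E := E)).symm_apply_apply _).symm
  · intro h
    have e : (toEuclidean (E := E)).symm (toEuclidean (E := E) x) = x :=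
      (toEuclidean (E := E)).symm_apply_apply _
    rw [← e] at h
    exact h.comp (toEuclidean (E := E) x) (toEuclidean (E := E)).symm.contDiff.contDiffAt

end Vec

theorem smoothAt_chart {M : Mfd} {c : Σ n : ℕ, OpenPartialHomeomorph M (EuclideanSpace ℝ (Fin n))}
    (hc : c ∈ M.charts) {x : M} (hx : x ∈ c.2.source) :
    SmoothAt (N := vec (EuclideanSpace ℝ (Fin c.1))) c.2 x := by
  refine (smoothAt_to_vec hc hx).2 (contDiffAt_id.congr_of_eventuallyEq ?_)
  filter_upwards [c.2.open_target.mem_nhds (c.2.map_source hx)] with v hv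
  exact c.2.right_inv hv

theorem smoothAt_chart_symm {M : Mfd}
    {c : Σ n : ℕ, OpenPartialHomeomorph M (EuclideanSpace ℝ (Fin n))}
    (hc : c ∈ M.charts) {v : EuclideanSpace ℝ (Fin c.1)} (hv : v ∈ c.2.target) :
    SmoothAt (M := vec (EuclideanSpace ℝ (Fin c.1))) c.2.symm v := by
  refine SmoothAt.of_chart (M := vec (EuclideanSpace ℝ (Fin c.1))) (c.2.continuousAt_symm hv)
    (c := vecChart _) rfl trivial hc (c.2.map_target hv) ?_
  refine ((toEuclidean (E := EuclideanSpace ℝ (Fin c.1))).symm.contDiff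
    (n := ∞)).contDiffAt.congr_of_eventuallyEq ?_
  have hcont : ContinuousAt (toEuclidean (E := EuclideanSpace ℝ (Fin c.1))).symm
      (toEuclidean v) := (toEuclidean (E := EuclideanSpace ℝ (Fin c.1))).symm.continuous.continuousAt
  rw [ContinuousAt, ContinuousLinearEquiv.symm_apply_apply] at hcont
  filter_upwards [hcont.eventually (c.2.open_target.mem_nhds hv)] with w hw
  exact c.2.right_inv hw

/-- The chart of a product of manifolds given by charts of the factors. -/
noncomputable def prodChart {M N : Mfd}
    (c : Σ n : ℕ, OpenPartialHomeomorph M (EuclideanSpace ℝ (Fin n)))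
    (d : Σ n : ℕ, OpenPartialHomeomorph N (EuclideanSpace ℝ (Fin n))) :
    Σ n : ℕ, OpenPartialHomeomorph (M × N) (EuclideanSpace ℝ (Fin n)) :=
  ⟨_, (c.2.prod d.2).trans
    (vecChart (EuclideanSpace ℝ (Fin c.1) × EuclideanSpace ℝ (Fin d.1))).2⟩

/-- The product of two manifolds. -/
abbrev prod (M N : Mfd) : Mfd where
  carrier := M × N
  charts := {e | ∃ c ∈ M.charts, ∃ d ∈ N.charts, e = prodChart c d}
  exists_chart x := by
    obtain ⟨c, hc, hx⟩ := M.exists_chart x.1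
    obtain ⟨d, hd, hx'⟩ := N.exists_chart x.2
    exact ⟨_, ⟨c, hc, d, hd, rfl⟩, ⟨⟨hx, hx'⟩, trivial⟩⟩
  compat := by
    rintro _ ⟨c, hc, d, hd, rfl⟩ _ ⟨c', hc', d', hd', rfl⟩
    have h1 := (M.compat c hc c' hc').prodMap (N.compat d hd d' hd')
    refine (toEuclidean (E := EuclideanSpace ℝ (Fin c'.1) ×
      EuclideanSpace ℝ (Fin d'.1))).contDiff.comp_contDiffOn (h1.comp
      (toEuclidean (E := EuclideanSpace ℝ (Fin c.1) ×
        EuclideanSpace ℝ (Fin d.1))).symm.contDiff.contDiffOn ?_)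
    rintro v hv
    obtain ⟨⟨-, hv1⟩, ⟨hv2, -⟩⟩ := hv
    exact ⟨⟨hv1.1, hv2.1⟩, ⟨hv1.2, hv2.2⟩⟩

theorem smoothAt_prod_iff {M N L : Mfd} {f : L → M.prod N} {x : L} :
    SmoothAt f x ↔ SmoothAt (fun y => (f y).1) x ∧ SmoothAt (fun y => (f y).2) x := by
  obtain ⟨b, hb, hbx⟩ := L.exists_chart x
  obtain ⟨c, hc, hcx⟩ := M.exists_chart (f x).1
  obtain ⟨d, hd, hdx⟩ := N.exists_chart (f x).2
  constructor
  · intro h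
    have h0 := h.2 b hb hbx (prodChart c d) ⟨c, hc, d, hd, rfl⟩ ⟨⟨hcx, hdx⟩, trivial⟩
    have h1 := (toEuclidean (E := EuclideanSpace ℝ (Fin c.1) ×
      EuclideanSpace ℝ (Fin d.1))).symm.contDiff (n := ∞) |>.contDiffAt.comp _ h0
    constructor
    · refine SmoothAt.of_chart (continuousAt_fst.comp (f := f) h.1) hb hbx hc hcx ?_
      refine (contDiffAt_fst.comp _ h1).congr_of_eventuallyEq (.of_forall fun v => ?_)
      exact congrArg Prod.fst ((toEuclidean (E := EuclideanSpace ℝ (Fin c.1) ×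
        EuclideanSpace ℝ (Fin d.1))).symm_apply_apply
        (c.2 (f (b.2.symm v)).1, d.2 (f (b.2.symm v)).2)).symm
    · refine SmoothAt.of_chart (continuousAt_snd.comp (f := f) h.1) hb hbx hd hdx ?_
      refine (contDiffAt_snd.comp _ h1).congr_of_eventuallyEq (.of_forall fun v => ?_)
      exact congrArg Prod.snd ((toEuclidean (E := EuclideanSpace ℝ (Fin c.1) ×
        EuclideanSpace ℝ (Fin d.1))).symm_apply_apply
        (c.2 (f (b.2.symm v)).1, d.2 (f (b.2.symm v)).2)).symm
  · rintro ⟨h1, h2⟩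
    refine SmoothAt.of_chart (h1.1.prodMk h2.1) hb hbx (d := prodChart c d)
      ⟨c, hc, d, hd, rfl⟩ ⟨⟨hcx, hdx⟩, trivial⟩ ?_
    exact (toEuclidean (E := EuclideanSpace ℝ (Fin c.1) ×
      EuclideanSpace ℝ (Fin d.1))).contDiff (n := ∞) |>.contDiffAt.comp _
      ((h1.2 b hb hbx c hc hcx).prodMk (h2.2 b hb hbx d hd hdx))

theorem smoothAt_fst {M N : Mfd} (x : M.prod N) : SmoothAt (M := M.prod N) Prod.fst x :=
  (smoothAt_prod_iff.1 (smooth_iff.1 (smooth_id _) x)).1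

theorem smoothAt_snd {M N : Mfd} (x : M.prod N) : SmoothAt (M := M.prod N) Prod.snd x :=
  (smoothAt_prod_iff.1 (smooth_iff.1 (smooth_id _) x)).2

/-! ### The inverse function theorem and the local form of submersions -/

/-- The inverse function theorem, with a smooth inverse on the whole target. -/
theorem exists_localDiffeo {E F : Type*} [NormedAddCommGroup E] [NormedSpace ℝ E]
    [CompleteSpace E] [NormedAddCommGroup F] [NormedSpace ℝ F] [CompleteSpace F] {G : E → F}
    {O : Set E} (hO : IsOpen O) (hG : ∀ y ∈ O, ContDiffAt ℝ ∞ G y) {x : E} (hx : x ∈ O)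
    (hbij : Function.Bijective (fderiv ℝ G x)) :
    ∃ e : OpenPartialHomeomorph E F, x ∈ e.source ∧ e.source ⊆ O ∧ (∀ y, e y = G y) ∧
      ∀ y ∈ e.target, ContDiffAt ℝ ∞ e.symm y := by
  have hne : (∞ : WithTop ℕ∞) ≠ 0 := by simp
  let L : E ≃L[ℝ] F := ContinuousLinearEquiv.ofBijective (fderiv ℝ G x)
    (LinearMap.ker_eq_bot.2 hbij.1) (LinearMap.range_eq_top.2 hbij.2)
  have hL : HasFDerivAt G (L : E →L[ℝ] F) x := ((hG x hx).differentiableAt hne).hasFDerivAt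
  let e := (hG x hx).toOpenPartialHomeomorph G hL hne
  -- Invertible linear maps form an open set, so the derivative stays invertible near `x`.
  -- Restricting the source to such a neighbourhood makes the inverse smooth on the whole target,
  -- not only at the image of `x`.
  have hcont : ContinuousAt (fderiv ℝ G) x :=
    ((hG x hx).fderiv_right (m := 0) (by simp)).continuousAt
  have hnh : {y | fderiv ℝ G y ∈ Set.range ((↑) : (E ≃L[ℝ] F) → E →L[ℝ] F)} ∈ 𝓝 x :=
    hcont (by
      have := ContinuousLinearEquiv.nhds L
      exact this)
  obtain ⟨W, hW, hWo, hxW⟩ := mem_nhds_iff.1 hnh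
  refine ⟨e.restrOpen (O ∩ W) (hO.inter hWo), ⟨(hG x hx).mem_toOpenPartialHomeomorph_source hL hne,
    hx, hxW⟩, fun y hy => hy.2.1, fun y => rfl, fun y hy => ?_⟩
  have hy' := (e.restrOpen (O ∩ W) (hO.inter hWo)).map_target hy
  obtain ⟨L', hL'⟩ := hW hy'.2.2
  refine (e.restrOpen (O ∩ W) (hO.inter hWo)).contDiffAt_symm hy (f₀' := L') ?_ (hG _ hy'.2.1)
  rw [hL']
  exact ((hG _ hy'.2.1).differentiableAt hne).hasFDerivAt

/-- The map `(F, P)` where `P` projects to the kernel of the derivative of `F` has bijective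
derivative. -/
theorem exists_complement {E F : Type*} [NormedAddCommGroup E] [NormedSpace ℝ E]
    [FiniteDimensional ℝ E] [NormedAddCommGroup F] [NormedSpace ℝ F] (L : E →L[ℝ] F)
    (hL : Function.Surjective L) :
    ∃ (n : ℕ) (P : E →L[ℝ] EuclideanSpace ℝ (Fin n)), Function.Bijective (L.prod P) ∧
      (Function.Injective L → n = 0) := by
  -- A continuous projection to the kernel of `L`, to be read in Euclidean coordinates: `n` is the
  -- dimension of the kernel, and so vanishes when `L` is injective.
  obtain ⟨P₀, hP₀⟩ := Submodule.ClosedComplemented.of_finiteDimensional (L : E →ₗ[ℝ] F).ker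
  refine ⟨_, (toEuclidean (E := (L : E →ₗ[ℝ] F).ker)).toContinuousLinearMap ∘L P₀, ⟨?_, ?_⟩, ?_⟩
  · intro x y h
    obtain ⟨h1, h2⟩ := Prod.ext_iff.1 h
    have h2 : P₀ x = P₀ y := (toEuclidean (E := (L : E →ₗ[ℝ] F).ker)).injective h2
    have h3 : x - y ∈ (L : E →ₗ[ℝ] F).ker := by
      simpa [sub_eq_zero] using h1
    have h4 := hP₀ ⟨x - y, h3⟩
    have h5 : P₀ (x - y) = 0 := by rw [map_sub, h2, sub_self]
    exact sub_eq_zero.1 (congrArg Subtype.val (h4.symm.trans h5))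
  · rintro ⟨y, k⟩
    obtain ⟨x, rfl⟩ := hL y
    let w : (L : E →ₗ[ℝ] F).ker := (toEuclidean (E := (L : E →ₗ[ℝ] F).ker)).symm k - P₀ x
    refine ⟨x + w, Prod.ext ?_ ?_⟩
    · have : L (w : E) = 0 := w.2
      simp [this]
    · have : P₀ (x + w) = (toEuclidean (E := (L : E →ₗ[ℝ] F).ker)).symm k := by
        rw [map_add, hP₀ w]; simp [w]
      change toEuclidean (P₀ (x + w)) = k
      rw [this]; simp
  · intro h
    have : (L : E →ₗ[ℝ] F).ker = ⊥ := LinearMap.ker_eq_bot.2 h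
    rw [this]; simp

/-- A map is a submersion at `x` if it has a smooth local section through `x`. -/
theorem surjective_fderiv_of_section {M N : Mfd} {f : M → N} {x : M} (hf : SmoothAt f x)
    {s : N → M} (hs : SmoothAt s (f x)) (hsx : s (f x) = x) (h : ∀ᶠ y in 𝓝 (f x), f (s y) = y)
    {c : Σ n : ℕ, OpenPartialHomeomorph M (EuclideanSpace ℝ (Fin n))}
    (hc : c ∈ M.charts) (hx : x ∈ c.2.source)
    {d : Σ n : ℕ, OpenPartialHomeomorph N (EuclideanSpace ℝ (Fin n))}
    (hd : d ∈ N.charts) (hd' : f x ∈ d.2.source) :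
    Function.Surjective (fderiv ℝ (fun v => d.2 (f (c.2.symm v))) (c.2 x)) := by
  have h1 := hf.2 c hc hx d hd hd'
  have h2 := hs.2 d hd hd' c hc (by rwa [hsx])
  have e : (c.2 ∘ s ∘ d.2.symm) (d.2 (f x)) = c.2 x := by simp [d.2.left_inv hd', hsx]
  have hne : (∞ : WithTop ℕ∞) ≠ 0 := by simp
  rw [← e] at h1
  have h3 := (h1.differentiableAt hne).hasFDerivAt.comp _ (h2.differentiableAt hne).hasFDerivAt
  have h4 : ((d.2 ∘ f ∘ c.2.symm) ∘ (c.2 ∘ s ∘ d.2.symm)) =ᶠ[𝓝 (d.2 (f x))] id := by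
    have t1 := tendsto_chart_symm hd'
    have t2 := hs.1.tendsto.comp t1
    rw [hsx] at t2
    filter_upwards [d.2.open_target.mem_nhds (d.2.map_source hd'),
      t2.eventually (c.2.open_source.mem_nhds hx), t1.eventually h] with v hv hv' hv''
    simp only [Function.comp_apply] at hv' ⊢
    rw [c.2.left_inv hv', hv'', d.2.right_inv hv, id]
  have h5 := h3.congr_of_eventuallyEq h4.symm |>.unique (hasFDerivAt_id _)
  rw [e] at h5
  intro v
  exact ⟨_, congrArg (fun T : _ →L[ℝ] _ => T v) h5⟩

/-- By the chain rule, the derivative of a local left inverse is a left inverse of the derivative.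
-/
theorem injective_fderiv_of_retraction {M N : Mfd} {f : M → N} {x : M} (hf : SmoothAt f x)
    {s : N → M} (hs : SmoothAt s (f x)) (h : ∀ᶠ y in 𝓝 x, s (f y) = y)
    {c : Σ n : ℕ, OpenPartialHomeomorph M (EuclideanSpace ℝ (Fin n))}
    (hc : c ∈ M.charts) (hx : x ∈ c.2.source)
    {d : Σ n : ℕ, OpenPartialHomeomorph N (EuclideanSpace ℝ (Fin n))}
    (hd : d ∈ N.charts) (hd' : f x ∈ d.2.source) :
    Function.Injective (fderiv ℝ (fun v => d.2 (f (c.2.symm v))) (c.2 x)) := by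
  have hsx := h.self_of_nhds
  have h1 := hf.2 c hc hx d hd hd'
  have h2 := hs.2 d hd hd' c hc (by rwa [hsx])
  have e : (d.2 ∘ f ∘ c.2.symm) (c.2 x) = d.2 (f x) := by simp [c.2.left_inv hx]
  have hne : (∞ : WithTop ℕ∞) ≠ 0 := by simp
  rw [← e] at h2
  have h3 := (h2.differentiableAt hne).hasFDerivAt.comp _ (h1.differentiableAt hne).hasFDerivAt
  have h4 : ((c.2 ∘ s ∘ d.2.symm) ∘ (d.2 ∘ f ∘ c.2.symm)) =ᶠ[𝓝 (c.2 x)] id := by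
    have t1 := tendsto_chart_symm hx
    have t2 := hf.1.tendsto.comp t1
    filter_upwards [c.2.open_target.mem_nhds (c.2.map_source hx),
      t2.eventually (d.2.open_source.mem_nhds hd'), t1.eventually h] with v hv hv' hv''
    simp only [Function.comp_apply] at hv' ⊢
    rw [d.2.left_inv hv', hv'', c.2.right_inv hv, id]
  have h5 := h3.congr_of_eventuallyEq h4.symm |>.unique (hasFDerivAt_id _)
  intro v w hvw
  have := congrArg (fun T : _ →L[ℝ] _ => T v) h5
  have h6 := congrArg (fun T : _ →L[ℝ] _ => T w) h5
  exact this.symm.trans ((congrArg (fderiv ℝ (c.2 ∘ s ∘ d.2.symm) _) hvw).trans h6)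

/-- The local form of a submersion: in a neighbourhood of each point it is the projection of a
product with a vector space. -/
theorem IsSubmersion.local_form {M N : Mfd} {f : M ⟶ N} (hf : IsSubmersion f) (x : M) :
    ∃ (n : ℕ) (U : Opens M) (k : M.restrict U ⟶ vec (EuclideanSpace ℝ (Fin n)))
      (V : Opens (N.prod (vec (EuclideanSpace ℝ (Fin n)))))
      (s : (N.prod (vec (EuclideanSpace ℝ (Fin n)))).restrict V ⟶ M.restrict U),
      x ∈ U ∧ (∀ u, ∃ h : (f u.1, k u) ∈ V, s ⟨_, h⟩ = u) ∧
      (∀ y, f (s y).1 = y.1.1 ∧ k (s y) = y.1.2) ∧ (IsEtale f → n = 0) := by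
  obtain ⟨c, hc, hx⟩ := M.exists_chart x
  obtain ⟨d, hd, hdx⟩ := N.exists_chart (f x)
  obtain ⟨n, P, hP, hn⟩ := exists_complement _ (hf x c hc hx d hd hdx)
  let F : EuclideanSpace ℝ (Fin c.1) → EuclideanSpace ℝ (Fin d.1) := fun v => d.2 (f (c.2.symm v))
  -- Completing `f`, read in charts, by the linear map `P` makes the derivative bijective at the
  -- given point. The local inverse of `G` becomes the inverse `s` of the product presentation, and
  -- `P` becomes the second coordinate `k`.
  let G := fun v => (F v, P v)
  let O : Set (EuclideanSpace ℝ (Fin c.1)) := c.2.target ∩ c.2.symm ⁻¹' (f ⁻¹' d.2.source)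
  have hO : IsOpen O := c.2.isOpen_inter_preimage_symm
    (d.2.open_source.preimage (continuous_coe f))
  have hF : ∀ v ∈ O, ContDiffAt ℝ ∞ F v := by
    rintro v ⟨hv, hv'⟩
    have := (smoothAt_coe f (c.2.symm v)).2 c hc (c.2.map_target hv) d hd hv'
    rwa [c.2.right_inv hv] at this
  have hne : (∞ : WithTop ℕ∞) ≠ 0 := by simp
  have hxO : c.2 x ∈ O := ⟨c.2.map_source hx, by simpa [c.2.left_inv hx] using hdx⟩
  obtain ⟨e, hxe, heO, heG, hes⟩ := exists_localDiffeo (G := G) hO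
    (fun v hv => (hF v hv).prodMk P.contDiff.contDiffAt) hxO (by
      have h1 : HasFDerivAt G ((fderiv ℝ F (c.2 x)).prod P) (c.2 x) :=
        ((hF _ hxO).differentiableAt hne).hasFDerivAt.prodMk P.hasFDerivAt
      rw [h1.fderiv]
      exact hP)
  let U : Opens M := ⟨c.2.source ∩ c.2 ⁻¹' e.source, c.2.isOpen_inter_preimage e.open_source⟩
  let V : Opens (N.prod (vec (EuclideanSpace ℝ (Fin n)))) :=
    ⟨(d.2.prod (OpenPartialHomeomorph.refl _)).source ∩
      (d.2.prod (OpenPartialHomeomorph.refl _)) ⁻¹' e.target,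
      (d.2.prod (OpenPartialHomeomorph.refl _)).isOpen_inter_preimage e.open_target⟩
  have hV1 : ∀ y ∈ V, y.1 ∈ d.2.source := fun y hy => hy.1.1
  have hV2 : ∀ y ∈ V, (d.2 y.1, y.2) ∈ e.target := fun y hy => hy.2
  have hs : ∀ y ∈ V, e.symm (d.2 y.1, y.2) ∈ e.source := fun y hy => e.map_target (hV2 y hy)
  have hs1 : ∀ y ∈ V, F (e.symm (d.2 y.1, y.2)) = d.2 y.1 ∧ P (e.symm (d.2 y.1, y.2)) = y.2 := by
    intro y hy
    have := e.right_inv (hV2 y hy)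
    rw [heG] at this
    exact ⟨congrArg Prod.fst this, congrArg Prod.snd this⟩
  have hs2 : ∀ y ∈ V, c.2 (c.2.symm (e.symm (d.2 y.1, y.2))) = e.symm (d.2 y.1, y.2) :=
    fun y hy => c.2.right_inv (heO (hs y hy)).1
  have hsU : ∀ y ∈ V, c.2.symm (e.symm (d.2 y.1, y.2)) ∈ U := fun y hy =>
    ⟨c.2.map_target (heO (hs y hy)).1, by
      change c.2 _ ∈ e.source; rw [hs2 y hy]; exact hs y hy⟩
  have hf1 : ∀ u ∈ U, F (c.2 u) = d.2 (f u) := fun u hu => by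
    change d.2 (f (c.2.symm (c.2 u))) = _
    rw [c.2.left_inv hu.1]
  have hfd : ∀ u ∈ U, f u ∈ d.2.source := fun u hu => by
    have : f (c.2.symm (c.2 u)) ∈ d.2.source := (heO hu.2).2
    rwa [c.2.left_inv hu.1] at this
  have hUV : ∀ u ∈ U, (d.2 (f u), P (c.2 u)) = e (c.2 u) := fun u hu => by
    rw [heG, ← hf1 u hu]
  refine ⟨n, U, homMk (fun u => P (c.2 u.1)) ?_, V,
    homMk (fun y => ⟨c.2.symm (e.symm (d.2 y.1.1, y.1.2)), hsU y.1 y.2⟩) ?_, ⟨hx, hxe⟩, ?_, ?_, ?_⟩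
  · refine smooth_restrict (N := vec (EuclideanSpace ℝ (Fin n))) (f := fun u => P (c.2 u)) fun u hu => ?_
    exact SmoothAt.comp (N := vec _) (g := P) (smoothAt_vec_iff.2 P.contDiff.contDiffAt)
      (smoothAt_chart hc hu.1)
  · refine Smooth.of_incl ?_
    refine smooth_restrict (f := fun y : N.prod (vec (EuclideanSpace ℝ (Fin n))) =>
      c.2.symm (e.symm (d.2 y.1, y.2))) fun y hy => ?_
    refine SmoothAt.comp (smoothAt_chart_symm hc (heO (hs y hy)).1) ?_
    refine SmoothAt.comp (N := vec (_ × _)) (g := e.symm)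
      (f := fun y : N.prod (vec (EuclideanSpace ℝ (Fin n))) => (d.2 y.1, y.2))
      (smoothAt_vec_iff.2 (hes _ (hV2 y hy))) ?_
    have h1 : SmoothAt (M := N.prod (vec (EuclideanSpace ℝ (Fin n))))
        (N := vec (EuclideanSpace ℝ (Fin d.1))) (fun y => d.2 y.1) y :=
      SmoothAt.comp (M := N.prod (vec (EuclideanSpace ℝ (Fin n)))) (N := N)
        (L := vec (EuclideanSpace ℝ (Fin d.1))) (f := Prod.fst) (g := d.2) (smoothAt_chart hd (hV1 y hy)) (smoothAt_fst y)
    obtain ⟨b, hb, hby⟩ := (N.prod (vec (EuclideanSpace ℝ (Fin n)))).exists_chart y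
    rw [smoothAt_to_vec hb hby] at h1 ⊢
    exact h1.prodMk ((smoothAt_to_vec hb hby).1 (smoothAt_snd y))
  · intro u
    have hu := u.2
    refine ⟨⟨⟨hfd _ hu, trivial⟩, ?_⟩, ?_⟩
    · change (d.2 (f u.1), P (c.2 u.1)) ∈ e.target
      rw [hUV _ hu]; exact e.map_source hu.2
    · apply Subtype.ext
      change c.2.symm (e.symm (d.2 (f u.1), P (c.2 u.1))) = u.1
      rw [hUV _ hu, e.left_inv hu.2, c.2.left_inv hu.1]
  · intro y
    have h := hs1 y.1 y.2
    constructor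
    · exact d.2.injOn (hfd _ (hsU _ y.2)) (hV1 _ y.2) h.1
    · change P (c.2 (c.2.symm _)) = _
      rw [hs2 _ y.2]; exact h.2
  · intro he
    exact hn (he x c hc hx d hd hdx).1

end Mfd

/-! ### Submersions and étale maps characterized by local sections -/

noncomputable section

namespace Mfd

open TopologicalSpace Topology

/-- A submersion has a smooth local section through every point. -/
theorem IsSubmersion.exists_section {M N : Mfd} {f : M ⟶ N} (hf : IsSubmersion f) (x : M) :
    ∃ (V : Opens N) (h : f x ∈ V) (s : N.restrict V ⟶ M), s ⟨f x, h⟩ = x ∧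
      ∀ y, f (s y) = y.1 := by
  obtain ⟨n, U, k, V, s, hx, h1, h2, -⟩ := hf.local_form x
  -- A section is obtained from the product form by freezing the second coordinate at its value at
  -- `x`.
  let j : N → N.prod (vec (EuclideanSpace ℝ (Fin n))) := fun y => (y, k ⟨x, hx⟩)
  have hj : Smooth j := smooth_iff.2 fun y => smoothAt_prod_iff.2
    ⟨smooth_iff.1 (smooth_id N) y, smooth_iff.1 (smooth_const _ _) y⟩
  obtain ⟨hV, hs⟩ := h1 ⟨x, hx⟩
  let V' : Opens N := ⟨j ⁻¹' V, V.isOpen.preimage hj.1⟩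
  refine ⟨V', hV, homMk (fun y => (s ⟨j y.1, y.2⟩).1) ?_, congrArg Subtype.val hs,
    fun y => (h2 _).1⟩
  refine Smooth.comp (smooth_coe (inclHom U)) (Smooth.comp (smooth_coe s) (Smooth.of_incl ?_))
  exact hj.comp (smooth_coe (inclHom V'))

/-- An étale map is a local diffeomorphism. -/
theorem IsEtale.local_form {M N : Mfd} {f : M ⟶ N} (hf : IsEtale f) (x : M) :
    ∃ (U : Opens M) (V : Opens N) (s : N.restrict V ⟶ M.restrict U), x ∈ U ∧
      (∀ u : M.restrict U, ∃ h : f u.1 ∈ V, s ⟨_, h⟩ = u) ∧ ∀ y, f (s y).1 = y.1 := by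
  obtain ⟨n, U, k, V, s, hx, h1, h2, hn⟩ :=
    IsSubmersion.local_form (f := f) (fun x c hc hx d hd hd' => (hf x c hc hx d hd hd').2) x
  obtain rfl := hn hf
  let j : N → N.prod (vec (EuclideanSpace ℝ (Fin 0))) := fun y => (y, 0)
  have hj : Smooth j := smooth_iff.2 fun y => smoothAt_prod_iff.2
    ⟨smooth_iff.1 (smooth_id N) y, smooth_iff.1 (smooth_const _ _) y⟩
  let V' : Opens N := ⟨j ⁻¹' V, V.isOpen.preimage hj.1⟩
  refine ⟨U, V', homMk (fun y => s ⟨j y.1, y.2⟩) ?_, hx, fun u => ?_, fun y => (h2 _).1⟩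
  · exact Smooth.comp (smooth_coe s) (Smooth.of_incl (hj.comp (smooth_coe (inclHom V'))))
  · obtain ⟨h, hs⟩ := h1 u
    have e : k u = 0 := Subsingleton.elim (α := EuclideanSpace ℝ (Fin 0)) _ _
    rw [e] at h
    refine ⟨h, Eq.trans ?_ hs⟩
    exact congrArg s (Subtype.ext (Prod.ext rfl e.symm))

/-- Extend a local map by a constant. -/
theorem exists_extension {M N : Mfd} {V : Opens N} (s : N.restrict V ⟶ M) (x : M) :
    ∃ s' : N → M, (∀ y (h : y ∈ V), s' y = s ⟨y, h⟩) ∧ ∀ y ∈ V, SmoothAt s' y := by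
  classical
  have key : ∀ y (h : y ∈ V), (fun y => if h : y ∈ V then s ⟨y, h⟩ else x) y = s ⟨y, h⟩ :=
    fun y h => dif_pos h
  refine ⟨_, key, fun y h => ?_⟩
  refine (smoothAt_incl_comp_iff (U := V) (x := ⟨y, h⟩)).1 ?_
  exact (smoothAt_coe s ⟨y, h⟩).congr (.of_forall fun z => key z.1 z.2)

/-- The converse of `IsSubmersion.exists_section`. From here on, composites, quotients and base
changes of submersions are handled with local sections only, and charts no longer appear. -/
theorem IsSubmersion.of_section {M N : Mfd} {f : M ⟶ N}
    (h : ∀ x, ∃ (V : Opens N) (h : f x ∈ V) (s : N.restrict V ⟶ M), s ⟨f x, h⟩ = x ∧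
      ∀ y, f (s y) = y.1) : IsSubmersion f := by
  intro x c hc hx d hd hd'
  obtain ⟨V, hV, s, hs, hfs⟩ := h x
  obtain ⟨s', h1, h2⟩ := exists_extension s x
  refine surjective_fderiv_of_section (f := fun x => f x) (smoothAt_coe f x) (h2 _ hV)
    ((h1 _ hV).trans hs) ?_ hc hx hd hd'
  filter_upwards [V.isOpen.mem_nhds hV] with y hy
  rw [h1 y hy, hfs]

/-- A local inverse is both a retraction, which makes the derivative injective, and a section, which
makes it surjective. -/
theorem IsEtale.of_local_inverse {M N : Mfd} {f : M ⟶ N}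
    (h : ∀ x, ∃ (U : Opens M) (V : Opens N) (s : N.restrict V ⟶ M), x ∈ U ∧
      (∀ u ∈ U, ∃ h : f u ∈ V, s ⟨_, h⟩ = u) ∧ ∀ y, f (s y) = y.1) : IsEtale f := by
  intro x c hc hx d hd hd'
  obtain ⟨U, V, s, hxU, hs, hfs⟩ := h x
  obtain ⟨hV, hsx⟩ := hs x hxU
  obtain ⟨s', h1, h2⟩ := exists_extension s x
  constructor
  · refine injective_fderiv_of_retraction (f := fun x => f x) (smoothAt_coe f x) (h2 _ hV)
      ?_ hc hx hd hd'
    filter_upwards [U.isOpen.mem_nhds hxU] with u hu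
    obtain ⟨h3, h4⟩ := hs u hu
    rw [h1 _ h3, h4]
  · refine surjective_fderiv_of_section (f := fun x => f x) (smoothAt_coe f x) (h2 _ hV)
      ((h1 _ hV).trans hsx) ?_ hc hx hd hd'
    filter_upwards [V.isOpen.mem_nhds hV] with y hy
    rw [h1 y hy, hfs]

theorem IsEtale.isSubmersion {M N : Mfd} {f : M ⟶ N} (hf : IsEtale f) : IsSubmersion f :=
  fun x c hc hx d hd hd' => (hf x c hc hx d hd hd').2

theorem IsSubmersion.comp {M N L : Mfd} {f : M ⟶ N} {g : N ⟶ L} (hf : IsSubmersion f)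
    (hg : IsSubmersion g) : IsSubmersion (f ≫ g) := by
  refine .of_section fun x => ?_
  obtain ⟨V, hV, s, hs, hfs⟩ := hf.exists_section x
  obtain ⟨V', hV', s', hs', hfs'⟩ := hg.exists_section (f x)
  have hcont : Continuous (fun y => s' y) := continuous_coe s'
  let O : Opens L := ⟨Subtype.val '' ((fun y => s' y) ⁻¹' V),
    V'.isOpen.isOpenMap_subtype_val _ (V.isOpen.preimage hcont)⟩
  have h1 : ∀ y ∈ O, ∃ h : y ∈ V', s' ⟨y, h⟩ ∈ V := by
    rintro _ ⟨y, hy, rfl⟩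
    exact ⟨y.2, hy⟩
  have hO : g (f x) ∈ O := ⟨⟨_, hV'⟩, by
    change s' _ ∈ V
    rw [hs']; exact hV, rfl⟩
  refine ⟨O, hO, homMk (fun y => s ⟨s' ⟨y.1, (h1 y.1 y.2).1⟩, (h1 y.1 y.2).2⟩) ?_, ?_, ?_⟩
  · refine Smooth.comp (smooth_coe s) (Smooth.of_incl (Smooth.comp (smooth_coe s')
      (Smooth.of_incl (smooth_coe (inclHom O)))))
  · refine Eq.trans (congrArg s (Subtype.ext ?_)) hs
    exact hs'
  · intro y
    change g (f (s _)) = _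
    rw [hfs, hfs']

/-- Composing a local section of the composite with `f` gives a local section of `g`; the
surjectivity of `f` is what provides one through every point. -/
theorem IsSubmersion.of_comp {M N L : Mfd} {f : M ⟶ N} {g : N ⟶ L}
    (h : IsSubmersion (f ≫ g)) (hf : Function.Surjective f) : IsSubmersion g := by
  refine .of_section fun y => ?_
  obtain ⟨x, rfl⟩ := hf y
  obtain ⟨V, hV, s, hs, hfs⟩ := h.exists_section x
  exact ⟨V, hV, s ≫ f, congrArg f hs, hfs⟩

theorem isSubmersion_id (M : Mfd) : IsSubmersion (𝟙 M) :=
  .of_section fun _ => ⟨⊤, trivial, inclHom _, rfl, fun _ => rfl⟩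

theorem isSubmersion_of_isIso {M N : Mfd} (f : M ⟶ N) [IsIso f] : IsSubmersion f :=
  IsSubmersion.of_comp (f := inv f) (g := f) (by rw [IsIso.inv_hom_id]; exact isSubmersion_id _)
    (fun x => ⟨f x, by rw [← ConcreteCategory.comp_apply, IsIso.hom_inv_id]; rfl⟩)

theorem IsSurjSubmersion.comp {M N L : Mfd} {f : M ⟶ N} {g : N ⟶ L} (hf : IsSurjSubmersion f)
    (hg : IsSurjSubmersion g) : IsSurjSubmersion (f ≫ g) :=
  ⟨hf.1.comp hg.1, fun z => by
    obtain ⟨y, rfl⟩ := hg.2 z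
    obtain ⟨x, rfl⟩ := hf.2 y
    exact ⟨x, rfl⟩⟩

theorem isSurjSubmersion_of_isIso {M N : Mfd} (f : M ⟶ N) [IsIso f] : IsSurjSubmersion f :=
  ⟨isSubmersion_of_isIso f, fun y => ⟨inv f y, by
    rw [← ConcreteCategory.comp_apply, IsIso.inv_hom_id]; rfl⟩⟩

/-- Smoothness descends along jointly surjective families of submersions. -/
theorem Smooth.descend {ι : Type*} {M N : Mfd} {W : ι → Mfd} (w : ∀ i, W i ⟶ M)
    (hw : ∀ i, IsSubmersion (w i)) {f : M → N} (hsurj : ∀ x, ∃ i, ∃ y, w i y = x)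
    (h : ∀ i, Smooth fun y => f (w i y)) : Smooth f := by
  refine Smooth.of_local fun x => ?_
  obtain ⟨i, y, rfl⟩ := hsurj x
  obtain ⟨V, hV, s, -, hs⟩ := (hw i).exists_section y
  refine ⟨V, hV, ?_⟩
  have := (h i).comp (smooth_coe s)
  simpa only [hs] using this

theorem Smooth.descend_one {M N W : Mfd} {w : W ⟶ M} (hw : IsSurjSubmersion w) {f : M → N}
    (h : Smooth fun y => f (w y)) : Smooth f :=
  Smooth.descend (ι := Unit) (fun _ => w) (fun _ => hw.1) (fun x => ⟨(), hw.2 x⟩) fun _ => h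

/-! ### Gluing of manifolds -/

/-- Families of maps `φ i` from manifolds to a set which are étale parametrizations of a manifold
structure on that set. -/
structure IsGluing {ι : Type} (W : ι → Mfd) {Z : Type} (φ : ∀ i, W i → Z) : Prop where
  surj : ∀ z, ∃ i w, φ i w = z
  inj : ∀ i w, ∃ U : Opens (W i), w ∈ U ∧ Set.InjOn (φ i) U
  trans : ∀ i j w w', φ i w = φ j w' → ∃ (U : Opens (W i)) (h : w ∈ U)
    (τ : (W i).restrict U ⟶ W j), τ ⟨w, h⟩ = w' ∧ ∀ u, φ j (τ u) = φ i u.1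

namespace IsGluing

variable {ι : Type} {W : ι → Mfd} {Z : Type} {φ : ∀ i, W i → Z}

/-- The topology of a glued manifold. -/
abbrev topology (_ : IsGluing W φ) : TopologicalSpace Z :=
  ⨆ i, TopologicalSpace.coinduced (φ i) (W i).top

variable (h : IsGluing W φ)

theorem isOpen_iff {s : Set Z} : IsOpen[h.topology] s ↔ ∀ i, IsOpen (φ i ⁻¹' s) := by
  simp only [isOpen_iSup_iff, isOpen_coinduced]

theorem continuous_param (i : ι) : Continuous[_, h.topology] (φ i) := by
  let := h.topology
  refine ⟨fun s hs => (h.isOpen_iff.1 hs i)⟩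

/-- Near a point of `W j` whose image lies in that of `U`, a transition map goes to `W i`, and the
preimage of `U` under it is an open set of points with the same property. -/
theorem isOpen_image {i : ι} {U : Set (W i)} (hU : IsOpen U) : IsOpen[h.topology] (φ i '' U) := by
  refine h.isOpen_iff.2 fun j => isOpen_iff_mem_nhds.2 ?_
  rintro w' ⟨w, hw, hww⟩
  obtain ⟨V, hV, τ, hτ, hτφ⟩ := h.trans j i w' w hww.symm
  have hopen : IsOpen (Subtype.val '' ((fun y => τ y) ⁻¹' U)) :=
    V.isOpen.isOpenMap_subtype_val _ (hU.preimage (continuous_coe τ))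
  refine Filter.mem_of_superset (hopen.mem_nhds ⟨⟨w', hV⟩, by
    change τ _ ∈ U; rwa [hτ], rfl⟩) ?_
  rintro _ ⟨y, hy, rfl⟩
  exact ⟨τ y, hy, hτφ y⟩

/-- A parametrization, restricted to an open set where it is injective. -/
theorem isOpenEmbedding {i : ι} {U : Opens (W i)} (hU : Set.InjOn (φ i) U) :
    letI := h.topology
    IsOpenEmbedding fun u : (W i).restrict U => φ i u.1 := by
  let := h.topology
  refine .of_continuous_injective_isOpenMap
    ((h.continuous_param i).comp continuous_subtype_val)
    (fun u v huv => Subtype.ext (hU u.2 v.2 huv)) fun O hO => ?_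
  have := h.isOpen_image (i := i) (U.isOpen.isOpenMap_subtype_val O hO)
  rwa [Set.image_image] at this

/-- The inverse of a parametrization, on an open set where it is injective. -/
def invParam {i : ι} {U : Opens (W i)} (hU : Set.InjOn (φ i) U) [Nonempty U] :
    letI := h.topology
    OpenPartialHomeomorph Z ((W i).restrict U) :=
  letI := h.topology
  have : Nonempty ((W i).restrict U) := ‹Nonempty U›
  ((h.isOpenEmbedding hU).toOpenPartialHomeomorph).symm

/-- Near `u`, the parametrizations `i` and `j` are related by a smooth transition map `τ`. Since the
parametrization `j` is injective on `V`, inverting it there returns the value of `τ`. -/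
theorem smoothAt_transition {i j : ι} {U : Opens (W i)} {V : Opens (W j)}
    (hV : Set.InjOn (φ j) V) [Nonempty V] (u : (W i).restrict U)
    (hu : φ i u.1 ∈ φ j '' V) :
    SmoothAt (fun u : (W i).restrict U => h.invParam hV (φ i u.1)) u := by
  let := h.topology
  have : Nonempty ((W j).restrict V) := ‹Nonempty V›
  obtain ⟨v, hv, hvu⟩ := hu
  obtain ⟨O, hO, τ, hτ, hτφ⟩ := h.trans i j u.1 v hvu.symm
  obtain ⟨τ', hτ1, hτ2⟩ := exists_extension τ v
  refine SmoothAt.of_incl ?_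
  refine SmoothAt.congr (f := fun u => τ' (incl U u)) ?_ ?_
  · exact smoothAt_incl_comp_iff.2 (hτ2 _ hO)
  · have h1 : ∀ᶠ x in 𝓝 u.1, x ∈ O ∧ τ' x ∈ V := by
      have h0 : ∀ᶠ x in 𝓝 u.1, x ∈ O := O.isOpen.mem_nhds hO
      refine h0.and ((hτ2 _ hO).1.eventually (V.isOpen.mem_nhds ?_))
      rw [hτ1 _ hO, hτ]; exact hv
    have h2 : Filter.Tendsto (incl U) (𝓝 u) (𝓝 u.1) := (continuous_incl U).continuousAt
    filter_upwards [h2.eventually h1] with x hx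
    obtain ⟨hx1, hx2⟩ := hx
    have h3 : φ i x.1 = φ j (τ' x.1) := by
      have h3 := hτφ ⟨x.1, hx1⟩
      rw [← hτ1 x.1 hx1] at h3
      exact h3.symm
    have h4 : h.invParam hV (φ j (τ' x.1)) = ⟨τ' x.1, hx2⟩ :=
      ((h.isOpenEmbedding hV).toOpenPartialHomeomorph).left_inv (x := ⟨τ' x.1, hx2⟩) trivial
    rw [← h3] at h4
    exact congrArg Subtype.val h4

/-- The manifold structure given by étale parametrizations. -/
abbrev mfd : Mfd where
  carrier := Z
  top := h.topology
  charts := {c | ∃ (i : ι) (U : Opens (W i)) (hU : Set.InjOn (φ i) U) (_ : Nonempty U),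
    ∃ c₀ ∈ ((W i).restrict U).charts,
      letI := h.topology
      c = ⟨c₀.1, (h.invParam hU).trans c₀.2⟩}
  exists_chart z := by
    let := h.topology
    obtain ⟨i, w, rfl⟩ := h.surj z
    obtain ⟨U, hw, hU⟩ := h.inj i w
    have : Nonempty U := ⟨⟨w, hw⟩⟩
    have : Nonempty ((W i).restrict U) := ‹Nonempty U›
    obtain ⟨c, hc, hcw⟩ := ((W i).restrict U).exists_chart ⟨w, hw⟩
    refine ⟨_, ⟨i, U, hU, inferInstance, c, hc, rfl⟩, ⟨⟨⟨w, hw⟩, trivial, rfl⟩, ?_⟩⟩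
    have h4 : h.invParam hU (φ i w) = ⟨w, hw⟩ :=
      ((h.isOpenEmbedding hU).toOpenPartialHomeomorph).left_inv (x := ⟨w, hw⟩) trivial
    change h.invParam hU (φ i w) ∈ c.2.source
    rwa [h4]
  compat := by
    let := h.topology
    rintro _ ⟨i, U, hU, nU, c, hc, rfl⟩ _ ⟨j, V, hV, nV, d, hd, rfl⟩ v hv
    refine ContDiffAt.contDiffWithinAt ?_
    obtain ⟨⟨hv1, -⟩, ⟨v', hv', e'⟩, hv2⟩ := hv
    have h1 := h.smoothAt_transition (U := U) hV (c.2.symm v) ⟨v'.1, v'.2, e'⟩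
    have h2 := h1.2 c hc (c.2.map_target hv1) d hd hv2
    rw [c.2.right_inv hv1] at h2
    exact h2

/-- In the charts that define the glued manifold, a parametrization and its inverse both become the
identity near the point. -/
theorem exists_param_chart {i : ι} (w : W i) :
    ∃ (U : Opens (W i)) (hU : Set.InjOn (φ i) U) (hw : w ∈ U) (_ : Nonempty U),
      SmoothAt (N := h.mfd) (fun u : (W i).restrict U => φ i u.1) ⟨w, hw⟩ ∧
      SmoothAt (M := h.mfd) (h.invParam hU) (φ i w) := by
  let := h.topology
  obtain ⟨U, hw, hU⟩ := h.inj i w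
  have : Nonempty U := ⟨⟨w, hw⟩⟩
  have : Nonempty ((W i).restrict U) := ‹Nonempty U›
  obtain ⟨c, hc, hcw⟩ := ((W i).restrict U).exists_chart ⟨w, hw⟩
  have h4 : ∀ u : (W i).restrict U, h.invParam hU (φ i u.1) = u := fun u =>
    ((h.isOpenEmbedding hU).toOpenPartialHomeomorph).left_inv (x := u) trivial
  let e : Σ n : ℕ, OpenPartialHomeomorph h.mfd (EuclideanSpace ℝ (Fin n)) :=
    ⟨c.1, (h.invParam hU).trans c.2⟩
  have he : e ∈ h.mfd.charts := ⟨i, U, hU, inferInstance, c, hc, rfl⟩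
  have hs : φ i w ∈ (h.invParam hU).source := ⟨⟨w, hw⟩, trivial, rfl⟩
  have hew : φ i w ∈ e.2.source := ⟨hs, by
    change h.invParam hU (φ i w) ∈ c.2.source
    rwa [h4 ⟨w, hw⟩]⟩
  have key : c.2 ∘ c.2.symm =ᶠ[𝓝 (c.2 ⟨w, hw⟩)] id := by
    filter_upwards [c.2.open_target.mem_nhds (c.2.map_source hcw)] with v hv
    exact c.2.right_inv hv
  refine ⟨U, hU, hw, inferInstance, ?_, ?_⟩
  · refine SmoothAt.of_chart (N := h.mfd) (d := e)
      (h.isOpenEmbedding hU).continuous.continuousAt hc hcw he hew ?_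
    refine contDiffAt_id.congr_of_eventuallyEq (Filter.EventuallyEq.trans
      (.of_forall fun v => congrArg c.2 (h4 _)) key)
  · refine SmoothAt.of_chart (M := h.mfd) (c := e) ((h.invParam hU).continuousAt hs) he hew hc
      (by rwa [h4 ⟨w, hw⟩]) ?_
    have e1 : e.2 (φ i w) = c.2 ⟨w, hw⟩ := congrArg c.2 (h4 ⟨w, hw⟩)
    rw [e1]
    refine contDiffAt_id.congr_of_eventuallyEq (Filter.EventuallyEq.trans
      (.of_forall fun v => congrArg c.2 (h4 _)) key)

/-- The parametrizations of a glued manifold. -/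
def param (i : ι) : W i ⟶ h.mfd := homMk (φ i) (smooth_iff.2 fun w => by
  obtain ⟨U, hU, hw, nU, h1, -⟩ := h.exists_param_chart w
  exact (smoothAt_incl_comp_iff (N := h.mfd) (f := φ i)).1 h1)

theorem isSubmersion_param (i : ι) : IsSubmersion (h.param i) := by
  intro w c hc hx d hd hd'
  let := h.topology
  obtain ⟨U, hU, hw, nU, h1, h2⟩ := h.exists_param_chart w
  have : Nonempty ((W i).restrict U) := ‹Nonempty U›
  have h4 : h.invParam hU (φ i w) = ⟨w, hw⟩ :=
    ((h.isOpenEmbedding hU).toOpenPartialHomeomorph).left_inv (x := ⟨w, hw⟩) trivial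
  refine surjective_fderiv_of_section (N := h.mfd) (f := fun x => h.param i x) (smoothAt_coe _ w)
    (s := fun z => incl U (h.invParam hU z)) ?_ (congrArg (incl U) h4) ?_ hc hx hd hd'
  · exact SmoothAt.comp (M := h.mfd) (smoothAt_incl _) h2
  · filter_upwards [(h.invParam hU).open_source.mem_nhds ⟨⟨w, hw⟩, trivial, rfl⟩] with z hz
    exact (h.invParam hU).left_inv hz

end IsGluing

/-! ### Fibre products along submersions -/

/-- A local presentation of a submersion as a projection. -/
structure LocalForm {M N : Mfd} (f : M ⟶ N) where
  n : ℕ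
  U : Opens M
  k : M.restrict U ⟶ vec (EuclideanSpace ℝ (Fin n))
  V : Opens (N.prod (vec (EuclideanSpace ℝ (Fin n))))
  s : (N.prod (vec (EuclideanSpace ℝ (Fin n)))).restrict V ⟶ M.restrict U
  mem : ∀ u : M.restrict U, (f u.1, k u) ∈ V
  s_mk : ∀ u : M.restrict U, s ⟨_, mem u⟩ = u
  f_s : ∀ y, f (s y).1 = y.1.1
  k_s : ∀ y, k (s y) = y.1.2

theorem IsSubmersion.exists_localForm {M N : Mfd} {f : M ⟶ N} (hf : IsSubmersion f) (x : M) :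
    ∃ F : LocalForm f, x ∈ F.U := by
  obtain ⟨n, U, k, V, s, hx, h1, h2, -⟩ := hf.local_form x
  exact ⟨⟨n, U, k, V, s, fun u => (h1 u).1, fun u => (h1 u).2, fun y => (h2 y).1,
    fun y => (h2 y).2⟩, hx⟩

section FibreProduct

variable {A B C : Mfd} (f : A ⟶ C) (g : B ⟶ C)

/-- The local parameter space of a fibre product. -/
abbrev fibreParam (F : LocalForm f) : Mfd :=
  (B.prod (vec (EuclideanSpace ℝ (Fin F.n)))).restrict
    ⟨(fun p => (g p.1, p.2)) ⁻¹' (F.V : Set (C.prod (vec (EuclideanSpace ℝ (Fin F.n))))),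
      F.V.isOpen.preimage (((continuous_coe g).comp continuous_fst).prodMk continuous_snd)⟩

theorem smooth_fibreParam_map (F : LocalForm f) :
    Smooth (N := A.restrict F.U) fun w : fibreParam f g F => F.s ⟨(g w.1.1, w.1.2), w.2⟩ := by
  refine Smooth.comp (smooth_coe F.s) (Smooth.of_incl ?_)
  refine smooth_iff.2 fun w => smoothAt_prod_iff.2 ⟨?_, ?_⟩
  · exact SmoothAt.comp (f := fun w : fibreParam f g F => w.1.1) (smoothAt_coe g _)
      (SmoothAt.comp (f := incl _) (smoothAt_fst _) (smoothAt_incl w))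
  · exact SmoothAt.comp (f := incl _) (smoothAt_snd _) (smoothAt_incl w)

/-- In a local form of `f` as a projection from an open `V ⊆ C × ℝⁿ`, the fibre product is the open
set of pairs `(b, v)` in `B × ℝⁿ` with `(g b, v) ∈ V`. A transition keeps `b` and replaces `v` by
the coordinate `k` of the second local form. -/
theorem isGluing_fibreProduct (hf : IsSubmersion f) :
    IsGluing (Z := {p : A × B // f p.1 = g p.2}) (fibreParam f g)
      fun F w => ⟨((F.s ⟨(g w.1.1, w.1.2), w.2⟩).1, w.1.1), F.f_s _⟩ := by
  constructor
  · rintro ⟨⟨a, b⟩, hab⟩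
    obtain ⟨F, ha⟩ := hf.exists_localForm a
    have hm : (g b, F.k ⟨a, ha⟩) ∈ F.V := by
      have := F.mem ⟨a, ha⟩
      rwa [show f a = g b from hab] at this
    refine ⟨F, ⟨(b, F.k ⟨a, ha⟩), hm⟩, Subtype.ext (Prod.ext ?_ rfl)⟩
    refine Eq.trans ?_ (congrArg Subtype.val (F.s_mk ⟨a, ha⟩))
    exact congrArg (fun y => (F.s y).1) (Subtype.ext (Prod.ext hab.symm rfl))
  · refine fun F w => ⟨⊤, trivial, fun w _ w' _ h => ?_⟩
    have h1 : (F.s ⟨(g w.1.1, w.1.2), w.2⟩) = (F.s ⟨(g w'.1.1, w'.1.2), w'.2⟩) :=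
      Subtype.ext (congrArg (fun z => z.1.1) h)
    refine Subtype.ext (Prod.ext (congrArg (fun z => z.1.2) h) ?_)
    have := congrArg F.k h1
    rwa [F.k_s, F.k_s] at this
  · intro F F' w w' h
    have hb : w.1.1 = w'.1.1 := congrArg (fun z => z.1.2) h
    have ha : (F.s ⟨(g w.1.1, w.1.2), w.2⟩).1 = (F'.s ⟨(g w'.1.1, w'.1.2), w'.2⟩).1 :=
      congrArg (fun z => z.1.1) h
    let O : Opens (fibreParam f g F) :=
      ⟨(fun w => (F.s ⟨(g w.1.1, w.1.2), w.2⟩).1) ⁻¹' F'.U,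
        F'.U.isOpen.preimage (continuous_subtype_val.comp (smooth_fibreParam_map f g F).1)⟩
    have hmem : ∀ u : (fibreParam f g F).restrict O,
        (g u.1.1.1, F'.k ⟨(F.s ⟨(g u.1.1.1, u.1.1.2), u.1.2⟩).1, u.2⟩) ∈ F'.V := fun u => by
      have := F'.mem ⟨(F.s ⟨(g u.1.1.1, u.1.1.2), u.1.2⟩).1, u.2⟩
      rwa [F.f_s] at this
    refine ⟨O, ?_, homMk (fun u => ⟨(u.1.1.1,
      F'.k ⟨(F.s ⟨(g u.1.1.1, u.1.1.2), u.1.2⟩).1, u.2⟩), hmem u⟩) ?_, ?_, ?_⟩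
    · change (F.s _).1 ∈ F'.U
      rw [ha]; exact (F'.s _).2
    · refine Smooth.of_incl (smooth_iff.2 fun u => smoothAt_prod_iff.2 ⟨?_, ?_⟩)
      · exact SmoothAt.comp (f := fun u : (fibreParam f g F).restrict O => u.1.1) (smoothAt_fst _)
          (SmoothAt.comp (f := incl O) (smoothAt_incl _) (smoothAt_incl u))
      · refine SmoothAt.comp (f := fun u : (fibreParam f g F).restrict O =>
          (⟨(F.s ⟨(g u.1.1.1, u.1.1.2), u.1.2⟩).1, u.2⟩ : A.restrict F'.U)) (smoothAt_coe F'.k _)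
          (SmoothAt.of_incl ?_)
        refine SmoothAt.comp (f := fun u : (fibreParam f g F).restrict O =>
          F.s ⟨(g u.1.1.1, u.1.1.2), u.1.2⟩) (smoothAt_incl _) ?_
        exact SmoothAt.comp (f := incl O) (smooth_iff.1 (smooth_fibreParam_map f g F) _)
          (smoothAt_incl u)
    · refine Subtype.ext (Prod.ext hb ?_)
      have : F'.k (F'.s ⟨(g w'.1.1, w'.1.2), w'.2⟩) = w'.1.2 := F'.k_s _
      refine Eq.trans ?_ this
      exact congrArg F'.k (Subtype.ext ha)
    · intro u
      refine Subtype.ext (Prod.ext ?_ rfl)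
      have := congrArg Subtype.val (F'.s_mk ⟨(F.s ⟨(g u.1.1.1, u.1.1.2), u.1.2⟩).1, u.2⟩)
      refine Eq.trans ?_ this
      refine congrArg (fun y => (F'.s y).1) (Subtype.ext (Prod.ext ?_ rfl))
      exact (F.f_s ⟨(g u.1.1.1, u.1.1.2), u.1.2⟩).symm

variable (hf : IsSubmersion f)

/-- The fibre product of a submersion and an arbitrary smooth map. -/
abbrev pb : Mfd := (isGluing_fibreProduct f g hf).mfd

/-- The first projection of a fibre product. -/
def pbFst : pb f g hf ⟶ A := homMk (fun p => p.1.1) (by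
  refine Smooth.descend (isGluing_fibreProduct f g hf).param
    (isGluing_fibreProduct f g hf).isSubmersion_param (isGluing_fibreProduct f g hf).surj
    fun F => ?_
  exact Smooth.comp (smooth_coe (inclHom F.U)) (smooth_fibreParam_map f g F))

/-- The second projection of a fibre product. -/
def pbSnd : pb f g hf ⟶ B := homMk (fun p => p.1.2) (by
  refine Smooth.descend (isGluing_fibreProduct f g hf).param
    (isGluing_fibreProduct f g hf).isSubmersion_param (isGluing_fibreProduct f g hf).surj
    fun F => smooth_iff.2 fun w => ?_
  exact SmoothAt.comp (f := incl _) (smoothAt_fst _) (smoothAt_incl w))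

variable {f g}

/-- The universal property of a fibre product. -/
def pbLift {T : Mfd} (u : T ⟶ A) (v : T ⟶ B) (w : ∀ x, f (u x) = g (v x)) : T ⟶ pb f g hf :=
  homMk (fun x => ⟨(u x, v x), w x⟩) (Smooth.of_local fun x => by
    obtain ⟨F, hF⟩ := hf.exists_localForm (u x)
    let O : Opens T := ⟨(fun x => u x) ⁻¹' F.U, F.U.isOpen.preimage (continuous_coe u)⟩
    have hk : Smooth fun y : T.restrict O => F.k ⟨u y.1, y.2⟩ :=
      Smooth.comp (smooth_coe F.k) (Smooth.of_incl (smooth_coe (inclHom O ≫ u)))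
    have hm : ∀ y : T.restrict O, (g (v y.1), F.k ⟨u y.1, y.2⟩) ∈ F.V := fun y => by
      have := F.mem ⟨u y.1, y.2⟩
      rwa [w] at this
    let e : T.restrict O ⟶ fibreParam f g F := homMk
      (fun y => ⟨(v y.1, F.k ⟨u y.1, y.2⟩), hm y⟩) (Smooth.of_incl (smooth_iff.2 fun y =>
        smoothAt_prod_iff.2 ⟨smoothAt_coe (inclHom O ≫ v) y, smooth_iff.1 hk y⟩))
    refine ⟨O, hF, ?_⟩
    have := smooth_coe (e ≫ (isGluing_fibreProduct f g hf).param F)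
    refine (congrArg (Smooth (M := T.restrict O) (N := pb f g hf)) (funext fun y => ?_)).mp this
    refine Subtype.ext (Prod.ext ?_ rfl)
    have h2 := congrArg Subtype.val (F.s_mk ⟨u y.1, y.2⟩)
    refine Eq.trans ?_ h2
    exact congrArg (fun y => (F.s y).1) (Subtype.ext (Prod.ext (w _).symm rfl)))

/-- A local section of `f`, composed with `g`, gives a local section of the projection. -/
theorem isSubmersion_pbSnd : IsSubmersion (pbSnd f g hf) := by
  refine .of_section fun p => ?_
  obtain ⟨V, hV, s, hs, hfs⟩ := hf.exists_section p.1.1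
  let O : Opens B := ⟨(fun x => g x) ⁻¹' V, V.isOpen.preimage (continuous_coe g)⟩
  have hO : p.1.2 ∈ O := by
    change g p.1.2 ∈ V
    rw [← p.2]; exact hV
  let s' : B.restrict O ⟶ A := homMk (fun b => s ⟨g b.1, b.2⟩)
    (Smooth.comp (smooth_coe s) (Smooth.of_incl (smooth_coe (inclHom O ≫ g))))
  refine ⟨O, hO, pbLift hf s' (inclHom O) (fun b => hfs _), ?_, fun b => rfl⟩
  refine Subtype.ext (Prod.ext ?_ rfl)
  have e : (⟨g p.1.2, hO⟩ : C.restrict V) = ⟨f p.1.1, hV⟩ := Subtype.ext p.2.symm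
  exact (congrArg s e).trans hs

theorem isSurjSubmersion_pbSnd (hf : IsSurjSubmersion f) :
    IsSurjSubmersion (pbSnd f g hf.1) :=
  ⟨isSubmersion_pbSnd hf.1, fun b => by
    obtain ⟨a, ha⟩ := hf.2 (g b)
    exact ⟨⟨(a, b), ha⟩, rfl⟩⟩

end FibreProduct

/-! ### Disjoint unions, the point and the circle -/

theorem isGluing_sigma {ι : Type} (W : ι → Mfd) :
    IsGluing W fun i w => (⟨i, w⟩ : Σ i, W i) where
  surj z := ⟨z.1, z.2, rfl⟩
  inj i w := ⟨⊤, trivial, fun u _ v _ h => by simpa using h⟩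
  trans i j w w' h := by
    obtain rfl : i = j := congrArg Sigma.fst h
    obtain rfl : w = w' := by simpa using h
    exact ⟨⊤, trivial, inclHom ⊤, rfl, fun _ => rfl⟩

/-- The disjoint union of a family of manifolds. -/
abbrev sigma {ι : Type} (W : ι → Mfd) : Mfd := (isGluing_sigma W).mfd

/-- The inclusion of a member of a disjoint union. -/
abbrev sigmaMk {ι : Type} (W : ι → Mfd) (i : ι) : W i ⟶ sigma W := (isGluing_sigma W).param i

/-- Maps out of a disjoint union. -/
def sigmaDesc {ι : Type} {W : ι → Mfd} {N : Mfd} (f : ∀ i, W i ⟶ N) : sigma W ⟶ N :=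
  homMk (fun z => f z.1 z.2) (Smooth.descend (sigmaMk W) (isGluing_sigma W).isSubmersion_param
    (isGluing_sigma W).surj fun i => smooth_coe (f i))

theorem isSubmersion_sigmaDesc {ι : Type} {W : ι → Mfd} {N : Mfd} {f : ∀ i, W i ⟶ N}
    (hf : ∀ i, IsSubmersion (f i)) : IsSubmersion (sigmaDesc f) := by
  refine .of_section fun z => ?_
  obtain ⟨V, hV, s, hs, hfs⟩ := (hf z.1).exists_section z.2
  exact ⟨V, hV, s ≫ sigmaMk W z.1, congrArg (sigmaMk W z.1) hs, hfs⟩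

/-- The one-point manifold. -/
abbrev pt : Mfd := vec PUnit

/-- A point of a manifold, as a morphism. -/
def ptHom {M : Mfd} (x : M) : pt ⟶ M := homMk (fun _ => x) (smooth_const _ x)

/-- The exponential is injective on open intervals of length `2π`, and two of its parameters for the
same point differ by a multiple of `2π`, so that transitions are translations. -/
theorem isGluing_circle :
    IsGluing (fun _ : Unit => vec ℝ) (fun _ x => Circle.exp x) where
  surj z := ⟨(), Complex.arg z, Circle.exp_arg z⟩
  inj _ w := by
    refine ⟨⟨Set.Ioo (w - Real.pi) (w + Real.pi), isOpen_Ioo⟩,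
      ⟨by linarith [Real.pi_pos], by linarith [Real.pi_pos]⟩, fun u hu v hv h => ?_⟩
    obtain ⟨m, hm⟩ := Circle.exp_eq_exp.1 h
    have h1 := hu.1; have h2 := hu.2; have h3 := hv.1; have h4 := hv.2
    have : (m : ℝ) * (2 * Real.pi) < 1 * (2 * Real.pi) := by linarith
    have h5 := lt_of_mul_lt_mul_right this (by linarith [Real.pi_pos])
    have : (-1 : ℝ) * (2 * Real.pi) < m * (2 * Real.pi) := by linarith
    have h6 := lt_of_mul_lt_mul_right this (by linarith [Real.pi_pos])
    have h7 : m = 0 := by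
      have h5' : m < 1 := by exact_mod_cast h5
      have h6' : -1 < m := by exact_mod_cast h6
      omega
    rw [hm, h7]; simp
  trans _ _ w w' h := by
    obtain ⟨m, hm⟩ := Circle.exp_eq_exp.1 h.symm
    refine ⟨⊤, trivial, homMk (fun x => x.1 + m * (2 * Real.pi)) ?_, hm.symm, fun u => ?_⟩
    · refine smooth_restrict (f := fun x : vec ℝ => ((x + m * (2 * Real.pi) : ℝ) : vec ℝ))
        fun x _ => smoothAt_vec_iff.2 (contDiffAt_id.add contDiffAt_const)
    · exact Circle.exp_eq_exp.2 ⟨m, rfl⟩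

/-- The circle, as a manifold. -/
abbrev circle : Mfd := isGluing_circle.mfd

theorem smooth_circle_coe : Smooth (M := circle) (N := vec ℂ) (fun z => (z : ℂ)) := by
  refine Smooth.descend (isGluing_circle.param) isGluing_circle.isSubmersion_param
    isGluing_circle.surj fun _ => smooth_iff.2 fun x => ?_
  have : ContDiffAt ℝ ∞ (fun x : ℝ => Complex.exp (x * Complex.I)) x :=
    ((Complex.ofRealCLM.contDiff.mul contDiff_const).cexp).contDiffAt
  exact smoothAt_vec_iff.2 this

/-- This turns circle-valued functions into maps of manifolds, so that descent along submersions
applies to them. -/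
theorem mem_smoothCircle_iff {T : Mfd} {l : T → Circle} :
    l ∈ smoothCircle T ↔ Smooth (N := circle) l := by
  constructor
  · intro h
    have h0 : ∀ x, SmoothAt (N := vec ℂ) (fun y => (l y : ℂ)) x := fun x => by
      obtain ⟨c, hc, hx⟩ := T.exists_chart x
      exact (smoothAt_to_vec hc hx).2 (h x c hc hx)
    refine smooth_iff.2 fun x => ?_
    -- A local angle of `l` near `x`: the quotient `l y / l x` is close to `1`, where the principal
    -- logarithm is smooth. The identity `l y = exp (F y)` holds for all `y`; only smoothness is
    -- local.
    let F : T → vec ℝ := fun y => Complex.arg (l x) + (Complex.log (l y / l x)).im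
    have h1 : (l x : ℂ) / l x = 1 := div_self (Circle.coe_ne_zero _)
    have hF : SmoothAt F x := by
      refine SmoothAt.comp (N := vec ℂ) (L := vec ℝ)
        (g := fun z => Complex.arg (l x) + (Complex.log (z / l x)).im) ?_ (h0 x)
      refine smoothAt_vec_iff.2 (contDiffAt_const.add ?_)
      refine Complex.imCLM.contDiff.contDiffAt.comp (f := fun z => Complex.log (z / l x)) (l x : ℂ) ?_
      have h2 : ContDiffAt ℝ ∞ Complex.log ((l x : ℂ) / l x) := by
        rw [h1]
        exact (Complex.contDiffAt_log Complex.one_mem_slitPlane).restrict_scalars ℝ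
      refine h2.comp (f := fun z : ℂ => z / l x) (l x : ℂ) ?_
      simp only [div_eq_mul_inv]
      exact contDiffAt_id.mul contDiffAt_const
    refine (SmoothAt.comp (N := vec ℝ) (smoothAt_coe (isGluing_circle.param ()) (F x)) hF).congr
      (.of_forall fun y => ?_)
    change l y = Circle.exp (F y)
    apply Circle.ext
    have h2 : (l y : ℂ) / l x ≠ 0 := div_ne_zero (Circle.coe_ne_zero _) (Circle.coe_ne_zero _)
    have h3 : Complex.log ((l y : ℂ) / l x) = ((Complex.log ((l y : ℂ) / l x)).im : ℂ) *
        Complex.I := by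
      apply Complex.ext <;> simp [Complex.log_re, Circle.norm_coe]
    have h4 := Circle.exp_arg (l x)
    rw [Circle.exp_add, h4, Circle.coe_mul, Circle.coe_exp, ← h3, Complex.exp_log h2]
    field_simp [Circle.coe_ne_zero (l x)]
  · intro h x c hc hx
    exact (smoothAt_to_vec hc hx).1
      (SmoothAt.comp (N := circle) (smooth_iff.1 smooth_circle_coe _) (smooth_iff.1 h x))

end Mfd

end

noncomputable section

open TopologicalSpace Topology

/-! ### Calculus in Lie groupoids -/

namespace LieGroupoid

variable {M : Mfd} (Γ : LieGroupoid M)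

open Classical in
/-- The product of arrows, extended by `g` to pairs which are not composable. -/
def m (g h : Γ.arr) : Γ.arr := if w : Γ.tgt g = Γ.src h then Γ.mul g h w else g

variable {Γ} {g h k : Γ.arr}

theorem m_eq (w : Γ.tgt g = Γ.src h) : Γ.m g h = Γ.mul g h w := dif_pos w

theorem src_m (w : Γ.tgt g = Γ.src h) : Γ.src (Γ.m g h) = Γ.src g := by
  rw [m_eq w, Γ.src_mul]

theorem tgt_m (w : Γ.tgt g = Γ.src h) : Γ.tgt (Γ.m g h) = Γ.tgt h := by
  rw [m_eq w, Γ.tgt_mul]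

theorem m_assoc (w : Γ.tgt g = Γ.src h) (w' : Γ.tgt h = Γ.src k) :
    Γ.m (Γ.m g h) k = Γ.m g (Γ.m h k) := by
  rw [m_eq ((tgt_m w).trans w'), m_eq (w.trans (src_m w').symm)]
  have := Γ.mul_assoc g h k w w'
  simp only [← m_eq] at this ⊢
  exact this

theorem one_m {x : M} (w : Γ.src g = x) : Γ.m (Γ.one x) g = g := by
  subst w
  rw [m_eq (Γ.tgt_one _), Γ.one_mul]

theorem m_one {x : M} (w : Γ.tgt g = x) : Γ.m g (Γ.one x) = g := by
  subst w
  rw [m_eq (Γ.src_one _).symm, Γ.mul_one]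

theorem m_inv (g : Γ.arr) : Γ.m g (Γ.inv g) = Γ.one (Γ.src g) := by
  rw [m_eq (Γ.src_inv g).symm, Γ.mul_inv]

theorem inv_m (g : Γ.arr) : Γ.m (Γ.inv g) g = Γ.one (Γ.tgt g) := by
  rw [m_eq (Γ.tgt_inv g), Γ.inv_mul]

theorem inv_m_m (w : Γ.tgt g = Γ.src h) : Γ.m (Γ.inv g) (Γ.m g h) = h := by
  rw [← m_assoc (Γ.tgt_inv g) w, inv_m, one_m w.symm]

theorem m_inv_m (w : Γ.src g = Γ.src h) : Γ.m g (Γ.m (Γ.inv g) h) = h := by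
  rw [← m_assoc (Γ.src_inv g).symm ((Γ.tgt_inv g).trans w), m_inv, one_m w.symm]

theorem m_m_inv (w : Γ.tgt g = Γ.src h) : Γ.m (Γ.m g h) (Γ.inv h) = g := by
  rw [m_assoc w (Γ.src_inv h).symm, m_inv, m_one w]

theorem left_cancel (w : Γ.tgt g = Γ.src h) (w' : Γ.tgt g = Γ.src k)
    (e : Γ.m g h = Γ.m g k) : h = k := by
  rw [← inv_m_m w, e, inv_m_m w']

theorem right_cancel (w : Γ.tgt g = Γ.src k) (w' : Γ.tgt h = Γ.src k)
    (e : Γ.m g k = Γ.m h k) : g = h := by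
  rw [← m_m_inv w, e, m_m_inv w']

theorem eq_inv (w : Γ.tgt g = Γ.src h) (e : Γ.m g h = Γ.one (Γ.src g)) : h = Γ.inv g := by
  refine left_cancel w (Γ.src_inv g).symm ?_
  rw [e, m_inv]

theorem inv_inv (g : Γ.arr) : Γ.inv (Γ.inv g) = g :=
  (eq_inv (Γ.tgt_inv g) (by rw [inv_m, Γ.src_inv])).symm

theorem inv_m_rev (w : Γ.tgt g = Γ.src h) : Γ.inv (Γ.m g h) = Γ.m (Γ.inv h) (Γ.inv g) := by
  have w' : Γ.tgt (Γ.inv h) = Γ.src (Γ.inv g) := by rw [Γ.tgt_inv, Γ.src_inv, w]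
  symm
  refine eq_inv (by rw [tgt_m w, src_m w', Γ.src_inv]) ?_
  rw [← m_assoc (by rw [tgt_m w, Γ.src_inv]) w', m_m_inv w, m_inv, src_m w]

theorem smooth_m {T : Mfd} {u v : T → Γ.arr} (hu : Smooth u) (hv : Smooth v)
    (w : ∀ x, Γ.tgt (u x) = Γ.src (v x)) : Smooth fun x => Γ.m (u x) (v x) := by
  simp only [m_eq (w _)]
  exact Γ.smooth_mul T (homMk u hu) (homMk v hv) w

theorem smooth_inv {T : Mfd} {u : T → Γ.arr} (hu : Smooth u) : Smooth fun x => Γ.inv (u x) :=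
  (smooth_coe Γ.inv).comp hu

theorem smooth_one {T : Mfd} {u : T → M} (hu : Smooth u) : Smooth fun x => Γ.one (u x) :=
  (smooth_coe Γ.one).comp hu

end LieGroupoid

open LieGroupoid

/-! ### Calculus in torsors -/

namespace LieTorsor

variable {M : Mfd} {Γ : LieGroupoid M}

@[simp]
theorem comp_base {P Q R : LieTorsor Γ} (f : P ⟶ Q) (g : Q ⟶ R) :
    Hom.base (f ≫ g) = Hom.base f ≫ Hom.base g := rfl

theorem hom_ext {P Q : LieTorsor Γ} {f g : P ⟶ Q} (h : Hom.base f = Hom.base g)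
    (h' : Hom.total f = Hom.total g) : f = g := Hom.ext h h'

variable (P : LieTorsor Γ)

open Classical in
/-- The action, extended by `p` to pairs which do not match. -/
def a (p : P.total) (g : Γ.arr) : P.total := if w : P.anchor p = Γ.src g then P.act p g w else p

open Classical in
/-- The arrow carrying one point of a fibre to another. -/
def div (p p' : P.total) : Γ.arr :=
  if h : P.proj p = P.proj p' then (P.simply_transitive p p' h).choose else Γ.one (P.anchor p)

variable {P} {p p' p'' : P.total} {g h : Γ.arr}

theorem a_eq (w : P.anchor p = Γ.src g) : P.a p g = P.act p g w := dif_pos w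

theorem proj_a (p : P.total) (g : Γ.arr) : P.proj (P.a p g) = P.proj p := by
  unfold a; split_ifs
  · exact P.proj_act _ _ _
  · rfl

theorem anchor_a (w : P.anchor p = Γ.src g) : P.anchor (P.a p g) = Γ.tgt g := by
  rw [a_eq w, P.anchor_act]

theorem a_one {x : M} (w : P.anchor p = x) : P.a p (Γ.one x) = p := by
  subst w
  rw [a_eq (Γ.src_one _).symm, P.act_one]

theorem a_a (w : P.anchor p = Γ.src g) (w' : Γ.tgt g = Γ.src h) :
    P.a (P.a p g) h = P.a p (Γ.m g h) := by
  have := P.act_mul p g h w w'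
  simp only [← a_eq, ← m_eq] at this
  exact this

theorem div_spec (e : P.proj p = P.proj p') :
    ∃ w, P.act p (P.div p p') w = p' := by
  rw [div, dif_pos e]
  exact (P.simply_transitive p p' e).choose_spec.1

theorem src_div (e : P.proj p = P.proj p') : Γ.src (P.div p p') = P.anchor p :=
  (div_spec e).1.symm

theorem a_div (e : P.proj p = P.proj p') : P.a p (P.div p p') = p' := by
  obtain ⟨w, h⟩ := div_spec e
  rw [a_eq w, h]

theorem tgt_div (e : P.proj p = P.proj p') : Γ.tgt (P.div p p') = P.anchor p' := by
  rw [← anchor_a (src_div e).symm, a_div e]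

theorem eq_div (w : P.anchor p = Γ.src g) (e : P.a p g = p') : g = P.div p p' := by
  have e' : P.proj p = P.proj p' := by rw [← e, proj_a]
  rw [a_eq w] at e
  exact (P.simply_transitive p p' e').unique ⟨w, e⟩ (div_spec e')

theorem div_self (p : P.total) : P.div p p = Γ.one (P.anchor p) :=
  (eq_div (Γ.src_one _).symm (a_one rfl)).symm

theorem m_div (e : P.proj p = P.proj p') (e' : P.proj p' = P.proj p'') :
    Γ.m (P.div p p') (P.div p' p'') = P.div p p'' := by
  have w : Γ.tgt (P.div p p') = Γ.src (P.div p' p'') := by rw [tgt_div e, src_div e']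
  refine eq_div (by rw [src_m w, src_div e]) ?_
  rw [← a_a (src_div e).symm w, a_div e, a_div e']

theorem smooth_a {T : Mfd} {u : T → P.total} {v : T → Γ.arr} (hu : Smooth u) (hv : Smooth v)
    (w : ∀ x, P.anchor (u x) = Γ.src (v x)) : Smooth fun x => P.a (u x) (v x) := by
  simp only [a_eq (w _)]
  exact P.smooth_act T (homMk u hu) (homMk v hv) w

theorem smooth_divide {T : Mfd} {u v : T → P.total} (hu : Smooth u) (hv : Smooth v)
    (w : ∀ x, P.proj (u x) = P.proj (v x)) : Smooth fun x => P.div (u x) (v x) :=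
  P.smooth_div T (homMk u hu) (homMk v hv) _ fun x => div_spec (w x)

namespace Hom

variable {P Q R : LieTorsor Γ} (f : P ⟶ Q)

theorem proj_tot (p : P.total) : Q.proj (Hom.total f p) = Hom.base f (P.proj p) :=
  Hom.proj_total f p

theorem anchor_tot (p : P.total) : Q.anchor (Hom.total f p) = P.anchor p :=
  Hom.anchor_total f p

theorem total_a (p : P.total) (g : Γ.arr) :
    Hom.total f (P.a p g) = Q.a (Hom.total f p) g := by
  by_cases w : P.anchor p = Γ.src g
  · rw [a_eq w, a_eq ((anchor_tot f p).trans w)]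
    exact Hom.total_act f p g w
  · have w' : ¬ Q.anchor (Hom.total f p) = Γ.src g := by rwa [anchor_tot]
    rw [a, dif_neg w, a, dif_neg w']

theorem proj_eq {p p' : P.total} (e : P.proj p = P.proj p') :
    Q.proj (Hom.total f p) = Q.proj (Hom.total f p') := by
  rw [proj_tot, proj_tot, e]

theorem div_total {p p' : P.total} (e : P.proj p = P.proj p') :
    Q.div (Hom.total f p) (Hom.total f p') = P.div p p' := by
  symm
  refine eq_div (by rw [anchor_tot, src_div e]) ?_
  rw [← total_a, a_div e]

/-- Morphisms of torsors preserve the arrow carrying one point of a fibre to another; if the images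
agree, that arrow is a unit. -/
theorem total_inj {p p' : P.total} (e : P.proj p = P.proj p')
    (h : Hom.total f p = Hom.total f p') : p = p' := by
  have h1 := div_total f e
  rw [← h, div_self, anchor_tot] at h1
  rw [← a_div e, ← h1, a_one rfl]

/-- The point over `b` of the source of a morphism that is mapped to `r`. -/
theorem exists_fib (b : P.base) (r : Q.total) (w : Q.proj r = Hom.base f b) :
    ∃ p : P.total, P.proj p = b ∧ Hom.total f p = r := by
  obtain ⟨p, rfl⟩ := P.proj_surjSubmersion.2 b
  have e : Q.proj (Hom.total f p) = Q.proj r := by rw [proj_tot, w]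
  exact ⟨P.a p (Q.div (Hom.total f p) r), by rw [proj_a], by rw [total_a, a_div e]⟩

/-- Smooth families of points of the source of a morphism correspond to compatible families of
points of its base and of the target. -/
theorem exists_fibHom {T : Mfd} (b : T ⟶ P.base) (r : T ⟶ Q.total)
    (w : ∀ x, Q.proj (r x) = Hom.base f (b x)) :
    ∃ p : T ⟶ P.total, (∀ x, P.proj (p x) = b x) ∧ ∀ x, Hom.total f (p x) = r x := by
  choose p hp hp' using fun x => exists_fib f (b x) (r x) (w x)
  refine ⟨homMk p ?_, hp, hp'⟩
  -- The points `p x` were merely chosen. After base change to `P.total ×_{P.base} T` they are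
  -- translates of the tautological point by a quotient computed in `Q`, which is smooth.
  refine Smooth.descend_one (isSurjSubmersion_pbSnd (g := b) P.proj_surjSubmersion) ?_
  have e : ∀ y : pb P.proj b P.proj_surjSubmersion.1,
      Q.proj (Hom.total f y.1.1) = Q.proj (r y.1.2) := fun y => by
    rw [proj_tot, w, y.2]
  have : (fun y => p (pbSnd P.proj b P.proj_surjSubmersion.1 y)) =
      fun y => P.a (pbFst P.proj b P.proj_surjSubmersion.1 y)
        (Q.div ((pbFst P.proj b P.proj_surjSubmersion.1 ≫ Hom.total f) y)
          ((pbSnd P.proj b P.proj_surjSubmersion.1 ≫ r) y)) := by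
    funext y
    refine total_inj f ?_ ?_
    · rw [proj_a, hp]
      exact y.2.symm
    · rw [hp', total_a]
      exact (a_div (e y)).symm
  rw [this]
  refine smooth_a (smooth_coe _) (smooth_divide (smooth_coe _) (smooth_coe _) e) fun y => ?_
  exact (anchor_tot f _).symm.trans (src_div (e y)).symm

/-- The total space of `P` is the fibre product of its base with the total space of `Q`. Precomposed
with the resulting surjection from that fibre product, the map on total spaces is the base change of
the submersion on bases. -/
theorem isSubmersion_total (hf : IsSubmersion (Hom.base f)) : IsSubmersion (Hom.total f) := by
  obtain ⟨m, hm, hm'⟩ := exists_fibHom f (pbFst (Hom.base f) Q.proj hf)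
    (pbSnd (Hom.base f) Q.proj hf) fun y => y.2.symm
  refine IsSubmersion.of_comp (f := m) ?_ ?_
  · have : m ≫ Hom.total f = pbSnd (Hom.base f) Q.proj hf := Mfd.hom_ext hm'
    rw [this]; exact isSubmersion_pbSnd hf
  · intro p
    refine ⟨⟨(P.proj p, Hom.total f p), (proj_tot f p).symm⟩, total_inj f ?_ ?_⟩
    · rw [hm]; rfl
    · rw [hm']; rfl

end Hom

/-- Arrows of the stack of torsors are cartesian. -/
theorem exists_lift {P Q R : LieTorsor Γ} (ψ : P ⟶ R) (φ : Q ⟶ R) (g : P.base ⟶ Q.base)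
    (w : Hom.base ψ = g ≫ Hom.base φ) : ∃ χ : P ⟶ Q, Hom.base χ = g ∧ χ ≫ φ = ψ := by
  obtain ⟨m, hm, hm'⟩ := Hom.exists_fibHom φ (P.proj ≫ g) (Hom.total ψ) fun x => by
    rw [Hom.proj_tot, w]; rfl
  have ha : ∀ p, Q.anchor (m p) = P.anchor p := fun p => by
    rw [← Hom.anchor_tot φ, hm', Hom.anchor_tot]
  refine ⟨{ base := g, total := m, proj_total := hm, anchor_total := ha, total_act := ?_ }, rfl,
    hom_ext w.symm (Mfd.hom_ext hm')⟩
  intro p x w'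
  rw [← a_eq, ← a_eq]
  refine Hom.total_inj φ ?_ ?_
  · rw [proj_a, hm, hm]
    exact congrArg g (proj_a p x)
  · rw [hm', Hom.total_a, Hom.total_a, hm']

theorem lift_unique {P Q R : LieTorsor Γ} {χ χ' : P ⟶ Q} (φ : Q ⟶ R)
    (h : Hom.base χ = Hom.base χ') (h' : χ ≫ φ = χ' ≫ φ) : χ = χ' := by
  refine hom_ext h (Mfd.hom_ext fun p => Hom.total_inj φ ?_ ?_)
  · rw [Hom.proj_tot, Hom.proj_tot, h]
  · exact congrArg (fun f : P ⟶ R => Hom.total f p) h'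

/-- The pullback of a torsor. -/
abbrev pullback (P : LieTorsor Γ) {S : Mfd} (f : S ⟶ P.base) : LieTorsor Γ where
  base := S
  total := pb P.proj f P.proj_surjSubmersion.1
  proj := pbSnd P.proj f P.proj_surjSubmersion.1
  anchor := pbFst P.proj f P.proj_surjSubmersion.1 ≫ P.anchor
  act p g _ := ⟨(P.a p.1.1 g, p.1.2), by rw [proj_a]; exact p.2⟩
  proj_surjSubmersion := isSurjSubmersion_pbSnd P.proj_surjSubmersion
  smooth_act T p g w := smooth_coe (pbLift P.proj_surjSubmersion.1
    (homMk (fun x => P.a ((p ≫ pbFst P.proj f P.proj_surjSubmersion.1) x) (g x))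
      (smooth_a (smooth_coe _) (smooth_coe g) w))
    (p ≫ pbSnd P.proj f P.proj_surjSubmersion.1) fun x => by
      rw [homMk_apply, proj_a]; exact (p x).2)
  proj_act p g w := rfl
  anchor_act p g w := anchor_a w
  act_one p := Subtype.ext (Prod.ext (a_one rfl) rfl)
  act_mul p g h w w' := Subtype.ext (Prod.ext (by
    have w1 : P.anchor p.1.1 = Γ.src g := w
    change P.a (P.a _ _) _ = P.a _ _
    rw [a_a w1 w', m_eq w']) rfl)
  simply_transitive p p' e := by
    have e' : p.1.2 = p'.1.2 := e
    have e1 : P.proj p.1.1 = P.proj p'.1.1 := by rw [p.2, p'.2, e']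
    refine ⟨P.div p.1.1 p'.1.1, ⟨(src_div e1).symm, Subtype.ext (Prod.ext (a_div e1) e')⟩, ?_⟩
    rintro g ⟨w, h⟩
    exact eq_div w (congrArg (fun z => z.1.1) h)
  smooth_div T p p' d hd := by
    refine P.smooth_div T (p ≫ pbFst P.proj f P.proj_surjSubmersion.1)
      (p' ≫ pbFst P.proj f P.proj_surjSubmersion.1) d fun x => ?_
    obtain ⟨w, h⟩ := hd x
    refine ⟨w, ?_⟩
    rw [← a_eq]
    exact congrArg (fun z => z.1.1) h

theorem pullback_a (P : LieTorsor Γ) {S : Mfd} (f : S ⟶ P.base) (p : (P.pullback f).total)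
    (g : Γ.arr) : ((P.pullback f).a p g).1 = (P.a p.1.1 g, p.1.2) := by
  by_cases w : (P.pullback f).anchor p = Γ.src g
  · rw [a_eq w]
  · have w' : ¬ P.anchor p.1.1 = Γ.src g := w
    rw [a, dif_neg w, a, dif_neg w']

/-- The canonical arrow from a pullback. -/
def pullbackHom (P : LieTorsor Γ) {S : Mfd} (f : S ⟶ P.base) : P.pullback f ⟶ P where
  base := f
  total := pbFst P.proj f P.proj_surjSubmersion.1
  proj_total p := p.2
  anchor_total _ := rfl
  total_act p g w := a_eq (P := P) w

/-- A morphism of torsors given on a section of the source. -/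
def homOfSection {P Q : LieTorsor Γ} (s : P.base ⟶ P.total) (hs : ∀ x, P.proj (s x) = x)
    (t : P.base ⟶ Q.total) (w : ∀ x, Q.anchor (t x) = P.anchor (s x)) : P ⟶ Q where
  base := t ≫ Q.proj
  total := homMk (fun p => Q.a (t (P.proj p)) (P.div (s (P.proj p)) p))
    (smooth_a (smooth_coe (P.proj ≫ t))
      (smooth_divide (smooth_coe (P.proj ≫ s)) (smooth_coe (𝟙 _)) fun p => hs _)
      fun p => by rw [src_div (hs _)]; exact w _)
  proj_total p := by rw [homMk_apply, proj_a]; rfl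
  anchor_total p := by
    rw [homMk_apply, anchor_a (by rw [src_div (hs _)]; exact w _), tgt_div (hs _)]
  total_act p g w' := by
    have w1 : Γ.tgt (P.div (s (P.proj p)) p) = Γ.src g := by rw [tgt_div (hs _), w']
    rw [← a_eq, ← a_eq, homMk_apply, homMk_apply, proj_a,
      a_a (by rw [src_div (hs _), w]) w1]
    congr 1
    symm
    refine eq_div (by rw [src_m w1, src_div (hs _)]) ?_
    rw [← a_a (src_div (hs _)).symm w1, a_div (hs _)]

/-- Morphisms of torsors which agree on a family of points meeting all fibres are equal. -/
theorem hom_ext_of_points {P Q : LieTorsor Γ} {f g : P ⟶ Q} (hb : Hom.base f = Hom.base g)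
    (h : ∀ b : P.base, ∃ p, P.proj p = b ∧ Hom.total f p = Hom.total g p) : f = g := by
  refine hom_ext hb (Mfd.hom_ext fun p => ?_)
  obtain ⟨q, hq, e⟩ := h (P.proj p)
  rw [← a_div hq, Hom.total_a, Hom.total_a, e]

/-- Gluing of morphisms of torsors. -/
theorem exists_glueHom {ι : Type} {x y : LieTorsor Γ} (z : ι → LieTorsor Γ) (e : ∀ i, z i ⟶ x)
    (φ : ∀ i, z i ⟶ y) (he : ∀ i, IsSubmersion (Hom.base (e i)))
    (hsurj : ∀ b, ∃ i, ∃ c, Hom.base (e i) c = b) (f : x.base ⟶ y.base)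
    (hf : ∀ i, Hom.base (φ i) = Hom.base (e i) ≫ f)
    (h : ∀ i j p q, Hom.total (e i) p = Hom.total (e j) q →
      Hom.total (φ i) p = Hom.total (φ j) q) :
    ∃ ψ : x ⟶ y, Hom.base ψ = f ∧ ∀ i, e i ≫ ψ = φ i := by
  have hs : ∀ p : x.total, ∃ i, ∃ q, Hom.total (e i) q = p := fun p => by
    obtain ⟨i, c, hc⟩ := hsurj (x.proj p)
    obtain ⟨q, -, hq⟩ := Hom.exists_fib (e i) c p hc.symm
    exact ⟨i, q, hq⟩
  choose I q hq using hs
  have key : ∀ i p, Hom.total (φ (I (Hom.total (e i) p))) (q (Hom.total (e i) p)) =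
      Hom.total (φ i) p := fun i p => h _ _ _ _ (hq _)
  let T : x.total ⟶ y.total := homMk (fun p => Hom.total (φ (I p)) (q p)) (by
    refine Smooth.descend (fun i => Hom.total (e i)) (fun i => Hom.isSubmersion_total _ (he i))
      (fun p => ⟨_, _, hq p⟩) fun i => ?_
    simp only [key]
    exact smooth_coe _)
  have hT : ∀ i p, T (Hom.total (e i) p) = Hom.total (φ i) p := key
  refine ⟨{ base := f, total := T, proj_total := ?_, anchor_total := ?_, total_act := ?_ }, rfl,
    fun i => hom_ext (hf i).symm (Mfd.hom_ext (hT i))⟩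
  · intro p
    obtain ⟨i, q, rfl⟩ : ∃ i, ∃ q, Hom.total (e i) q = p := ⟨_, _, hq p⟩
    rw [hT, Hom.proj_tot, Hom.proj_tot, hf]; rfl
  · intro p
    obtain ⟨i, q, rfl⟩ : ∃ i, ∃ q, Hom.total (e i) q = p := ⟨_, _, hq p⟩
    rw [hT, Hom.anchor_tot, Hom.anchor_tot]
  · intro p g w
    rw [← a_eq, ← a_eq]
    obtain ⟨i, q, rfl⟩ : ∃ i, ∃ q, Hom.total (e i) q = p := ⟨_, _, hq p⟩
    rw [hT, ← Hom.total_a, hT, Hom.total_a]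

/-! ### Gluing of torsors -/

/-- Gluing data for torsors over the members of an étale covering family. -/
structure GlueData {ι : Type} (X : Mfd) (P : ι → LieTorsor Γ) (u : ∀ i, (P i).base ⟶ X) where
  cover : IsCover u
  τ : ∀ i j (p : (P i).total) (b : (P j).base), u i ((P i).proj p) = u j b → (P j).total
  proj_τ : ∀ i j p b w, (P j).proj (τ i j p b w) = b
  anchor_τ : ∀ i j p b w, (P j).anchor (τ i j p b w) = (P i).anchor p
  τ_a : ∀ i j p b w g w', τ i j ((P i).a p g) b w' = (P j).a (τ i j p b w) g
  τ_τ : ∀ i j k p b c w w' w'', τ j k (τ i j p b w) c w' = τ i k p c w''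
  smooth_τ : ∀ i j (T : Mfd) (p : T ⟶ (P i).total) (b : T ⟶ (P j).base)
    (w : ∀ x, u i ((P i).proj (p x)) = u j (b x)), Smooth fun x => τ i j (p x) (b x) (w x)

namespace GlueData

variable {ι : Type} {X : Mfd} {P : ι → LieTorsor Γ} {u : ∀ i, (P i).base ⟶ X}
  (D : GlueData X P u)

/-- The cocycle identity makes `τ i i` idempotent. Writing `τ p = p · d` and using equivariance
gives `τ p · d = τ p`; the action is free, so `d` is a unit. -/
theorem τ_self (i : ι) (p : (P i).total) (w) : D.τ i i p ((P i).proj p) w = p := by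
  have e : (P i).proj p = (P i).proj (D.τ i i p ((P i).proj p) w) := (D.proj_τ _ _ _ _ _).symm
  have h1 := D.τ_τ i i i p ((P i).proj p) ((P i).proj p) w (by rw [D.proj_τ]) w
  have h2 : D.τ i i ((P i).a p ((P i).div p (D.τ i i p ((P i).proj p) w))) ((P i).proj p)
      (by rw [proj_a]) = D.τ i i p ((P i).proj p) w := by
    simp only [a_div e]
    exact h1
  rw [D.τ_a i i p _ w] at h2
  have w1 : (P i).anchor (D.τ i i p ((P i).proj p) w) =
      Γ.src ((P i).div p (D.τ i i p ((P i).proj p) w)) := by rw [src_div e, D.anchor_τ]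
  have h3 := eq_div w1 h2
  rw [div_self, D.anchor_τ] at h3
  have h4 := a_div e
  rw [h3, a_one rfl] at h4
  exact h4.symm

/-- The equivalence relation whose quotient is the glued torsor. -/
def setoid : Setoid (Σ i, (P i).total) where
  r p q := ∃ w, D.τ p.1 q.1 p.2 ((P q.1).proj q.2) w = q.2
  iseqv := by
    refine ⟨fun p => ⟨rfl, D.τ_self _ _ _⟩, ?_, ?_⟩
    · rintro ⟨i, p⟩ ⟨j, q⟩ ⟨w, h⟩
      refine ⟨w.symm, ?_⟩
      dsimp only at h ⊢
      have h1 := D.τ_τ i j i p _ ((P i).proj p) w (by rw [h]; exact w.symm) rfl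
      simp only [h] at h1
      rw [h1, D.τ_self]
    · rintro ⟨i, p⟩ ⟨j, q⟩ ⟨k, r⟩ ⟨w, h⟩ ⟨w', h'⟩
      refine ⟨w.trans w', ?_⟩
      dsimp only at h h' ⊢
      have h1 := D.τ_τ i j k p _ ((P k).proj r) w (by rw [h]; exact w') (w.trans w')
      simp only [h] at h1
      rw [← h1, h']

/-- The class of a point in the glued torsor. -/
def cls (i : ι) (p : (P i).total) : Quotient D.setoid := Quotient.mk D.setoid ⟨i, p⟩

theorem cls_eq_iff {i j : ι} {p : (P i).total} {q : (P j).total} :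
    D.cls i p = D.cls j q ↔ ∃ w, D.τ i j p ((P j).proj q) w = q :=
  Quotient.eq (r := D.setoid)

theorem cls_τ (i j : ι) (p : (P i).total) (b : (P j).base) (w) :
    D.cls j (D.τ i j p b w) = D.cls i p :=
  (D.cls_eq_iff.2 ⟨by rw [D.proj_τ, w], by simp only [D.proj_τ]⟩).symm

theorem cls_inj {i : ι} {p q : (P i).total} (e : (P i).proj p = (P i).proj q)
    (h : D.cls i p = D.cls i q) : p = q := by
  obtain ⟨w, h⟩ := D.cls_eq_iff.1 h
  simp only [← e, D.τ_self] at h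
  exact h

theorem exists_rep (z : Quotient D.setoid) : ∃ i p, D.cls i p = z := by
  obtain ⟨⟨i, p⟩, rfl⟩ := Quotient.exists_rep z
  exact ⟨i, p, rfl⟩

/-- The map `u i` is étale, hence injective on an open set, and `cls` is then injective above that
set because `cls` is injective on each fibre. Transition maps are `τ` evaluated on a local section
of `u j`. -/
theorem isGluing : IsGluing (fun i => (P i).total) D.cls where
  surj := D.exists_rep
  inj i p := by
    obtain ⟨U, V, s, hU, hs, -⟩ := (D.cover.1 i).local_form ((P i).proj p)
    refine ⟨⟨(fun p => (P i).proj p) ⁻¹' U, U.isOpen.preimage (continuous_coe _)⟩, hU,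
      fun q hq q' hq' h => D.cls_inj ?_ h⟩
    obtain ⟨w, -⟩ := D.cls_eq_iff.1 h
    obtain ⟨h1, h2⟩ := hs ⟨_, hq⟩
    obtain ⟨h3, h4⟩ := hs ⟨_, hq'⟩
    have e : (⟨u i ((P i).proj q), h1⟩ : X.restrict V) = ⟨u i ((P i).proj q'), h3⟩ :=
      Subtype.ext w
    have h5 := h2.symm.trans ((congrArg s e).trans h4)
    exact congrArg Subtype.val h5
  trans i j p q h := by
    obtain ⟨w, h⟩ := D.cls_eq_iff.1 h
    obtain ⟨V, hV, s, hs, hus⟩ := (D.cover.1 j).isSubmersion.exists_section ((P j).proj q)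
    let O : Opens (P i).total := ⟨(fun p => u i ((P i).proj p)) ⁻¹' V,
      V.isOpen.preimage (continuous_coe ((P i).proj ≫ u i))⟩
    have hO : p ∈ O := by
      change u i ((P i).proj p) ∈ V
      rw [w]; exact hV
    let b : (P i).total.restrict O ⟶ (P j).base := homMk (fun y => s ⟨u i ((P i).proj y.1), y.2⟩)
      (Smooth.comp (smooth_coe s)
        (Smooth.of_incl (smooth_coe (inclHom O ≫ (P i).proj ≫ u i))))
    have hb : ∀ y : (P i).total.restrict O, u i ((P i).proj (inclHom O y)) = u j (b y) :=
      fun y => (hus ⟨u i ((P i).proj y.1), y.2⟩).symm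
    refine ⟨O, hO, homMk _ (D.smooth_τ i j _ (inclHom O) b hb), ?_, fun y => D.cls_τ _ _ _ _ _⟩
    refine Eq.trans ?_ h
    have e : b ⟨p, hO⟩ = (P j).proj q := by
      have e' : (⟨u i ((P i).proj p), hO⟩ : X.restrict V) = ⟨_, hV⟩ := Subtype.ext w
      exact (congrArg s e').trans hs
    have key : ∀ b' (hb' : b' = (P j).proj q) w', D.τ i j p b' w' = D.τ i j p _ w := by
      rintro _ rfl _; rfl
    exact key _ e _

/-- The total space of a glued torsor. -/
abbrev tot : Mfd := D.isGluing.mfd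

/-- The inclusion of the total spaces in the glued one. -/
abbrev inc (i : ι) : (P i).total ⟶ D.tot := D.isGluing.param i

theorem descend {N : Mfd} {f : D.tot → N} (h : ∀ i, Smooth fun p => f (D.cls i p)) : Smooth f :=
  Smooth.descend D.inc D.isGluing.isSubmersion_param D.isGluing.surj h

/-- Smooth maps from the source of a map to a glued torsor may be tested after lifting. -/
theorem descend_along {T N : Mfd} (z : T ⟶ D.tot) {f : T → N}
    (h : ∀ (i : ι) (T' : Mfd) (v : T' ⟶ T) (p : T' ⟶ (P i).total),
      (∀ y, z (v y) = D.cls i (p y)) → Smooth fun y => f (v y)) : Smooth f := by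
  refine Smooth.descend (fun i => pbSnd (D.inc i) z (D.isGluing.isSubmersion_param i))
    (fun i => isSubmersion_pbSnd _) (fun x => ?_) fun i => h i _ _ (pbFst _ _ _) fun y => y.2.symm
  obtain ⟨i, p, hp⟩ := D.exists_rep (z x)
  exact ⟨i, ⟨(p, x), hp⟩, rfl⟩

/-- The structure map of a glued torsor. -/
def projHom : D.tot ⟶ X := homMk (Quotient.lift (fun p => u p.1 ((P p.1).proj p.2))
  (fun _ _ h => h.1)) (D.descend fun i => smooth_coe ((P i).proj ≫ u i))

theorem projHom_cls (i : ι) (p : (P i).total) : D.projHom (D.cls i p) = u i ((P i).proj p) := rfl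

/-- The anchor map of a glued torsor. -/
def anchorHom : D.tot ⟶ M := homMk (Quotient.lift (fun p => (P p.1).anchor p.2)
  (fun p q h => by obtain ⟨w, h⟩ := h; rw [← h, D.anchor_τ]))
  (D.descend fun i => smooth_coe ((P i).anchor))

theorem anchorHom_cls (i : ι) (p : (P i).total) : D.anchorHom (D.cls i p) = (P i).anchor p := rfl

/-- The action on a glued torsor. -/
def actFun (z : D.tot) (g : Γ.arr) : D.tot :=
  Quotient.lift (fun p => D.cls p.1 ((P p.1).a p.2 g)) (by
    rintro ⟨i, p⟩ ⟨j, q⟩ ⟨w, h⟩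
    dsimp only at h ⊢
    rw [← h, ← D.τ_a i j p _ w g (by rw [proj_a, w]), D.cls_τ]) z

theorem actFun_cls (i : ι) (p : (P i).total) (g : Γ.arr) :
    D.actFun (D.cls i p) g = D.cls i ((P i).a p g) := rfl

theorem projHom_actFun (z : D.tot) (g : Γ.arr) : D.projHom (D.actFun z g) = D.projHom z := by
  obtain ⟨i, p, rfl⟩ := D.exists_rep z
  rw [actFun_cls, projHom_cls, projHom_cls, proj_a]

theorem exists_common_rep {z z' : D.tot} (e : D.projHom z = D.projHom z') :
    ∃ i p p', D.cls i p = z ∧ D.cls i p' = z' ∧ (P i).proj p = (P i).proj p' := by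
  obtain ⟨i, p, rfl⟩ := D.exists_rep z
  obtain ⟨j, q, rfl⟩ := D.exists_rep z'
  exact ⟨j, D.τ i j p ((P j).proj q) e, q, D.cls_τ _ _ _ _ _, rfl, D.proj_τ _ _ _ _ _⟩

/-- The glued torsor. -/
abbrev torsor : LieTorsor Γ where
  base := X
  total := D.tot
  proj := D.projHom
  anchor := D.anchorHom
  act z g _ := D.actFun z g
  proj_surjSubmersion := by
    refine ⟨.of_section fun z => ?_, fun x => ?_⟩
    · obtain ⟨i, p, rfl⟩ := D.exists_rep z
      obtain ⟨V, hV, s, hs, hfs⟩ := ((P i).proj_surjSubmersion.1.comp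
        (D.cover.1 i).isSubmersion).exists_section p
      exact ⟨V, hV, s ≫ D.inc i, congrArg (D.inc i) hs, hfs⟩
    · obtain ⟨i, b, rfl⟩ := D.cover.2 x
      obtain ⟨p, rfl⟩ := (P i).proj_surjSubmersion.2 b
      exact ⟨D.cls i p, rfl⟩
  smooth_act T z g w := by
    refine D.descend_along z fun i T' v p hp => ?_
    simp only [hp]
    have w' : ∀ y, (P i).anchor (p y) = Γ.src ((v ≫ g) y) := fun y => by
      have := w (v y)
      rwa [hp, anchorHom_cls] at this
    exact (smooth_coe (D.inc i)).comp (smooth_a (smooth_coe p) (smooth_coe (v ≫ g)) w')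
  proj_act z g _ := D.projHom_actFun z g
  anchor_act z g w := by
    obtain ⟨i, p, rfl⟩ := D.exists_rep z
    exact anchor_a (P := P i) w
  act_one z := by
    obtain ⟨i, p, rfl⟩ := D.exists_rep z
    exact congrArg (D.cls i) (a_one rfl)
  act_mul z g h w w' := by
    obtain ⟨i, p, rfl⟩ := D.exists_rep z
    refine congrArg (D.cls i) ?_
    rw [← m_eq w']
    exact a_a (P := P i) w w'
  simply_transitive z z' e := by
    obtain ⟨i, p, p', rfl, rfl, e'⟩ := D.exists_common_rep e
    refine ⟨(P i).div p p', ⟨(src_div e').symm, congrArg (D.cls i) (a_div e')⟩, ?_⟩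
    rintro g ⟨w, h⟩
    exact eq_div (P := P i) w (D.cls_inj (by rw [proj_a, e']) h)
  smooth_div T z z' d hd := by
    -- Both points are lifted locally to representatives in members `i` and `j`; the first is
    -- transported to `j` by `τ`, and the quotient is the smooth one of `P j`.
    refine D.descend_along z fun i T' v p hp => ?_
    refine D.descend_along (v ≫ z') fun j T'' v' p' hp' => ?_
    have e : ∀ y, u i ((P i).proj (p (v' y))) = u j ((P j).proj (p' y)) := fun y => by
      obtain ⟨w, h⟩ := hd (v (v' y))
      have h1 := D.projHom_actFun (z (v (v' y))) (d (v (v' y)))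
      rw [h] at h1
      have h2 : z' (v (v' y)) = D.cls j (p' y) := hp' y
      rw [h2, hp] at h1
      exact h1.symm
    have hq := D.smooth_τ i j T'' (v' ≫ p) (p' ≫ (P j).proj) e
    have : (fun y => d (v (v' y))) =
        fun y => (P j).div (D.τ i j ((v' ≫ p) y) ((p' ≫ (P j).proj) y) (e y)) (p' y) := by
      funext y
      obtain ⟨w, h⟩ := hd (v (v' y))
      have h2 : z' (v (v' y)) = D.cls j (p' y) := hp' y
      rw [h2, hp] at h
      rw [hp, anchorHom_cls] at w
      have h3 : z (v (v' y)) = D.cls j (D.τ i j (p (v' y)) ((P j).proj (p' y)) (e y)) := by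
        rw [hp, D.cls_τ]
      refine eq_div ?_ (D.cls_inj ?_ ?_)
      · rw [D.anchor_τ]; exact w
      · rw [proj_a, D.proj_τ]; rfl
      · rw [← actFun_cls]
        refine Eq.trans ?_ h
        congr 1
        exact D.cls_τ _ _ _ _ _
    rw [this]
    exact smooth_divide hq (smooth_coe p') fun y => D.proj_τ _ _ _ _ _

/-- The arrows to the glued torsor. -/
def incHom (i : ι) : P i ⟶ D.torsor where
  base := u i
  total := D.inc i
  proj_total _ := rfl
  anchor_total _ := rfl
  total_act p g w := by
    rw [← a_eq]; rfl

end GlueData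

end LieTorsor

end

noncomputable section

open TopologicalSpace Topology LieGroupoid LieTorsor

/-! ### Calculus in principal circle bundles and central extensions -/

namespace PrincipalCircle

variable {P B : Mfd} {π : P ⟶ B} (C : PrincipalCircle π) {p p' p'' : P} {a b : Circle}

open Classical in
/-- The element of the circle carrying one point of a fibre to another. -/
def quo (p p' : P) : Circle :=
  if h : π p = π p' then (C.simply_transitive p p' h).choose else 1

theorem quo_smul (h : π p = π p') : C.smul (C.quo p p') p = p' := by
  rw [quo, dif_pos h]
  exact (C.simply_transitive p p' h).choose_spec.1

theorem eq_quo (h : C.smul a p = p') : a = C.quo p p' := by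
  have h' : π p = π p' := by rw [← h, C.proj_smul]
  exact (C.simply_transitive p p' h').unique h (C.quo_smul h')

theorem smul_cancel (h : C.smul a p = C.smul b p) : a = b :=
  (C.eq_quo h).trans (C.eq_quo rfl).symm

theorem quo_mul_quo (h : π p = π p') (h' : π p' = π p'') :
    C.quo p p' * C.quo p' p'' = C.quo p p'' := by
  apply C.eq_quo
  rw [mul_comm, C.mul_smul, C.quo_smul h, C.quo_smul h']

theorem quo_self (p : P) : C.quo p p = 1 := (C.eq_quo (C.one_smul p)).symm

theorem quo_smul_left (h : π p = π p') : C.quo (C.smul a p) p' = a⁻¹ * C.quo p p' := by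
  symm
  apply C.eq_quo
  rw [← C.mul_smul, mul_comm _ a, mul_inv_cancel_left, C.quo_smul h]

theorem quo_smul_right (h : π p = π p') : C.quo p (C.smul a p') = a * C.quo p p' := by
  symm
  apply C.eq_quo
  rw [C.mul_smul, C.quo_smul h]

theorem quo_mem {T : Mfd} {u v : T → P} (hu : Smooth u) (hv : Smooth v)
    (w : ∀ x, π (u x) = π (v x)) : (fun x => C.quo (u x) (v x)) ∈ smoothCircle T :=
  C.smooth_div T (homMk u hu) (homMk v hv) _ fun x => C.quo_smul (w x)

theorem smooth_sm {T : Mfd} {l : T → Circle} {u : T → P} (hl : l ∈ smoothCircle T)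
    (hu : Smooth u) : Smooth fun x => C.smul (l x) (u x) :=
  C.smooth_smul T ⟨l, hl⟩ (homMk u hu)

end PrincipalCircle

namespace CentralExtension

variable {M : Mfd} {X : LieGroupoid M} (E : CentralExtension X)

/-- The action of the circle. -/
abbrev sm (a : Circle) (g : E.grpd.arr) : E.grpd.arr := E.principal.smul a g

variable {E} {g h : E.grpd.arr} {a b : Circle}

theorem src_eq_of_π (e : E.π g = E.π h) : E.grpd.src g = E.grpd.src h := by
  rw [← E.src_π, e, E.src_π]

theorem tgt_eq_of_π (e : E.π g = E.π h) : E.grpd.tgt g = E.grpd.tgt h := by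
  rw [← E.tgt_π, e, E.tgt_π]

@[simp]
theorem π_sm (a : Circle) (g : E.grpd.arr) : E.π (E.sm a g) = E.π g := E.principal.proj_smul a g

@[simp]
theorem src_sm (a : Circle) (g : E.grpd.arr) : E.grpd.src (E.sm a g) = E.grpd.src g :=
  src_eq_of_π (π_sm a g)

@[simp]
theorem tgt_sm (a : Circle) (g : E.grpd.arr) : E.grpd.tgt (E.sm a g) = E.grpd.tgt g :=
  tgt_eq_of_π (π_sm a g)

@[simp]
theorem one_sm (g : E.grpd.arr) : E.sm 1 g = g := E.principal.one_smul g

theorem sm_sm (a b : Circle) (g : E.grpd.arr) : E.sm a (E.sm b g) = E.sm (a * b) g :=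
  (E.principal.mul_smul a b g).symm

theorem sm_m_sm (w : E.grpd.tgt g = E.grpd.src h) :
    E.grpd.m (E.sm a g) (E.sm b h) = E.sm (a * b) (E.grpd.m g h) := by
  rw [m_eq w, m_eq (by rw [src_sm, tgt_sm, w])]
  exact E.smul_mul_smul a b g h w _

theorem sm_m (w : E.grpd.tgt g = E.grpd.src h) :
    E.grpd.m (E.sm a g) h = E.sm a (E.grpd.m g h) := by
  have := sm_m_sm (a := a) (b := 1) w
  rwa [one_sm, _root_.mul_one] at this

theorem m_sm (w : E.grpd.tgt g = E.grpd.src h) :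
    E.grpd.m g (E.sm a h) = E.sm a (E.grpd.m g h) := by
  have := sm_m_sm (a := 1) (b := a) w
  rwa [one_sm, _root_.one_mul] at this

theorem π_m (w : E.grpd.tgt g = E.grpd.src h) : E.π (E.grpd.m g h) = X.m (E.π g) (E.π h) := by
  rw [m_eq w, E.π_mul, m_eq]

/-- Preservation of units is not part of the definition of an extension; it follows because the
image of a unit is idempotent. -/
theorem π_one (x : M) : E.π (E.grpd.one x) = X.one x := by
  have w : E.grpd.tgt (E.grpd.one x) = E.grpd.src (E.grpd.one x) := by
    rw [E.grpd.tgt_one, E.grpd.src_one]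
  have h1 := π_m (E := E) w
  rw [one_m (E.grpd.src_one x)] at h1
  have h2 : X.m (E.π (E.grpd.one x)) (X.one x) = E.π (E.grpd.one x) :=
    m_one (by rw [E.tgt_π, E.grpd.tgt_one])
  exact (left_cancel (by rw [E.tgt_π, E.src_π, w])
    (by rw [E.tgt_π, E.grpd.tgt_one, X.src_one]) (h1.symm.trans h2.symm))

theorem π_inv (g : E.grpd.arr) : E.π (E.grpd.inv g) = X.inv (E.π g) := by
  have w := (E.grpd.src_inv g).symm
  refine eq_inv (by rw [E.tgt_π, E.src_π, w]) ?_
  rw [← π_m w, LieGroupoid.m_inv, π_one, E.src_π]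

theorem inv_sm (a : Circle) (g : E.grpd.arr) :
    E.grpd.inv (E.sm a g) = E.sm a⁻¹ (E.grpd.inv g) := by
  symm
  refine eq_inv (by rw [tgt_sm, src_sm, E.grpd.src_inv]) ?_
  rw [sm_m_sm (E.grpd.src_inv g).symm, mul_inv_cancel, one_sm, LieGroupoid.m_inv, src_sm]

theorem sm_one_m {x : M} (w : E.grpd.src g = x) :
    E.grpd.m (E.sm a (E.grpd.one x)) g = E.sm a g := by
  rw [sm_m (by rw [E.grpd.tgt_one, w]), one_m w]

theorem m_sm_one {x : M} (w : E.grpd.tgt g = x) :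
    E.grpd.m g (E.sm a (E.grpd.one x)) = E.sm a g := by
  rw [m_sm (by rw [E.grpd.src_one, w]), m_one w]

end CentralExtension

open CentralExtension

/-! ### Local liftings of torsors to a central extension -/

/-- A lifting of a torsor `Q` to a central extension, presented on a covering family `σ` of points
of `Q` by a cocycle with values in the extension. -/
structure LiftDatum {M : Mfd} {X : LieGroupoid M} (E : CentralExtension X) where
  Q : LieTorsor X
  V : Mfd
  σ : V ⟶ Q.total
  surj : IsSurjSubmersion (σ ≫ Q.proj)
  c : V → V → E.grpd.arr
  π_c : ∀ v v', Q.proj (σ v) = Q.proj (σ v') → E.π (c v v') = Q.div (σ v) (σ v')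
  c_c : ∀ v v' v'', Q.proj (σ v) = Q.proj (σ v') → Q.proj (σ v') = Q.proj (σ v'') →
    E.grpd.m (c v v') (c v' v'') = c v v''
  smooth_c : ∀ (T : Mfd) (u u' : T ⟶ V), (∀ x, Q.proj (σ (u x)) = Q.proj (σ (u' x))) →
    Smooth fun x => c (u x) (u' x)

namespace LiftDatum

variable {M : Mfd} {X : LieGroupoid M} {E : CentralExtension X}

/-- The point of the base below a point of the covering. -/
abbrev q (x : LiftDatum E) (v : x.V) : x.Q.base := x.Q.proj (x.σ v)

/-- The covering of the base. -/
abbrev qHom (x : LiftDatum E) : x.V ⟶ x.Q.base := x.σ ≫ x.Q.proj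

theorem src_c (x : LiftDatum E) {v v' : x.V} (w : x.q v = x.q v') :
    E.grpd.src (x.c v v') = x.Q.anchor (x.σ v) := by
  rw [← E.src_π, x.π_c v v' w, src_div w]

theorem tgt_c (x : LiftDatum E) {v v' : x.V} (w : x.q v = x.q v') :
    E.grpd.tgt (x.c v v') = x.Q.anchor (x.σ v') := by
  rw [← E.tgt_π, x.π_c v v' w, tgt_div w]

theorem c_self (x : LiftDatum E) (v : x.V) : x.c v v = E.grpd.one (x.Q.anchor (x.σ v)) := by
  have w : E.grpd.tgt (x.c v v) = E.grpd.src (x.c v v) := by rw [x.src_c rfl, x.tgt_c rfl]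
  refine left_cancel w (by rw [E.grpd.src_one, x.tgt_c rfl]) ?_
  rw [x.c_c v v v rfl rfl, m_one (x.tgt_c rfl)]

/-- A morphism of liftings. -/
structure Hom (x y : LiftDatum E) where
  φ : x.Q ⟶ y.Q
  h : ∀ (v : x.V) (v' : y.V), LieTorsor.Hom.base φ (x.q v) = y.q v' → E.grpd.arr
  π_h : ∀ v v' w, E.π (h v v' w) = y.Q.div (LieTorsor.Hom.total φ (x.σ v)) (y.σ v')
  c_h : ∀ v₁ v v' w w₁, x.q v₁ = x.q v → E.grpd.m (x.c v₁ v) (h v v' w) = h v₁ v' w₁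
  h_c : ∀ v v' v₁' w w₁, y.q v' = y.q v₁' → E.grpd.m (h v v' w) (y.c v' v₁') = h v v₁' w₁
  smooth_h : ∀ (T : Mfd) (u : T ⟶ x.V) (u' : T ⟶ y.V)
    (w : ∀ t, LieTorsor.Hom.base φ (x.q (u t)) = y.q (u' t)), Smooth fun t => h (u t) (u' t) (w t)

namespace Hom

variable {x y z : LiftDatum E} (f : Hom x y) (g : Hom y z)

theorem proj_eq' {v : x.V} {v' : y.V} (w : LieTorsor.Hom.base f.φ (x.q v) = y.q v') :
    y.Q.proj (LieTorsor.Hom.total f.φ (x.σ v)) = y.Q.proj (y.σ v') := by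
  rw [LieTorsor.Hom.proj_tot, w]

theorem src_h {v : x.V} {v' : y.V} (w) : E.grpd.src (f.h v v' w) = x.Q.anchor (x.σ v) := by
  rw [← E.src_π, f.π_h, src_div (f.proj_eq' w), LieTorsor.Hom.anchor_tot]

theorem tgt_h {v : x.V} {v' : y.V} (w) : E.grpd.tgt (f.h v v' w) = y.Q.anchor (y.σ v') := by
  rw [← E.tgt_π, f.π_h, tgt_div (f.proj_eq' w)]

theorem ext' {f g : Hom x y} (hφ : f.φ = g.φ) (hh : ∀ v v' w w', f.h v v' w = g.h v v' w') :
    f = g := by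
  obtain ⟨φ, h, _, _, _, _⟩ := f
  obtain ⟨φ', h', _, _, _, _⟩ := g
  obtain rfl : φ = φ' := hφ
  obtain rfl : h = h' := by
    funext v v' w
    exact hh v v' w w
  rfl

/-- Replacing the intermediate point inserts a value of the cocycle of `y`, which is absorbed by the
left factor through `h_c` or by the right factor through `c_h`. Composition may therefore use any
intermediate point. -/
theorem comp_indep {v : x.V} {v' v₁' : y.V} {v'' : z.V}
    (w : LieTorsor.Hom.base f.φ (x.q v) = y.q v') (w' : LieTorsor.Hom.base g.φ (y.q v') = z.q v'')
    (w₁ : LieTorsor.Hom.base f.φ (x.q v) = y.q v₁')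
    (w₁' : LieTorsor.Hom.base g.φ (y.q v₁') = z.q v'') :
    E.grpd.m (f.h v v' w) (g.h v' v'' w') = E.grpd.m (f.h v v₁' w₁) (g.h v₁' v'' w₁') := by
  have e : y.q v' = y.q v₁' := w.symm.trans w₁
  rw [← g.c_h v' v₁' v'' w₁' w' e, ← m_assoc, f.h_c v v' v₁' w w₁ e]
  · rw [tgt_h, y.src_c e]
  · rw [y.tgt_c e, src_h]

theorem exists_mid (v : x.V) : ∃ v' : y.V, LieTorsor.Hom.base f.φ (x.q v) = y.q v' := by
  obtain ⟨v', h⟩ := y.surj.2 (LieTorsor.Hom.base f.φ (x.q v))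
  exact ⟨v', h.symm⟩

/-- The composition of morphisms of liftings. -/
def comp : Hom x z where
  φ := f.φ ≫ g.φ
  h v v'' w := E.grpd.m (f.h v (f.exists_mid v).choose (f.exists_mid v).choose_spec)
    (g.h _ v'' (by rw [← (f.exists_mid v).choose_spec]; exact w))
  π_h v v'' w := by
    generalize_proofs h1 h2 h3
    have w1 : E.grpd.tgt (f.h v h1.choose h2) = E.grpd.src (g.h h1.choose v'' h3) := by
      rw [tgt_h, src_h]
    rw [π_m w1, f.π_h, g.π_h, ← LieTorsor.Hom.div_total g.φ (f.proj_eq' h2), m_div]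
    · rfl
    · exact LieTorsor.Hom.proj_eq _ (f.proj_eq' h2)
    · exact g.proj_eq' h3
  c_h v₁ v v'' w w₁ e := by
    generalize_proofs h1 h2 h3 h4 h5 h6
    have w1 : LieTorsor.Hom.base f.φ (x.q v₁) = y.q h1.choose :=
      (congrArg (LieTorsor.Hom.base f.φ) e).trans h2
    rw [← m_assoc (by rw [src_h, x.tgt_c e]) (by rw [tgt_h, src_h]), f.c_h v₁ v _ h2 w1 e]
    exact comp_indep f g _ _ _ _
  h_c v v'' v₁'' w w₁ e := by
    generalize_proofs h1 h2 h3 h4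
    rw [m_assoc (by rw [tgt_h, src_h]) (by rw [tgt_h, z.src_c e]), g.h_c _ v'' v₁'' h3 h4 e]
  smooth_h T u u'' w := by
    -- The chosen intermediate point need not vary smoothly. On the fibre product with `y.V` there
    -- is a smooth tautological one, and `comp_indep` allows it to be used instead.
    refine Smooth.descend_one (isSurjSubmersion_pbSnd (g := u ≫ x.qHom ≫ LieTorsor.Hom.base f.φ)
      y.surj) ?_
    let T' := pb y.qHom (u ≫ x.qHom ≫ LieTorsor.Hom.base f.φ) y.surj.1
    let r : T' ⟶ T := pbSnd y.qHom (u ≫ x.qHom ≫ LieTorsor.Hom.base f.φ) y.surj.1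
    let s : T' ⟶ y.V := pbFst y.qHom (u ≫ x.qHom ≫ LieTorsor.Hom.base f.φ) y.surj.1
    have w1 : ∀ t, LieTorsor.Hom.base f.φ (x.q ((r ≫ u) t)) = y.q (s t) := fun t => t.2.symm
    have w2 : ∀ t, LieTorsor.Hom.base g.φ (y.q (s t)) = z.q ((r ≫ u'') t) := fun t => by
      rw [← w1]; exact w (r t)
    have := smooth_m (f.smooth_h T' (r ≫ u) s w1) (g.smooth_h T' s (r ≫ u'') w2)
      fun t => by rw [tgt_h, src_h]
    refine (congrArg Smooth (funext fun t => ?_)).mp this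
    exact comp_indep f g _ _ _ _

theorem comp_apply {v : x.V} {v' : y.V} {v'' : z.V} (w)
    (w₁ : LieTorsor.Hom.base f.φ (x.q v) = y.q v')
    (w₂ : LieTorsor.Hom.base g.φ (y.q v') = z.q v'') :
    (f.comp g).h v v'' w = E.grpd.m (f.h v v' w₁) (g.h v' v'' w₂) :=
  comp_indep f g _ _ _ _

/-- The identity of a lifting. -/
def id (x : LiftDatum E) : Hom x x where
  φ := 𝟙 _
  h v v' _ := x.c v v'
  π_h v v' w := x.π_c v v' w
  c_h v₁ v v' w _ e := x.c_c v₁ v v' e w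
  h_c v v' v₁' w _ e := x.c_c v v' v₁' w e
  smooth_h T u u' w := x.smooth_c T u u' w

end Hom

instance : Category (LiftDatum E) where
  Hom := Hom
  id := Hom.id
  comp := Hom.comp
  id_comp {x y} f := Hom.ext' (Category.id_comp f.φ) fun v v' w w' => by
    have w1 : x.q v = x.q (Hom.exists_mid (Hom.id x) v).choose :=
      (Hom.exists_mid (Hom.id x) v).choose_spec
    exact f.c_h _ _ _ (by rw [← w1]; exact w') _ w1
  comp_id {x y} f := Hom.ext' (Category.comp_id f.φ) fun v v' w w' =>
    f.h_c _ _ _ (f.exists_mid v).choose_spec _ ((f.exists_mid v).choose_spec.symm.trans w')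
  assoc {x y z t} f g h := Hom.ext' (Category.assoc f.φ g.φ h.φ) fun v v' w w' => by
    obtain ⟨u, hu⟩ := f.exists_mid v
    obtain ⟨u', hu'⟩ := g.exists_mid u
    have e1 : LieTorsor.Hom.base (f.φ ≫ g.φ) (x.q v) = z.q u' := by
      rw [← hu', ← hu]; rfl
    have e2 : LieTorsor.Hom.base h.φ (z.q u') = t.q v' := by rw [← e1]; exact w
    have e3 : LieTorsor.Hom.base (g.φ ≫ h.φ) (y.q u) = t.q v' := by rw [← hu]; exact w
    rw [Hom.comp_apply (f.comp g) h (v' := u') w e1 e2, Hom.comp_apply f g e1 hu hu',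
      Hom.comp_apply f (g.comp h) (v' := u) w' hu e3, Hom.comp_apply g h e3 hu' e2,
      m_assoc (by rw [Hom.tgt_h, Hom.src_h]) (by rw [Hom.tgt_h, Hom.src_h])]

theorem comp_h {x y z : LiftDatum E} (f : x ⟶ y) (g : y ⟶ z) {v : x.V} (v' : y.V) {v'' : z.V}
    (w) (w₁ : LieTorsor.Hom.base (Hom.φ f) (x.q v) = y.q v')
    (w₂ : LieTorsor.Hom.base (Hom.φ g) (y.q v') = z.q v'') :
    Hom.h (f ≫ g) v v'' w = E.grpd.m (Hom.h f v v' w₁) (Hom.h g v' v'' w₂) :=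
  Hom.comp_indep f g _ _ _ _

theorem hom_ext {x y : LiftDatum E} {f g : x ⟶ y} (hφ : Hom.φ f = Hom.φ g)
    (hh : ∀ v v' w w', Hom.h f v v' w = Hom.h g v v' w') : f = g := Hom.ext' hφ hh

theorem h_congr {x y : LiftDatum E} {f g : x ⟶ y} (e : f = g) {v v'} (w) (w') :
    Hom.h f v v' w = Hom.h g v v' w' := by
  subst e; rfl

end LiftDatum

end

/-! ### The category of liftings is fibered in groupoids -/

noncomputable section

open TopologicalSpace Topology LieGroupoid LieTorsor CentralExtension

/-- The base changes of the parametrizations along `z` are jointly surjective submersions onto `T`,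
and on each of them `z` lifts to a member of the family. -/
theorem Mfd.IsGluing.descend_along {ι : Type} {W : ι → Mfd} {Z : Type} {φ : ∀ i, W i → Z}
    (D : IsGluing W φ) {T N : Mfd} (z : T ⟶ D.mfd) {f : T → N}
    (h : ∀ (i : ι) (T' : Mfd) (v : T' ⟶ T) (p : T' ⟶ W i),
      (∀ y, z (v y) = φ i (p y)) → Smooth fun y => f (v y)) : Smooth f := by
  refine Smooth.descend (fun i => pbSnd (D.param i) z (D.isSubmersion_param i))
    (fun i => isSubmersion_pbSnd _) (fun x => ?_) fun i => h i _ _ (pbFst _ _ _) fun y => y.2.symm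
  obtain ⟨i, p, hp⟩ := D.surj (z x)
  exact ⟨i, ⟨(p, x), hp⟩, rfl⟩

namespace LieGroupoid

variable {M : Mfd} {Γ : LieGroupoid M} {g h k : Γ.arr}

theorem m_m_inv_m (w : Γ.tgt g = Γ.src k) (w' : Γ.tgt h = Γ.src k) :
    Γ.m (Γ.m g k) (Γ.inv (Γ.m h k)) = Γ.m g (Γ.inv h) := by
  rw [inv_m_rev w', ← m_assoc, m_m_inv w]
  · rw [tgt_m w, Γ.src_inv]
  · rw [Γ.tgt_inv, Γ.src_inv, w']

theorem inv_m_m_m (w : Γ.tgt g = Γ.src h) (w' : Γ.tgt g = Γ.src k) :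
    Γ.m (Γ.inv (Γ.m g h)) (Γ.m g k) = Γ.m (Γ.inv h) k := by
  rw [inv_m_rev w, m_assoc, inv_m_m w']
  · rw [Γ.tgt_inv, Γ.src_inv, w]
  · rw [src_m w', Γ.tgt_inv]

end LieGroupoid

theorem isHomLift_iff {𝒮 𝒳 : Type*} [Category 𝒮] [Category 𝒳] (p : 𝒳 ⥤ 𝒮) {a b : 𝒳}
    (f : p.obj a ⟶ p.obj b) (φ : a ⟶ b) : p.IsHomLift f φ ↔ p.map φ = f := by
  constructor
  · intro h
    exact (IsHomLift.eq_of_isHomLift p f φ).symm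
  · rintro rfl
    infer_instance

namespace LiftDatum

variable {M : Mfd} {X : LieGroupoid M} {E : CentralExtension X}

/-- The map of bases below a morphism of liftings. -/
abbrev bs {x y : LiftDatum E} (f : x ⟶ y) : x.Q.base ⟶ y.Q.base := LieTorsor.Hom.base (Hom.φ f)

/-- The map of torsors below a morphism of liftings. -/
abbrev tt {x y : LiftDatum E} (f : x ⟶ y) : x.Q.total ⟶ y.Q.total :=
  LieTorsor.Hom.total (Hom.φ f)

variable (E) in
/-- The stack of liftings of torsors to a central extension. -/
abbrev stk : BasedCategory.{0, 1} Mfd where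
  obj := LiftDatum E
  p := { obj := fun x => x.Q.base, map := fun f => bs f }

variable (E) in
/-- The morphism which forgets the lifting. -/
abbrev toTorsors : stk E ⥤ᵇ LieTorsor.stack X where
  toFunctor := { obj := LiftDatum.Q, map := fun f => Hom.φ f }
  w := rfl

theorem tgt_h_eq {x y : LiftDatum E} (f : x ⟶ y) {v v'} (w) :
    E.grpd.tgt (Hom.h f v v' w) = y.Q.anchor (y.σ v') := Hom.tgt_h f w

theorem src_h_eq {x y : LiftDatum E} (f : x ⟶ y) {v v'} (w) :
    E.grpd.src (Hom.h f v v' w) = x.Q.anchor (x.σ v) := Hom.src_h f w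

theorem exists_q (x : LiftDatum E) (b : x.Q.base) : ∃ v, x.q v = b := x.surj.2 b

/-- The pullback of a lifting. -/
abbrev pullback (x : LiftDatum E) {S : Mfd} (f : S ⟶ x.Q.base) : LiftDatum E where
  Q := x.Q.pullback f
  V := pb x.qHom f x.surj.1
  σ := pbLift x.Q.proj_surjSubmersion.1 (pbFst x.qHom f x.surj.1 ≫ x.σ) (pbSnd x.qHom f x.surj.1)
    fun p => p.2
  surj := isSurjSubmersion_pbSnd x.surj
  c p p' := x.c p.1.1 p'.1.1
  π_c p p' w := by
    have w' : p.1.2 = p'.1.2 := w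
    rw [x.π_c, ← LieTorsor.Hom.div_total (x.Q.pullbackHom f) w]
    · rfl
    · exact p.2.trans ((congrArg f w').trans p'.2.symm)
  c_c p p' p'' w w' := by
    have e : p.1.2 = p'.1.2 := w
    have e' : p'.1.2 = p''.1.2 := w'
    exact x.c_c _ _ _ (p.2.trans ((congrArg f e).trans p'.2.symm))
      (p'.2.trans ((congrArg f e').trans p''.2.symm))
  smooth_c T u u' w := x.smooth_c T (u ≫ pbFst x.qHom f x.surj.1) (u' ≫ pbFst x.qHom f x.surj.1)
    fun t => (u t).2.trans ((congrArg f (w t)).trans (u' t).2.symm)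

/-- The canonical arrow from a pullback. -/
def pullbackHom (x : LiftDatum E) {S : Mfd} (f : S ⟶ x.Q.base) : x.pullback f ⟶ x where
  φ := x.Q.pullbackHom f
  h p v _ := x.c p.1.1 v
  π_h p v w := x.π_c _ _ (p.2.trans w)
  c_h p₁ p v w w₁ e := by
    have e' : p₁.1.2 = p.1.2 := e
    exact x.c_c _ _ _ (p₁.2.trans ((congrArg f e').trans p.2.symm)) (p.2.trans w)
  h_c p v v₁ w w₁ e := x.c_c _ _ _ (p.2.trans w) e
  smooth_h T u u' w := x.smooth_c T (u ≫ pbFst x.qHom f x.surj.1) u' fun t => (u t).2.trans (w t)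

/-- The torsor maps agree because arrows of torsors are cartesian. For the comparison functions, the
composites are evaluated through the intermediate point `v'` and the common right factor is
cancelled. -/
theorem lift_unique {x y z : LiftDatum E} {χ χ' : y ⟶ x} (φ : x ⟶ z) (hb : bs χ = bs χ')
    (h : χ ≫ φ = χ' ≫ φ) : χ = χ' := by
  refine hom_ext (LieTorsor.lift_unique (Hom.φ φ) hb (congrArg Hom.φ h)) fun v v' w w' => ?_
  obtain ⟨u, hu⟩ := z.exists_q (bs φ (x.q v'))
  have e : bs (χ ≫ φ) (y.q v) = z.q u := by
    rw [hu, ← w]; rfl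
  have e' : bs (χ' ≫ φ) (y.q v) = z.q u := by
    rw [hu, ← w']; rfl
  have h1 := h_congr h e e'
  rw [comp_h _ _ v' e w hu.symm, comp_h _ _ v' e' w' hu.symm] at h1
  exact right_cancel (by rw [tgt_h_eq, src_h_eq]) (by rw [tgt_h_eq, src_h_eq]) h1

/-- The equation `χ ≫ φ = ψ` forces the comparison function of `χ` at `(v, v')` to be `h_ψ(v, u) ·
h_φ(v', u)⁻¹`. Another choice of `u` multiplies both factors on the right by the same cocycle value,
which cancels. -/
theorem exists_lift {x y z : LiftDatum E} (ψ : y ⟶ z) (φ : x ⟶ z) (g : y.Q.base ⟶ x.Q.base)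
    (hg : bs ψ = g ≫ bs φ) : ∃ χ : y ⟶ x, bs χ = g ∧ χ ≫ φ = ψ := by
  obtain ⟨χ₀, hb, hχ₀⟩ := LieTorsor.exists_lift (Hom.φ ψ) (Hom.φ φ) g hg
  have hb' : ∀ b, LieTorsor.Hom.base χ₀ b = g b := fun b => by rw [hb]
  have hg' : ∀ b, bs ψ b = bs φ (g b) := fun b => by rw [hg]; rfl
  have hmid : ∀ v' : x.V, ∃ u, bs φ (x.q v') = z.q u := fun v' => by
    obtain ⟨u, hu⟩ := z.exists_q (bs φ (x.q v'))
    exact ⟨u, hu.symm⟩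
  have hψ : ∀ {v v' u}, LieTorsor.Hom.base χ₀ (y.q v) = x.q v' → bs φ (x.q v') = z.q u →
      bs ψ (y.q v) = z.q u := fun {v v' u} w w' => by
    rw [hg', ← hb', w, w']
  have hw : ∀ v v' u w w', E.grpd.tgt (Hom.h ψ v u w) =
      E.grpd.src (E.grpd.inv (Hom.h φ v' u w')) := fun v v' u w w' => by
    rw [E.grpd.src_inv, tgt_h_eq, tgt_h_eq]
  have indep : ∀ v v' u u' w w' w₁ w₁', E.grpd.m (Hom.h ψ v u w) (E.grpd.inv (Hom.h φ v' u w')) =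
      E.grpd.m (Hom.h ψ v u' w₁) (E.grpd.inv (Hom.h φ v' u' w₁')) := by
    intro v v' u u' w w' w₁ w₁'
    have e : z.q u = z.q u' := w'.symm.trans w₁'
    rw [← Hom.h_c ψ v u u' w w₁ e, ← Hom.h_c φ v' u u' w' w₁' e]
    exact (m_m_inv_m (by rw [tgt_h_eq, z.src_c e]) (by rw [tgt_h_eq, z.src_c e])).symm
  let H : ∀ (v : y.V) (v' : x.V), LieTorsor.Hom.base χ₀ (y.q v) = x.q v' → E.grpd.arr :=
    fun v v' w => E.grpd.m (Hom.h ψ v (hmid v').choose (hψ w (hmid v').choose_spec))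
      (E.grpd.inv (Hom.h φ v' _ (hmid v').choose_spec))
  have hH : ∀ v v' w u w₁ w₂, H v v' w =
      E.grpd.m (Hom.h ψ v u w₁) (E.grpd.inv (Hom.h φ v' u w₂)) := fun v v' w u w₁ w₂ =>
    indep _ _ _ _ _ _ _ _
  have hm : ∀ v v' w u w₁ w₂, E.grpd.m (H v v' w) (Hom.h φ v' u w₁) = Hom.h ψ v u w₂ := by
    intro v v' w u w₁ w₂
    rw [hH v v' w u w₂ w₁, m_assoc (hw _ _ _ _ _) (E.grpd.tgt_inv _), LieGroupoid.inv_m,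
      m_one (by rw [tgt_h_eq, tgt_h_eq])]
  refine ⟨{ φ := χ₀, h := H, π_h := ?_, c_h := ?_, h_c := ?_, smooth_h := ?_ }, hb, ?_⟩
  · intro v v' w
    obtain ⟨u, hu⟩ := hmid v'
    have e1 := Hom.proj_eq' ψ (hψ w hu)
    have e2 := Hom.proj_eq' φ hu
    have e3 : x.Q.proj (LieTorsor.Hom.total χ₀ (y.σ v)) = x.Q.proj (x.σ v') := by
      rw [LieTorsor.Hom.proj_tot, w]
    have e4 : LieTorsor.Hom.total (Hom.φ φ) (LieTorsor.Hom.total χ₀ (y.σ v)) =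
        LieTorsor.Hom.total (Hom.φ ψ) (y.σ v) :=
      congrArg (fun f : y.Q ⟶ z.Q => LieTorsor.Hom.total f (y.σ v)) hχ₀
    have h1 := congrArg E.π (hm v v' w u hu (hψ w hu))
    have w1 : E.grpd.tgt (H v v' w) = E.grpd.src (Hom.h φ v' u hu) := by
      rw [hH v v' w u (hψ w hu) hu, tgt_m (hw _ _ _ _ _), E.grpd.tgt_inv]
    rw [π_m w1, Hom.π_h, Hom.π_h] at h1
    rw [← LieTorsor.Hom.div_total (Hom.φ φ) e3]
    have e5 := LieTorsor.Hom.proj_eq (Hom.φ φ) e3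
    refine right_cancel (by rw [E.tgt_π, w1, src_h_eq, src_div e2, LieTorsor.Hom.anchor_tot])
      (by rw [tgt_div e5, src_div e2]) (h1.trans ?_)
    rw [m_div e5 e2, e4]
  · intro v₁ v v' w w₁ e
    obtain ⟨u, hu⟩ := hmid v'
    rw [hH v v' w u (hψ w hu) hu, hH v₁ v' w₁ u (hψ w₁ hu) hu,
      ← m_assoc (by rw [y.tgt_c e, src_h_eq]) (hw _ _ _ _ _), Hom.c_h ψ v₁ v u _ (hψ w₁ hu) e]
  · intro v v' v₁' w w₁ e
    obtain ⟨u, hu⟩ := hmid v'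
    have hu₁ : bs φ (x.q v₁') = z.q u := by rw [← e, hu]
    have e' : x.q v₁' = x.q v' := e.symm
    have e1 : E.grpd.tgt (x.c v' v₁') = E.grpd.src (Hom.h φ v₁' u hu₁) := by
      rw [x.tgt_c e, src_h_eq]
    have e2 : E.grpd.tgt (E.grpd.inv (Hom.h φ v₁' u hu₁)) =
        E.grpd.src (E.grpd.inv (x.c v' v₁')) := by
      rw [E.grpd.tgt_inv, E.grpd.src_inv, e1]
    rw [hH v v' w u (hψ w hu) hu, hH v v₁' w₁ u (hψ w hu) hu₁, ← Hom.c_h φ v' v₁' u hu₁ hu e,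
      inv_m_rev e1, m_assoc (by rw [src_m e2, hw]) (by rw [tgt_m e2, E.grpd.tgt_inv]),
      m_assoc e2 (E.grpd.tgt_inv _), LieGroupoid.inv_m, m_one (by rw [E.grpd.tgt_inv, e1])]
  · intro T u u' w
    refine Smooth.descend_one (isSurjSubmersion_pbSnd (g := u' ≫ x.qHom ≫ bs φ) z.surj) ?_
    let T' := pb z.qHom (u' ≫ x.qHom ≫ bs φ) z.surj.1
    let r : T' ⟶ T := pbSnd z.qHom (u' ≫ x.qHom ≫ bs φ) z.surj.1
    let s : T' ⟶ z.V := pbFst z.qHom (u' ≫ x.qHom ≫ bs φ) z.surj.1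
    have w1 : ∀ t, bs φ (x.q ((r ≫ u') t)) = z.q (s t) := fun t => t.2.symm
    have w2 : ∀ t, bs ψ (y.q ((r ≫ u) t)) = z.q (s t) := fun t => hψ (w (r t)) (w1 t)
    have := smooth_m (Hom.smooth_h ψ T' (r ≫ u) s w2)
      (smooth_inv (Hom.smooth_h φ T' (r ≫ u') s w1)) fun t => hw _ _ _ _ _
    refine (congrArg Smooth (funext fun t => ?_)).mp this
    exact (hH _ _ (w (r t)) _ _ _).symm
  · refine hom_ext hχ₀ fun v u w w' => ?_
    obtain ⟨v', hv'⟩ := x.exists_q (g (y.q v))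
    have e1 : LieTorsor.Hom.base χ₀ (y.q v) = x.q v' := by rw [hb', hv']
    have e2 : bs φ (x.q v') = z.q u := by rw [hv', ← hg', w']
    rw [comp_h _ _ v' w e1 e2]
    exact hm _ _ e1 _ e2 w'

theorem isFiberedInGroupoids : IsFiberedInGroupoids (stk E) where
  exists_pullback x V f := ⟨x.pullback f, x.pullbackHom f, (isHomLift_iff (stk E).p _ _).2 rfl⟩
  cartesian {x y} φ :=
    { toIsHomLift := (isHomLift_iff (stk E).p _ _).2 rfl
      universal_property' := fun {a'} g φ' h => by
        have h' := (isHomLift_iff (stk E).p _ _).1 h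
        obtain ⟨χ, h1, h2⟩ := exists_lift φ' φ g h'
        refine ⟨χ, ⟨(isHomLift_iff (stk E).p _ _).2 h1, h2⟩, fun χ' h3 => ?_⟩
        exact lift_unique φ (((isHomLift_iff (stk E).p _ _).1 h3.1).trans h1.symm)
          (h3.2.trans h2.symm) }

end LiftDatum

end

noncomputable section

open TopologicalSpace Topology LieGroupoid LieTorsor CentralExtension

namespace LiftDatum

variable {M : Mfd} {X : LieGroupoid M} {E : CentralExtension X}

/-! ### The stack property -/

theorem tgt_h_src_h {x y z : LiftDatum E} (f : x ⟶ y) (g : y ⟶ z) {v v' v''} (w w') :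
    E.grpd.tgt (Hom.h f v v' w) = E.grpd.src (Hom.h g v' v'' w') := by
  rw [tgt_h_eq, src_h_eq]

theorem comp_tt {x y z : LiftDatum E} (f : x ⟶ y) (g : y ⟶ z) (p : x.Q.total) :
    tt (f ≫ g) p = tt g (tt f p) := rfl

theorem comp_bs {x y z : LiftDatum E} (f : x ⟶ y) (g : y ⟶ z) (p : x.Q.base) :
    bs (f ≫ g) p = bs g (bs f p) := rfl

/-- Points with the same image under two arrows are images of a point under a pair of arrows which
become equal. -/
theorem exists_span {x z z' : LiftDatum E} (e : z ⟶ x) (e' : z' ⟶ x) {b : z.Q.base}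
    {b' : z'.Q.base} (w : bs e b = bs e' b') :
    ∃ (t : LiftDatum E) (a : t ⟶ z) (a' : t ⟶ z') (s : t.Q.base), a ≫ e = a' ≫ e' ∧
      bs a s = b ∧ bs a' s = b' := by
  obtain ⟨χ, h1, h2⟩ := exists_lift (z.pullbackHom (ptHom b) ≫ e) e' (ptHom b')
    (Mfd.hom_ext fun _ => w)
  exact ⟨_, z.pullbackHom (ptHom b), χ, (0 : PUnit), h2.symm, rfl,
    congrArg (fun f : pt ⟶ z'.Q.base => f (0 : PUnit)) h1⟩

/-- Both the torsor maps and the comparison functions are determined pointwise: the value at a point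
of `x` is read off from a composite with some `e i`, whose contribution cancels on the left. -/
theorem eq_of_cover {ι : Type} {x y : LiftDatum E} {φ ψ : x ⟶ y} (z : ι → LiftDatum E)
    (e : ∀ i, z i ⟶ x) (hsurj : ∀ b, ∃ i c, bs (e i) c = b) (hb : bs φ = bs ψ)
    (h : ∀ i, e i ≫ φ = e i ≫ ψ) : φ = ψ := by
  refine hom_ext (LieTorsor.hom_ext_of_points hb fun b => ?_) fun v v' w w' => ?_
  · obtain ⟨i, c, rfl⟩ := hsurj b
    obtain ⟨p, rfl⟩ := (z i).Q.proj_surjSubmersion.2 c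
    refine ⟨tt (e i) p, LieTorsor.Hom.proj_tot _ _, ?_⟩
    exact congrArg (fun f => tt f p) (h i)
  · obtain ⟨i, c, hc⟩ := hsurj (x.q v)
    obtain ⟨u, rfl⟩ := (z i).exists_q c
    have e1 : bs (e i ≫ φ) ((z i).q u) = y.q v' := by rw [comp_bs, hc]; exact w
    have e2 : bs (e i ≫ ψ) ((z i).q u) = y.q v' := by rw [comp_bs, hc]; exact w'
    have := h_congr (h i) e1 e2
    rw [comp_h _ _ v e1 hc w, comp_h _ _ v e2 hc w'] at this
    exact left_cancel (tgt_h_src_h _ _ _ _) (tgt_h_src_h _ _ _ _) this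

/-- The comparison function must be `h_{e i}(u, v)⁻¹ · h_{φ i}(u, v')`. Agreement on overlaps makes
it independent of `i` and `u`. The family need only consist of submersions, which is enough for
smoothness to descend. -/
theorem exists_glueHom {ι : Type} {x y : LiftDatum E} (z : ι → LiftDatum E) (e : ∀ i, z i ⟶ x)
    (φ : ∀ i, z i ⟶ y) (he : ∀ i, IsSubmersion (bs (e i)))
    (hsurj : ∀ b, ∃ i c, bs (e i) c = b) (f : x.Q.base ⟶ y.Q.base)
    (hf : ∀ i, bs (φ i) = bs (e i) ≫ f)
    (h : ∀ i j t (a : t ⟶ z i) (b : t ⟶ z j), a ≫ e i = b ≫ e j → a ≫ φ i = b ≫ φ j) :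
    ∃ ψ : x ⟶ y, bs ψ = f ∧ ∀ i, e i ≫ ψ = φ i := by
  obtain ⟨ψ₀, hb, hψ₀⟩ := LieTorsor.exists_glueHom (fun i => (z i).Q) (fun i => Hom.φ (e i))
    (fun i => Hom.φ (φ i)) he hsurj f hf (by
      intro i j p q hpq
      have w : bs (e i) ((z i).Q.proj p) = bs (e j) ((z j).Q.proj q) := by
        rw [← LieTorsor.Hom.proj_tot, ← LieTorsor.Hom.proj_tot, hpq]
      obtain ⟨t, a, a', s, h1, h2, h3⟩ := exists_span (e i) (e j) w
      obtain ⟨r, rfl, hr⟩ := LieTorsor.Hom.exists_fib (Hom.φ a) s p h2.symm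
      have hr' : tt a' r = q := by
        refine LieTorsor.Hom.total_inj (Hom.φ (e j)) ?_ ?_
        · rw [LieTorsor.Hom.proj_tot, h3]
        · rw [← hpq, ← hr]
          exact congrArg (fun f => tt f r) h1.symm
      rw [← hr, ← hr']
      exact congrArg (fun f => tt f r) (h i j t a a' h1))
  have hfb : ∀ i c, bs (φ i) c = f (bs (e i) c) := fun i c => by rw [hf]; rfl
  have hb' : ∀ b, LieTorsor.Hom.base ψ₀ b = f b := fun b => by rw [hb]
  have hmid : ∀ v : x.V, ∃ i, ∃ u : (z i).V, bs (e i) ((z i).q u) = x.q v := fun v => by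
    obtain ⟨i, c, hc⟩ := hsurj (x.q v)
    obtain ⟨u, rfl⟩ := (z i).exists_q c
    exact ⟨i, u, hc⟩
  have hφ : ∀ {i u v v'}, bs (e i) ((z i).q u) = x.q v →
      LieTorsor.Hom.base ψ₀ (x.q v) = y.q v' → bs (φ i) ((z i).q u) = y.q v' := by
    intro i u v v' w w'
    rw [hfb, w, ← hb', w']
  have indep : ∀ i j u u' v v' w₁ w₂ w₁' w₂',
      E.grpd.m (E.grpd.inv (Hom.h (e i) u v w₁)) (Hom.h (φ i) u v' w₂) =
      E.grpd.m (E.grpd.inv (Hom.h (e j) u' v w₁')) (Hom.h (φ j) u' v' w₂') := by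
    intro i j u u' v v' w₁ w₂ w₁' w₂'
    -- Two expressions for the same value are compared over a one-point manifold mapping to both
    -- members of the family. The comparison function of the arrow from it cancels in each product,
    -- and the agreement hypothesis applies to the composites.
    obtain ⟨t, a, a', s, h1, h2, h3⟩ := exists_span (e i) (e j) (w₁.trans w₁'.symm)
    obtain ⟨r, rfl⟩ := t.exists_q s
    have k1 : bs (a ≫ e i) (t.q r) = x.q v := by rw [comp_bs, h2, w₁]
    have k2 : bs (a' ≫ e j) (t.q r) = x.q v := by rw [comp_bs, h3, w₁']
    have k3 : bs (a ≫ φ i) (t.q r) = y.q v' := by rw [comp_bs, h2]; exact w₂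
    have k4 : bs (a' ≫ φ j) (t.q r) = y.q v' := by rw [comp_bs, h3]; exact w₂'
    rw [← inv_m_m_m (tgt_h_src_h a (e i) h2 w₁) (tgt_h_src_h a (φ i) h2 w₂),
      ← inv_m_m_m (tgt_h_src_h a' (e j) h3 w₁') (tgt_h_src_h a' (φ j) h3 w₂'),
      ← comp_h a (e i) u k1 h2 w₁, ← comp_h a (φ i) u k3 h2 w₂,
      ← comp_h a' (e j) u' k2 h3 w₁', ← comp_h a' (φ j) u' k4 h3 w₂',
      h_congr h1 k1 k2, h_congr (h i j t a a' h1) k3 k4]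
  let H : ∀ (v : x.V) (v' : y.V), LieTorsor.Hom.base ψ₀ (x.q v) = y.q v' → E.grpd.arr :=
    fun v v' w => E.grpd.m (E.grpd.inv (Hom.h (e _) _ v (hmid v).choose_spec.choose_spec))
      (Hom.h (φ _) (hmid v).choose_spec.choose v' (hφ (hmid v).choose_spec.choose_spec w))
  have hH : ∀ v v' w i u w₁ w₂, H v v' w =
      E.grpd.m (E.grpd.inv (Hom.h (e i) u v w₁)) (Hom.h (φ i) u v' w₂) :=
    fun v v' w i u w₁ w₂ => indep _ _ _ _ _ _ _ _ _ _
  clear_value H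
  have hw : ∀ {i u v v'} (w w'), E.grpd.tgt (E.grpd.inv (Hom.h (e i) u v w)) =
      E.grpd.src (Hom.h (φ i) u v' w') := fun w w' => by
    rw [E.grpd.tgt_inv, src_h_eq, src_h_eq]
  have hm : ∀ v v' w i u w₁ w₂, E.grpd.m (Hom.h (e i) u v w₁) (H v v' w) =
      Hom.h (φ i) u v' w₂ := by
    intro v v' w i u w₁ w₂
    rw [hH v v' w i u w₁ w₂, m_inv_m (by rw [src_h_eq, src_h_eq])]
  have hsrc : ∀ v v' w, E.grpd.src (H v v' w) = x.Q.anchor (x.σ v) := by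
    intro v v' w
    obtain ⟨i, u, hu⟩ := hmid v
    rw [hH v v' w i u hu (hφ hu w), src_m (hw _ _), E.grpd.src_inv, tgt_h_eq]
  have htgt : ∀ v v' w, E.grpd.tgt (H v v' w) = y.Q.anchor (y.σ v') := by
    intro v v' w
    obtain ⟨i, u, hu⟩ := hmid v
    rw [hH v v' w i u hu (hφ hu w), tgt_m (hw _ _), tgt_h_eq]
  have hw' : ∀ v v' w i u w₁, E.grpd.tgt (Hom.h (e i) u v w₁) = E.grpd.src (H v v' w) := by
    intro v v' w i u w₁
    rw [tgt_h_eq, hsrc]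
  refine ⟨{ φ := ψ₀, h := H, π_h := ?_, c_h := ?_, h_c := ?_, smooth_h := ?_ }, hb, ?_⟩
  · intro v v' w
    obtain ⟨i, u, hu⟩ := hmid v
    have h1 := congrArg E.π (hm v v' w i u hu (hφ hu w))
    have e1 := Hom.proj_eq' (e i) hu
    have e3 : y.Q.proj (LieTorsor.Hom.total ψ₀ (x.σ v)) = y.Q.proj (y.σ v') := by
      rw [LieTorsor.Hom.proj_tot, w]
    have e4 : LieTorsor.Hom.total ψ₀ (tt (e i) ((z i).σ u)) = tt (φ i) ((z i).σ u) :=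
      congrArg (fun f : (z i).Q ⟶ y.Q => LieTorsor.Hom.total f ((z i).σ u)) (hψ₀ i)
    have e5 := LieTorsor.Hom.proj_eq ψ₀ e1
    rw [π_m (hw' _ _ _ _ _ _), Hom.π_h, Hom.π_h] at h1
    refine left_cancel (by rw [tgt_div e1, E.src_π, hsrc])
      (by rw [tgt_div e1, src_div e3, LieTorsor.Hom.anchor_tot]) (h1.trans ?_)
    rw [← LieTorsor.Hom.div_total ψ₀ e1, m_div e5 e3, e4]
  · intro v₁ v v' w w₁ e'
    obtain ⟨i, u, hu⟩ := hmid v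
    have hu₁ : bs (e i) ((z i).q u) = x.q v₁ := hu.trans e'.symm
    have k : E.grpd.tgt (x.c v₁ v) = E.grpd.src (H v v' w) := by rw [x.tgt_c e', hsrc]
    have k' : E.grpd.tgt (Hom.h (e i) u v₁ hu₁) = E.grpd.src (x.c v₁ v) := by
      rw [tgt_h_eq, x.src_c e']
    refine left_cancel (by rw [src_m k, k']) (hw' v₁ v' w₁ i u hu₁) ?_
    rw [← m_assoc k' k, Hom.h_c (e i) u v₁ v hu₁ hu e', hm v v' w i u hu (hφ hu w),
      hm v₁ v' w₁ i u hu₁ (hφ hu w)]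
  · intro v v' v₁' w w₁ e'
    obtain ⟨i, u, hu⟩ := hmid v
    have k : E.grpd.tgt (H v v' w) = E.grpd.src (y.c v' v₁') := by rw [y.src_c e', htgt]
    refine left_cancel (by rw [src_m k]; exact hw' v v' w i u hu) (hw' v v₁' w₁ i u hu) ?_
    rw [← m_assoc (hw' v v' w i u hu) k, hm v v' w i u hu (hφ hu w),
      hm v v₁' w₁ i u hu (hφ hu w₁)]
    exact Hom.h_c (φ i) u v' v₁' _ _ e'
  · intro T u u' w
    have hsub : ∀ i, IsSubmersion ((z i).qHom ≫ bs (e i)) := fun i => (z i).surj.1.comp (he i)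
    refine Smooth.descend (fun i => pbSnd ((z i).qHom ≫ bs (e i)) (u ≫ x.qHom) (hsub i))
      (fun i => isSubmersion_pbSnd _) (fun t => ?_) fun i => ?_
    · obtain ⟨i, r, hr⟩ := hmid (u t)
      exact ⟨i, ⟨(r, t), hr⟩, rfl⟩
    · let T' := pb ((z i).qHom ≫ bs (e i)) (u ≫ x.qHom) (hsub i)
      let r : T' ⟶ T := pbSnd ((z i).qHom ≫ bs (e i)) (u ≫ x.qHom) (hsub i)
      let s : T' ⟶ (z i).V := pbFst ((z i).qHom ≫ bs (e i)) (u ≫ x.qHom) (hsub i)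
      have w1 : ∀ t, bs (e i) ((z i).q (s t)) = x.q ((r ≫ u) t) := fun t => t.2
      have w2 : ∀ t, bs (φ i) ((z i).q (s t)) = y.q ((r ≫ u') t) := fun t =>
        hφ (w1 t) (w (r t))
      have := smooth_m (smooth_inv (Hom.smooth_h (e i) T' s (r ≫ u) w1))
        (Hom.smooth_h (φ i) T' s (r ≫ u') w2) fun t => hw _ _
      refine (congrArg Smooth (funext fun t => ?_)).mp this
      exact (hH _ _ (w (r t)) _ _ _ _).symm
  · intro i
    refine hom_ext (hψ₀ i) fun u v' w w' => ?_
    obtain ⟨v, hv⟩ := x.exists_q (bs (e i) ((z i).q u))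
    have e2 : LieTorsor.Hom.base ψ₀ (x.q v) = y.q v' := by rw [hb', hv, ← hfb, w']
    rw [comp_h _ _ v w hv.symm e2]
    exact hm _ _ e2 _ _ hv.symm w'

/-! ### Descent of liftings -/

variable (E) in
/-- Gluing data for liftings over the members of an étale covering family. -/
structure Descent (ι : Type) (S : Mfd) where
  x : ι → LiftDatum E
  u : ∀ i, (x i).Q.base ⟶ S
  cover : IsCover u
  θ : ∀ (i j : ι) (t : LiftDatum E) (a : t ⟶ x i) (b : t.Q.base ⟶ (x j).Q.base),
    bs a ≫ u i = b ≫ u j → (t ⟶ x j)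
  bs_θ : ∀ i j t a b w, bs (θ i j t a b w) = b
  θ_comp : ∀ i j t t' (c : t' ⟶ t) (a : t ⟶ x i) b w w',
    θ i j t' (c ≫ a) (bs c ≫ b) w' = c ≫ θ i j t a b w
  θ_θ : ∀ i j k t (a : t ⟶ x i) b c w w' w'', θ j k t (θ i j t a b w) c w'' = θ i k t a c w'

namespace Descent

variable {ι : Type} {S : Mfd} (D : Descent E ι S)

theorem bs_θ_apply {i j t a b w} (s : t.Q.base) : bs (D.θ i j t a b w) s = b s := by
  rw [D.bs_θ]

theorem θ_congr {i j t a a' b b' w} (ha : a = a') (hb : b = b') :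
    D.θ i j t a b w = D.θ i j t a' b' (by rw [← ha, ← hb, w]) := by
  subst ha hb; rfl

/-- Write `θ a = α ≫ a` with `α` over the identity. Naturality gives `θ (α ≫ a) = α ≫ θ a`, and the
cocycle condition gives `θ (θ a) = θ a`. Hence `α ≫ θ a = θ a`, so that `α` is the identity. -/
theorem θ_self {i t a w} : D.θ i i t a (bs a) w = a := by
  obtain ⟨α, h1, h2⟩ := exists_lift (D.θ i i t a (bs a) w) a (𝟙 _) (D.bs_θ _ _ _ _ _ _)
  have h3 := D.θ_comp i i t t α a (bs a) w (by simp only [Category.assoc]; rfl)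
  rw [D.θ_congr h2 (b' := bs a) (by rw [h1]; exact Category.id_comp _),
    D.θ_θ i i i t a (bs a) (bs a) w w] at h3
  have h4 : α = 𝟙 t := lift_unique (D.θ i i t a (bs a) w) h1 (by rw [← h3, Category.id_comp])
  rw [← h2, h4, Category.id_comp]

/-- The arrow from the restriction of an object to a point. -/
abbrev ptArrow (x : LiftDatum E) (b : x.Q.base) : x.pullback (ptHom b) ⟶ x :=
  x.pullbackHom (ptHom b)

/-- Restriction of gluing data to a point. -/
theorem θ_ptArrow {i j t} (a : t ⟶ D.x i) (b) (w : bs a ≫ D.u i = b ≫ D.u j) (s : t.Q.base)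
    {b₁ : (D.x i).Q.base} {b₂ : (D.x j).Q.base} (h₁ : bs a s = b₁) (h₂ : b s = b₂) (w') :
    ∃ c : (D.x i).pullback (ptHom b₁) ⟶ t, bs c = ptHom s ∧ c ≫ a = ptArrow (D.x i) b₁ ∧
      c ≫ D.θ i j t a b w = D.θ i j _ (ptArrow (D.x i) b₁) (ptHom b₂) w' := by
  obtain ⟨c, hc, hc'⟩ := exists_lift (ptArrow (D.x i) b₁) a (ptHom s)
    (Mfd.hom_ext fun _ => h₁.symm)
  refine ⟨c, hc, hc', ?_⟩
  rw [← D.θ_comp i j t _ c a b w (by rw [Category.assoc, ← w]; rfl)]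
  exact D.θ_congr hc' (by rw [hc]; exact Mfd.hom_ext fun _ => h₂)

theorem pt_w {i j : ι} {b₁ : (D.x i).Q.base} {b₂ : (D.x j).Q.base} (w : D.u i b₁ = D.u j b₂) :
    bs (ptArrow (D.x i) b₁) ≫ D.u i = ptHom b₂ ≫ D.u j := Mfd.hom_ext fun _ => w

/-- The gluing data of the torsors. -/
def τ (i j : ι) (p : (D.x i).Q.total) (b : (D.x j).Q.base)
    (w : D.u i ((D.x i).Q.proj p) = D.u j b) : (D.x j).Q.total :=
  tt (D.θ i j _ (ptArrow (D.x i) ((D.x i).Q.proj p)) (ptHom b) (D.pt_w w)) ⟨(p, (0 : PUnit)), rfl⟩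

/-- The map `τ` is defined by restricting `θ` to a single point; by naturality it can be computed
from `θ` over any `t` with a point above `p`. Choosing `t` to be a pullback to a parameter manifold
gives smoothness, and choosing `a` to be a value of `θ` gives the cocycle identity. -/
theorem τ_eq {i j t} (a : t ⟶ D.x i) (b) (w : bs a ≫ D.u i = b ≫ D.u j) (p' : t.Q.total)
    {p b'} (hp : tt a p' = p) (hb : b (t.Q.proj p') = b') (w') :
    D.τ i j p b' w' = tt (D.θ i j t a b w) p' := by
  have h₁ : bs a (t.Q.proj p') = (D.x i).Q.proj p := by rw [← hp, LieTorsor.Hom.proj_tot]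
  obtain ⟨c, hc, hc', hθ⟩ := D.θ_ptArrow a b w (t.Q.proj p') h₁ hb (D.pt_w w')
  rw [τ, ← hθ, comp_tt]
  congr 1
  refine LieTorsor.Hom.total_inj (Hom.φ a) ?_ ?_
  · rw [LieTorsor.Hom.proj_tot]
    exact congrArg (fun f : pt ⟶ t.Q.base => f (0 : PUnit)) hc
  · rw [hp]
    exact congrArg (fun f => tt f _) hc'

/-- The gluing data of the torsors. -/
def torsorData : LieTorsor.GlueData S (fun i => (D.x i).Q) D.u where
  cover := D.cover
  τ := D.τ
  proj_τ i j p b w := by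
    rw [τ, LieTorsor.Hom.proj_tot]
    exact D.bs_θ_apply _
  anchor_τ i j p b w := by rw [τ, LieTorsor.Hom.anchor_tot]; rfl
  τ_a i j p b w g w' := by
    refine (D.τ_eq (ptArrow (D.x i) ((D.x i).Q.proj p)) (ptHom b) (D.pt_w w)
      (((D.x i).pullback (ptHom ((D.x i).Q.proj p))).Q.a ⟨(p, (0 : PUnit)), rfl⟩ g) ?_ rfl
      w').trans (LieTorsor.Hom.total_a _ _ _)
    exact LieTorsor.Hom.total_a _ _ _
  τ_τ i j k p b c w w' w'' := by
    have h : D.u i ((D.x i).Q.proj p) = D.u k c := w''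
    refine (D.τ_eq (D.θ i j _ (ptArrow (D.x i) ((D.x i).Q.proj p)) (ptHom b) (D.pt_w w)) (ptHom c)
      (by rw [D.bs_θ]; exact Mfd.hom_ext fun _ => w.symm.trans h) ⟨(p, (0 : PUnit)), rfl⟩ rfl rfl
      w').trans ?_
    exact congrArg (fun f => tt f _) (D.θ_θ i j k _ _ _ _ _ (D.pt_w w'') _)
  smooth_τ i j T p b w := by
    let t := (D.x i).pullback (p ≫ (D.x i).Q.proj)
    let s : T ⟶ t.Q.total := pbLift (D.x i).Q.proj_surjSubmersion.1 p (𝟙 T) fun _ => rfl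
    have e : bs ((D.x i).pullbackHom (p ≫ (D.x i).Q.proj)) ≫ D.u i = b ≫ D.u j :=
      Mfd.hom_ext w
    refine (congrArg Smooth (funext fun y => ?_)).mp
      (smooth_coe (s ≫ tt (D.θ i j t ((D.x i).pullbackHom _) b e)))
    exact (D.τ_eq _ b e (s y) rfl rfl (w y)).symm

/-- The gluing data of the liftings. -/
def C (i j : ι) (v : (D.x i).V) (v' : (D.x j).V) (w : D.u i ((D.x i).q v) = D.u j ((D.x j).q v')) :
    E.grpd.arr :=
  Hom.h (D.θ i j _ (ptArrow (D.x i) ((D.x i).q v)) (ptHom ((D.x j).q v')) (D.pt_w w))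
    ⟨(v, (0 : PUnit)), rfl⟩ v' (D.bs_θ_apply _)

theorem π_C (i j v v' w) :
    E.π (D.C i j v v' w) = (D.x j).Q.div (D.τ i j ((D.x i).σ v) ((D.x j).q v') w) ((D.x j).σ v') :=
  Hom.π_h _ _ _ _

theorem src_C (i j v v' w) : E.grpd.src (D.C i j v v' w) = (D.x i).Q.anchor ((D.x i).σ v) :=
  src_h_eq _ _

theorem tgt_C (i j v v' w) : E.grpd.tgt (D.C i j v v' w) = (D.x j).Q.anchor ((D.x j).σ v') :=
  tgt_h_eq _ _

/-- The counterpart of `τ_eq` for the comparison functions: an arrow from a one-point restriction to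
`t` contributes the inverse of the comparison function of `a`, so that `C` is read off from `θ` over
an arbitrary `t`. -/
theorem C_eq {i j t} (a : t ⟶ D.x i) (b) (w : bs a ≫ D.u i = b ≫ D.u j) {v₀ : t.V} {v v'}
    (hv : bs a (t.q v₀) = (D.x i).q v) (hv' : bs (D.θ i j t a b w) (t.q v₀) = (D.x j).q v') (w') :
    E.grpd.m (Hom.h a v₀ v hv) (D.C i j v v' w') = Hom.h (D.θ i j t a b w) v₀ v' hv' := by
  obtain ⟨c, hc, hc', hθ⟩ := D.θ_ptArrow a b w (t.q v₀) hv
    ((D.bs_θ_apply (t.q v₀)).symm.trans hv') (D.pt_w w')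
  let v₁ : ((D.x i).pullback (ptHom ((D.x i).q v))).V := ⟨(v, (0 : PUnit)), rfl⟩
  have k : bs c (((D.x i).pullback (ptHom ((D.x i).q v))).q v₁) = t.q v₀ := by rw [hc]; rfl
  have h1 : E.grpd.m (Hom.h c v₁ v₀ k) (Hom.h a v₀ v hv) =
      E.grpd.one ((D.x i).Q.anchor ((D.x i).σ v)) := by
    rw [← comp_h c a v₀ (by rw [hc']; rfl) k hv, h_congr hc' _ rfl]
    exact (D.x i).c_self v
  have h2 : E.grpd.m (Hom.h c v₁ v₀ k) (Hom.h (D.θ i j t a b w) v₀ v' hv') = D.C i j v v' w' := by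
    rw [← comp_h c _ v₀ (by rw [comp_bs, k, hv']) k hv', C]
    exact h_congr hθ _ _
  have h3 : Hom.h a v₀ v hv = E.grpd.inv (Hom.h c v₁ v₀ k) :=
    eq_inv (tgt_h_src_h _ _ _ _) (h1.trans (congrArg _ (src_h_eq c k).symm))
  rw [← h2, h3, inv_m_m (tgt_h_src_h _ _ _ _)]

theorem C_C (i j k v v' v'' w w' w'') :
    E.grpd.m (D.C i j v v' w) (D.C j k v' v'' w') = D.C i k v v'' w'' := by
  have h : bs (D.θ i j _ (ptArrow (D.x i) ((D.x i).q v)) (ptHom ((D.x j).q v')) (D.pt_w w)) ≫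
      D.u j = ptHom ((D.x k).q v'') ≫ D.u k := by
    rw [D.bs_θ]; exact Mfd.hom_ext fun _ => w'
  refine (D.C_eq _ (ptHom ((D.x k).q v'')) h _ (D.bs_θ_apply _) w').trans ?_
  exact h_congr (D.θ_θ i j k _ _ _ _ _ (D.pt_w w'') _) _ _

theorem C_self (i v v' w) (h : (D.x i).q v = (D.x i).q v') :
    D.C i i v v' w = (D.x i).c v v' := by
  have e : ptHom ((D.x i).q v') = bs (ptArrow (D.x i) ((D.x i).q v)) := by rw [← h]; rfl
  rw [C]
  exact h_congr ((D.θ_congr rfl e).trans (D.θ_self (w := rfl))) _ h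

/-- The object `t` is the pullback of `D.x i` along the family itself. The comparison function of
the canonical arrow is a unit along the tautological points, so `C` equals the comparison function
of `θ` there. -/
theorem smooth_C (i j) (T : Mfd) (v : T ⟶ (D.x i).V) (v' : T ⟶ (D.x j).V)
    (w : ∀ t, D.u i ((D.x i).q (v t)) = D.u j ((D.x j).q (v' t))) :
    Smooth fun t => D.C i j (v t) (v' t) (w t) := by
  let t := (D.x i).pullback (v ≫ (D.x i).qHom)
  let s : T ⟶ t.V := pbLift (D.x i).surj.1 v (𝟙 T) fun _ => rfl
  have e : bs ((D.x i).pullbackHom (v ≫ (D.x i).qHom)) ≫ D.u i = (v' ≫ (D.x j).qHom) ≫ D.u j :=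
    Mfd.hom_ext w
  refine (congrArg Smooth (funext fun y => ?_)).mp
    (Hom.smooth_h (D.θ i j t ((D.x i).pullbackHom _) (v' ≫ (D.x j).qHom) e) T s v'
      fun y => D.bs_θ_apply _)
  refine (D.C_eq (v₀ := s y) _ _ e (v := v y) rfl (D.bs_θ_apply _) (w y)).symm.trans ?_
  have : Hom.h ((D.x i).pullbackHom (v ≫ (D.x i).qHom)) (s y) (v y) rfl =
      E.grpd.one ((D.x i).Q.anchor ((D.x i).σ (v y))) := (D.x i).c_self (v y)
  exact (congrArg (fun g => E.grpd.m g _) this).trans (one_m (D.src_C _ _ _ _ _))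

theorem div_cls {i j} (p : (D.x i).Q.total) (q : (D.x j).Q.total) (w) :
    D.torsorData.torsor.div (D.torsorData.cls i p) (D.torsorData.cls j q) =
      (D.x j).Q.div (D.τ i j p ((D.x j).Q.proj q) w) q := by
  rw [← D.torsorData.cls_τ i j p ((D.x j).Q.proj q) w]
  exact LieTorsor.Hom.div_total (D.torsorData.incHom j) (D.torsorData.proj_τ _ _ _ _ _)

open Classical in
/-- The cocycle of the glued lifting. -/
def cocycle (v v' : Σ i, (D.x i).V) : E.grpd.arr :=
  if w : D.u v.1 ((D.x v.1).q v.2) = D.u v'.1 ((D.x v'.1).q v'.2) then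
    D.C v.1 v'.1 v.2 v'.2 w else E.grpd.one ((D.x v.1).Q.anchor ((D.x v.1).σ v.2))

theorem cocycle_eq {v v' : Σ i, (D.x i).V}
    (w : D.u v.1 ((D.x v.1).q v.2) = D.u v'.1 ((D.x v'.1).q v'.2)) :
    D.cocycle v v' = D.C v.1 v'.1 v.2 v'.2 w := dif_pos w

/-- The glued lifting. -/
abbrev glued : LiftDatum E where
  Q := D.torsorData.torsor
  V := sigma fun i => (D.x i).V
  σ := sigmaDesc fun i => (D.x i).σ ≫ D.torsorData.inc i
  surj := by
    refine ⟨?_, fun s => ?_⟩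
    · refine isSubmersion_sigmaDesc (f := fun i => (D.x i).qHom ≫ D.u i) fun i => ?_
      exact (D.x i).surj.1.comp (D.cover.1 i).isSubmersion
    · obtain ⟨i, b, rfl⟩ := D.cover.2 s
      obtain ⟨v, rfl⟩ := (D.x i).exists_q b
      exact ⟨⟨i, v⟩, rfl⟩
  c := D.cocycle
  π_c v v' w := ((congrArg E.π (D.cocycle_eq w)).trans (D.π_C _ _ _ _ _)).trans
    (D.div_cls _ _ w).symm
  c_c v v' v'' w w' := (congrArg₂ E.grpd.m (D.cocycle_eq w) (D.cocycle_eq w')).trans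
    ((D.C_C _ _ _ _ _ _ _ _ _).trans (D.cocycle_eq (w.trans w')).symm)
  smooth_c T u u' w := by
    refine (isGluing_sigma fun i => (D.x i).V).descend_along u fun i T' v p hp => ?_
    refine (isGluing_sigma fun i => (D.x i).V).descend_along (v ≫ u') fun j T'' v' p' hp' => ?_
    have h2 : ∀ y, u' (v (v' y)) = ⟨j, p' y⟩ := hp'
    have w' : ∀ y, D.u i ((D.x i).q ((v' ≫ p) y)) = D.u j ((D.x j).q (p' y)) := fun y => by
      have := w (v (v' y))
      rw [h2, hp] at this
      exact this
    refine (congrArg Smooth (funext fun y => ?_)).mp (D.smooth_C i j T'' (v' ≫ p) p' w')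
    exact (D.cocycle_eq (v := ⟨i, p (v' y)⟩) (v' := ⟨j, p' y⟩) (w' y)).symm.trans
      (congrArg₂ D.cocycle (hp (v' y)).symm (h2 y).symm)

/-- The arrows to the glued lifting. -/
def incl (i : ι) : D.x i ⟶ D.glued where
  φ := D.torsorData.incHom i
  h v v' w := D.C i v'.1 v v'.2 w
  π_h v v' w := (D.π_C i v'.1 v v'.2 w).trans (D.div_cls _ _ w).symm
  c_h v₁ v v' w w₁ e := (congrArg (fun g => E.grpd.m g _)
    (D.C_self i v₁ v (congrArg (D.u i) e) e).symm).trans (D.C_C _ _ _ _ _ _ _ _ _)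
  h_c v v' v₁' w w₁ e := (congrArg (E.grpd.m _) (D.cocycle_eq e)).trans
    (D.C_C _ _ _ _ _ _ _ _ _)
  smooth_h T u u' w := by
    refine (isGluing_sigma fun i => (D.x i).V).descend_along u' fun j T' v p hp => ?_
    have w' : ∀ y, D.u i ((D.x i).q ((v ≫ u) y)) = D.u j ((D.x j).q (p y)) := fun y => by
      have := w (v y)
      rw [hp] at this
      exact this
    refine (congrArg Smooth (funext fun y => ?_)).mp (D.smooth_C i j T' (v ≫ u) p w')
    have : ∀ (v' : Σ i, (D.x i).V) (e : ⟨j, p y⟩ = v') (w₁),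
        D.C i j (u (v y)) (p y) (w' y) = D.C i v'.1 (u (v y)) v'.2 w₁ := by
      rintro _ rfl _; rfl
    exact this _ (hp y).symm _

theorem θ_incl (i j t) (a : t ⟶ D.x i) (b w) : D.θ i j t a b w ≫ D.incl j = a ≫ D.incl i := by
  refine hom_ext (LieTorsor.hom_ext ?_ (Mfd.hom_ext fun p => ?_)) fun v₀ v'' w₁ w₂ => ?_
  · change bs _ ≫ D.u j = bs a ≫ D.u i
    rw [D.bs_θ, w]
  · change D.torsorData.cls j (tt (D.θ i j t a b w) p) = D.torsorData.cls i (tt a p)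
    have h : D.u i ((D.x i).Q.proj (tt a p)) = D.u j (b (t.Q.proj p)) := by
      rw [LieTorsor.Hom.proj_tot]
      exact congrArg (fun f : t.Q.base ⟶ S => f (t.Q.proj p)) w
    rw [← D.τ_eq a b w p rfl rfl h]
    exact D.torsorData.cls_τ i j _ _ h
  · obtain ⟨v, hv⟩ := (D.x i).exists_q (bs a (t.q v₀))
    obtain ⟨v', hv'⟩ := (D.x j).exists_q (b (t.q v₀))
    have k : bs (D.θ i j t a b w) (t.q v₀) = (D.x j).q v' := (D.bs_θ_apply _).trans hv'.symm
    have e1 : D.u i ((D.x i).q v) = D.u v''.1 ((D.x v''.1).q v''.2) := by rw [hv]; exact w₂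
    have e2 : D.u j ((D.x j).q v') = D.u v''.1 ((D.x v''.1).q v''.2) := by rw [← k]; exact w₁
    have e3 : D.u i ((D.x i).q v) = D.u j ((D.x j).q v') := e1.trans e2.symm
    rw [comp_h _ _ v' w₁ k e2, comp_h _ _ v w₂ hv.symm e1, ← D.C_eq a b w hv.symm k e3,
      m_assoc (by rw [tgt_h_eq, src_C]) (by rw [tgt_C]; exact (src_h_eq (D.incl j) e2).symm)]
    congr 1
    exact D.C_C _ _ _ _ _ _ _ e2 e1

end Descent

theorem isStack : IsStack (stk E) where
  toIsFiberedInGroupoids := isFiberedInGroupoids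
  separated {ι x y} φ ψ z e hc h1 h2 h := by
    refine eq_of_cover z e hc.2 ?_ h
    exact (IsHomLift.fac' (stk E).p (𝟙 ((stk E).p.obj x)) φ).trans
      (IsHomLift.fac' (stk E).p (𝟙 ((stk E).p.obj x)) ψ).symm
  glue_hom {ι x y} h z e φ hc hb hφ := by
    obtain ⟨ψ, h1, h2⟩ := exists_glueHom z e φ (fun i => (hc.1 i).isSubmersion) hc.2 (eqToHom h)
      hb hφ
    exact ⟨ψ, IsHomLift.of_fac _ _ _ rfl h.symm (by
      change _ = _ ≫ bs ψ ≫ _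
      rw [h1]; simp), h2⟩
  glue_obj {ι} S x u hu θ lift h1 h2 :=
    let D : Descent E ι S := ⟨x, u, hu, θ, lift, h1, fun i j k t a b c w w' w'' => h2 i j k t a b c w w'⟩
    ⟨D.glued, D.incl, rfl, fun i => (isHomLift_iff (stk E).p _ _).2 rfl, D.θ_incl⟩

end LiftDatum

end

noncomputable section

open TopologicalSpace Topology LieGroupoid LieTorsor CentralExtension

namespace LiftDatum

variable {M : Mfd} {X : LieGroupoid M} {E : CentralExtension X}

/-! ### The band -/

/-- The automorphism of a lifting given by a function with values in the circle. -/
def gauge (x : LiftDatum E) (l : smoothCircle x.Q.base) : x ⟶ x where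
  φ := 𝟙 _
  -- The inverse is a matter of convention that has to match two other places: `S¹` acts on a pair
  -- `(a, b)` through the first arrow, which enters the pair inverted, and rotating a point `p` of a
  -- circle bundle divides the quotient of `p'` by `p`.
  h v v' _ := E.sm (l.1 (x.q v))⁻¹ (x.c v v')
  π_h v v' w := by rw [π_sm, x.π_c v v' w]; rfl
  c_h v₁ v v' w w₁ e := by
    have w' : x.q v = x.q v' := w
    rw [m_sm (by rw [x.tgt_c e, x.src_c w']), x.c_c _ _ _ e w', e]
  h_c v v' v₁' w w₁ e := by
    have w' : x.q v = x.q v' := w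
    rw [sm_m (by rw [x.tgt_c w', x.src_c e]), x.c_c _ _ _ w' e]
  smooth_h T u u' w := E.principal.smooth_sm
    (inv_mem (smoothCircle.pullback (u ≫ x.qHom) l).2) (x.smooth_c T u u' w)

theorem gauge_h (x : LiftDatum E) (l : smoothCircle x.Q.base) (v v' w) :
    Hom.h (x.gauge l) v v' w = E.sm (l.1 (x.q v))⁻¹ (x.c v v') := rfl

theorem comp_gauge_h {x y : LiftDatum E} (ρ : x ⟶ y) (l : smoothCircle y.Q.base) {v v'} (w w') :
    Hom.h (ρ ≫ y.gauge l) v v' w = E.sm (l.1 (y.q v'))⁻¹ (Hom.h ρ v v' w') := by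
  refine (comp_h ρ (y.gauge l) v' w w' rfl).trans ?_
  refine (congrArg (fun g => E.grpd.m _ (E.sm _ g)) (y.c_self v')).trans ?_
  exact m_sm_one (tgt_h_eq _ _)

theorem gauge_comp_h {x y : LiftDatum E} (ρ : x ⟶ y) (l : smoothCircle x.Q.base) {v v'} (w w') :
    Hom.h (x.gauge l ≫ ρ) v v' w = E.sm (l.1 (x.q v))⁻¹ (Hom.h ρ v v' w') := by
  refine (comp_h (x.gauge l) ρ v w rfl w').trans ?_
  refine (congrArg (fun g => E.grpd.m (E.sm _ g) _) (x.c_self v)).trans ?_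
  exact sm_one_m (src_h_eq _ _)

theorem gauge_one (x : LiftDatum E) : x.gauge 1 = 𝟙 x :=
  hom_ext rfl fun v v' w w' => by
    exact (congrArg (fun a => E.sm a _) _root_.inv_one).trans (one_sm _)

theorem gauge_comp (x : LiftDatum E) (l l' : smoothCircle x.Q.base) :
    x.gauge l ≫ x.gauge l' = x.gauge (l * l') :=
  hom_ext rfl fun v v' w w' => by
    refine (gauge_comp_h (x.gauge l') l w w').trans ((sm_sm _ _ _).trans ?_)
    exact congrArg (fun a => E.sm a _) (_root_.mul_inv (l.1 (x.q v)) (l'.1 (x.q v))).symm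

/-- The identification of functions with values in the circle with automorphisms. -/
def band (x : LiftDatum E) : smoothCircle x.Q.base →* Aut x where
  toFun l := ⟨x.gauge l, x.gauge l⁻¹, by rw [gauge_comp, mul_inv_cancel, gauge_one],
    by rw [gauge_comp, inv_mul_cancel, gauge_one]⟩
  map_one' := Iso.ext x.gauge_one
  map_mul' l l' := Iso.ext (by
    change x.gauge (l * l') = x.gauge l' ≫ x.gauge l
    rw [gauge_comp, mul_comm])

theorem gauge_injective (x : LiftDatum E) {l l' : smoothCircle x.Q.base}
    (h : x.gauge l = x.gauge l') : l = l' := by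
  refine Subtype.ext (funext fun b => ?_)
  obtain ⟨v, rfl⟩ := x.exists_q b
  have := h_congr h (v := v) (v' := v) rfl rfl
  exact _root_.inv_injective (E.principal.smul_cancel this)

/-- The comparison function of `α` and the cocycle have the same projection, so on the diagonal of
`V` they differ by a circle-valued function `L`. Compatibility with the cocycle on both sides,
together with the centrality of the circle, makes `L` constant on the fibres over the base, and
smoothness descends. -/
theorem exists_gauge {x : LiftDatum E} (α : x ⟶ x) (h : Hom.φ α = 𝟙 _) :
    ∃ l, x.gauge l = α := by
  have hα : ∀ b, bs α b = b := fun b =>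
    congrArg (fun f : x.Q ⟶ x.Q => LieTorsor.Hom.base f b) h
  have hw : ∀ {v v' : x.V}, x.q v = x.q v' → bs α (x.q v) = x.q v' := fun w => (hα _).trans w
  have hw' : ∀ {v v' : x.V}, bs α (x.q v) = x.q v' → x.q v = x.q v' := fun w =>
    (hα _).symm.trans w
  have hπ : ∀ v v' w, E.π (Hom.h α v v' w) = E.π (x.c v v') := fun v v' w => by
    rw [Hom.π_h, x.π_c v v' (hw' w), h]; rfl
  let L : ∀ v : x.V, Circle := fun v => E.principal.quo (Hom.h α v v (hw rfl)) (x.c v v)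
  have hL : ∀ v, E.sm (L v) (Hom.h α v v (hw rfl)) = x.c v v := fun v =>
    E.principal.quo_smul (hπ _ _ _)
  have hL' : ∀ v v' w, E.sm (L v) (Hom.h α v v' w) = x.c v v' := fun v v' w => by
    rw [← Hom.h_c α v v v' (hw rfl) w (hw' w), ← sm_m (by rw [tgt_h_eq, x.src_c (hw' w)]), hL,
      x.c_c _ _ _ rfl (hw' w)]
  have indep : ∀ v v', x.q v = x.q v' → L v = L v' := fun v v' e => by
    refine E.principal.smul_cancel (p := Hom.h α v v' (hw e)) ?_
    refine (hL' v v' (hw e)).trans ?_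
    have k : E.grpd.tgt (x.c v v') = E.grpd.src (Hom.h α v' v' (hw rfl)) := by
      rw [x.tgt_c e, src_h_eq]
    rw [← Hom.c_h α v v' v' (hw rfl) (hw e) e]
    refine Eq.trans ?_ (m_sm k)
    rw [hL, x.c_c _ _ _ e rfl]
  let l : x.Q.base → Circle := fun b => L (x.exists_q b).choose
  have hl : ∀ v, l (x.q v) = L v := fun v => indep _ _ (x.exists_q (x.q v)).choose_spec
  have hs : l ∈ smoothCircle x.Q.base := by
    rw [mem_smoothCircle_iff]
    refine Smooth.descend_one x.surj ?_
    rw [← mem_smoothCircle_iff]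
    have : (fun v => l (x.qHom v)) = L := funext hl
    change (fun v => l (x.qHom v)) ∈ _
    rw [this]
    exact E.principal.quo_mem (Hom.smooth_h α _ (𝟙 _) (𝟙 _) fun v => hw rfl)
      (x.smooth_c _ (𝟙 _) (𝟙 _) fun _ => rfl) fun v => hπ _ _ _
  refine ⟨⟨l, hs⟩, hom_ext h.symm fun v v' w w' => ?_⟩
  rw [gauge_h, ← hL' v v' w', sm_sm]
  change E.sm ((l (x.q v))⁻¹ * L v) _ = _
  rw [hl, inv_mul_cancel, one_sm]

/-! ### Liftings of torsors with a section -/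

/-- The trivial lifting of a torsor with a section. -/
abbrev ofSection (E : CentralExtension X) (y : LieTorsor X) (s : y.base ⟶ y.total)
    (hs : ∀ b, y.proj (s b) = b) : LiftDatum E where
  Q := y
  V := y.base
  σ := s
  surj := by
    have : s ≫ y.proj = 𝟙 _ := Mfd.hom_ext hs
    rw [this]; exact isSurjSubmersion_of_isIso _
  c b _ := E.grpd.one (y.anchor (s b))
  π_c b b' w := by
    obtain rfl : b = b' := by rw [← hs b, w, hs]
    rw [π_one, div_self]
  c_c b b' b'' w w' := by
    obtain rfl : b = b' := by rw [← hs b, w, hs]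
    exact one_m (E.grpd.src_one _)
  smooth_c T u u' w := smooth_one (smooth_coe (u ≫ s ≫ y.anchor))

/-- Arrows from the trivial lifting of a torsor with a section. -/
def homOfSection {y : LieTorsor X} {s : y.base ⟶ y.total} {hs : ∀ b, y.proj (s b) = b}
    {x : LiftDatum E} (φ : y ⟶ x.Q) (v : y.base ⟶ x.V) (r : y.base ⟶ E.grpd.arr)
    (hv : ∀ b, LieTorsor.Hom.base φ b = x.q (v b))
    (hr : ∀ b, E.π (r b) = x.Q.div (LieTorsor.Hom.total φ (s b)) (x.σ (v b))) :
    ofSection E y s hs ⟶ x where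
  φ := φ
  h b v' _ := E.grpd.m (r b) (x.c (v b) v')
  π_h b v' w := by
    have w' : x.q (v b) = x.q v' := (hv _).symm.trans ((congrArg (LieTorsor.Hom.base φ) (hs _)).symm.trans w)
    have e : x.Q.proj (LieTorsor.Hom.total φ (s b)) = x.Q.proj (x.σ (v b)) := by
      rw [LieTorsor.Hom.proj_tot, hs]; exact hv b
    rw [π_m (by rw [← E.tgt_π, hr, tgt_div e, x.src_c w']), hr, x.π_c _ _ w', m_div e w']
  c_h b₁ b v' w w₁ e := by
    obtain rfl : b₁ = b := by rw [← hs b₁]; exact e.trans (hs b)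
    have w' : x.q (v b₁) = x.q v' := (hv _).symm.trans ((congrArg (LieTorsor.Hom.base φ) (hs _)).symm.trans w)
    have e : x.Q.proj (LieTorsor.Hom.total φ (s b₁)) = x.Q.proj (x.σ (v b₁)) := by
      rw [LieTorsor.Hom.proj_tot, hs]; exact hv b₁
    refine one_m ?_
    rw [src_m (by rw [← E.tgt_π, hr, tgt_div e, x.src_c w']), ← E.src_π, hr, src_div e,
      LieTorsor.Hom.anchor_tot]
  h_c b v' v₁' w w₁ e' := by
    have w' : x.q (v b) = x.q v' := (hv _).symm.trans ((congrArg (LieTorsor.Hom.base φ) (hs _)).symm.trans w)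
    have e : x.Q.proj (LieTorsor.Hom.total φ (s b)) = x.Q.proj (x.σ (v b)) := by
      rw [LieTorsor.Hom.proj_tot, hs]; exact hv b
    rw [m_assoc (by rw [← E.tgt_π, hr, tgt_div e, x.src_c w']) (by rw [x.tgt_c w', x.src_c e']),
      x.c_c _ _ _ w' e']
  smooth_h T u u' w := by
    have w' : ∀ t, x.q (v (u t)) = x.q (u' t) := fun t => (hv _).symm.trans ((congrArg (LieTorsor.Hom.base φ) (hs _)).symm.trans (w t))
    refine smooth_m (smooth_coe (u ≫ r)) (x.smooth_c T (u ≫ v) u' w') fun t => ?_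
    have e : x.Q.proj (LieTorsor.Hom.total φ (s (u t))) = x.Q.proj (x.σ (v (u t))) := by
      rw [LieTorsor.Hom.proj_tot, hs]; exact hv (u t)
    rw [x.src_c (w' t), ← E.tgt_π]
    exact (congrArg X.tgt (hr (u t))).trans (tgt_div e)

/-- The tautological section of the pullback of a torsor to its total space. -/
abbrev diagSection (y : LieTorsor X) : y.total ⟶ (y.pullback y.proj).total :=
  pbLift y.proj_surjSubmersion.1 (𝟙 _) (𝟙 _) fun _ => rfl

theorem proj_diagSection (y : LieTorsor X) (b : y.total) :
    (y.pullback y.proj).proj (diagSection y b) = b := rfl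

/-- Every torsor acquires a section, and so a trivial lifting, after pullback to its own total
space. -/
theorem epi : IsEpimorphism (toTorsors E) := fun y =>
  ⟨ofSection E (y.pullback y.proj) (diagSection y) (proj_diagSection y), y.pullbackHom y.proj,
    y.proj_surjSubmersion⟩

/-- Two liftings of torsors identified by `β` become isomorphic after a surjective submersion: on a
common covering their points differ by an arrow of `X`, and an isomorphism of the liftings amounts
to a lift of that arrow to `E`. -/
theorem diagonal_epi : IsEpimorphism (diagonal (toTorsors E)) := by
  rintro ⟨⟨x, x', β⟩, h1, h2⟩
  let x : LiftDatum E := x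
  let x' : LiftDatum E := x'
  let β : x.Q ⟶ x'.Q := β
  let W := pb x'.qHom (x.qHom ≫ LieTorsor.Hom.base β) x'.surj.1
  let w' : W ⟶ x'.V := pbFst x'.qHom (x.qHom ≫ LieTorsor.Hom.base β) x'.surj.1
  let w : W ⟶ x.V := pbSnd x'.qHom (x.qHom ≫ LieTorsor.Hom.base β) x'.surj.1
  have hw : ∀ b, x'.Q.proj (LieTorsor.Hom.total β (x.σ (w b))) = x'.Q.proj (x'.σ (w' b)) :=
    fun b => by
      rw [LieTorsor.Hom.proj_tot]; exact b.2.symm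
  let d : W ⟶ X.arr := homMk (fun b => x'.Q.div (LieTorsor.Hom.total β (x.σ (w b))) (x'.σ (w' b)))
    (smooth_divide (smooth_coe (w ≫ x.σ ≫ LieTorsor.Hom.total β)) (smooth_coe (w' ≫ x'.σ)) hw)
  -- The base change of the circle bundle `E.π` along `d` is the manifold of all such lifts, so that
  -- a lift exists tautologically on it.
  let T := pb E.π d E.principal.surjSubmersion.1
  let r : T ⟶ E.grpd.arr := pbFst E.π d E.principal.surjSubmersion.1
  let k : T ⟶ W := pbSnd E.π d E.principal.surjSubmersion.1
  have hk : IsSurjSubmersion ((k ≫ w) ≫ x.qHom) :=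
    ((isSurjSubmersion_pbSnd E.principal.surjSubmersion).comp
      (isSurjSubmersion_pbSnd x'.surj)).comp x.surj
  let y := x.Q.pullback ((k ≫ w) ≫ x.qHom)
  let s : y.base ⟶ y.total := pbLift x.Q.proj_surjSubmersion.1 ((k ≫ w) ≫ x.σ) (𝟙 _) fun _ => rfl
  have hs : ∀ b, y.proj (s b) = b := fun b => rfl
  let a : ofSection E y s hs ⟶ x := homOfSection (x.Q.pullbackHom _) (k ≫ w)
    (k ≫ w ≫ x.σ ≫ x.Q.anchor ≫ E.grpd.one) (fun b => rfl) fun b => by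
      refine (π_one _).trans ?_
      exact (LieTorsor.div_self (x.σ (w (k b)))).symm
  let a' : ofSection E y s hs ⟶ x' := homOfSection (x.Q.pullbackHom _ ≫ β) (k ≫ w') r
    (fun b => (k b).2.symm) fun b => b.2
  refine ⟨ofSection E y s hs, ?_, ?_⟩
  · exact ⟨⟨a, a', (Category.id_comp (x.Q.pullbackHom _ ≫ β)).symm⟩⟩
  · exact hk

end LiftDatum

end

noncomputable section

open TopologicalSpace Topology LieGroupoid LieTorsor CentralExtension

/-- The preimage of an open set. -/
abbrev Mfd.preimage {A B : Mfd} (f : A ⟶ B) (U : Opens B) : Opens A :=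
  ⟨(fun x => f x) ⁻¹' U, U.isOpen.preimage (continuous_coe f)⟩

/-! ### Circle bundles from cocycles -/

/-- A cocycle with values in the circle on a surjective submersion. -/
structure CircleCocycle {V S : Mfd} (q : V ⟶ S) where
  surj : IsSurjSubmersion q
  d : V → V → Circle
  d_d : ∀ v v' v'', q v = q v' → q v' = q v'' → d v v' * d v' v'' = d v v''
  smooth_d : ∀ (T : Mfd) (u u' : T ⟶ V), (∀ x, q (u x) = q (u' x)) →
    (fun x => d (u x) (u' x)) ∈ smoothCircle T

namespace CircleCocycle

variable {V S : Mfd} {q : V ⟶ S} (D : CircleCocycle q)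

/-- Local sections of the submersion. -/
structure LocalSection (q : V ⟶ S) where
  U : Opens S
  s : S.restrict U ⟶ V
  hs : ∀ y, q (s y) = y.1

/-- A choice of a point in each fibre. -/
def pick (b : S) : V := (D.surj.2 b).choose

theorem q_pick (b : S) : q (D.pick b) = b := (D.surj.2 b).choose_spec

/-- The parametrization of the associated bundle given by a local section. -/
def chart (i : LocalSection q) (z : (S.restrict i.U).prod circle) : S × Circle :=
  (z.1.1, z.2 * D.d (D.pick z.1.1) (i.s z.1))

/-- The first projection of a product. -/
abbrev fstHom {A B : Mfd} : A.prod B ⟶ A := homMk Prod.fst (smooth_iff.2 smoothAt_fst)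

/-- As a set the associated bundle is `S × Circle`, by means of an arbitrary, possibly
discontinuous, point in each fibre of `q`. A local section reads the second coordinate relative to a
smooth point instead. In a transition the arbitrary point drops out by the cocycle identity, leaving
multiplication by `d` of two smooth sections. -/
theorem isGluing : IsGluing (fun i : LocalSection q => (S.restrict i.U).prod circle) D.chart where
  surj z := by
    obtain ⟨V, hV, s, -, hs⟩ := D.surj.1.exists_section (D.pick z.1)
    rw [q_pick] at hV
    refine ⟨⟨V, s, hs⟩, (⟨z.1, hV⟩, z.2 * (D.d (D.pick z.1) (s ⟨z.1, hV⟩))⁻¹), ?_⟩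
    exact Prod.ext rfl (inv_mul_cancel_right z.2 _)
  inj i w := by
    refine ⟨⊤, trivial, fun u _ v _ h => ?_⟩
    have h1 : u.1 = v.1 := Subtype.ext (congrArg Prod.fst h)
    have h2 : u.2 * D.d (D.pick u.1.1) (i.s u.1) = v.2 * D.d (D.pick v.1.1) (i.s v.1) :=
      congrArg Prod.snd h
    rw [h1] at h2
    exact Prod.ext h1 (mul_right_cancel h2)
  trans i j w w' h := by
    have h1 : w.1.1 = w'.1.1 := congrArg Prod.fst h
    let O := Mfd.preimage ((fstHom : (S.restrict i.U).prod circle ⟶ _) ≫ inclHom i.U) j.U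
    have hO : w ∈ O := by
      change w.1.1 ∈ j.U
      rw [h1]; exact w'.1.2
    let f : ((S.restrict i.U).prod circle).restrict O ⟶ S.restrict i.U :=
      homMk (fun z => z.1.1) (Smooth.comp (smooth_iff.2 smoothAt_fst) (smooth_coe (inclHom O)))
    let b : ((S.restrict i.U).prod circle).restrict O ⟶ S.restrict j.U :=
      homMk (fun z => ⟨z.1.1.1, z.2⟩) (Smooth.of_incl (smooth_coe (f ≫ inclHom i.U)))
    have hl : (fun z : ((S.restrict i.U).prod circle).restrict O => (z.1.2 : Circle)) ∈
        smoothCircle _ :=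
      mem_smoothCircle_iff.2 (Smooth.comp (smooth_iff.2 smoothAt_snd) (smooth_coe (inclHom O)))
    have hd := D.smooth_d _ (b ≫ j.s) (f ≫ i.s) fun z => by
      exact (j.hs _).trans (i.hs _).symm
    have hτ := mem_smoothCircle_iff.1 (mul_mem hl hd)
    have key : ∀ z : ((S.restrict i.U).prod circle).restrict O,
        D.d (j.s (b z)) (i.s (f z)) * D.d (D.pick z.1.1.1) (j.s (b z)) =
          D.d (D.pick z.1.1.1) (i.s (f z)) := fun z => by
      rw [mul_comm]
      exact D.d_d _ _ _ ((D.q_pick _).trans (j.hs (b z)).symm)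
        ((j.hs (b z)).trans (i.hs (f z)).symm)
    refine ⟨O, hO, homMk (fun z => (b z, z.1.2 * D.d (j.s (b z)) (i.s (f z))))
      (smooth_iff.2 fun z => smoothAt_prod_iff.2 ⟨smoothAt_coe b z, smooth_iff.1 hτ z⟩),
      Prod.ext (Subtype.ext h1) ?_, fun z => Prod.ext rfl ?_⟩
    · have h2 : w.2 * D.d (D.pick w.1.1) (i.s w.1) = w'.2 * D.d (D.pick w'.1.1) (j.s w'.1) :=
        congrArg Prod.snd h
      have e : b ⟨w, hO⟩ = w'.1 := Subtype.ext h1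
      have k := key ⟨w, hO⟩
      change w.2 * D.d (j.s (b ⟨w, hO⟩)) (i.s w.1) = w'.2
      change D.d (j.s (b ⟨w, hO⟩)) (i.s w.1) * D.d (D.pick w.1.1) (j.s (b ⟨w, hO⟩)) =
        D.d (D.pick w.1.1) (i.s w.1) at k
      rw [← k, ← _root_.mul_assoc, e, h1] at h2
      rw [e]
      exact mul_right_cancel h2
    · change (z.1.2 * D.d (j.s (b z)) (i.s (f z))) * D.d (D.pick z.1.1.1) (j.s (b z)) = _
      rw [_root_.mul_assoc, key]; rfl

/-- The total space of the associated bundle. -/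
abbrev tot : Mfd := D.isGluing.mfd

theorem smooth_tot {T : Mfd} {f : T → S × Circle} (i : LocalSection q) (b : T ⟶ S.restrict i.U)
    {l : T → Circle} (hl : l ∈ smoothCircle T)
    (hf : ∀ x, f x = ((b x).1, l x * D.d (D.pick (b x).1) (i.s (b x)))) :
    Smooth (N := D.tot) f := by
  let k : T ⟶ (S.restrict i.U).prod circle := homMk (fun x => (b x, l x))
    (smooth_iff.2 fun z => smoothAt_prod_iff.2 ⟨smoothAt_coe b z,
      smooth_iff.1 (mem_smoothCircle_iff.1 hl) z⟩)
  have h := smooth_coe (k ≫ D.isGluing.param i)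
  refine (congrArg (Smooth (N := D.tot)) (funext fun x => ?_)).mp h
  exact (hf x).symm

theorem smooth_of_tot {T N : Mfd} (z : T ⟶ D.tot) {f : T → N}
    (h : ∀ (i : LocalSection q) (T' : Mfd) (v : T' ⟶ T) (b : T' ⟶ S.restrict i.U) (l : T' → Circle),
      l ∈ smoothCircle T' → (∀ y, z (v y) = ((b y).1, l y * D.d (D.pick (b y).1) (i.s (b y)))) →
      Smooth fun y => f (v y)) : Smooth f := by
  refine D.isGluing.descend_along z fun i T' v p hp => ?_
  exact h i T' v (homMk (fun y => (p y).1) (Smooth.comp (smooth_iff.2 smoothAt_fst) (smooth_coe p)))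
    (fun y => (p y).2) (mem_smoothCircle_iff.2
      (Smooth.comp (smooth_iff.2 smoothAt_snd) (smooth_coe p))) hp

/-- The projection of the associated bundle. -/
def proj : D.tot ⟶ S := homMk Prod.fst (D.smooth_of_tot (𝟙 _) fun i T' v b l hl h => by
  have : (fun y => (v y : S × Circle).1) = fun y => (b y).1 := funext fun y =>
    congrArg Prod.fst (h y)
  rw [this]
  exact smooth_coe (b ≫ inclHom i.U))

/-- The map from the covering to the associated bundle. -/
def lift : V ⟶ D.tot := homMk (fun v => (q v, D.d (D.pick (q v)) v)) (by
  refine Smooth.of_local fun v => ?_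
  obtain ⟨U, hU, s, -, hs⟩ := D.surj.1.exists_section v
  let O : Opens V := ⟨(fun v => q v) ⁻¹' U, U.isOpen.preimage (continuous_coe q)⟩
  let b : V.restrict O ⟶ S.restrict U := homMk (fun y => ⟨q y.1, y.2⟩)
    (Smooth.of_incl (smooth_coe (inclHom O ≫ q)))
  refine ⟨O, hU, D.smooth_tot ⟨U, s, hs⟩ b
    (D.smooth_d _ (b ≫ s) (inclHom O) fun y => hs _) fun y => Prod.ext rfl ?_⟩
  refine (D.d_d _ (s (b y)) y.1 ((D.q_pick (q y.1)).trans (hs (b y)).symm)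
    (hs (b y))).symm.trans (mul_comm _ _))

/-- The associated bundle is a principal circle bundle. -/
def principal : PrincipalCircle D.proj where
  smul a z := (z.1, a * z.2)
  one_smul z := Prod.ext rfl (_root_.one_mul z.2)
  mul_smul a b z := Prod.ext rfl (_root_.mul_assoc a b z.2)
  proj_smul _ _ := rfl
  surjSubmersion := by
    refine ⟨.of_section fun z => ?_, fun b => ⟨(b, 1), rfl⟩⟩
    obtain ⟨U, hU, s, hs, hs'⟩ := D.surj.1.exists_section (D.pick z.1)
    rw [← show D.proj z = q (D.pick z.1) from (D.q_pick z.1).symm] at hU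
    let a := z.2 * (D.d (D.pick z.1) (s ⟨z.1, hU⟩))⁻¹
    refine ⟨U, hU, homMk (fun y => (y.1, a * D.d (D.pick y.1) (s y))) ?_, Prod.ext rfl ?_,
      fun y => rfl⟩
    · exact D.smooth_tot ⟨U, s, hs'⟩ (𝟙 _) (l := fun _ => a)
        (mem_smoothCircle_iff.2 (smooth_const _ (N := circle) a)) fun y => rfl
    · exact inv_mul_cancel_right z.2 _
  smooth_smul T l p := by
    refine D.smooth_of_tot p fun i T' v b l' hl' h => ?_
    refine D.smooth_tot i b (mul_mem (smoothCircle.pullback v l).2 hl') fun y => ?_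
    rw [h]
    exact Prod.ext rfl (_root_.mul_assoc _ _ _).symm
  simply_transitive p p' h := by
    refine ⟨p'.2 * p.2⁻¹, Prod.ext h (inv_mul_cancel_right p'.2 _), fun a ha => ?_⟩
    have : a * p.2 = p'.2 := congrArg Prod.snd ha
    rw [← this]
    exact (mul_inv_cancel_right a p.2).symm
  smooth_div T p p' l hl := by
    rw [mem_smoothCircle_iff]
    refine D.smooth_of_tot p fun i T' v b a ha h => ?_
    refine D.smooth_of_tot (v ≫ p') fun j T'' v' b' a' ha' h' => ?_
    rw [← mem_smoothCircle_iff]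
    have e : ∀ y, ((b (v' y)).1 = (b' y).1) ∧ l (v (v' y)) * (a (v' y) *
        D.d (D.pick (b (v' y)).1) (i.s (b (v' y)))) = a' y * D.d (D.pick (b' y).1) (j.s (b' y)) := by
      intro y
      have := hl (v (v' y))
      have h2 : p' (v (v' y)) = _ := h' y
      rw [h2, h] at this
      exact ⟨congrArg Prod.fst this, congrArg Prod.snd this⟩
    have hq : ∀ y, q (i.s (b (v' y))) = q (j.s (b' y)) := fun y => by
      rw [i.hs, j.hs, (e y).1]
    have hd := D.smooth_d T'' (v' ≫ b ≫ i.s) (b' ≫ j.s) hq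
    refine (congrArg (· ∈ smoothCircle T'') (funext fun y => ?_)).mp
      (mul_mem (mul_mem ha' (inv_mem (smoothCircle.pullback v' ⟨a, ha⟩).2)) hd)
    change a' y * (a (v' y))⁻¹ * D.d (i.s (b (v' y))) (j.s (b' y)) = l (v (v' y))
    have e2 := (e y).2
    have e3 := D.d_d (D.pick (b' y).1) (i.s (b (v' y))) (j.s (b' y))
      (by rw [D.q_pick, i.hs, (e y).1]) (hq y)
    rw [(e y).1, ← e3] at e2
    have e4 : l (v (v' y)) * a (v' y) = a' y * D.d (i.s (b (v' y))) (j.s (b' y)) := by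
      refine mul_right_cancel (b := D.d (D.pick (b' y).1) (i.s (b (v' y)))) ?_
      rw [_root_.mul_assoc, e2, _root_.mul_assoc, mul_comm (D.d (i.s (b (v' y))) (j.s (b' y)))]
    rw [mul_right_comm, ← e4, mul_inv_cancel_right]

/-- The cocycle is recovered from the bundle, on the covering that carries the tautological points.
-/
theorem quo_lift {v v' : V} (h : q v = q v') :
    D.principal.quo (D.lift v) (D.lift v') = D.d v v' := by
  symm
  refine D.principal.eq_quo (Prod.ext h ?_)
  change D.d v v' * D.d (D.pick (q v)) v = D.d (D.pick (q v')) v'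
  rw [mul_comm, h]
  exact D.d_d _ _ _ ((D.q_pick _).trans h.symm) h

/-- The associated circle bundle. -/
abbrev bundle : CircleBundle := ⟨S, D.tot, D.proj, D.principal⟩

/-- The trivial cocycle. -/
abbrev trivial (S : Mfd) : CircleCocycle (𝟙 S) where
  surj := isSurjSubmersion_of_isIso _
  d _ _ := 1
  d_d _ _ _ _ _ := _root_.one_mul 1
  smooth_d _ _ _ _ := one_mem _

end CircleCocycle

end

noncomputable section

open TopologicalSpace Topology LieGroupoid LieTorsor CentralExtension

/-! ### Arrows of categories fibered in groupoids -/

namespace IsFiberedInGroupoids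

variable {𝒳 : BasedCategory.{0, 1} Mfd}

theorem exists_lift (h𝒳 : IsFiberedInGroupoids 𝒳) {x y z : 𝒳.obj} (ψ : y ⟶ z) (φ : x ⟶ z) (g : 𝒳.p.obj y ⟶ 𝒳.p.obj x)
    (hg : 𝒳.p.map ψ = g ≫ 𝒳.p.map φ) : ∃ χ : y ⟶ x, 𝒳.p.map χ = g ∧ χ ≫ φ = ψ := by
  have := h𝒳.cartesian φ
  have : 𝒳.p.IsHomLift (g ≫ 𝒳.p.map φ) ψ := (isHomLift_iff _ _ _).2 hg
  obtain ⟨χ, ⟨h1, h2⟩, -⟩ := Functor.IsStronglyCartesian.universal_property' (p := 𝒳.p)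
    (f := 𝒳.p.map φ) (φ := φ) g ψ
  exact ⟨χ, (isHomLift_iff _ _ _).1 h1, h2⟩

theorem lift_unique (h𝒳 : IsFiberedInGroupoids 𝒳) {x y z : 𝒳.obj} {χ χ' : y ⟶ x} (φ : x ⟶ z) (hb : 𝒳.p.map χ = 𝒳.p.map χ')
    (h : χ ≫ φ = χ' ≫ φ) : χ = χ' := by
  have := h𝒳.cartesian φ
  have hg : 𝒳.p.map (χ' ≫ φ) = 𝒳.p.map χ ≫ 𝒳.p.map φ := by rw [hb, Functor.map_comp]
  have : 𝒳.p.IsHomLift (𝒳.p.map χ ≫ 𝒳.p.map φ) (χ' ≫ φ) := (isHomLift_iff _ _ _).2 hg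
  obtain ⟨χ'', -, h2⟩ := Functor.IsStronglyCartesian.universal_property' (p := 𝒳.p)
    (f := 𝒳.p.map φ) (φ := φ) (𝒳.p.map χ) (χ' ≫ φ)
  exact (h2 χ ⟨(isHomLift_iff _ _ _).2 rfl, h⟩).trans
    (h2 χ' ⟨(isHomLift_iff _ _ _).2 hb.symm, rfl⟩).symm

theorem isIso_of_isIso_map (h𝒳 : IsFiberedInGroupoids 𝒳) {x y : 𝒳.obj} (φ : x ⟶ y) [IsIso (𝒳.p.map φ)] : IsIso φ := by
  obtain ⟨χ, h1, h2⟩ := h𝒳.exists_lift (𝟙 y) φ (inv (𝒳.p.map φ)) (by simp)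
  refine ⟨χ, h𝒳.lift_unique φ ?_ ?_, h2⟩
  · rw [Functor.map_comp, h1, IsIso.hom_inv_id, CategoryTheory.Functor.map_id]
  · rw [Category.assoc, h2, Category.comp_id, Category.id_comp]

end IsFiberedInGroupoids

namespace CircleBundle

variable {P P' : CircleBundle} (f : P ⟶ P')

theorem Hom.quo_total {p p' : P.total} (h : P.proj p = P.proj p') :
    P'.principal.quo (Hom.total f p) (Hom.total f p') = P.principal.quo p p' := by
  symm
  apply P'.principal.eq_quo
  rw [← Hom.total_smul f, P.principal.quo_smul h]

end CircleBundle

namespace LieTorsor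

variable {M : Mfd} {Γ : LieGroupoid M}

theorem one_eq_div {P : LieTorsor Γ} {p p' : P.total} {x : M} (hx : x = P.anchor p)
    (e : p = p') : Γ.one x = P.div p p' := by
  subst hx e; exact (div_self p).symm

/-- The arrow between two pullbacks of a torsor. -/
abbrev pullbackMap (y : LieTorsor Γ) {S S' : Mfd} (g : S ⟶ y.base) (g' : S' ⟶ y.base) (b : S ⟶ S')
    (w : b ≫ g' = g) : y.pullback g ⟶ y.pullback g' where
  base := b
  total := pbLift y.proj_surjSubmersion.1 (pbFst y.proj g y.proj_surjSubmersion.1)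
    (pbSnd y.proj g y.proj_surjSubmersion.1 ≫ b) fun p =>
      p.2.trans (congrArg (fun f : S ⟶ y.base => f p.1.2) w).symm
  proj_total _ := rfl
  anchor_total _ := rfl
  total_act _ _ _ := rfl

end LieTorsor

theorem CentralExtension.sm_one_m_sm_one {M : Mfd} {X : LieGroupoid M} {E : CentralExtension X}
    {a b : Circle} {x x' : M} (e : x = x') :
    E.grpd.m (E.sm a (E.grpd.one x)) (E.sm b (E.grpd.one x')) = E.sm (a * b) (E.grpd.one x) := by
  subst e
  rw [sm_m_sm (by rw [E.grpd.tgt_one, E.grpd.src_one]), one_m (E.grpd.src_one _)]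

/-! ### Liftings of pullbacks of a torsor with a section, given by circle bundles -/

namespace LiftDatum

variable {M : Mfd} {X : LieGroupoid M} (E : CentralExtension X) (y : LieTorsor X)
  (s : y.base ⟶ y.total) (hs : ∀ b, y.proj (s b) = b)

/-- The lifting of the pullback of a torsor with a section given by a circle bundle. -/
abbrev ofBundle (P : CircleBundle) (g : P.base ⟶ y.base) : LiftDatum E where
  Q := y.pullback g
  V := P.total
  σ := pbLift y.proj_surjSubmersion.1 (P.proj ≫ g ≫ s) P.proj fun p => hs _
  surj := P.principal.surjSubmersion
  c p p' := E.sm (P.principal.quo p p') (E.grpd.one (y.anchor (s (g (P.proj p)))))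
  π_c p p' w := by
    have w' : P.proj p = P.proj p' := w
    rw [π_sm, π_one]
    refine one_eq_div (P := y.pullback g) rfl (Subtype.ext (Prod.ext ?_ ?_))
    · exact congrArg (fun b => s (g b)) w'
    · exact w'
  c_c p p' p'' w w' := by
    have e : P.proj p = P.proj p' := w
    have e' : P.proj p' = P.proj p'' := w'
    rw [sm_one_m_sm_one (by rw [e]), P.principal.quo_mul_quo e e']
  smooth_c T u u' w := E.principal.smooth_sm (P.principal.quo_mem (smooth_coe u) (smooth_coe u') w)
    (smooth_one (smooth_coe (u ≫ P.proj ≫ g ≫ s ≫ y.anchor)))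

/-- The arrow of liftings given by an arrow of circle bundles. -/
def ofBundleMap {P P' : CircleBundle} {g : P.base ⟶ y.base} {g' : P'.base ⟶ y.base} (f : P ⟶ P')
    (w : CircleBundle.Hom.base f ≫ g' = g) : ofBundle E y s hs P g ⟶ ofBundle E y s hs P' g' where
  φ := y.pullbackMap g g' (CircleBundle.Hom.base f) w
  h p p' _ := E.sm (P'.principal.quo (CircleBundle.Hom.total f p) p')
    (E.grpd.one (y.anchor (s (g (P.proj p)))))
  π_h p p' w₁ := by
    have w' : CircleBundle.Hom.base f (P.proj p) = P'.proj p' := w₁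
    rw [π_sm, π_one]
    have k : g (P.proj p) = g' (P'.proj p') := by rw [← w', ← w]; rfl
    refine one_eq_div (P := y.pullback g') rfl (Subtype.ext (Prod.ext ?_ ?_))
    · exact congrArg s k
    · exact w'
  c_h p₁ p p' w₁ w₂ e := by
    have w' : CircleBundle.Hom.base f (P.proj p) = P'.proj p' := w₁
    have e' : P.proj p₁ = P.proj p := e
    rw [sm_one_m_sm_one (by rw [e']),
      ← CircleBundle.Hom.quo_total f e', P'.principal.quo_mul_quo]
    · rw [CircleBundle.Hom.proj_total f, CircleBundle.Hom.proj_total f, e']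
    · rw [CircleBundle.Hom.proj_total f, w']
  h_c p p' p₁' w₁ w₂ e := by
    have w' : CircleBundle.Hom.base f (P.proj p) = P'.proj p' := w₁
    have e' : P'.proj p' = P'.proj p₁' := e
    have k : g (P.proj p) = g' (P'.proj p') := by rw [← w', ← w]; rfl
    rw [sm_one_m_sm_one (by rw [k]), P'.principal.quo_mul_quo _ e']
    rw [CircleBundle.Hom.proj_total f, w']
  smooth_h T u u' w₁ := E.principal.smooth_sm
    (P'.principal.quo_mem (smooth_coe (u ≫ CircleBundle.Hom.total f)) (smooth_coe u') fun t =>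
      (CircleBundle.Hom.proj_total f _).trans (w₁ t))
    (smooth_one (smooth_coe (u ≫ P.proj ≫ g ≫ s ≫ y.anchor)))

/-- The trivialization of the restriction of the gerbe to the base of a torsor with a section. -/
def trivialization : circleTimes y.base ⥤ᵇ restriction (toTorsors E) y where
  toFunctor :=
    { obj := fun B => CostructuredArrow.mk (S := (toTorsors E).toFunctor) (T := y)
        (Y := ofBundle E y s hs B.left B.hom) (y.pullbackHom B.hom)
      map := fun f => CostructuredArrow.homMk
        (ofBundleMap E y s hs f.left (CostructuredArrow.w f))
        (LieTorsor.hom_ext (CostructuredArrow.w f) rfl)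
      map_id := fun B => by
        refine CommaMorphism.ext (hom_ext rfl fun p p' w w' => rfl) (Subsingleton.elim _ _)
      map_comp := fun {B B' B''} f f' => by
        refine CommaMorphism.ext (hom_ext rfl fun p p' w w' => ?_) (Subsingleton.elim _ _)
        have w₀ : CircleBundle.Hom.base f'.left (CircleBundle.Hom.base f.left (B.left.proj p)) =
          B''.left.proj p' := w
        have k₁ : CircleBundle.Hom.base f.left (B.left.proj p) =
            B'.left.proj (CircleBundle.Hom.total f.left p) :=
          (CircleBundle.Hom.proj_total f.left p).symm
        have k₂ : B.hom (B.left.proj p) = B'.hom (B'.left.proj (CircleBundle.Hom.total f.left p)) :=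
          (congrArg (fun b : B.left.base ⟶ y.base => b (B.left.proj p))
            (CostructuredArrow.w f)).symm.trans (congrArg B'.hom k₁)
        refine Eq.trans ?_ (comp_h (ofBundleMap E y s hs f.left (CostructuredArrow.w f))
          (ofBundleMap E y s hs f'.left (CostructuredArrow.w f'))
          (CircleBundle.Hom.total f.left p) w' k₁
          ((congrArg (CircleBundle.Hom.base f'.left) k₁.symm).trans w₀)).symm
        refine Eq.trans ?_ (sm_one_m_sm_one (congrArg (fun b => y.anchor (s b)) k₂)).symm
        rw [PrincipalCircle.quo_self, _root_.one_mul]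
        rfl }
  w := rfl

end LiftDatum

end

/-! ### The trivialization is an equivalence -/

noncomputable section

open TopologicalSpace Topology LieGroupoid LieTorsor CentralExtension

namespace LiftDatum

variable {M : Mfd} {X : LieGroupoid M} {E : CentralExtension X} {y : LieTorsor X}
  {s : y.base ⟶ y.total} {hs : ∀ b, y.proj (s b) = b}

/-- The comparison function at `(p, f p)` is a unit, so the one of `f'` is a unit there as well,
which says that `f' p = f p`. -/
theorem ofBundleMap_injective {P P' : CircleBundle} {g : P.base ⟶ y.base} {g' : P'.base ⟶ y.base}
    {f f' : P ⟶ P'} {w w'}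
    (h : ofBundleMap E y s hs (g := g) (g' := g') f w = ofBundleMap E y s hs f' w') : f = f' := by
  have hb : CircleBundle.Hom.base f = CircleBundle.Hom.base f' := congrArg (fun χ => bs χ) h
  refine CircleBundle.Hom.ext hb (Mfd.hom_ext fun p => ?_)
  have e : CircleBundle.Hom.base f (P.proj p) = P'.proj (CircleBundle.Hom.total f p) :=
    (CircleBundle.Hom.proj_total f p).symm
  have e' : CircleBundle.Hom.base f' (P.proj p) = P'.proj (CircleBundle.Hom.total f p) := by
    rw [← hb, e]
  have := E.principal.smul_cancel (h_congr h (v := p) (v' := CircleBundle.Hom.total f p) e e')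
  rw [PrincipalCircle.quo_self] at this
  have k := P'.principal.quo_smul ((CircleBundle.Hom.proj_total f' p).trans e')
  rw [← this, P'.principal.one_smul] at k
  exact k.symm

/-- Compatibility with the section makes the comparison function of `χ` project to units, so it has
the form `L(p, p')` times a unit of `E`. The bundle map sends `p` to the unique `p'` with `L(p, p')
= 1`. -/
theorem exists_ofBundleMap {P P' : CircleBundle} {g : P.base ⟶ y.base} {g' : P'.base ⟶ y.base}
    (χ : ofBundle E y s hs P g ⟶ ofBundle E y s hs P' g')
    (hχ : Hom.φ χ ≫ y.pullbackHom g' = y.pullbackHom g) :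
    ∃ f w, ofBundleMap E y s hs f w = χ := by
  let β : P.base ⟶ P'.base := bs χ
  have hβ : β ≫ g' = g := congrArg (fun f => LieTorsor.Hom.base f) hχ
  have hβ' : ∀ b, g' (β b) = g b := fun b => congrArg (fun f : P.base ⟶ y.base => f b) hβ
  have htot : ∀ z : (y.pullback g).total, (tt χ z).1.1 = z.1.1 := fun z =>
    congrArg (fun f => LieTorsor.Hom.total f z) hχ
  have htot' : ∀ z : (y.pullback g).total, (tt χ z).1.2 = β z.1.2 := fun z =>
    LieTorsor.Hom.proj_tot (Hom.φ χ) z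
  let H : ∀ p p', β (P.proj p) = P'.proj p' → E.grpd.arr := fun p p' w => Hom.h χ p p' w
  let u : P.total → E.grpd.arr := fun p => E.grpd.one (y.anchor (s (g (P.proj p))))
  have hπ : ∀ p p' w, E.π (u p) = E.π (H p p' w) := fun p p' w => by
    refine (π_one _).trans (Eq.trans ?_ (Hom.π_h χ p p' w).symm)
    refine one_eq_div ?_ (Subtype.ext (Prod.ext ?_ ?_))
    · exact (LieTorsor.Hom.anchor_tot (Hom.φ χ) ((ofBundle E y s hs P g).σ p)).symm
    · refine (htot _).trans ?_
      change s (g (P.proj p)) = s (g' (P'.proj p'))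
      rw [← w, hβ']
    · exact (htot' _).trans w
  let L : ∀ p p', β (P.proj p) = P'.proj p' → Circle := fun p p' w =>
    E.principal.quo (u p) (H p p' w)
  have hL : ∀ p p' w, E.sm (L p p' w) (u p) = H p p' w := fun p p' w =>
    E.principal.quo_smul (hπ p p' w)
  have L_right : ∀ p p' p'' w w', L p p'' w' = L p p' w * P'.principal.quo p' p'' := by
    intro p p' p'' w w'
    refine (E.principal.eq_quo ?_).symm
    refine (sm_one_m_sm_one (E := E) (x' := y.anchor (s (g' (P'.proj p')))) ?_).symm.trans ?_
    · rw [← w, hβ']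
    · refine (congrArg (fun h => E.grpd.m h _) (hL p p' w)).trans ?_
      exact Hom.h_c χ p p' p'' w w' (w.symm.trans w')
  have L_left : ∀ p₁ p p' w₁ w, P.proj p₁ = P.proj p →
      L p₁ p' w₁ = P.principal.quo p₁ p * L p p' w := by
    intro p₁ p p' w₁ w e
    refine (E.principal.eq_quo ?_).symm
    refine (sm_one_m_sm_one (E := E) (x' := y.anchor (s (g (P.proj p)))) ?_).symm.trans ?_
    · rw [e]
    · refine (congrArg (fun h => E.grpd.m _ h) (hL p p' w)).trans ?_
      exact Hom.c_h χ p₁ p p' w w₁ e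
  have hmid : ∀ p, ∃ p', β (P.proj p) = P'.proj p' := fun p => by
    obtain ⟨p', h⟩ := P'.principal.surjSubmersion.2 (β (P.proj p))
    exact ⟨p', h.symm⟩
  have indep : ∀ p p' p'' w w', P'.principal.smul (L p p' w)⁻¹ p' =
      P'.principal.smul (L p p'' w')⁻¹ p'' := by
    intro p p' p'' w w'
    rw [L_right p p' p'' w w', ← P'.principal.quo_smul (w.symm.trans w'), ← P'.principal.mul_smul]
    congr 1
    rw [P'.principal.quo_smul (w.symm.trans w')]
    simp
  -- Since `L` is multiplied by `λ` when `p'` is replaced by `λ p'`, rotating any admissible `p'` by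
  -- the inverse of `L` produces the point where `L` is `1`.
  let F : P.total → P'.total := fun p =>
    P'.principal.smul (L p (hmid p).choose (hmid p).choose_spec)⁻¹ (hmid p).choose
  have hF : ∀ p p' w, F p = P'.principal.smul (L p p' w)⁻¹ p' := fun p p' w => indep _ _ _ _ _
  clear_value F
  have hFs : Smooth F := by
    refine Smooth.descend_one (isSurjSubmersion_pbSnd (g := P.proj ≫ β)
      P'.principal.surjSubmersion) ?_
    let T := pb P'.proj (P.proj ≫ β) P'.principal.surjSubmersion.1
    let r : T ⟶ P.total := pbSnd P'.proj (P.proj ≫ β) P'.principal.surjSubmersion.1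
    let r' : T ⟶ P'.total := pbFst P'.proj (P.proj ≫ β) P'.principal.surjSubmersion.1
    have w : ∀ t, β (P.proj (r t)) = P'.proj (r' t) := fun t => t.2.symm
    have h1 := E.principal.quo_mem (smooth_one (smooth_coe (r ≫ P.proj ≫ g ≫ s ≫ y.anchor)))
      (Hom.smooth_h χ T r r' w) fun t => hπ _ _ _
    refine (congrArg Smooth (funext fun t => ?_)).mp
      (P'.principal.smooth_sm (inv_mem h1) (smooth_coe r'))
    exact (hF (r t) (r' t) (w t)).symm
  let f : P ⟶ P' :=
    { base := β
      total := homMk F hFs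
      proj_total := fun p => by
        obtain ⟨p', w⟩ := hmid p
        rw [homMk_apply, hF p p' w, P'.principal.proj_smul, w]
      total_smul := fun a p => by
        obtain ⟨p', w⟩ := hmid p
        have e : P.proj (P.principal.smul a p) = P.proj p := P.principal.proj_smul a p
        have w' : β (P.proj (P.principal.smul a p)) = P'.proj p' := by rw [e, w]
        rw [homMk_apply, homMk_apply, hF p p' w, hF _ p' w', L_left _ _ _ w' w e,
          PrincipalCircle.quo_smul_left _ rfl, PrincipalCircle.quo_self, ← P'.principal.mul_smul]
        simp [mul_comm] }
  refine ⟨f, hβ, hom_ext (LieTorsor.hom_ext rfl (Mfd.hom_ext fun z => ?_)) fun p p' w w' => ?_⟩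
  · exact Subtype.ext (Prod.ext (htot z).symm (htot' z).symm)
  · refine Eq.trans ?_ (hL p p' w)
    change E.sm (P'.principal.quo (F p) p') (u p) = _
    rw [hF p p' w, PrincipalCircle.quo_smul_left _ rfl, PrincipalCircle.quo_self]
    simp

variable (E s hs) in
-- This is essential surjectivity. The arrows `δ` of `X` from the points `σ v` to the section
-- trivialize the torsor; the lifts of `δ` to `E` form a circle bundle over `V`, and the cocycle of
-- `x` gives it descent data to the base.
theorem exists_ofBundle_hom (x : LiftDatum E) (α : x.Q ⟶ y) :
    ∃ (P : CircleBundle) (g : P.base ⟶ y.base) (χ : ofBundle E y s hs P g ⟶ x),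
      IsIso (bs χ) ∧ Hom.φ χ ≫ α = y.pullbackHom g := by
  let g := LieTorsor.Hom.base α
  have hδ : ∀ v, y.proj (LieTorsor.Hom.total α (x.σ v)) = y.proj (s (g (x.q v))) := fun v => by
    rw [LieTorsor.Hom.proj_tot, hs]
  let δ : x.V ⟶ X.arr := homMk (fun v => y.div (LieTorsor.Hom.total α (x.σ v)) (s (g (x.q v))))
    (smooth_divide (smooth_coe (x.σ ≫ LieTorsor.Hom.total α)) (smooth_coe (x.qHom ≫ g ≫ s)) hδ)
  have δ_apply : ∀ v, δ v = y.div (LieTorsor.Hom.total α (x.σ v)) (s (g (x.q v))) := fun v => rfl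
  have src_δ : ∀ v, X.src (δ v) = x.Q.anchor (x.σ v) := fun v => by
    rw [δ_apply, src_div (hδ v), LieTorsor.Hom.anchor_tot]
  have tgt_δ : ∀ v, X.tgt (δ v) = y.anchor (s (g (x.q v))) := fun v => by
    rw [δ_apply, tgt_div (hδ v)]
  have c_δ : ∀ v v', x.q v = x.q v' → X.m (E.π (x.c v v')) (δ v') = δ v := fun v v' e => by
    rw [x.π_c v v' e, ← LieTorsor.Hom.div_total α e, δ_apply, δ_apply,
      m_div (LieTorsor.Hom.proj_eq α e) (hδ v'), e]
  clear_value δ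
  -- Points of `Y` are pairs of a point `v` and a lift `r` of `δ v` to `E`.
  let Y := pb E.π δ E.principal.surjSubmersion.1
  let vY : Y ⟶ x.V := pbSnd E.π δ E.principal.surjSubmersion.1
  let rY : Y ⟶ E.grpd.arr := pbFst E.π δ E.principal.surjSubmersion.1
  have hY : ∀ z, E.π (rY z) = δ (vY z) := fun z => z.2
  have exY : ∀ v r, E.π r = δ v → ∃ z, rY z = r ∧ vY z = v := fun v r h => ⟨⟨(r, v), h⟩, rfl, rfl⟩
  have hvY : IsSurjSubmersion vY := isSurjSubmersion_pbSnd E.principal.surjSubmersion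
  clear_value rY vY
  have wY : ∀ z z', x.q (vY z) = x.q (vY z') → E.grpd.tgt (x.c (vY z) (vY z')) =
      E.grpd.src (rY z') := fun z z' e => by
    rw [x.tgt_c e, ← E.src_π, hY, src_δ]
  have πY : ∀ z z', x.q (vY z) = x.q (vY z') →
      E.π (rY z) = E.π (E.grpd.m (x.c (vY z) (vY z')) (rY z')) := fun z z' e => by
    rw [π_m (wY z z' e), hY, hY, c_δ _ _ e]
  -- Over points of `Y` in one fibre, `r` and `c(v, v') r'` lift the same arrow of `X`; the circle
  -- element that separates them is a cocycle because the circle is central.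
  let D : CircleCocycle (vY ≫ x.qHom) :=
    { surj := hvY.comp x.surj
      d := fun z z' => E.principal.quo (rY z) (E.grpd.m (x.c (vY z) (vY z')) (rY z'))
      d_d := fun z z' z'' e e' => by
        have e₁ : x.q (vY z) = x.q (vY z') := e
        have e₂ : x.q (vY z') = x.q (vY z'') := e'
        apply E.principal.eq_quo
        rw [mul_comm, E.principal.mul_smul, E.principal.quo_smul (πY z z' e₁)]
        refine (m_sm (wY z z' e₁)).symm.trans ?_
        change E.grpd.m _ (E.principal.smul _ _) = _
        rw [E.principal.quo_smul (πY z' z'' e₂), ← m_assoc _ (wY z' z'' e₂), x.c_c _ _ _ e₁ e₂]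
        rw [x.tgt_c e₁, x.src_c e₂]
      smooth_d := fun T u u' w => by
        refine E.principal.quo_mem (smooth_coe (u ≫ rY)) (smooth_m
          (x.smooth_c T (u ≫ vY) (u' ≫ vY) w) (smooth_coe (u' ≫ rY)) fun t => ?_) fun t => ?_
        · exact wY _ _ (w t)
        · exact πY _ _ (w t) }
  have hd : ∀ z z', x.q (vY z) = x.q (vY z') →
      E.sm (D.principal.quo (D.lift z) (D.lift z')) (rY z) =
        E.grpd.m (x.c (vY z) (vY z')) (rY z') := fun z z' e => by
    rw [D.quo_lift e]
    exact E.principal.quo_smul (πY z z' e)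
  have hproj : ∀ z, D.proj (D.lift z) = x.q (vY z) := fun z => rfl
  -- The comparison function of the desired arrow, with an auxiliary lift `r` of `δ v`: a change of
  -- lift alters the quotient and the inverse of `r` by opposite factors.
  let K : D.tot → Y → E.grpd.arr := fun p z =>
    E.sm (D.principal.quo p (D.lift z)) (E.grpd.inv (rY z))
  have K_c : ∀ p z z', D.proj p = x.q (vY z) → x.q (vY z) = x.q (vY z') →
      E.grpd.m (K p z) (x.c (vY z) (vY z')) = K p z' := by
    intro p z z' e e'
    have w1 := wY z z' e'
    have w2 : E.grpd.tgt (E.grpd.inv (rY z)) = E.grpd.src (x.c (vY z) (vY z')) := by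
      rw [E.grpd.tgt_inv, ← E.src_π, hY, src_δ, x.src_c e']
    have h1 := hd z z' e'
    have h2 : E.grpd.m (E.grpd.inv (rY z)) (x.c (vY z) (vY z')) =
        E.sm (D.principal.quo (D.lift z) (D.lift z')) (E.grpd.inv (rY z')) := by
      have w3 : E.grpd.tgt (E.sm (D.principal.quo (D.lift z) (D.lift z')) (E.grpd.inv (rY z'))) =
          E.grpd.src (rY z') := by rw [tgt_sm, E.grpd.tgt_inv]
      refine right_cancel (by rw [tgt_m w2, w1]) w3 ?_
      rw [m_assoc w2 w1, ← h1, sm_m (E.grpd.tgt_inv _), LieGroupoid.inv_m,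
        m_sm (E.grpd.tgt_inv _), LieGroupoid.inv_m, ← E.tgt_π, ← E.tgt_π, hY, hY, tgt_δ, tgt_δ, e']
    change E.grpd.m (E.sm _ _) _ = _
    rw [sm_m w2, h2, sm_sm, D.principal.quo_mul_quo e e']
  have hK : ∀ p z, K p z = E.sm (D.principal.quo p (D.lift z)) (E.grpd.inv (rY z)) :=
    fun p z => rfl
  have smK : ∀ (T : Mfd) (u : T ⟶ D.tot) (u' : T ⟶ Y), (∀ t, D.proj (u t) = x.q (vY (u' t))) →
      Smooth fun t => K (u t) (u' t) := fun T u u' w =>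
    E.principal.smooth_sm (D.principal.quo_mem (smooth_coe u) (smooth_coe (u' ≫ D.lift)) w)
      (smooth_coe (u' ≫ rY ≫ E.grpd.inv))
  clear_value K
  have srcK : ∀ p z, E.grpd.src (K p z) = y.anchor (s (g (x.q (vY z)))) := fun p z => by
    rw [hK, src_sm, E.grpd.src_inv, ← E.tgt_π, hY, tgt_δ]
  have tgtK : ∀ p z, E.grpd.tgt (K p z) = x.Q.anchor (x.σ (vY z)) := fun p z => by
    rw [hK, tgt_sm, E.grpd.tgt_inv, ← E.src_π, hY, src_δ]
  have indep : ∀ p z z', D.proj p = x.q (vY z) → vY z = vY z' → K p z = K p z' := by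
    intro p z z' e e'
    rw [← K_c p z z' e (by rw [e']), ← e', c_self, m_one (tgtK p z)]
  -- The lift of `v'` to `Y` may be chosen without any regularity, because by `indep` the value of
  -- `K` depends on the lift only through `v'`.
  choose Z hZ using hvY.2
  obtain ⟨χ₀, h₁, h₂⟩ := LieTorsor.exists_lift (y.pullbackHom g) α (𝟙 _) (Category.id_comp g).symm
  have hb : ∀ b, LieTorsor.Hom.base χ₀ b = b := fun b => by rw [h₁]; rfl
  have inv_δ : ∀ (p : D.tot) v', D.proj p = x.q v' → X.inv (δ v') = x.Q.div
      (LieTorsor.Hom.total χ₀ ((ofBundle E y s hs D.bundle g).σ p)) (x.σ v') := by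
    intro p v' e
    have e1 : LieTorsor.Hom.total α
        (LieTorsor.Hom.total χ₀ ((ofBundle E y s hs D.bundle g).σ p)) = s (g (x.q v')) := by
      refine (congrArg (fun f => LieTorsor.Hom.total f _) h₂).trans ?_
      exact congrArg (fun b => s (g b)) e
    have e2 : x.Q.proj (LieTorsor.Hom.total χ₀ ((ofBundle E y s hs D.bundle g).σ p)) =
        x.Q.proj (x.σ v') := by
      rw [LieTorsor.Hom.proj_tot, hb]
      exact e
    rw [← LieTorsor.Hom.div_total α e2, e1, δ_apply]
    refine (eq_inv ?_ ?_).symm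
    · rw [tgt_div (hδ v'), src_div (hδ v').symm]
    · rw [m_div (hδ v') (hδ v').symm, LieTorsor.div_self, src_div (hδ v')]
  have hw : ∀ {p : D.tot} {v' : x.V}, LieTorsor.Hom.base χ₀ (D.proj p) = x.q v' →
      D.proj p = x.q v' := fun {p v'} w => (hb _).symm.trans w
  let χ : ofBundle E y s hs D.bundle g ⟶ x :=
    { φ := χ₀
      h := fun p v' _ => K p (Z v')
      π_h := fun p v' w => by
        rw [hK, π_sm, π_inv, hY, hZ]
        exact inv_δ p v' (hw w)
      c_h := fun p₁ p v' w w₁ e => by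
        have e' : D.proj p₁ = D.proj p := e
        have e1 : D.proj p = D.proj (D.lift (Z v')) := by rw [hproj, hZ]; exact hw w
        have e2 : E.grpd.src (E.grpd.inv (rY (Z v'))) = y.anchor (s (g (D.proj p₁))) := by
          rw [E.grpd.src_inv, ← E.tgt_π, hY, tgt_δ, e', e1, hproj]
        rw [hK, hK]
        refine (sm_m_sm (by rw [E.grpd.tgt_one]; exact e2.symm)).trans ?_
        rw [one_m e2, D.principal.quo_mul_quo e' e1]
      h_c := fun p v' v₁' w w₁ e => by
        have := K_c p (Z v') (Z v₁') (by rw [hZ]; exact hw w) (by rw [hZ, hZ]; exact e)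
        rw [hZ, hZ] at this
        exact this
      smooth_h := fun T u u' w => by
        refine Smooth.descend_one (isSurjSubmersion_pbSnd (g := u') hvY) ?_
        refine (congrArg Smooth (funext fun t => ?_)).mp (smK _ (pbSnd vY u' hvY.1 ≫ u)
          (pbFst vY u' hvY.1) fun t => (hw (w t.1.2)).trans (congrArg x.q t.2).symm)
        exact indep _ _ _ ((hw (w t.1.2)).trans (congrArg x.q t.2).symm) (t.2.trans (hZ _).symm) }
  refine ⟨D.bundle, g, χ, ?_, h₂⟩
  have : bs χ = 𝟙 _ := h₁
  rw [this]; infer_instance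

variable (E s hs) in
theorem trivialization_isEquivalence : (trivialization E y s hs).toFunctor.IsEquivalence where
  faithful :=
    { map_injective := fun {B B'} f f' h => by
        refine CommaMorphism.ext ?_ (Subsingleton.elim _ _)
        exact ofBundleMap_injective (congrArg (fun χ => χ.left) h) }
  full :=
    { map_surjective := fun {B B'} χ => by
        obtain ⟨f, w, h⟩ := exists_ofBundleMap χ.left (CostructuredArrow.w χ)
        exact ⟨CostructuredArrow.homMk f w, CommaMorphism.ext h (Subsingleton.elim _ _)⟩ }
  essSurj :=
    { mem_essImage := fun a => by
        obtain ⟨P, g, χ, h₁, h₂⟩ := exists_ofBundle_hom E s hs a.left a.hom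
        have : IsIso ((stk E).p.map χ) := h₁
        have hχ : IsIso χ := isFiberedInGroupoids.isIso_of_isIso_map (𝒳 := stk E) χ
        exact ⟨CostructuredArrow.mk (S := CircleBundle.toMfd) (Y := P) g,
          ⟨CostructuredArrow.isoMk (@asIso _ _ _ _ χ hχ) h₂⟩⟩ }

end LiftDatum

end

/-! ### The gerbe of an extension, and its association with the extension -/

noncomputable section

open TopologicalSpace Topology LieGroupoid LieTorsor CentralExtension

namespace CentralExtension

open LiftDatum

variable {M : Mfd} {X : LieGroupoid M} (E : CentralExtension X)

/-- The gerbe of liftings of torsors to a central extension. -/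
abbrev circleGerbe : CircleGerbe (LieTorsor.stack X) where
  stk := stk E
  map := toTorsors E
  isStack := LiftDatum.isStack
  epi := LiftDatum.epi
  diagonal_epi := LiftDatum.diagonal_epi
  locally_trivial x := ⟨x.pullback x.proj, x.pullbackHom x.proj, x.proj_surjSubmersion,
    trivialization E (x.pullback x.proj) (diagSection x) (proj_diagSection x),
    trivialization_isEquivalence E (y := LieTorsor.pullback x x.proj) (diagSection x)
      (proj_diagSection x)⟩
  band := LiftDatum.band
  band_injective r l l' h := r.gauge_injective (congrArg (fun α : Aut r => α.hom) h)
  mem_range_band r α := by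
    constructor
    · rintro ⟨l, rfl⟩; rfl
    · intro h
      obtain ⟨l, hl⟩ := exists_gauge α.hom h
      exact ⟨l, Iso.ext hl⟩
  band_natural {r r'} ρ l := by
    refine LiftDatum.hom_ext ((Category.comp_id _).trans (Category.id_comp _).symm)
      fun v v' w w' => ?_
    have w₀ : bs ρ (LiftDatum.q r v) = LiftDatum.q r' v' := w
    refine (comp_gauge_h ρ l w w₀).trans (Eq.trans ?_ (gauge_comp_h ρ _ w' w₀).symm)
    rw [← w₀]; rfl

/-- The gerbe of liftings of torsors to a central extension, with its trivialization. -/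
abbrev gerbe : TrivializedGerbe X where
  toCircleGerbe := circleGerbe E
  triv := trivialization E X.universalTorsor X.one X.src_one
  triv_equivalence := trivialization_isEquivalence E _ _
  triv_band B l := by
    refine LiftDatum.hom_ext (LieTorsor.hom_ext rfl rfl) fun p p' w w' => ?_
    refine Eq.trans ?_ (sm_sm _ _ _).symm
    have w₀ : B.left.proj p = B.left.proj p' := w
    exact congrArg (fun a => E.sm a _) (B.left.principal.quo_smul_left w₀)

/-- The trivial circle bundle over the manifold of objects. -/
abbrev trivialBundle (M : Mfd) : CostructuredArrow CircleBundle.toMfd M :=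
  CostructuredArrow.mk (Y := (CircleCocycle.trivial M).bundle) (𝟙 M)

/-- The trivial lifting over the manifold of objects. -/
abbrev point : LiftDatum E :=
  ofBundle E X.universalTorsor X.one X.src_one (CircleCocycle.trivial M).bundle (𝟙 M)

/-- The section of the trivial bundle. -/
abbrev sec (M : Mfd) : M ⟶ (CircleCocycle.trivial M).tot := (CircleCocycle.trivial M).lift

variable {E} {z : LiftDatum E}

/-- The value of an arrow to the trivial lifting at the unit section. -/
abbrev val (a : z ⟶ E.point) (v : z.V) : E.grpd.arr := Hom.h a v (sec M (bs a (z.q v))) rfl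

theorem src_val (a : z ⟶ E.point) (v : z.V) : E.grpd.src (val a v) = z.Q.anchor (z.σ v) :=
  src_h_eq _ _

theorem tgt_val (a : z ⟶ E.point) (v : z.V) : E.grpd.tgt (val a v) = bs a (z.q v) :=
  (tgt_h_eq _ _).trans (X.tgt_one _)

theorem c_val (a : z ⟶ E.point) {v v' : z.V} (e : z.q v = z.q v') :
    E.grpd.m (z.c v v') (val a v') = val a v := by
  have key : ∀ b (hb : bs a (z.q v') = b) (w), Hom.h a v' (sec M b) w = val a v' := by
    rintro _ rfl _; rfl
  rw [← key (bs a (z.q v)) (by rw [e]) (by rw [e]; rfl)]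
  exact Hom.c_h a v v' _ _ rfl e

theorem comp_val {z' : LiftDatum E} (c : z' ⟶ z) (a : z ⟶ E.point) {v' : z'.V} {v : z.V}
    (w : bs c (z'.q v') = z.q v) :
    val (c ≫ a) v' = E.grpd.m (Hom.h c v' v w) (val a v) := by
  have w' : bs (c ≫ a) (z'.q v') = bs a (z.q v) := by rw [← w]; rfl
  have key : ∀ b (hb : bs (c ≫ a) (z'.q v') = b) (w₁),
      Hom.h (c ≫ a) v' (sec M b) w₁ = val (c ≫ a) v' := by
    rintro _ rfl _; rfl
  rw [← key _ w' w']
  exact comp_h c a v w' w rfl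

/-- A point of the universal torsor is an arrow of `X`, and the arrow that carries it to the unit at
its source is its inverse. -/
theorem π_val (a : z ⟶ E.point) (v : z.V) :
    E.π (val a v) = X.inv (tt a (z.σ v)).1.1 := by
  have e : (tt a (z.σ v)).1.2 = bs a (z.q v) := LieTorsor.Hom.proj_tot (Hom.φ a) _
  have e' : X.src (tt a (z.σ v)).1.1 = bs a (z.q v) := (tt a (z.σ v)).2.trans e
  refine (Hom.π_h a v _ rfl).trans (LieTorsor.eq_div ?_ ?_).symm
  · exact (X.src_inv _).symm
  · refine Subtype.ext ((LieTorsor.pullback_a _ _ _ _).trans (Prod.ext ?_ e))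
    have : X.universalTorsor.a (tt a (z.σ v)).1.1 (X.inv (tt a (z.σ v)).1.1) =
      X.m (tt a (z.σ v)).1.1 (X.inv (tt a (z.σ v)).1.1) := rfl
    refine this.trans ?_
    rw [LieGroupoid.m_inv]
    exact congrArg X.one e'

theorem smooth_val (a : z ⟶ E.point) : Smooth fun v => val a v :=
  Hom.smooth_h a z.V (𝟙 _) (z.qHom ≫ bs a ≫ sec M) fun _ => rfl

theorem tgt_inv_val (a b : z ⟶ E.point) (v : z.V) :
    E.grpd.tgt (E.grpd.inv (val a v)) = E.grpd.src (val b v) := by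
  rw [E.grpd.tgt_inv, src_val, src_val]

/-- The difference of two arrows to the trivial lifting. -/
abbrev diff (a b : z ⟶ E.point) (x : z.Q.base) : E.grpd.arr :=
  E.grpd.m (E.grpd.inv (val a (z.exists_q x).choose)) (val b (z.exists_q x).choose)

/-- A change of `v` multiplies both values on the left by the same element of the cocycle, which
cancels; so the difference is a function on the base. -/
theorem diff_q (a b : z ⟶ E.point) (v : z.V) :
    diff a b (z.q v) = E.grpd.m (E.grpd.inv (val a v)) (val b v) := by
  have e : z.q v = z.q (z.exists_q (z.q v)).choose := (z.exists_q (z.q v)).choose_spec.symm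
  rw [← c_val a e, ← c_val b e, inv_m_m_m]
  · rw [z.tgt_c e, src_val]
  · rw [z.tgt_c e, src_val]

theorem smooth_diff (a b : z ⟶ E.point) : Smooth (diff a b) := by
  refine Smooth.descend_one z.surj ?_
  refine (congrArg Smooth (funext fun v => ?_)).mp
    (smooth_m (smooth_inv (smooth_val a)) (smooth_val b) (tgt_inv_val a b))
  exact (diff_q a b v).symm

theorem src_diff (a b : z ⟶ E.point) (x) : E.grpd.src (diff a b x) = bs a x := by
  obtain ⟨v, rfl⟩ := z.exists_q x
  rw [diff_q, src_m (tgt_inv_val a b v), E.grpd.src_inv, tgt_val]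

theorem tgt_diff (a b : z ⟶ E.point) (x) : E.grpd.tgt (diff a b x) = bs b x := by
  obtain ⟨v, rfl⟩ := z.exists_q x
  rw [diff_q, tgt_m (tgt_inv_val a b v), tgt_val]

theorem val_diff (a b : z ⟶ E.point) (v : z.V) :
    E.grpd.m (val a v) (diff a b (z.q v)) = val b v := by
  rw [diff_q, m_inv_m (by rw [src_val, src_val])]

theorem diff_comp {z' : LiftDatum E} (c : z' ⟶ z) (a b : z ⟶ E.point) (x) :
    diff (c ≫ a) (c ≫ b) x = diff a b (bs c x) := by
  obtain ⟨v', rfl⟩ := z'.exists_q x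
  obtain ⟨v, hv⟩ := z.exists_q (bs c (z'.q v'))
  rw [diff_q, ← hv, diff_q, comp_val c a hv.symm, comp_val c b hv.symm, inv_m_m_m]
  · rw [tgt_h_eq, src_val]
  · rw [tgt_h_eq, src_val]

theorem diff_m_diff (a b c : z ⟶ E.point) (x) :
    E.grpd.m (diff a b x) (diff b c x) = diff a c x := by
  obtain ⟨v, rfl⟩ := z.exists_q x
  have w : E.grpd.tgt (diff a b (z.q v)) = E.grpd.src (diff b c (z.q v)) := by
    rw [tgt_diff, src_diff]
  refine left_cancel (g := val a v) ?_ ?_ ?_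
  · rw [src_m w, tgt_val, src_diff]
  · rw [tgt_val, src_diff]
  · rw [← m_assoc _ w, val_diff, val_diff, val_diff]
    rw [tgt_val, src_diff]

theorem π_diff (a b : z ⟶ E.point) (q : z.Q.total) :
    X.m (E.π (diff a b (z.Q.proj q))) (tt b q).1.1 = (tt a q).1.1 := by
  obtain ⟨v, hv⟩ := z.exists_q (z.Q.proj q)
  have key : ∀ f : z ⟶ E.point, (tt f q).1.1 =
      X.m (tt f (z.σ v)).1.1 (z.Q.div (z.σ v) q) := fun f => by
    have h1 := LieTorsor.Hom.total_a (Hom.φ f) (z.σ v) (z.Q.div (z.σ v) q)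
    rw [a_div hv] at h1
    exact congrArg (fun t => t.1.1) h1 |>.trans (congrArg Prod.fst (LieTorsor.pullback_a _ _ _ _))
  have htgt : ∀ f : z ⟶ E.point, X.tgt (tt f (z.σ v)).1.1 = z.Q.anchor (z.σ v) := fun f =>
    LieTorsor.Hom.anchor_tot (Hom.φ f) (z.σ v)
  have w₁ : X.tgt (tt a (z.σ v)).1.1 = X.src (X.inv (tt b (z.σ v)).1.1) := by
    rw [X.src_inv, htgt, htgt]
  have w₂ : X.tgt (tt b (z.σ v)).1.1 = X.src (z.Q.div (z.σ v) q) := by rw [htgt, src_div hv]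
  rw [← hv, diff_q, π_m (tgt_inv_val a b v), π_inv, π_val, π_val, LieGroupoid.inv_inv, key b, key a,
    m_assoc w₁ (by rw [X.tgt_inv, src_m w₂]), inv_m_m w₂]

theorem src_tt (a : z ⟶ E.point) (q : z.Q.total) : X.src (tt a q).1.1 = bs a (z.Q.proj q) :=
  (tt a q).2.trans (LieTorsor.Hom.proj_tot (Hom.φ a) q)

theorem tgt_tt (a : z ⟶ E.point) (q : z.Q.total) : X.tgt (tt a q).1.1 = z.Q.anchor q :=
  LieTorsor.Hom.anchor_tot (Hom.φ a) q

/-- The arrow `b` is prescribed by `val b = val a · g` on the unit section and extended to the whole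
trivial bundle by rotation. Its torsor map multiplies that of `a` on the left by the inverse of the
projection of `g`. -/
theorem exists_diff (a : z ⟶ E.point) (g : z.Q.base ⟶ E.grpd.arr)
    (hg : ∀ x, E.grpd.src (g x) = bs a x) : ∃ b : z ⟶ E.point, ∀ x, diff a b x = g x := by
  have w₁ : ∀ q, X.tgt (X.inv (E.π (g (z.Q.proj q)))) = X.src (tt a q).1.1 := fun q => by
    rw [X.tgt_inv, E.src_π, hg, src_tt]
  let t : z.Q.total ⟶ X.arr := homMk (fun q => X.m (X.inv (E.π (g (z.Q.proj q)))) (tt a q).1.1)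
    (smooth_m (smooth_coe (z.Q.proj ≫ g ≫ E.π ≫ X.inv))
      (smooth_coe (tt a ≫ LieTorsor.Hom.total (X.universalTorsor.pullbackHom (𝟙 M)))) w₁)
  have ht : ∀ q, t q = X.m (X.inv (E.π (g (z.Q.proj q)))) (tt a q).1.1 := fun q => rfl
  clear_value t
  have src_t : ∀ q, X.src (t q) = E.grpd.tgt (g (z.Q.proj q)) := fun q => by
    rw [ht, src_m (w₁ q), X.src_inv, E.tgt_π]
  have tgt_t : ∀ q, X.tgt (t q) = z.Q.anchor q := fun q => by
    rw [ht, tgt_m (w₁ q), tgt_tt]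
  let φ : z.Q ⟶ E.point.Q :=
    { base := g ≫ E.grpd.tgt
      total := pbLift X.universalTorsor.proj_surjSubmersion.1 t (z.Q.proj ≫ g ≫ E.grpd.tgt) src_t
      proj_total := fun q => rfl
      anchor_total := tgt_t
      total_act := fun q γ w => by
        refine Subtype.ext (Prod.ext ?_ ?_)
        · change t (z.Q.act q γ w) = X.m (t q) γ
          have h1 := LieTorsor.Hom.total_a (Hom.φ a) q γ
          have h2 : (tt a (z.Q.a q γ)).1.1 = X.m (tt a q).1.1 γ :=
            (congrArg (fun t => t.1.1) h1).trans
              (congrArg Prod.fst (LieTorsor.pullback_a _ _ _ _))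
          rw [← LieTorsor.a_eq w, ht, h2, proj_a, ht,
            m_assoc (w₁ q) (by rw [tgt_tt]; exact w)]
        · change E.grpd.tgt (g (z.Q.proj (z.Q.act q γ w))) = E.grpd.tgt (g (z.Q.proj q))
          rw [z.Q.proj_act] }
  have w₂ : ∀ v, E.grpd.tgt (val a v) = E.grpd.src (g (z.q v)) := fun v => by rw [tgt_val, hg]
  have sec_w : ∀ (x : z.Q.base) (p : (CircleCocycle.trivial M).tot),
      E.grpd.tgt (g x) = (CircleCocycle.trivial M).proj p →
      (CircleCocycle.trivial M).proj (sec M (E.grpd.tgt (g x))) = (CircleCocycle.trivial M).proj p :=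
    fun x p w => w
  let b : z ⟶ E.point :=
    { φ := φ
      h := fun v p _ => E.sm ((CircleCocycle.trivial M).principal.quo
        (sec M (E.grpd.tgt (g (z.q v)))) p) (E.grpd.m (val a v) (g (z.q v)))
      π_h := fun v p w => by
        have w' : E.grpd.tgt (g (z.q v)) = (CircleCocycle.trivial M).proj p := w
        have w₃ : X.tgt (t (z.σ v)) = X.src (X.m (X.inv (tt a (z.σ v)).1.1) (E.π (g (z.q v)))) := by
          rw [tgt_t, src_m (by rw [X.tgt_inv, E.src_π, hg, src_tt]), X.src_inv, tgt_tt]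
        rw [π_sm, π_m (w₂ v), π_val]
        refine LieTorsor.eq_div w₃ ?_
        refine Subtype.ext ((LieTorsor.pullback_a _ _ _ _).trans (Prod.ext ?_ w'))
        change X.m (t (z.σ v)) _ = X.one ((CircleCocycle.trivial M).proj p)
        have k : X.m (X.inv (tt a (z.σ v)).1.1) (E.π (g (z.q v))) = X.inv (t (z.σ v)) := by
          rw [ht, inv_m_rev (w₁ (z.σ v)), LieGroupoid.inv_inv]
        rw [k, LieGroupoid.m_inv, src_t, w']
      c_h := fun v₁ v p w w₁ e => by
        refine (m_sm ?_).trans ?_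
        · rw [z.tgt_c e, src_m (w₂ v), src_val]
        · rw [← m_assoc (by rw [z.tgt_c e, src_val]) (w₂ v), c_val a e, e]
      h_c := fun v p p₁ w w₁ e => by
        have e' : (CircleCocycle.trivial M).proj p = (CircleCocycle.trivial M).proj p₁ := e
        have w' : E.grpd.tgt (g (z.q v)) = (CircleCocycle.trivial M).proj p := w
        have k : E.grpd.tgt (E.grpd.m (val a v) (g (z.q v))) =
            X.tgt (X.one ((CircleCocycle.trivial M).proj p)) := by
          rw [tgt_m (w₂ v), X.tgt_one, w']
        refine (m_sm_one ?_).trans ((sm_sm _ _ _).trans ?_)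
        · rw [tgt_sm]; exact k
        · rw [mul_comm, PrincipalCircle.quo_mul_quo _ (sec_w _ _ w') e']
      smooth_h := fun T u u' w => by
        refine E.principal.smooth_sm ((CircleCocycle.trivial M).principal.quo_mem
          (smooth_coe (u ≫ z.qHom ≫ g ≫ E.grpd.tgt ≫ sec M)) (smooth_coe u') fun x => w x)
          (smooth_m ((smooth_val a).comp (smooth_coe u)) (smooth_coe (u ≫ z.qHom ≫ g))
            fun x => w₂ _) }
  refine ⟨b, fun x => ?_⟩
  obtain ⟨v, rfl⟩ := z.exists_q x
  have : val b v = E.grpd.m (val a v) (g (z.q v)) := by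
    refine Eq.trans (congrArg (fun l => E.sm l _) ?_) (one_sm _)
    exact PrincipalCircle.quo_self _ _
  rw [diff_q, this, inv_m_m (w₂ v)]

/-- The difference determines the map of bases as its target, the torsor map through `π_diff`, and
the values on the unit section through `val_diff`; the other values follow from the cocycle of the
trivial bundle. -/
theorem eq_of_diff_eq {a b b' : z ⟶ E.point} (h : ∀ x, diff a b x = diff a b' x) : b = b' := by
  have hb : ∀ x, bs b x = bs b' x := fun x => by rw [← tgt_diff a b, h, tgt_diff]
  have hq : ∀ q, X.tgt (E.π (diff a b (z.Q.proj q))) = X.src (tt b q).1.1 := fun q => by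
    rw [E.tgt_π, tgt_diff, src_tt]
  refine LiftDatum.hom_ext (LieTorsor.hom_ext (Mfd.hom_ext hb) (Mfd.hom_ext fun q => ?_))
    fun v p w w' => ?_
  · refine Subtype.ext (Prod.ext ?_ ?_)
    · refine left_cancel (hq q) ?_ ((π_diff a b q).trans ?_)
      · rw [E.tgt_π, tgt_diff, hb, ← src_tt]
      · rw [h]; exact (π_diff a b' q).symm
    · exact ((LieTorsor.Hom.proj_tot (Hom.φ b) q).trans (hb _)).trans
        (LieTorsor.Hom.proj_tot (Hom.φ b') q).symm
  · have hv : val b v = val b' v := by rw [← val_diff a b, h, val_diff]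
    have e : E.point.q (sec M (bs b (z.q v))) = E.point.q p := w
    have e' : E.point.q (sec M (bs b' (z.q v))) = E.point.q p := w'
    refine (Hom.h_c b v _ p rfl w e).symm.trans (Eq.trans ?_ (Hom.h_c b' v _ p rfl w' e'))
    exact congrArg₂ E.grpd.m hv (congrArg (fun x => E.point.c (sec M x) p) (hb _))

/-- The gauge multiplies the value of `a` by the inverse of `l`, and this value enters the
difference inverted. -/
theorem gauge_diff (a b : z ⟶ E.point) (l : smoothCircle z.Q.base) (x) :
    diff (z.gauge l ≫ a) b x = E.sm (l.1 x) (diff a b x) := by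
  obtain ⟨v, rfl⟩ := z.exists_q x
  have : val (z.gauge l ≫ a) v = E.sm (l.1 (z.q v))⁻¹ (val a v) := gauge_comp_h a l _ _
  rw [diff_q, diff_q, this, inv_sm, _root_.inv_inv, sm_m (tgt_inv_val a b v)]

variable (E) in
/-- The gerbe of liftings gives back the central extension. -/
def association : Association E E.gerbe where
  B := trivialBundle M
  isIso_B := inferInstanceAs (IsIso (𝟙 M))
  sec := sec M
  sec_proj := rfl
  Ψ {z} a b := homMk (diff (z := z) a b) (smooth_diff a b)
  src_Ψ {z} a b := Mfd.hom_ext (src_diff (z := z) a b)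
  tgt_Ψ {z} a b := Mfd.hom_ext (tgt_diff (z := z) a b)
  natural {z z'} c a b := Mfd.hom_ext (diff_comp (z := z) (z' := z') c a b)
  bijective {z} a g hg := by
    obtain ⟨b, hb⟩ := exists_diff (z := z) a g fun x =>
      congrArg (fun f : (LiftDatum.Q z).base ⟶ M => f x) hg
    refine ⟨b, Mfd.hom_ext hb, fun b' hb' => ?_⟩
    refine eq_of_diff_eq (a := a) fun x => ?_
    rw [hb, ← hb']; rfl
  mul_Ψ {z} a b c x := ⟨by
      rw [homMk_apply, homMk_apply]
      exact (tgt_diff (z := z) a b x).trans (src_diff (z := z) b c x).symm,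
    (m_eq _).symm.trans (diff_m_diff (z := z) a b c x)⟩
  π_Ψ {z} a b q := ⟨(E.tgt_π _).trans
      ((tgt_diff (z := z) a b _).trans (src_tt (z := z) b q).symm),
    (m_eq _).symm.trans (π_diff (z := z) a b q)⟩
  smul_Ψ {z} a b l x := gauge_diff (z := z) a b l x

end CentralExtension

end

noncomputable section

open TopologicalSpace Topology LieGroupoid LieTorsor CentralExtension

/-! ### Gerbes lying strictly over their torsors -/

namespace LieTorsor

variable {M : Mfd} {X : LieGroupoid M} {C : Type 1} [Category.{0} C] (F : C ⥤ LieTorsor X)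

/-- A category of objects with underlying torsors, as a category over manifolds. -/
abbrev total.stk : BasedCategory.{0, 1} Mfd where
  obj := C
  p := F ⋙ (stack X).p

/-- The functor to torsors, as a based functor. -/
abbrev total.map : total.stk F ⥤ᵇ stack X := ⟨F, rfl⟩

end LieTorsor

/-- A trivialized gerbe whose objects lie over the base of their torsor by definition. -/
structure StrictGerbe {M : Mfd} (X : LieGroupoid M) where
  C : Type 1
  [cat : Category.{0} C]
  F : C ⥤ LieTorsor X
  isStack : IsStack (total.stk F)
  epi : IsEpimorphism (total.map F)
  diagonal_epi : IsEpimorphism (diagonal (total.map F))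
  locally_trivial : ∀ x : LieTorsor X, ∃ (y : LieTorsor X) (φ : y ⟶ x),
    IsSurjSubmersion (Hom.base φ) ∧
      ∃ Θ : circleTimes y.base ⥤ᵇ restriction (total.map F) y, Θ.toFunctor.IsEquivalence
  band : ∀ r : C, smoothCircle (F.obj r).base →* Aut r
  band_injective : ∀ r, Function.Injective (band r)
  mem_range_band : ∀ (r : C) (α : Aut r), α ∈ (band r).range ↔ F.map α.hom = 𝟙 (F.obj r)
  band_natural : ∀ {r r' : C} (ρ : r ⟶ r') (l : smoothCircle (F.obj r').base),
    ρ ≫ (band r' l).hom = (band r (smoothCircle.pullback (Hom.base (F.map ρ)) l)).hom ≫ ρ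
  triv : circleTimes M ⥤ᵇ restriction (total.map F) X.universalTorsor
  triv_equivalence : triv.toFunctor.IsEquivalence
  triv_band : ∀ (B : CostructuredArrow CircleBundle.toMfd M) (l : smoothCircle B.left.base),
    (triv.map (circleTimes.gauge B l)).left =
      (band (triv.obj B).left (smoothCircle.pullback
        (eqToHom (restriction_base_eq (F := total.map F) (x := X.universalTorsor) triv B)) l)).hom

attribute [instance] StrictGerbe.cat

/-- The trivialized gerbe of a strict one. -/
abbrev StrictGerbe.toGerbe {M : Mfd} {X : LieGroupoid M} (S : StrictGerbe X) :
    TrivializedGerbe X where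
  stk := total.stk S.F
  map := total.map S.F
  isStack := S.isStack
  epi := S.epi
  diagonal_epi := S.diagonal_epi
  locally_trivial := S.locally_trivial
  band := S.band
  band_injective := S.band_injective
  mem_range_band := S.mem_range_band
  band_natural := S.band_natural
  triv := S.triv
  triv_equivalence := S.triv_equivalence
  triv_band := S.triv_band

/-- The condition that the morphism to torsors lies over manifolds is an equality of functors, so
the projection to manifolds can be replaced by the base of the torsor. Bases of objects and bases of
their torsors then coincide by definition. -/
theorem TrivializedGerbe.exists_strict {M : Mfd} {X : LieGroupoid M} (G : TrivializedGerbe X) :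
    ∃ S : StrictGerbe X, S.toGerbe = G := by
  obtain ⟨⟨⟨C, cat, p⟩, ⟨F, w⟩, h1, h2, h3, h4, band, h5, h6, h7⟩, triv, h8, h9⟩ := G
  change C ⥤ LieTorsor X at F
  change F ⋙ (stack X).p = p at w
  subst w
  exact ⟨⟨C, F, h1, h2, h3, h4, band, h5, h6, h7, triv, h8, h9⟩, rfl⟩

/-- The gerbe of liftings lies strictly over its torsors. -/
abbrev CentralExtension.strict {M : Mfd} {X : LieGroupoid M} (E : CentralExtension X) :
    StrictGerbe X where
  C := LiftDatum E
  F := (LiftDatum.toTorsors E).toFunctor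
  isStack := E.gerbe.isStack
  epi := E.gerbe.epi
  diagonal_epi := E.gerbe.diagonal_epi
  locally_trivial := E.gerbe.locally_trivial
  band := E.gerbe.band
  band_injective := E.gerbe.band_injective
  mem_range_band := E.gerbe.mem_range_band
  band_natural := E.gerbe.band_natural
  triv := E.gerbe.triv
  triv_equivalence := E.gerbe.triv_equivalence
  triv_band := E.gerbe.triv_band

theorem Mfd.iso_inv_hom {A B : Mfd} (e : A ≅ B) (x : A) : e.inv (e.hom x) = x :=
  ConcreteCategory.congr_hom e.hom_inv_id x

theorem Mfd.iso_hom_inv {A B : Mfd} (e : A ≅ B) (x : B) : e.hom (e.inv x) = x :=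
  ConcreteCategory.congr_hom e.inv_hom_id x

theorem IsFiberedInGroupoids.exists_restrict {𝒳 : BasedCategory.{0, 1} Mfd}
    (h𝒳 : IsFiberedInGroupoids 𝒳) (x : 𝒳.obj) {V : Mfd} (f : V ⟶ 𝒳.p.obj x) :
    ∃ (y : 𝒳.obj) (φ : y ⟶ x) (e : 𝒳.p.obj y ≅ V), 𝒳.p.map φ = e.hom ≫ f := by
  obtain ⟨y, φ, h⟩ := h𝒳.exists_pullback x V f
  obtain rfl := IsHomLift.domain_eq 𝒳.p f φ
  exact ⟨y, φ, Iso.refl _, ((isHomLift_iff 𝒳.p _ _).1 h).trans (Category.id_comp _).symm⟩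

theorem LieTorsor.isIso_of_isIso_base {M : Mfd} {Γ : LieGroupoid M} {P Q : LieTorsor Γ} (φ : P ⟶ Q)
    (h : IsIso (Hom.base φ)) : IsIso φ := by
  obtain ⟨χ, h1, h2⟩ := LieTorsor.exists_lift (𝟙 Q) φ (inv (Hom.base φ)) (IsIso.inv_hom_id _).symm
  refine ⟨χ, LieTorsor.lift_unique φ ?_ ?_, h2⟩
  · rw [LieTorsor.comp_base, h1, IsIso.hom_inv_id]; rfl
  · rw [Category.assoc, h2, Category.comp_id, Category.id_comp]

/-! ### Arrows of a strict gerbe: differences by the band, local existence, gluing -/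

namespace StrictGerbe

variable {M : Mfd} {X : LieGroupoid M} (S : StrictGerbe X)

variable {S}

/-- The map of bases below an arrow. -/
abbrev bs {z z' : S.C} (f : z ⟶ z') : (S.F.obj z).base ⟶ (S.F.obj z').base := Hom.base (S.F.map f)

theorem comp_bs {z z' z'' : S.C} (f : z ⟶ z') (g : z' ⟶ z'') (x) :
    bs (f ≫ g) x = bs g (bs f x) := by
  rw [bs, S.F.map_comp]; rfl

theorem comp_total {z z' z'' : S.C} (f : z ⟶ z') (g : z' ⟶ z'') (x) :
    Hom.total (S.F.map (f ≫ g)) x = Hom.total (S.F.map g) (Hom.total (S.F.map f) x) := by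
  rw [S.F.map_comp]; rfl

theorem exists_restrict (z : S.C) {V : Mfd} (f : V ⟶ (S.F.obj z).base) :
    ∃ (y : S.C) (φ : y ⟶ z) (e : (S.F.obj y).base ≅ V), bs φ = e.hom ≫ f :=
  S.isStack.toIsFiberedInGroupoids.exists_restrict (𝒳 := total.stk S.F) z f

theorem exists_lift {x y z : S.C} (ψ : y ⟶ z) (φ : x ⟶ z) (g : (S.F.obj y).base ⟶ (S.F.obj x).base)
    (hg : bs ψ = g ≫ bs φ) : ∃ χ : y ⟶ x, bs χ = g ∧ χ ≫ φ = ψ :=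
  S.isStack.toIsFiberedInGroupoids.exists_lift (𝒳 := total.stk S.F) ψ φ g hg

theorem lift_unique {x y z : S.C} {χ χ' : y ⟶ x} (φ : x ⟶ z) (hb : bs χ = bs χ')
    (h : χ ≫ φ = χ' ≫ φ) : χ = χ' :=
  S.isStack.toIsFiberedInGroupoids.lift_unique (𝒳 := total.stk S.F) φ hb h

theorem isIso_of_isIso_bs {x y : S.C} (φ : x ⟶ y) (h : IsIso (bs φ)) : IsIso φ :=
  have : IsIso ((total.stk S.F).p.map φ) := h
  S.isStack.toIsFiberedInGroupoids.isIso_of_isIso_map (𝒳 := total.stk S.F) φ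

/-- The automorphism given by the band. -/
abbrev gauge (z : S.C) (l : smoothCircle (S.F.obj z).base) : z ⟶ z := (S.band z l).hom

theorem F_gauge (z : S.C) (l : smoothCircle (S.F.obj z).base) : S.F.map (gauge z l) = 𝟙 _ :=
  (S.mem_range_band z _).1 ⟨l, rfl⟩

/-- Arrows with the same underlying map of torsors differ by the band. -/
theorem exists_gauge {z z' : S.C} (f g : z ⟶ z') (h : S.F.map f = S.F.map g) :
    ∃ l, gauge z l ≫ f = g := by
  obtain ⟨χ, hχ, hχ'⟩ := exists_lift g f (𝟙 _) (by rw [Category.id_comp, bs, bs, h])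
  have hF : S.F.map χ = 𝟙 _ := by
    refine LieTorsor.lift_unique (S.F.map f) hχ ?_
    rw [← S.F.map_comp, hχ', ← h]
    exact (Category.id_comp _).symm
  have : IsIso χ := isIso_of_isIso_bs χ (by rw [hχ]; infer_instance)
  obtain ⟨l, hl⟩ := (S.mem_range_band z (asIso χ)).2 hF
  exact ⟨l, by rw [gauge, hl]; exact hχ'⟩

theorem gauge_one (z : S.C) : gauge z 1 = 𝟙 z := congrArg (fun α : Aut z => α.hom) (S.band z).map_one

theorem gauge_cancel {z z' : S.C} {f : z ⟶ z'} {l l' : smoothCircle (S.F.obj z).base}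
    (h : gauge z l ≫ f = gauge z l' ≫ f) : l = l' := by
  refine S.band_injective z (Iso.ext (lift_unique f ?_ h))
  rw [bs, bs]
  exact congrArg Hom.base ((F_gauge z l).trans (F_gauge z l').symm)

/-- Arrows which agree on a covering are equal. -/
theorem eq_of_cover {ι : Type} {z z' : S.C} (w : ι → S.C) (k : ∀ i, w i ⟶ z)
    (hk : ∀ x, ∃ i y, bs (k i) y = x) {f g : z ⟶ z'} (h : ∀ i, k i ≫ f = k i ≫ g) : f = g := by
  have hF : S.F.map f = S.F.map g := by
    have h' (i) : S.F.map (k i) ≫ S.F.map f = S.F.map (k i) ≫ S.F.map g := by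
      rw [← S.F.map_comp, ← S.F.map_comp, h]
    refine LieTorsor.hom_ext (Mfd.hom_ext fun x => ?_) (Mfd.hom_ext fun q => ?_)
    · obtain ⟨i, y, rfl⟩ := hk x
      exact congrArg (fun φ : S.F.obj (w i) ⟶ S.F.obj z' => Hom.base φ y) (h' i)
    · obtain ⟨i, y, hy⟩ := hk ((S.F.obj z).proj q)
      obtain ⟨q', -, rfl⟩ := Hom.exists_fib (S.F.map (k i)) y q hy.symm
      exact congrArg (fun φ : S.F.obj (w i) ⟶ S.F.obj z' => Hom.total φ q') (h' i)
  obtain ⟨l, hl⟩ := exists_gauge f g hF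
  have : l = 1 := by
    refine Subtype.ext (funext fun x => ?_)
    obtain ⟨i, y, rfl⟩ := hk x
    have h1 : smoothCircle.pullback (bs (k i)) l = 1 := by
      refine gauge_cancel (z := w i) (f := k i ≫ f) ?_
      rw [gauge_one, Category.id_comp, ← Category.assoc]
      refine Eq.trans (congrArg (· ≫ f) (S.band_natural (k i) l).symm) ?_
      rw [Category.assoc]
      exact (congrArg (k i ≫ ·) hl).trans (h i).symm
    exact congrArg (fun l : smoothCircle _ => l.1 y) h1
  rw [this, gauge_one, Category.id_comp] at hl
  exact hl

/-- Objects related by a map of torsors are locally isomorphic. -/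
theorem exists_common_cover {z z' : S.C} (φ : S.F.obj z ⟶ S.F.obj z') :
    ∃ (t : S.C) (k : t ⟶ z) (k' : t ⟶ z'), IsSurjSubmersion (bs k) ∧
      S.F.map k ≫ φ = S.F.map k' := by
  -- After `z'` is pulled back along the base of `φ`, the map `φ` factors through an isomorphism `γ`
  -- of torsors over an identity. The triple of `z`, `z₁` and `γ` is an object of the fibered
  -- product to which the epimorphism property of the diagonal applies.
  obtain ⟨z₁, m, hm⟩ := S.isStack.exists_pullback z' (S.F.obj z).base (Hom.base φ)
  have hd : (S.F.obj z₁).base = (S.F.obj z).base := IsHomLift.domain_eq (total.stk S.F).p (Hom.base φ) m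
  have hm' : Hom.base φ = eqToHom hd.symm ≫ bs m := by
    have := IsHomLift.fac (total.stk S.F).p (Hom.base φ) m
    exact this.trans (congrArg (eqToHom hd.symm ≫ ·) (Category.comp_id _))
  obtain ⟨γ, hγ, hγ'⟩ := LieTorsor.exists_lift φ (S.F.map m) (eqToHom hd.symm) hm'
  have hiso : IsIso γ := LieTorsor.isIso_of_isIso_base γ (by rw [hγ]; infer_instance)
  have hl : (LieTorsor.stack X).p.IsHomLift (𝟙 (S.F.obj z).base) γ := by
    refine IsHomLift.of_fac (LieTorsor.stack X).p _ _ rfl hd ?_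
    refine Eq.trans ?_ (Category.id_comp _).symm
    refine Eq.trans ?_ (congrArg (· ≫ eqToHom hd) hγ.symm)
    exact (eqToHom_trans hd.symm hd).symm
  obtain ⟨x, χ, hχ⟩ := S.diagonal_epi ⟨⟨z, z₁, γ⟩, hiso, hl⟩
  let x : S.C := x
  let u : x ⟶ z := χ.hom.left
  let u' : x ⟶ z₁ := χ.hom.right
  have hw : S.F.map u ≫ γ = 𝟙 _ ≫ S.F.map u' := χ.hom.w
  refine ⟨x, u, u' ≫ m, hχ, ?_⟩
  rw [Category.id_comp] at hw
  rw [S.F.map_comp, ← hγ', ← Category.assoc, hw]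

/-- Arrows given on a covering by submersions glue. -/
theorem exists_glueHom {ι : Type} {z z' : S.C} (w : ι → S.C) (k : ∀ i, w i ⟶ z)
    (φ : ∀ i, w i ⟶ z') (hk : ∀ i, IsSubmersion (bs (k i))) (hsurj : ∀ x, ∃ i y, bs (k i) y = x)
    (f : (S.F.obj z).base ⟶ (S.F.obj z').base) (hf : ∀ i, bs (φ i) = bs (k i) ≫ f)
    (h : ∀ i j (t : S.C) (a : t ⟶ w i) (b : t ⟶ w j), a ≫ k i = b ≫ k j → a ≫ φ i = b ≫ φ j) :
    ∃ ψ : z ⟶ z', bs ψ = f ∧ ∀ i, k i ≫ ψ = φ i := by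
  -- The stack axiom glues arrows over an identity along étale covers. So `z'` is replaced by its
  -- pullback along `f`, and the submersions by open sets on which they have sections, indexed by
  -- the points of the base.
  obtain ⟨y, n, hn⟩ := S.isStack.exists_pullback z' (S.F.obj z).base f
  have hd : (S.F.obj y).base = (S.F.obj z).base := IsHomLift.domain_eq (total.stk S.F).p f n
  have hn' : f = eqToHom hd.symm ≫ bs n := by
    have := IsHomLift.fac (total.stk S.F).p f n
    exact this.trans (congrArg (eqToHom hd.symm ≫ ·) (Category.comp_id _))
  have hsec (b : (S.F.obj z).base) : ∃ (i : ι) (V : Opens (S.F.obj z).base)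
      (s : (S.F.obj z).base.restrict V ⟶ (S.F.obj (w i)).base), b ∈ V ∧
        ∀ y, bs (k i) (s y) = y.1 := by
    obtain ⟨i, y, rfl⟩ := hsurj b
    obtain ⟨V, hV, s, -, hs⟩ := (hk i).exists_section y
    exact ⟨i, V, s, hV, hs⟩
  choose i V s hbV hs using hsec
  choose w' e ε he using fun b => exists_restrict z (inclHom (V b))
  choose d hd' hdk using fun b => exists_lift (e b) (k (i b)) ((ε b).hom ≫ s b) (by
    rw [he]
    exact Mfd.hom_ext fun x => (hs b ((ε b).hom x)).symm)
  choose φ' hφ' hφn using fun b => exists_lift (d b ≫ φ (i b)) n (bs (e b) ≫ eqToHom hd.symm) (by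
    rw [Category.assoc, ← hn', bs, S.F.map_comp]
    refine (congrArg (bs (d b) ≫ ·) (hf (i b))).trans ?_
    rw [← Category.assoc, ← hdk b, bs, bs, bs, S.F.map_comp]
    rfl)
  have hcov : IsCover fun b => (total.stk S.F).p.map (e b) := by
    refine ⟨fun b => ?_, fun b => ⟨b, (ε b).inv ⟨b, hbV b⟩, ?_⟩⟩
    · refine IsEtale.of_local_inverse fun x => ⟨⊤, V b, (ε b).inv, trivial, fun u _ => ?_,
        fun y => ?_⟩
      · have : bs (e b) u = ((ε b).hom u).1 := ConcreteCategory.congr_hom (he b) u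
        refine ⟨this ▸ ((ε b).hom u).2, ?_⟩
        refine Eq.trans (congrArg (ε b).inv (Subtype.ext this)) ?_
        exact iso_inv_hom (ε b) u
      · exact (ConcreteCategory.congr_hom (he b) _).trans (congrArg Subtype.val (iso_hom_inv (ε b) y))
    · exact (ConcreteCategory.congr_hom (he b) _).trans (congrArg Subtype.val (iso_hom_inv (ε b) _))
  obtain ⟨ψ, hψ, hψe⟩ := S.isStack.glue_hom (x := z) (y := y) hd.symm w' e φ' hcov hφ'
    (fun b b' t a a' haa => by
      refine lift_unique n ?_ ?_
      · refine Eq.trans (congrArg Hom.base (S.F.map_comp _ _)) (Eq.trans ?_ (congrArg Hom.base (S.F.map_comp _ _)).symm)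
        refine (congrArg (bs a ≫ ·) (hφ' b)).trans (Eq.trans ?_ (congrArg (bs a' ≫ ·) (hφ' b')).symm)
        have := congrArg bs haa
        rw [bs, bs, S.F.map_comp, S.F.map_comp] at this
        exact congrArg (· ≫ eqToHom hd.symm) this
      · rw [Category.assoc, Category.assoc, hφn, hφn, ← Category.assoc, ← Category.assoc]
        refine h _ _ t _ _ ?_
        rw [Category.assoc, Category.assoc, hdk, hdk, haa])
  have hψn : bs (ψ ≫ n) = f := by
    refine (congrArg Hom.base (S.F.map_comp _ _)).trans (Eq.trans ?_ hn'.symm)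
    refine congrArg (· ≫ bs n) ?_
    have := IsHomLift.fac' (total.stk S.F).p (𝟙 ((total.stk S.F).p.obj z)) ψ
    exact this.trans (by
      refine (Category.id_comp _).trans (Category.id_comp _))
  refine ⟨ψ ≫ n, hψn, fun j => ?_⟩
  -- The equality over `w j` is tested on all its points: `eq_of_cover` asks only for joint
  -- surjectivity, so the family of one-point restrictions is enough.
  choose t c δ hc using fun x => exists_restrict (w j) (ptHom (M := (S.F.obj (w j)).base) x)
  refine eq_of_cover t c (fun x => ⟨x, (δ x).inv (0 : PUnit), by rw [hc]; rfl⟩) fun x => ?_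
  obtain ⟨a, ha, hae⟩ := exists_lift (c x ≫ k j) (e (bs (k j) x))
    (ptHom ((ε (bs (k j) x)).inv ⟨bs (k j) x, hbV _⟩) |> ((δ x).hom ≫ ·)) (by
      refine (congrArg Hom.base (S.F.map_comp _ _)).trans ?_
      refine (congrArg (· ≫ bs (k j)) (hc x)).trans ?_
      rw [he]
      refine Mfd.hom_ext fun y => ?_
      exact (congrArg Subtype.val (iso_hom_inv (ε (bs (k j) x)) ⟨_, hbV (bs (k j) x)⟩)).symm)
  have h1 : c x ≫ φ j = (a ≫ d _) ≫ φ (i (bs (k j) x)) := by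
    refine h _ _ _ _ _ ?_
    rw [Category.assoc, hdk, hae]
  rw [h1, ← Category.assoc, ← hae, Category.assoc, Category.assoc, ← hφn, ← Category.assoc (e _),
    hψe]

end StrictGerbe
end

noncomputable section

open TopologicalSpace Topology LieGroupoid LieTorsor CentralExtension

/-! ### Morphisms of gerbes are equivalences -/

namespace StrictGerbe

variable {M : Mfd} {X : LieGroupoid M} {S S' : StrictGerbe X} {K : S.C ⥤ S'.C}
  {κ : K ⋙ S'.F ≅ S.F}

theorem map_comp_κ {z z' : S.C} (f : z ⟶ z') :
    S'.F.map (K.map f) ≫ κ.hom.app z' = κ.hom.app z ≫ S.F.map f := κ.hom.naturality f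

variable (κ) in
/-- The identification of the base of an object with the base of its image. -/
abbrev baseIso (z : S.C) : (S'.F.obj (K.obj z)).base ≅ (S.F.obj z).base :=
  (stack X).p.mapIso (κ.app z)

theorem bs_map {z z' : S.C} (f : z ⟶ z') :
    bs (K.map f) ≫ (baseIso κ z').hom = (baseIso κ z).hom ≫ bs f :=
  congrArg Hom.base (map_comp_κ f)

theorem bs_map_apply {z z' : S.C} (f : z ⟶ z') (x) :
    (baseIso κ z').hom (bs (K.map f) x) = bs f ((baseIso κ z).hom x) :=
  ConcreteCategory.congr_hom (bs_map f) x

/-- The 2-isomorphism `κ` shows that `f` and `g` have the same torsor map, so they differ by an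
element of the band. Its image under `K` is trivial, and `K` does not change the element except for
the identification of bases. -/
theorem map_injective_of_band (hband : ∀ (z : S.C) (l : smoothCircle (S.F.obj z).base),
    K.map (gauge z l) = gauge (K.obj z) (smoothCircle.pullback (baseIso κ z).hom l))
    {z z' : S.C} {f g : z ⟶ z'} (h : K.map f = K.map g) : f = g := by
  have hF : S.F.map f = S.F.map g := by
    have h1 := map_comp_κ (κ := κ) f
    rw [h, map_comp_κ] at h1
    exact ((cancel_epi _).1 h1).symm
  obtain ⟨l, rfl⟩ := exists_gauge f g hF
  have : l = 1 := by
    have h2 : smoothCircle.pullback (baseIso κ z).hom l = 1 := by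
      refine gauge_cancel (f := K.map f) ?_
      rw [gauge_one, Category.id_comp, ← hband, ← K.map_comp]
      exact h.symm
    refine Subtype.ext (funext fun x => ?_)
    have := congrArg (fun l : smoothCircle _ => l.1 ((baseIso κ z).inv x)) h2
    exact (congrArg l.1 (iso_hom_inv (baseIso κ z) x)).symm.trans this
  rw [this, gauge_one, Category.id_comp]

/-- The torsor map of `g` is lifted locally to an arrow `k'` of the first gerbe. The image of `k'`
differs from `g` by the band, and the band of the source can correct it. The corrected arrow
descends because `K` is faithful. -/
theorem exists_preimage_of_band (hband : ∀ (z : S.C) (l : smoothCircle (S.F.obj z).base),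
    K.map (gauge z l) = gauge (K.obj z) (smoothCircle.pullback (baseIso κ z).hom l))
    {z z' : S.C} (g : K.obj z ⟶ K.obj z') : ∃ f, K.map f = g := by
  let φ : S.F.obj z ⟶ S.F.obj z' := κ.inv.app z ≫ S'.F.map g ≫ κ.hom.app z'
  have hφ : κ.hom.app z ≫ φ = S'.F.map g ≫ κ.hom.app z' := by
    simp only [φ, Iso.hom_inv_id_app_assoc]
  obtain ⟨t, k, k', hk, hkk⟩ := exists_common_cover φ
  have hF : S'.F.map (K.map k') = S'.F.map (K.map k ≫ g) := by
    refine (cancel_mono (κ.hom.app z')).1 ?_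
    rw [map_comp_κ, ← hkk, ← Category.assoc, ← map_comp_κ, Category.assoc, hφ, S'.F.map_comp,
      Category.assoc]
  obtain ⟨l, hl⟩ := exists_gauge _ _ hF
  let l₀ : smoothCircle (S.F.obj t).base := smoothCircle.pullback (baseIso κ t).inv l
  have hl₀ : smoothCircle.pullback (baseIso κ t).hom l₀ = l :=
    Subtype.ext (funext fun x => congrArg l.1 (iso_inv_hom (baseIso κ t) x))
  have hf₀ : K.map (gauge t l₀ ≫ k') = K.map k ≫ g := by
    rw [K.map_comp, hband, hl₀, hl]
  obtain ⟨ψ, -, hψk⟩ := exists_glueHom (ι := Unit) (fun _ => t) (fun _ => k)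
    (fun _ => gauge t l₀ ≫ k') (fun _ => hk.1) (fun x => ⟨(), hk.2 x⟩) (Hom.base φ) (fun _ => by
      have h1 := congrArg Hom.base hkk
      refine Eq.trans ?_ h1.symm
      rw [bs, S.F.map_comp, F_gauge, Category.id_comp]) (fun _ _ t' a b hab => by
      refine map_injective_of_band hband ?_
      rw [K.map_comp a, K.map_comp b, hf₀, ← Category.assoc, ← Category.assoc, ← K.map_comp,
        ← K.map_comp, hab])
  refine ⟨ψ, eq_of_cover (ι := Unit) (fun _ => K.obj t) (fun _ => K.map k) (fun x => ?_)
    fun _ => ?_⟩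
  · obtain ⟨y, hy⟩ := hk.2 ((baseIso κ z).hom x)
    refine ⟨(), (baseIso κ t).inv y, ?_⟩
    have := bs_map_apply (κ := κ) k ((baseIso κ t).inv y)
    rw [iso_hom_inv, hy] at this
    exact ((iso_inv_hom _ _).symm.trans (congrArg (baseIso κ z).inv this)).trans (iso_inv_hom _ _)
  · rw [← K.map_comp, hψk (), hf₀]

/-- An arrow with given image and given map of bases. -/
theorem existsUnique_lift_of_band (hband : ∀ (z : S.C) (l : smoothCircle (S.F.obj z).base),
    K.map (gauge z l) = gauge (K.obj z) (smoothCircle.pullback (baseIso κ z).hom l))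
    {t z : S.C} {y : S'.C} (ρ : K.obj z ⟶ y) (g : K.obj t ⟶ y)
    (c : (S.F.obj t).base ⟶ (S.F.obj z).base)
    (hc : bs g = (baseIso κ t).hom ≫ c ≫ (baseIso κ z).inv ≫ bs ρ) :
    ∃! f : t ⟶ z, bs f = c ∧ K.map f ≫ ρ = g := by
  obtain ⟨χ, hχ, hχ'⟩ := exists_lift g ρ ((baseIso κ t).hom ≫ c ≫ (baseIso κ z).inv) (by
    rw [hc, Category.assoc, Category.assoc])
  obtain ⟨f, hf⟩ := exists_preimage_of_band hband χ
  refine ⟨f, ⟨?_, by rw [hf, hχ']⟩, ?_⟩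
  · have h1 := bs_map (κ := κ) f
    rw [hf, hχ, Category.assoc, Category.assoc, Iso.inv_hom_id, Category.comp_id] at h1
    exact ((cancel_epi _).1 h1).symm
  · rintro f' ⟨hf', hf''⟩
    refine map_injective_of_band hband ?_
    rw [hf]
    refine lift_unique ρ ?_ (by rw [hf'', hχ'])
    refine (cancel_mono (baseIso κ z).hom).1 ?_
    rw [bs_map, hf', hχ, Category.assoc, Category.assoc, Iso.inv_hom_id, Category.comp_id]

/-- Some object of the first gerbe lies locally over the torsor of `y`, since that gerbe maps
epimorphically to torsors. Its image and `y` are then isomorphic on a further covering, and the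
covering is pulled back to the first gerbe. -/
theorem exists_local_image (K : S.C ⥤ S'.C) (κ : K ⋙ S'.F ≅ S.F) (y : S'.C) :
    ∃ (z : S.C) (ρ : K.obj z ⟶ y), IsSurjSubmersion (bs ρ) := by
  obtain ⟨z, φ, hφ⟩ := S.epi (S'.F.obj y)
  let z : S.C := z
  let φ' : S'.F.obj (K.obj z) ⟶ S'.F.obj y := κ.hom.app z ≫ φ
  obtain ⟨t, k, k', hk, hkk⟩ := exists_common_cover φ'
  obtain ⟨z₁, m, e, hm⟩ := exists_restrict z (bs k ≫ (baseIso κ z).hom)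
  obtain ⟨χ, hχ, -⟩ := exists_lift (K.map m) k ((baseIso κ z₁).hom ≫ e.hom) (by
    refine (cancel_mono (baseIso κ z).hom).1 ?_
    rw [bs_map, hm, Category.assoc, Category.assoc])
  refine ⟨z₁, χ ≫ k', ?_⟩
  have h1 : bs (χ ≫ k') = ((baseIso κ z₁).hom ≫ e.hom) ≫ bs k ≫ (baseIso κ z).hom ≫ Hom.base φ := by
    rw [bs, S'.F.map_comp, ← hkk]
    exact congrArg (· ≫ bs k ≫ (baseIso κ z).hom ≫ Hom.base φ) hχ
  rw [h1]
  exact (isSurjSubmersion_of_isIso _).comp (hk.comp ((isSurjSubmersion_of_isIso _).comp hφ))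

/-- A morphism of banded gerbes over the stack of torsors is essentially surjective. -/
theorem essSurj_of_band (hband : ∀ (z : S.C) (l : smoothCircle (S.F.obj z).base),
    K.map (gauge z l) = gauge (K.obj z) (smoothCircle.pullback (baseIso κ z).hom l)) (y : S'.C) :
    ∃ (x : S.C) (ψ : K.obj x ⟶ y), IsIso ψ := by
  obtain ⟨z, ρ, hρ⟩ := exists_local_image K κ y
  have hsec (b : (S'.F.obj y).base) : ∃ (V : Opens (S'.F.obj y).base)
      (s : (S'.F.obj y).base.restrict V ⟶ (S'.F.obj (K.obj z)).base), b ∈ V ∧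
        ∀ y, bs ρ (s y) = y.1 := by
    obtain ⟨x, rfl⟩ := hρ.2 b
    obtain ⟨V, hV, s, -, hs⟩ := hρ.1.exists_section x
    exact ⟨V, s, hV, hs⟩
  choose V s hbV hs using hsec
  choose w e ε he using fun b => exists_restrict z (s b ≫ (baseIso κ z).hom)
  let u (b) : (S.F.obj (w b)).base ⟶ (S'.F.obj y).base := (ε b).hom ≫ inclHom (V b)
  have hu (b) : bs (K.map (e b) ≫ ρ) = (baseIso κ (w b)).hom ≫ u b := by
    rw [bs, S'.F.map_comp]
    change bs (K.map (e b)) ≫ bs ρ = _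
    have h1 : bs (K.map (e b)) = (baseIso κ (w b)).hom ≫ (ε b).hom ≫ s b := by
      refine (cancel_mono (baseIso κ z).hom).1 ?_
      rw [bs_map, he, Category.assoc, Category.assoc]
    rw [h1]
    exact Mfd.hom_ext fun x => hs b _
  have hcov : IsCover u := by
    refine ⟨fun b => ?_, fun b => ⟨b, (ε b).inv ⟨b, hbV b⟩, ?_⟩⟩
    · exact IsEtale.of_local_inverse fun x => ⟨⊤, V b, (ε b).inv, trivial, fun u _ =>
        ⟨((ε b).hom u).2, iso_inv_hom (ε b) u⟩,
        fun y => congrArg Subtype.val (iso_hom_inv (ε b) y)⟩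
    · exact congrArg Subtype.val (iso_hom_inv (ε b) _)
  -- The gluing data are the unique arrows whose images under `K` commute with the given arrows to
  -- `y`. Uniqueness yields both compatibility with pullback and the cocycle condition.
  have hθ (i j) (t : S.C) (a : t ⟶ w i) (b : (S.F.obj t).base ⟶ (S.F.obj (w j)).base)
      (h : bs a ≫ u i = b ≫ u j) :
      ∃! f : t ⟶ w j, bs f = b ∧ K.map f ≫ K.map (e j) ≫ ρ = K.map a ≫ K.map (e i) ≫ ρ := by
    refine existsUnique_lift_of_band hband _ _ _ ?_
    rw [hu, Iso.inv_hom_id_assoc, ← h, bs, S'.F.map_comp]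
    change bs (K.map a) ≫ bs (K.map (e i) ≫ ρ) = _
    rw [hu, ← Category.assoc, bs_map, Category.assoc]
  choose θ hθ₁ hθ₂ using hθ
  obtain ⟨x, e', hx, he', heθ⟩ := S.isStack.glue_obj (S'.F.obj y).base w u hcov θ
    (fun i j t a b h => (hθ₁ i j t a b h).1)
    (fun i j t t' c a b h h' => by
      have h1 := hθ₁ i j t a b h
      refine (hθ₂ i j t' (c ≫ a) (bs c ≫ b) h' (c ≫ θ i j t a b h) ⟨?_, ?_⟩).symm
      · rw [bs, S.F.map_comp]
        exact congrArg (bs c ≫ ·) h1.1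
      · rw [K.map_comp, Category.assoc, h1.2, K.map_comp, Category.assoc])
    (fun i j k t a b c h h' => by
      have h1 := hθ₁ i j t a b h
      refine hθ₂ i k t a c h' _ ⟨(hθ₁ j k t _ c _).1, ?_⟩
      rw [(hθ₁ j k t _ c _).2, h1.2])
  have hx' : (S.F.obj x).base = (S'.F.obj y).base := hx
  have hbe (i) : bs (e' i) ≫ eqToHom hx' = u i := by
    have := he' i
    have := IsHomLift.fac (total.stk S.F).p (u i) (e' i)
    exact (this.trans (Category.id_comp _)).symm
  refine ⟨x, ?_⟩
  suffices H : ∃ ψ : K.obj x ⟶ y, bs ψ = (baseIso κ x).hom ≫ eqToHom hx' ∧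
      ∀ i, K.map (e' i) ≫ ψ = K.map (e i) ≫ ρ by
    obtain ⟨ψ, hψ, -⟩ := H
    exact ⟨ψ, isIso_of_isIso_bs ψ (by rw [hψ]; infer_instance)⟩
  refine exists_glueHom (fun i => K.obj (w i)) (fun i => K.map (e' i))
    (fun i => K.map (e i) ≫ ρ) (fun i => ?_) (fun b => ?_) _ (fun i => ?_)
    (fun i j t a b hab => ?_)
  · have h1 : bs (K.map (e' i)) = (baseIso κ (w i)).hom ≫ u i ≫ eqToHom hx'.symm ≫ (baseIso κ x).inv := by
      refine (cancel_mono (baseIso κ x).hom).1 ?_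
      rw [bs_map, ← hbe]
      simp only [Category.assoc, eqToHom_trans_assoc, eqToHom_refl, Category.id_comp,
        Iso.inv_hom_id, Category.comp_id]
    rw [h1]
    exact (isSubmersion_of_isIso _).comp ((hcov.1 i).isSubmersion.comp (isSubmersion_of_isIso _))
  · obtain ⟨i, v, hv⟩ := hcov.2 (eqToHom hx' ((baseIso κ x).hom b))
    refine ⟨i, (baseIso κ (w i)).inv v, ?_⟩
    have h1 := ConcreteCategory.congr_hom (bs_map (κ := κ) (e' i)) ((baseIso κ (w i)).inv v)
    have h2 : bs (e' i) v = (baseIso κ x).hom b := by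
      have h3 := (ConcreteCategory.congr_hom (hbe i) v).trans hv
      have h4 := congrArg (eqToHom hx'.symm) h3
      have h5 (q) : eqToHom hx'.symm (eqToHom hx' q) = q :=
        ConcreteCategory.congr_hom ((eqToHom_trans hx' hx'.symm).trans (eqToHom_refl _ _)) q
      exact (h5 _).symm.trans (h4.trans (h5 _))
    have h6 : (baseIso κ x).hom (bs (K.map (e' i)) ((baseIso κ (w i)).inv v)) = (baseIso κ x).hom b :=
      h1.trans ((congrArg (bs (e' i)) (iso_hom_inv (baseIso κ (w i)) v)).trans h2)
    exact (iso_inv_hom _ _).symm.trans ((congrArg (baseIso κ x).inv h6).trans (iso_inv_hom _ _))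
  · rw [hu, ← hbe, ← Category.assoc, ← bs_map, Category.assoc]
  -- The test object `t` belongs to the second gerbe. It is replaced by an isomorphic object in the
  -- image of `K`, where fullness turns `b` into the image of an arrow and the gluing property of
  -- the glued object applies.
  · obtain ⟨t₀, a₀, ε₀, ha₀⟩ := exists_restrict (w i) (bs a ≫ (baseIso κ (w i)).hom)
    obtain ⟨c, hc, hca⟩ := exists_lift (K.map a₀) a ((baseIso κ t₀).hom ≫ ε₀.hom) (by
      refine (cancel_mono (baseIso κ (w i)).hom).1 ?_
      rw [bs_map, ha₀, Category.assoc, Category.assoc])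
    have : IsIso c := isIso_of_isIso_bs c (by rw [hc]; infer_instance)
    obtain ⟨b₀, hb₀⟩ := exists_preimage_of_band hband (c ≫ b)
    refine (cancel_epi c).1 ?_
    rw [← Category.assoc c a, hca, ← Category.assoc c b, ← hb₀]
    have h1 : a₀ ≫ e' i = b₀ ≫ e' j := by
      refine map_injective_of_band hband ?_
      rw [K.map_comp, K.map_comp, hb₀, ← hca, Category.assoc, Category.assoc, hab]
    have h2 : bs a₀ ≫ u i = bs b₀ ≫ u j := by
      rw [← hbe, ← hbe, ← Category.assoc, ← Category.assoc]
      refine congrArg (· ≫ eqToHom hx') ?_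
      have := congrArg bs h1
      rw [bs, bs, S.F.map_comp, S.F.map_comp] at this
      exact this
    have h3 : θ i j t₀ a₀ (bs b₀) h2 = b₀ := lift_unique (e' j) (hθ₁ i j t₀ a₀ _ h2).1 (by
      rw [← h1]; exact heθ i j t₀ a₀ _ h2)
    have h4 := (hθ₁ i j t₀ a₀ _ h2).2
    rw [h3] at h4
    exact h4.symm

/-- A morphism of banded gerbes over the stack of torsors is an equivalence. -/
theorem isEquivalence_of_band (hband : ∀ (z : S.C) (l : smoothCircle (S.F.obj z).base),
    K.map (gauge z l) = gauge (K.obj z) (smoothCircle.pullback (baseIso κ z).hom l)) :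
    K.IsEquivalence where
  faithful := ⟨fun h => map_injective_of_band hband h⟩
  full := ⟨fun g => exists_preimage_of_band hband g⟩
  essSurj := ⟨fun y => by
    obtain ⟨x, ψ, h⟩ := essSurj_of_band hband y
    exact ⟨x, ⟨asIso ψ⟩⟩⟩

end StrictGerbe
end

noncomputable section

open TopologicalSpace Topology LieGroupoid LieTorsor CentralExtension

/-! ### Maps from trivial circle bundles -/

namespace CircleBundle

/-- The trivial circle bundle. -/
abbrev triv (T : Mfd) : CircleBundle := (CircleCocycle.trivial T).bundle

/-- The map from the trivial bundle given by a map to the total space of a bundle. -/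
def ofSec {T : Mfd} {P : CircleBundle} (u : T ⟶ P.total) : triv T ⟶ P where
  base := u ≫ P.proj
  total := homMk (fun p => P.principal.smul ((triv T).principal.quo (sec T ((triv T).proj p)) p)
    (u ((triv T).proj p)))
    (P.principal.smooth_sm ((triv T).principal.quo_mem (smooth_coe ((triv T).proj ≫ sec T))
      (smooth_id _) fun _ => rfl) (smooth_coe ((triv T).proj ≫ u)))
  proj_total p := P.principal.proj_smul _ _
  total_smul a p := by
    refine Eq.trans ?_ (P.principal.mul_smul _ _ _)
    exact congrArg (P.principal.smul · (u ((triv T).proj p)))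
      ((triv T).principal.quo_smul_right (p := sec T ((triv T).proj p)) (p' := p) rfl)

theorem ofSec_sec {T : Mfd} {P : CircleBundle} (u : T ⟶ P.total) (x : T) :
    Hom.total (ofSec u) (sec T x) = u x := by
  refine Eq.trans ?_ (P.principal.one_smul (u x))
  exact congrArg (P.principal.smul · (u x)) ((triv T).principal.quo_self _)

theorem hom_ext_sec {T : Mfd} {P : CircleBundle} {f g : triv T ⟶ P}
    (h : ∀ x, Hom.total f (sec T x) = Hom.total g (sec T x)) : f = g := by
  have hb : Hom.base f = Hom.base g := Mfd.hom_ext fun x =>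
    (Hom.proj_total f (sec T x)).symm.trans ((congrArg P.proj (h x)).trans (Hom.proj_total g (sec T x)))
  refine Hom.ext hb (Mfd.hom_ext fun p => ?_)
  have hp := (triv T).principal.quo_smul (p := sec T ((triv T).proj p)) (p' := p) rfl
  rw [← hp]
  exact (Hom.total_smul f _ _).trans ((congrArg _ (h _)).trans (Hom.total_smul g _ _).symm)

end CircleBundle

/-! ### Objects of the gerbe given by circle bundles over `M`, and arrows to `r₀` -/

namespace StrictGerbe

variable {M : Mfd} {X : LieGroupoid M} (S : StrictGerbe X)

/-- The object of the gerbe given by a circle bundle over a manifold over `M`. -/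
abbrev Θ (B : CostructuredArrow CircleBundle.toMfd M) : S.C := (S.triv.obj B).left

/-- The section of the torsor of an object given by a circle bundle. -/
abbrev θ (B : CostructuredArrow CircleBundle.toMfd M) : S.F.obj (S.Θ B) ⟶ X.universalTorsor :=
  (S.triv.obj B).hom

/-- The base of the object given by a circle bundle. -/
abbrev bb (B : CostructuredArrow CircleBundle.toMfd M) : (S.F.obj (S.Θ B)).base ≅ B.left.base :=
  eqToIso (restriction_base_eq (F := total.map S.F) (x := X.universalTorsor) S.triv B)

variable {B B' B'' : CostructuredArrow CircleBundle.toMfd M}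

/-- The functoriality of the object given by a circle bundle. -/
abbrev Θmap (f : B ⟶ B') : S.Θ B ⟶ S.Θ B' := (S.triv.map f).left

theorem Θmap_comp (f : B ⟶ B') (g : B' ⟶ B'') : S.Θmap (f ≫ g) = S.Θmap f ≫ S.Θmap g := by
  rw [Θmap, S.triv.toFunctor.map_comp]; rfl

theorem F_Θmap (f : B ⟶ B') : S.F.map (S.Θmap f) ≫ S.θ B' = S.θ B := CostructuredArrow.w (S.triv.map f)

theorem bb_comp (B : CostructuredArrow CircleBundle.toMfd M) :
    (S.bb B).hom ≫ B.hom = Hom.base (S.θ B) := by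
  have h : Over.mk (Hom.base (S.θ B)) = Over.mk B.hom := S.triv.w_obj B
  have h1 := Over.w (eqToHom h)
  rw [Over.eqToHom_left] at h1
  exact h1

theorem bs_Θmap (f : B ⟶ B') :
    bs (S.Θmap f) ≫ (S.bb B').hom = (S.bb B).hom ≫ CircleBundle.Hom.base f.left := by
  have h := Functor.congr_hom S.triv.w f
  have h1 := congrArg (fun g => g.left) h
  simp only [Over.comp_left, Over.eqToHom_left] at h1
  have h2 : bs (S.Θmap f) = (S.bb B).hom ≫ CircleBundle.Hom.base f.left ≫ (S.bb B').inv := h1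
  rw [h2, Category.assoc, Category.assoc, Iso.inv_hom_id, Category.comp_id]

theorem exists_Θ (z : S.C) (α : S.F.obj z ⟶ X.universalTorsor) :
    ∃ (B : CostructuredArrow CircleBundle.toMfd M) (e : S.Θ B ⟶ z), IsIso e ∧
      S.F.map e ≫ α = S.θ B := by
  have := S.triv_equivalence
  let y : CostructuredArrow (total.map S.F).toFunctor X.universalTorsor :=
    CostructuredArrow.mk (S := (total.map S.F).toFunctor) (Y := z) α
  obtain ⟨B, ⟨e⟩⟩ := (this.essSurj.mem_essImage y)
  exact ⟨B, e.hom.left, ⟨e.inv.left, congrArg CommaMorphism.left e.hom_inv_id,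
    congrArg CommaMorphism.left e.inv_hom_id⟩, CostructuredArrow.w e.hom⟩

theorem exists_Θmap (g : S.Θ B ⟶ S.Θ B') (h : S.F.map g ≫ S.θ B' = S.θ B) : ∃ f, S.Θmap f = g := by
  have := S.triv_equivalence
  obtain ⟨f, hf⟩ := S.triv.toFunctor.map_surjective (CostructuredArrow.homMk g h)
  exact ⟨f, congrArg CommaMorphism.left hf⟩

theorem Θmap_injective {f g : B ⟶ B'} (h : S.Θmap f = S.Θmap g) : f = g := by
  have := S.triv_equivalence
  exact S.triv.toFunctor.map_injective (CommaMorphism.ext h (Subsingleton.elim _ _))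

theorem Θmap_gauge (l : smoothCircle B.left.base) :
    S.Θmap (circleTimes.gauge B l) = gauge (S.Θ B) (smoothCircle.pullback (S.bb B).hom l) :=
  S.triv_band B l

/-- The object of the gerbe that defines the morphism from `M`. -/
abbrev r₀ : S.C := S.Θ (trivialBundle M)

variable {S}

/-- The trivialization of the torsor of an object given by an arrow to `r₀`. -/
abbrev tor {z : S.C} (a : z ⟶ S.r₀) : S.F.obj z ⟶ X.universalTorsor := S.F.map a ≫ S.θ (trivialBundle M)

theorem tor_comp {z z' : S.C} (c : z' ⟶ z) (a : z ⟶ S.r₀) : tor (c ≫ a) = S.F.map c ≫ tor a := by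
  rw [tor, S.F.map_comp, Category.assoc]

/-- The map to `M` below an arrow to `r₀`. -/
abbrev ob {z : S.C} (a : z ⟶ S.r₀) : (S.F.obj z).base ⟶ M := Hom.base (tor a)

theorem ob_comp {z z' : S.C} (c : z' ⟶ z) (a : z ⟶ S.r₀) : ob (c ≫ a) = bs c ≫ ob a :=
  congrArg Hom.base (tor_comp c a)

/-- The base of `r₀` is `M`. -/
abbrev obIso : (S.F.obj S.r₀).base ≅ M := S.bb (trivialBundle M)

theorem ob_eq {z : S.C} (a : z ⟶ S.r₀) : ob a = bs a ≫ obIso.hom := by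
  have h : obIso.hom = Hom.base (S.θ (trivialBundle M)) :=
    (Category.comp_id _).symm.trans (S.bb_comp (trivialBundle M))
  rw [h]
  rfl

/-- The map from the object given by the trivial bundle. -/
abbrev secMap {T : Mfd} {g : T ⟶ M} {B : CostructuredArrow CircleBundle.toMfd M}
    (u : T ⟶ B.left.total) (h : (u ≫ B.left.proj) ≫ B.hom = g) :
    CostructuredArrow.mk (S := CircleBundle.toMfd) (Y := CircleBundle.triv T) g ⟶ B :=
  CostructuredArrow.homMk (CircleBundle.ofSec u) h

/-- Every object is covered by an object with an arrow to `r₀`. -/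
theorem exists_chart (z : S.C) : ∃ (w : S.C) (k : w ⟶ z) (_ : w ⟶ S.r₀), IsSurjSubmersion (bs k) := by
  obtain ⟨y, m, e, hm⟩ := exists_restrict z (S.F.obj z).proj
  have hs : ∀ x, (S.F.obj z).proj (e.hom x) = bs m x := fun x => (ConcreteCategory.congr_hom hm x).symm
  -- Over the total space of its torsor, `z` has a torsor with a section, which maps to the
  -- universal torsor and so to the torsor of `r₀`. Locally this map comes from an arrow of the
  -- gerbe.
  obtain ⟨s, hs, hs'⟩ := Hom.exists_fibHom (S.F.map m) (𝟙 _) e.hom hs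
  let φ : S.F.obj y ⟶ X.universalTorsor := homOfSection s hs (s ≫ (S.F.obj y).anchor ≫ X.one)
    fun x => X.tgt_one _
  obtain ⟨ψ, -, -⟩ := LieTorsor.exists_lift φ (S.θ (trivialBundle M)) (Hom.base φ ≫ obIso.inv) (by
    have h : obIso.hom = Hom.base (S.θ (trivialBundle M)) :=
      (Category.comp_id _).symm.trans (S.bb_comp (trivialBundle M))
    rw [← h, Category.assoc, Iso.inv_hom_id, Category.comp_id])
  obtain ⟨t, k, k', hk, -⟩ := exists_common_cover ψ
  refine ⟨t, k ≫ m, k', ?_⟩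
  rw [bs, S.F.map_comp]
  refine hk.comp (Eq.subst (motive := IsSurjSubmersion) hm.symm
    ((isSurjSubmersion_of_isIso e.hom).comp (S.F.obj z).proj_surjSubmersion))

/-- Families of pairs of points with the same image come from pairs of arrows. -/
theorem exists_span {z w w' : S.C} (k : w ⟶ z) (k' : w' ⟶ z) {T : Mfd} (v : T ⟶ (S.F.obj w).base)
    (v' : T ⟶ (S.F.obj w').base) (h : v ≫ bs k = v' ≫ bs k') :
    ∃ (t : S.C) (e : (S.F.obj t).base ≅ T) (d : t ⟶ w) (d' : t ⟶ w'), bs d = e.hom ≫ v ∧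
      bs d' = e.hom ≫ v' ∧ d ≫ k = d' ≫ k' := by
  obtain ⟨t, d, e, hd⟩ := exists_restrict w v
  obtain ⟨d', hd', hdd⟩ := exists_lift (d ≫ k) k' (e.hom ≫ v') (by
    rw [bs, S.F.map_comp, Category.assoc, ← h, ← Category.assoc, ← hd]; rfl)
  exact ⟨t, e, d, d', hd, hd', hdd.symm⟩

theorem exists_span_pt {z w w' : S.C} (k : w ⟶ z) (k' : w' ⟶ z) {v v'} (h : bs k v = bs k' v') :
    ∃ (t : S.C) (d : t ⟶ w) (d' : t ⟶ w') (x : (S.F.obj t).base), bs d x = v ∧ bs d' x = v' ∧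
      d ≫ k = d' ≫ k' := by
  obtain ⟨t, e, d, d', hd, hd', hdd⟩ := exists_span k k' (ptHom v) (ptHom v') (Mfd.hom_ext fun _ => h)
  exact ⟨t, d, d', e.inv (0 : PUnit), by rw [hd]; rfl, by rw [hd']; rfl, hdd⟩

variable (S) in
/-- The central extension `E` is the one given by the gerbe `S`. -/
structure Assoc (E : CentralExtension X) where
  Ψ : ∀ {z : S.C} (_ _ : z ⟶ S.r₀), (S.F.obj z).base ⟶ E.grpd.arr
  src_Ψ : ∀ {z} (a b : z ⟶ S.r₀) (x), E.grpd.src (Ψ a b x) = ob a x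
  tgt_Ψ : ∀ {z} (a b : z ⟶ S.r₀) (x), E.grpd.tgt (Ψ a b x) = ob b x
  natural : ∀ {z z'} (c : z' ⟶ z) (a b : z ⟶ S.r₀) (x), Ψ (c ≫ a) (c ≫ b) x = Ψ a b (bs c x)
  bijective : ∀ {z} (a : z ⟶ S.r₀) (g : (S.F.obj z).base ⟶ E.grpd.arr),
    (∀ x, E.grpd.src (g x) = ob a x) → ∃! b, Ψ a b = g
  m_Ψ : ∀ {z} (a b c : z ⟶ S.r₀) (x), E.grpd.m (Ψ a b x) (Ψ b c x) = Ψ a c x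
  π_Ψ : ∀ {z} (a b : z ⟶ S.r₀) (q), X.m (E.π (Ψ a b ((S.F.obj z).proj q))) (Hom.total (tor b) q) =
    Hom.total (tor a) q
  sm_Ψ : ∀ {z} (a b : z ⟶ S.r₀) (l : smoothCircle (S.F.obj z).base) (x),
    Ψ (gauge z l ≫ a) b x = E.sm (l.1 x) (Ψ a b x)

variable {E : CentralExtension X}

/-- The association of a central extension and a strict gerbe. -/
def Assoc.toAssociation (A : S.Assoc E) : Association E S.toGerbe where
  B := trivialBundle M
  isIso_B := inferInstanceAs (IsIso (𝟙 M))
  sec := sec M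
  sec_proj := Mfd.hom_ext fun _ => rfl
  Ψ a b := A.Ψ a b
  src_Ψ a b := Mfd.hom_ext fun x => A.src_Ψ a b x
  tgt_Ψ a b := Mfd.hom_ext fun x => A.tgt_Ψ a b x
  natural c a b := Mfd.hom_ext fun x => A.natural c a b x
  bijective a g h := A.bijective a g fun x => ConcreteCategory.congr_hom h x
  mul_Ψ a b c x := by
    have w : E.grpd.tgt (A.Ψ a b x) = E.grpd.src (A.Ψ b c x) := by rw [A.tgt_Ψ, A.src_Ψ]
    exact ⟨w, (m_eq w).symm.trans (A.m_Ψ a b c x)⟩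
  π_Ψ {z} a b q := by
    have w : X.tgt (E.π (A.Ψ a b ((S.F.obj z).proj q))) = X.src (Hom.total (tor b) q) := by
      rw [E.tgt_π, A.tgt_Ψ]
      exact (Hom.proj_tot (tor b) q).symm
    exact ⟨w, (m_eq w).symm.trans (A.π_Ψ a b q)⟩
  smul_Ψ a b l x := A.sm_Ψ a b l x

/-- An association may use any trivial circle bundle with a section. The section identifies it with
the standard trivial bundle, and all the data are transported along the resulting isomorphism `J`
from `r₀`. -/
theorem exists_assoc (A : Association E S.toGerbe) : Nonempty (S.Assoc E) := by
  obtain ⟨g, hg₁, hg₂⟩ := A.isIso_B.out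
  let g : M ⟶ A.B.left.base := g
  have hg : IsIso g := ⟨A.B.hom, hg₂, hg₁⟩
  have hgp : (g ≫ A.sec) ≫ A.B.left.proj = g := by
    rw [Category.assoc, A.sec_proj, Category.comp_id]
  let j : trivialBundle M ⟶ A.B := secMap (g ≫ A.sec)
    ((congrArg (· ≫ A.B.hom) hgp).trans hg₂)
  let J : S.r₀ ⟶ S.Θ A.B := S.Θmap j
  have hJ : IsIso J := by
    refine isIso_of_isIso_bs J ?_
    have h1 : bs J ≫ (S.bb A.B).hom = obIso.hom ≫ g :=
      (S.bs_Θmap j).trans (congrArg (obIso.hom ≫ ·) hgp)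
    have h2 : bs J = (obIso.hom ≫ g) ≫ (S.bb A.B).inv := by
      rw [← h1, Category.assoc, Iso.hom_inv_id, Category.comp_id]
    rw [h2]; infer_instance
  have hθ : S.F.map J ≫ S.θ A.B = S.θ (trivialBundle M) := S.F_Θmap j
  have htor {z : S.C} (a : z ⟶ S.r₀) : S.F.map (a ≫ J) ≫ S.θ A.B = tor a := by
    rw [S.F.map_comp, Category.assoc, hθ]
  have hob {z : S.C} (a : z ⟶ S.r₀) (x) : Hom.base (S.θ A.B) (bs (a ≫ J) x) = ob a x :=
    congrArg (fun φ : S.F.obj z ⟶ X.universalTorsor => Hom.base φ x) (htor a)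
  refine ⟨⟨fun a b => A.Ψ (a ≫ J) (b ≫ J), ?_, ?_, ?_, ?_, ?_, ?_, ?_⟩⟩
  · exact fun a b x => (ConcreteCategory.congr_hom (A.src_Ψ (a ≫ J) (b ≫ J)) x).trans (hob a x)
  · exact fun a b x => (ConcreteCategory.congr_hom (A.tgt_Ψ (a ≫ J) (b ≫ J)) x).trans (hob b x)
  · intro z z' c a b x
    rw [Category.assoc, Category.assoc]
    exact ConcreteCategory.congr_hom (A.natural c (a ≫ J) (b ≫ J)) x
  · intro z a g h
    obtain ⟨b, hb, hb'⟩ := A.bijective (a ≫ J) g (Mfd.hom_ext fun x => (h x).trans (hob a x).symm)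
    let b : z ⟶ S.Θ A.B := b
    have e : (b ≫ inv J) ≫ J = b := by rw [Category.assoc, IsIso.inv_hom_id, Category.comp_id]
    refine ⟨b ≫ inv J, (congrArg (A.Ψ (a ≫ J)) e).trans hb, fun b₁ hb₁ => ?_⟩
    have := hb' (b₁ ≫ J) hb₁
    rw [IsIso.eq_comp_inv]
    exact this
  · intro z a b c x
    obtain ⟨w, h⟩ := A.mul_Ψ (a ≫ J) (b ≫ J) (c ≫ J) x
    exact (m_eq w).trans h
  · intro z a b q
    obtain ⟨w, h⟩ := A.π_Ψ (a ≫ J) (b ≫ J) q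
    have ha := congrArg (fun φ : S.F.obj z ⟶ X.universalTorsor => Hom.total φ q) (htor a)
    have hb := congrArg (fun φ : S.F.obj z ⟶ X.universalTorsor => Hom.total φ q) (htor b)
    refine Eq.trans ?_ (h.trans ha)
    rw [← m_eq w]
    exact congrArg (X.m _) hb.symm
  · intro z a b l x
    rw [Category.assoc]
    exact A.smul_Ψ (a ≫ J) (b ≫ J) l x

end StrictGerbe
end

noncomputable section

open TopologicalSpace Topology LieGroupoid LieTorsor CentralExtension

namespace StrictGerbe

variable {M : Mfd} {X : LieGroupoid M} {S S' : StrictGerbe X} {E E' : CentralExtension X}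

namespace Assoc

/-! ### The central extension of a gerbe is unique -/

theorem ob_eq_iff {z z' : S.C} {a : z ⟶ S.r₀} {a' : z' ⟶ S.r₀}
    {f : (S.F.obj z).base ⟶ (S.F.obj z').base} : bs a = f ≫ bs a' ↔ ob a = f ≫ ob a' := by
  rw [ob_eq, ob_eq, ← Category.assoc]
  exact (cancel_mono _).symm

/-- Pull `r₀` back along the source map of `E`. Then the identity of the arrows of `E` is a map with
the prescribed source, so bijectivity provides the second member of a universal pair. -/
theorem exists_universal (A : S.Assoc E) :
    ∃ (t : S.C) (a b : t ⟶ S.r₀) (e : (S.F.obj t).base ≅ E.grpd.arr), A.Ψ a b = e.hom := by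
  obtain ⟨t, a, e, ha⟩ := exists_restrict S.r₀ (E.grpd.src ≫ obIso.inv)
  obtain ⟨b, hb, -⟩ := A.bijective a e.hom fun x => by
    rw [ob_eq, ha, Category.assoc, Category.assoc, Iso.inv_hom_id, Category.comp_id]; rfl
  exact ⟨t, a, b, e, hb⟩

theorem exists_lift_universal (A : S.Assoc E) {t : S.C} {a b : t ⟶ S.r₀}
    {e : (S.F.obj t).base ≅ E.grpd.arr} (h : A.Ψ a b = e.hom) {z : S.C} (a' b' : z ⟶ S.r₀) :
    ∃ c : z ⟶ t, bs c = A.Ψ a' b' ≫ e.inv ∧ c ≫ a = a' ∧ c ≫ b = b' := by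
  obtain ⟨c, hc, hca⟩ := exists_lift a' a (A.Ψ a' b' ≫ e.inv) (ob_eq_iff.2 (Mfd.hom_ext fun x => by
    have h1 := A.src_Ψ a b (e.inv (A.Ψ a' b' x))
    rw [h, iso_hom_inv, A.src_Ψ] at h1
    exact h1))
  refine ⟨c, hc, hca, ?_⟩
  refine (A.bijective a' (A.Ψ a' b') (A.src_Ψ a' b')).unique (Mfd.hom_ext fun x => ?_) rfl
  rw [← hca, A.natural, h, hc]
  exact (iso_hom_inv e (A.Ψ a' b' x)).trans (by rw [hca])

theorem exists_transport (A : S.Assoc E) (A' : S.Assoc E') :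
    ∃ f : E.grpd.arr ⟶ E'.grpd.arr, ∀ {z : S.C} (a b : z ⟶ S.r₀) (x), f (A.Ψ a b x) = A'.Ψ a b x := by
  obtain ⟨t, a, b, e, h⟩ := A.exists_universal
  refine ⟨e.inv ≫ A'.Ψ a b, fun {z} a' b' x => ?_⟩
  obtain ⟨c, hc, rfl, rfl⟩ := A.exists_lift_universal h a' b'
  rw [A'.natural, hc]
  rfl

/-- Identities in `E` are checked on triples of arrows over a point: `g` restricts the universal
pair to the pair `(a, b)`, and bijectivity provides `c` from `h`. -/
theorem exists_pair (A : S.Assoc E) {g h : E.grpd.arr} (w : E.grpd.tgt g = E.grpd.src h) :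
    ∃ (z : S.C) (a b c : z ⟶ S.r₀) (x : (S.F.obj z).base), A.Ψ a b x = g ∧ A.Ψ b c x = h := by
  obtain ⟨t, a, b, e, he⟩ := A.exists_universal
  obtain ⟨z, d, ε, hd⟩ := exists_restrict t (ptHom (e.inv g))
  have hg (x) : A.Ψ (d ≫ a) (d ≫ b) x = g := by
    rw [A.natural, hd, he]; exact iso_hom_inv e g
  obtain ⟨c, hc, -⟩ := A.bijective (d ≫ b) (ε.hom ≫ ptHom h) fun x => by
    rw [← A.tgt_Ψ (d ≫ a), hg, w]; rfl
  exact ⟨z, d ≫ a, d ≫ b, c, ε.inv (0 : PUnit), hg _, by rw [hc]; rfl⟩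

theorem exists_eq (A : S.Assoc E) (g : E.grpd.arr) :
    ∃ (z : S.C) (a b : z ⟶ S.r₀) (x : (S.F.obj z).base), A.Ψ a b x = g := by
  obtain ⟨z, a, b, -, x, h, -⟩ := A.exists_pair (g := g) (E.grpd.src_one _).symm
  exact ⟨z, a, b, x, h⟩

theorem tgt_π_Ψ (A : S.Assoc E) {z : S.C} (a b : z ⟶ S.r₀) (q) :
    X.tgt (E.π (A.Ψ a b ((S.F.obj z).proj q))) = X.src (Hom.total (tor b) q) := by
  rw [E.tgt_π, A.tgt_Ψ]
  exact (Hom.proj_tot (tor b) q).symm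

/-- A gerbe determines its central extension. -/
theorem nonempty_iso (A : S.Assoc E) (A' : S.Assoc E') : Nonempty (E.Iso E') := by
  obtain ⟨f, hf⟩ := A.exists_transport A'
  obtain ⟨f', hf'⟩ := A'.exists_transport A
  refine ⟨⟨⟨f, f', ?_, ?_⟩, ?_, ?_, ?_⟩⟩
  · refine Mfd.hom_ext fun g => ?_
    obtain ⟨z, a, b, x, rfl⟩ := A.exists_eq g
    exact (congrArg f' (hf a b x)).trans (hf' a b x)
  · refine Mfd.hom_ext fun g => ?_
    obtain ⟨z, a, b, x, rfl⟩ := A'.exists_eq g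
    exact (congrArg f (hf' a b x)).trans (hf a b x)
  · intro g
    obtain ⟨z, a, b, x, rfl⟩ := A.exists_eq g
    rw [hf]
    obtain ⟨q, rfl⟩ := (S.F.obj z).proj_surjSubmersion.2 x
    exact right_cancel (A'.tgt_π_Ψ a b q) (A.tgt_π_Ψ a b q) ((A'.π_Ψ a b q).trans (A.π_Ψ a b q).symm)
  · intro l g
    obtain ⟨z, a, b, x, rfl⟩ := A.exists_eq g
    let l' : smoothCircle (S.F.obj z).base := ⟨fun _ => l, fun _ _ _ _ => contDiffAt_const⟩
    have h1 := A.sm_Ψ a b l' x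
    have h2 := A'.sm_Ψ a b l' x
    rw [← hf, h1, ← hf] at h2
    exact h2
  · intro g h w w'
    obtain ⟨z, a, b, c, x, rfl, rfl⟩ := A.exists_pair w
    rw [← m_eq w, ← m_eq w', A.m_Ψ]
    exact (hf a c x).trans (Eq.trans (A'.m_Ψ a b c x).symm (congrArg₂ _ (hf a b x).symm (hf b c x).symm))

/-- Transport along an isomorphism of central extensions. -/
def ofIso (A : S.Assoc E) (I : E.Iso E') : S.Assoc E' where
  Ψ a b := A.Ψ a b ≫ I.iso.hom
  src_Ψ a b x := by
    refine Eq.trans ?_ (A.src_Ψ a b x)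
    exact (E'.src_π _).symm.trans ((congrArg X.src (I.π_iso _)).trans (E.src_π _))
  tgt_Ψ a b x := by
    refine Eq.trans ?_ (A.tgt_Ψ a b x)
    exact (E'.tgt_π _).symm.trans ((congrArg X.tgt (I.π_iso _)).trans (E.tgt_π _))
  natural c a b x := congrArg I.iso.hom (A.natural c a b x)
  bijective a g h := by
    obtain ⟨b, hb, hb'⟩ := A.bijective a (g ≫ I.iso.inv) fun x => by
      refine Eq.trans ?_ (h x)
      refine (E.src_π _).symm.trans (Eq.trans ?_ (E'.src_π _))
      exact congrArg X.src ((I.π_iso _).symm.trans (congrArg E'.π (iso_hom_inv I.iso (g x))))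
    refine ⟨b, (Iso.eq_comp_inv _).1 hb, fun b' h' => hb' b' ((Iso.eq_comp_inv _).2 h')⟩
  m_Ψ a b c x := by
    have w : E.grpd.tgt (A.Ψ a b x) = E.grpd.src (A.Ψ b c x) := by rw [A.tgt_Ψ, A.src_Ψ]
    have w' : E'.grpd.tgt (I.iso.hom (A.Ψ a b x)) = E'.grpd.src (I.iso.hom (A.Ψ b c x)) := by
      rw [← E'.tgt_π, ← E'.src_π, I.π_iso, I.π_iso, E.tgt_π, E.src_π, w]
    have h := I.iso_mul _ _ w w'
    rw [← m_eq w, ← m_eq w', A.m_Ψ] at h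
    exact h.symm
  π_Ψ a b q := (congrArg (X.m · _) (I.π_iso _)).trans (A.π_Ψ a b q)
  sm_Ψ a b l x := (congrArg I.iso.hom (A.sm_Ψ a b l x)).trans (I.iso_smul _ _)

end Assoc

/-! ### Isomorphic gerbes have the same central extensions -/

section Transport

variable (I : S.toGerbe.Iso S'.toGerbe)

/-- The equivalence underlying an isomorphism of gerbes. -/
abbrev isoK : S.C ⥤ S'.C := I.K.toFunctor

/-- The 2-isomorphism underlying an isomorphism of gerbes. -/
abbrev isoκ : isoK I ⋙ S'.F ≅ S.F := (BasedNatTrans.forgetful _ _).mapIso I.κ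

/-- The 2-isomorphism lies over identities, so on bases it can only be the canonical identification.
This brings the compatibility with the bands into the form used by `isEquivalence_of_band`. -/
theorem isoκ_base (z : S.C) : (baseIso (isoκ I) z).hom = eqToHom (I.K.w_obj z) := by
  have h : (stack X).p.IsHomLift (𝟙 (S.F.obj z).base) (I.κ.hom.toNatTrans.app z) :=
    I.κ.hom.isHomLift' z
  have h1 := IsHomLift.fac' (stack X).p (𝟙 (S.F.obj z).base) (I.κ.hom.toNatTrans.app z)
  refine h1.trans ((congrArg (_ ≫ ·) (Category.id_comp _)).trans ?_)
  exact eqToHom_trans _ _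

/-- The image of the object defining the morphism from `M`. -/
abbrev isoδ : (isoK I).obj S.r₀ ⟶ S'.r₀ := (I.δ.hom.app (trivialBundle M)).left

instance : IsIso (isoδ I) :=
  ⟨(I.δ.inv.app (trivialBundle M)).left, congrArg CommaMorphism.left (I.δ.hom_inv_id_app _),
    congrArg CommaMorphism.left (I.δ.inv_hom_id_app _)⟩

theorem F_isoδ : S'.F.map (isoδ I) ≫ S'.θ (trivialBundle M) =
    (isoκ I).hom.app S.r₀ ≫ S.θ (trivialBundle M) :=
  CostructuredArrow.w (I.δ.hom.app (trivialBundle M))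

theorem isoK_gauge (z : S.C) (l : smoothCircle (S.F.obj z).base) :
    (isoK I).map (gauge z l) =
      gauge ((isoK I).obj z) (smoothCircle.pullback (baseIso (isoκ I) z).hom l) := by
  rw [isoκ_base]
  exact I.band z l

theorem F_isoK_comp {z : S.C} {z' : S'.C} (e : (isoK I).obj z ⟶ z') {a : z ⟶ S.r₀}
    {a' : z' ⟶ S'.r₀} (h : (isoK I).map a ≫ isoδ I = e ≫ a') :
    S'.F.map e ≫ tor a' = (isoκ I).hom.app z ≫ tor a := by
  rw [tor, ← Category.assoc, ← S'.F.map_comp, ← h, S'.F.map_comp, Category.assoc, F_isoδ,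
    ← Category.assoc, map_comp_κ, Category.assoc]

/-- Transport along an isomorphism of gerbes. -/
theorem exists_assoc_of_iso (I : S.toGerbe.Iso S'.toGerbe) (A : S.Assoc E) : Nonempty (S'.Assoc E) := by
  have hK : (isoK I).IsEquivalence := I.equivalence
  let e (z' : S'.C) : (isoK I).obj ((isoK I).objPreimage z') ≅ z' := (isoK I).objObjPreimageIso z'
  -- Arrows to the object `r₀` of the second gerbe correspond to arrows to `r₀` in the first,
  -- through a preimage of the source under the equivalence and the identification `isoδ` of the two
  -- objects.
  let pre {z' : S'.C} (a' : z' ⟶ S'.r₀) : (isoK I).objPreimage z' ⟶ S.r₀ :=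
    (isoK I).preimage ((e z').hom ≫ a' ≫ inv (isoδ I))
  have hpre {z' : S'.C} (a' : z' ⟶ S'.r₀) :
      (isoK I).map (pre a') ≫ isoδ I = (e z').hom ≫ a' := by
    simp only [pre, Functor.map_preimage, Category.assoc, IsIso.inv_hom_id, Category.comp_id]
  have pre_eq {z' : S'.C} {a' : z' ⟶ S'.r₀} {a : (isoK I).objPreimage z' ⟶ S.r₀}
      (h : (isoK I).map a ≫ isoδ I = (e z').hom ≫ a') : pre a' = a := by
    refine (isoK I).map_injective ((cancel_mono (isoδ I)).1 ?_)
    rw [hpre, h]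
  let pe (z' : S'.C) : (S'.F.obj z').base ≅ (S.F.obj ((isoK I).objPreimage z')).base :=
    (S'.F ⋙ (stack X).p).mapIso (e z').symm ≪≫ baseIso (isoκ I) _
  have hob {z' : S'.C} (a' : z' ⟶ S'.r₀) (x) : ob (pre a') ((pe z').hom x) = ob a' x := by
    have h := congrArg (fun φ => Hom.base φ (bs (e z').inv x)) (F_isoK_comp I _ (hpre a'))
    refine Eq.trans h.symm ?_
    change ob a' (bs (e z').hom (bs (e z').inv x)) = ob a' x
    rw [← comp_bs, Iso.inv_hom_id, bs, CategoryTheory.Functor.map_id]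
    rfl
  refine ⟨⟨fun {z'} a' b' => (pe z').hom ≫ A.Ψ (pre a') (pre b'), ?_, ?_, ?_, ?_, ?_, ?_, ?_⟩⟩
  · intro z' a' b' x
    exact (A.src_Ψ _ _ _).trans (hob a' x)
  · intro z' a' b' x
    exact (A.tgt_Ψ _ _ _).trans (hob b' x)
  · intro z z' c a b x
    let c₀ := (isoK I).preimage ((e z').hom ≫ c ≫ (e z).inv)
    have hc₀ : (isoK I).map c₀ ≫ (e z).hom = (e z').hom ≫ c := by
      simp only [c₀, Functor.map_preimage, Category.assoc, Iso.inv_hom_id, Category.comp_id]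
    have hp (a : z ⟶ S'.r₀) : pre (c ≫ a) = c₀ ≫ pre a := pre_eq (by
      rw [Functor.map_comp, Category.assoc, hpre, ← Category.assoc, hc₀, Category.assoc])
    have hx : bs c₀ ((pe z').hom x) = (pe z).hom (bs c x) := by
      refine (bs_map_apply (κ := isoκ I) c₀ (bs (e z').inv x)).symm.trans
        (congrArg (baseIso (isoκ I) _).hom ?_)
      refine (comp_bs _ _ x).symm.trans (Eq.trans ?_ (comp_bs c (e z).inv x))
      refine congrArg (fun f => bs f x) ?_
      rw [Iso.inv_comp_eq, ← Category.assoc, Iso.eq_comp_inv, hc₀]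
    change A.Ψ (pre (c ≫ a)) (pre (c ≫ b)) ((pe z').hom x) = A.Ψ (pre a) (pre b) ((pe z).hom (bs c x))
    rw [hp, hp, A.natural, hx]
  · intro z' a' g h
    obtain ⟨b, hb, hb'⟩ := A.bijective (pre a') ((pe z').inv ≫ g) fun x => by
      refine (h _).trans ((hob a' _).symm.trans ?_)
      exact congrArg (ob (pre a')) (iso_hom_inv (pe z') x)
    have hp : pre ((e z').inv ≫ (isoK I).map b ≫ isoδ I) = b := pre_eq (by
      rw [Iso.hom_inv_id_assoc])
    refine ⟨(e z').inv ≫ (isoK I).map b ≫ isoδ I, ?_, fun b₁ hb₁ => ?_⟩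
    · change (pe z').hom ≫ A.Ψ (pre a') (pre ((e z').inv ≫ (isoK I).map b ≫ isoδ I)) = g
      rw [hp, hb, Iso.hom_inv_id_assoc]
    · have h1 := hb' (pre b₁) ((Iso.eq_inv_comp _).2 hb₁)
      rw [← h1, hpre, Iso.inv_hom_id_assoc]
  · intro z' a b c x
    exact A.m_Ψ _ _ _ _
  · intro z' a b q
    let q₀ := Hom.total ((isoκ I).hom.app _) (Hom.total (S'.F.map (e z').inv) q)
    have hq₀ : (S.F.obj _).proj q₀ = (pe z').hom ((S'.F.obj z').proj q) := by
      refine (Hom.proj_tot _ _).trans ?_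
      exact congrArg (baseIso (isoκ I) _).hom (Hom.proj_tot _ _)
    have ht (a : z' ⟶ S'.r₀) : Hom.total (tor (pre a)) q₀ = Hom.total (tor a) q := by
      have h := congrArg (fun φ => Hom.total φ (Hom.total (S'.F.map (e z').inv) q))
        (F_isoK_comp I _ (hpre a))
      refine Eq.trans h.symm ?_
      change Hom.total (tor a) (Hom.total (S'.F.map (e z').hom) (Hom.total (S'.F.map (e z').inv) q)) = _
      rw [← comp_total, Iso.inv_hom_id, CategoryTheory.Functor.map_id]
      rfl
    have h := A.π_Ψ (pre a) (pre b) q₀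
    rw [ht, ht, hq₀] at h
    exact h
  · intro z' a b l x
    let l₀ : smoothCircle (S.F.obj ((isoK I).objPreimage z')).base :=
      smoothCircle.pullback (pe z').inv l
    have hp : pre (gauge z' l ≫ a) = gauge _ l₀ ≫ pre a := pre_eq (by
      rw [Functor.map_comp, isoK_gauge, Category.assoc, hpre, ← Category.assoc, ← Category.assoc]
      refine congrArg (· ≫ a) ?_
      refine Eq.trans ?_ (S'.band_natural (e z').hom l).symm
      refine congrArg (fun l => gauge _ l ≫ (e z').hom) ?_
      refine Subtype.ext (funext fun y => congrArg l.1 ?_)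
      exact congrArg (bs (e z').hom) (iso_inv_hom (baseIso (isoκ I) _) y))
    change A.Ψ (pre (gauge z' l ≫ a)) (pre b) ((pe z').hom x) = _
    rw [hp, A.sm_Ψ]
    refine congrArg (E.sm · _) ?_
    exact congrArg l.1 (iso_inv_hom (pe z') x)

end Transport

end StrictGerbe
end

noncomputable section

open TopologicalSpace Topology LieGroupoid LieTorsor CentralExtension

namespace StrictGerbe

variable {M : Mfd} {X : LieGroupoid M} {S : StrictGerbe X} {E : CentralExtension X}

/-! ### Transition functions -/

theorem bs_gauge (z : S.C) (l : smoothCircle (S.F.obj z).base) (x) : bs (gauge z l) x = x := by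
  rw [bs, F_gauge]; rfl

/-- The point of the torsor at which the trivialization given by an arrow to `r₀` is a unit. -/
def unitSec {w : S.C} (a : w ⟶ S.r₀) : (S.F.obj w).base ⟶ (S.F.obj w).total :=
  (Hom.exists_fibHom (tor a) (𝟙 _) (ob a ≫ X.one) fun _ => X.src_one _).choose

theorem proj_unitSec {w : S.C} (a : w ⟶ S.r₀) (v) : (S.F.obj w).proj (unitSec a v) = v :=
  (Hom.exists_fibHom (tor a) (𝟙 _) (ob a ≫ X.one) fun _ => X.src_one _).choose_spec.1 v

theorem tor_unitSec {w : S.C} (a : w ⟶ S.r₀) (v) : Hom.total (tor a) (unitSec a v) = X.one (ob a v) :=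
  (Hom.exists_fibHom (tor a) (𝟙 _) (ob a ≫ X.one) fun _ => X.src_one _).choose_spec.2 v

theorem eq_unitSec {w : S.C} (a : w ⟶ S.r₀) {v} {q : (S.F.obj w).total}
    (hq : (S.F.obj w).proj q = v) (hq' : Hom.total (tor a) q = X.one (ob a v)) : q = unitSec a v :=
  Hom.total_inj (tor a) (hq.trans (proj_unitSec a v).symm) (hq'.trans (tor_unitSec a v).symm)

theorem total_unitSec {t w : S.C} (d : t ⟶ w) (a : w ⟶ S.r₀) (x) :
    Hom.total (S.F.map d) (unitSec (d ≫ a) x) = unitSec a (bs d x) := by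
  refine eq_unitSec a ?_ ?_
  · rw [Hom.proj_tot, proj_unitSec]
  · have h := tor_unitSec (d ≫ a) x
    rw [tor_comp, ob_comp] at h
    exact h

namespace Assoc

variable (A : S.Assoc E)

theorem Ψ_self {z : S.C} (a : z ⟶ S.r₀) (x) : A.Ψ a a x = E.grpd.one (ob a x) := by
  have h := A.m_Ψ a a a x
  refine left_cancel (g := A.Ψ a a x) (by rw [A.tgt_Ψ, A.src_Ψ]) (by rw [A.tgt_Ψ, E.grpd.src_one]) ?_
  rw [h, m_one (A.tgt_Ψ a a x)]

/-- Applying the gauge to both members of a pair changes nothing, as it covers the identity of the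
base; so its effect on the second member is inverse to that on the first. -/
theorem Ψ_gauge {z : S.C} (a b : z ⟶ S.r₀) (l : smoothCircle (S.F.obj z).base) (x) :
    A.Ψ a (gauge z l ≫ b) x = E.sm (l.1 x)⁻¹ (A.Ψ a b x) := by
  have h := A.natural (gauge z l) a b x
  rw [A.sm_Ψ, bs, F_gauge] at h
  have h' : E.sm (l.1 x) (A.Ψ a (gauge z l ≫ b) x) = A.Ψ a b x := h
  rw [← h', sm_sm, inv_mul_cancel, one_sm]

/-- A torsor map preserves quotients, and the map given by `a` sends its own unit point to a unit;
what remains is the formula for the projection evaluated at the unit point of `b`. -/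
theorem π_Ψ_eq {z : S.C} (a b : z ⟶ S.r₀) (x) :
    E.π (A.Ψ a b x) = (S.F.obj z).div (unitSec a x) (unitSec b x) := by
  have e : (S.F.obj z).proj (unitSec a x) = (S.F.obj z).proj (unitSec b x) := by
    rw [proj_unitSec, proj_unitSec]
  rw [← Hom.div_total (tor a) e, tor_unitSec]
  have h := A.π_Ψ a b (unitSec b x)
  rw [proj_unitSec, tor_unitSec, m_one (by rw [E.tgt_π, A.tgt_Ψ])] at h
  rw [← h]
  have w : X.tgt (X.one (ob a x)) = X.src (E.π (A.Ψ a b x)) := by rw [X.tgt_one, E.src_π, A.src_Ψ]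
  refine eq_div (P := X.universalTorsor) w ?_
  rw [a_eq (P := X.universalTorsor) w]
  refine (m_eq w).symm.trans (one_m ?_)
  rw [E.src_π, A.src_Ψ]

/-- A third object over a single point maps to both spans. Cancelling `k'` shows that the second
legs agree there as well, and naturality gives the equality. -/
theorem Ψ_eq_of_span {z w w' : S.C} {k : w ⟶ z} {a : w ⟶ S.r₀} {k' : w' ⟶ z} {a' : w' ⟶ S.r₀}
    {t t₁ : S.C} {d : t ⟶ w} {d' : t ⟶ w'} (h : d ≫ k = d' ≫ k') {d₁ : t₁ ⟶ w} {d₁' : t₁ ⟶ w'}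
    (h₁ : d₁ ≫ k = d₁' ≫ k') {x x₁} (hx : bs d x = bs d₁ x₁) (hx' : bs d' x = bs d₁' x₁) :
    A.Ψ (d ≫ a) (d' ≫ a') x = A.Ψ (d₁ ≫ a) (d₁' ≫ a') x₁ := by
  obtain ⟨p, e, c, c₁, hc, hc₁, hcc⟩ := exists_span d d₁ (ptHom x) (ptHom x₁) (Mfd.hom_ext fun _ => hx)
  have h2 : c ≫ d' = c₁ ≫ d₁' := by
    refine lift_unique k' ?_ ?_
    · refine Mfd.hom_ext fun y => ?_
      rw [comp_bs, comp_bs, hc, hc₁]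
      exact hx'
    · rw [Category.assoc, Category.assoc, ← h, ← h₁, ← Category.assoc, hcc, Category.assoc]
  have hy : bs c (e.inv (0 : PUnit)) = x := by rw [hc]; rfl
  have hy₁ : bs c₁ (e.inv (0 : PUnit)) = x₁ := by rw [hc₁]; rfl
  rw [← hy, ← hy₁, ← A.natural, ← A.natural, ← Category.assoc, ← Category.assoc, hcc, h2,
    Category.assoc, Category.assoc]

variable {z z' w w' w'' : S.C} (k : w ⟶ z) (a : w ⟶ S.r₀) (k' : w' ⟶ z) (a' : w' ⟶ S.r₀)
  (k'' : w'' ⟶ z) (a'' : w'' ⟶ S.r₀)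

theorem exists_H {v v'} (h : bs k v = bs k' v') :
    ∃ g, ∀ (t : S.C) (d : t ⟶ w) (d' : t ⟶ w') (x), d ≫ k = d' ≫ k' → bs d x = v → bs d' x = v' →
      A.Ψ (d ≫ a) (d' ≫ a') x = g := by
  obtain ⟨t₁, d₁, d₁', x₁, h1, h2, h3⟩ := exists_span_pt k k' h
  exact ⟨A.Ψ (d₁ ≫ a) (d₁' ≫ a') x₁, fun t d d' x e hv hv' =>
    A.Ψ_eq_of_span e h3 (hv.trans h1.symm) (hv'.trans h2.symm)⟩

open Classical in
/-- The transition function between two local trivializations of an object of the gerbe. -/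
def H (v : (S.F.obj w).base) (v' : (S.F.obj w').base) : E.grpd.arr :=
  if h : bs k v = bs k' v' then (A.exists_H k a k' a' h).choose else E.grpd.one (ob a v)

variable {k a k' a' k'' a''}

theorem Ψ_eq_H {t : S.C} {d : t ⟶ w} {d' : t ⟶ w'} (h : d ≫ k = d' ≫ k') {x v v'}
    (hv : bs d x = v) (hv' : bs d' x = v') : A.Ψ (d ≫ a) (d' ≫ a') x = A.H k a k' a' v v' := by
  have e : bs k v = bs k' v' := by rw [← hv, ← hv', ← comp_bs, ← comp_bs, h]
  rw [H, dif_pos e]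
  exact (A.exists_H k a k' a' e).choose_spec t d d' x h hv hv'

/-- All three values are computed on one object lying over `w`, `w'` and `w''`, where the identity
is `(a, b)(b, c) = (a, c)`. -/
theorem H_m {v v' v''} (h : bs k v = bs k' v') (h' : bs k' v' = bs k'' v'') :
    E.grpd.m (A.H k a k' a' v v') (A.H k' a' k'' a'' v' v'') = A.H k a k'' a'' v v'' := by
  obtain ⟨t, d, d', x, rfl, rfl, e⟩ := exists_span_pt k k' h
  obtain ⟨t₁, c, c'', x₁, h1, rfl, e₁⟩ := exists_span_pt (d' ≫ k') k'' (v := x) (by rw [comp_bs]; exact h')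
  have e₂ : (c ≫ d) ≫ k = (c ≫ d') ≫ k' := by rw [Category.assoc, e, Category.assoc]
  have e₃ : (c ≫ d') ≫ k' = c'' ≫ k'' := by rw [Category.assoc, e₁]
  have hd : bs (c ≫ d) x₁ = bs d x := by rw [comp_bs, h1]
  have hd' : bs (c ≫ d') x₁ = bs d' x := by rw [comp_bs, h1]
  rw [← A.Ψ_eq_H e₂ hd hd', ← A.Ψ_eq_H e₃ hd' rfl, ← A.Ψ_eq_H (e₂.trans e₃) hd rfl, A.m_Ψ]

theorem H_comp (f : z ⟶ z') {v v'} (h : bs k v = bs k' v') :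
    A.H (k ≫ f) a (k' ≫ f) a' v v' = A.H k a k' a' v v' := by
  obtain ⟨t, d, d', x, rfl, rfl, e⟩ := exists_span_pt k k' h
  rw [← A.Ψ_eq_H e rfl rfl, ← A.Ψ_eq_H (by rw [← Category.assoc, e, Category.assoc]) rfl rfl]

/-- The gauge of `z` is moved across the span to the second leg by naturality of the band, and there
it acts on the second member of the pair. -/
theorem H_gauge (l : smoothCircle (S.F.obj z).base) {v v'} (h : bs k v = bs k' v') :
    A.H (k ≫ gauge z l) a k' a' v v' = E.sm (l.1 (bs k v))⁻¹ (A.H k a k' a' v v') := by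
  obtain ⟨t, d, d', x, rfl, rfl, e⟩ := exists_span_pt k k' h
  have e' : d ≫ k ≫ gauge z l = (gauge t (smoothCircle.pullback (bs (d ≫ k)) l) ≫ d') ≫ k' := by
    rw [Category.assoc, ← e, ← Category.assoc]
    exact S.band_natural (d ≫ k) l
  have hb : bs (gauge t (smoothCircle.pullback (bs (d ≫ k)) l) ≫ d') x = bs d' x := by
    rw [comp_bs, bs_gauge]
  rw [← A.Ψ_eq_H e rfl rfl, ← A.Ψ_eq_H e' rfl hb, Category.assoc, A.Ψ_gauge]
  exact congrArg (fun y => E.sm (l.1 y)⁻¹ _) (comp_bs d k x)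

/-- The two families form a span over the parameter manifold itself, and on it `H` is a value of
`Ψ`, which is a morphism of manifolds. -/
theorem smooth_H {T : Mfd} (v : T ⟶ (S.F.obj w).base) (v' : T ⟶ (S.F.obj w').base)
    (h : ∀ x, bs k (v x) = bs k' (v' x)) : Smooth fun x => A.H k a k' a' (v x) (v' x) := by
  obtain ⟨t, e, d, d', hd, hd', hdd⟩ := exists_span k k' v v' (Mfd.hom_ext h)
  have : (fun x => A.H k a k' a' (v x) (v' x)) = fun x => (e.inv ≫ A.Ψ (d ≫ a) (d' ≫ a')) x := by
    funext x
    refine (A.Ψ_eq_H hdd ?_ ?_).symm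
    · rw [hd]; exact congrArg v (iso_hom_inv e x)
    · rw [hd']; exact congrArg v' (iso_hom_inv e x)
  rw [this]
  exact smooth_coe _

theorem π_H {v v'} (h : bs k v = bs k' v') :
    E.π (A.H k a k' a' v v') = (S.F.obj z).div (Hom.total (S.F.map k) (unitSec a v))
      (Hom.total (S.F.map k') (unitSec a' v')) := by
  obtain ⟨t, d, d', x, rfl, rfl, e⟩ := exists_span_pt k k' h
  rw [← A.Ψ_eq_H e rfl rfl, A.π_Ψ_eq, ← total_unitSec, ← total_unitSec, ← comp_total, ← comp_total,
    ← e, Hom.div_total _ (by rw [proj_unitSec, proj_unitSec])]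

end Assoc

/-! ### The comparison functor -/

variable (S) in
/-- An object covering a given one, with an arrow to `r₀`. -/
abbrev ch (z : S.C) : S.C := (exists_chart z).choose

/-- The covering of an object. -/
abbrev ck (z : S.C) : S.ch z ⟶ z := (exists_chart z).choose_spec.choose

/-- The arrow from the covering of an object to `r₀`. -/
abbrev ca (z : S.C) : S.ch z ⟶ S.r₀ := (exists_chart z).choose_spec.choose_spec.choose

theorem isSurjSubmersion_ck (z : S.C) : IsSurjSubmersion (bs (ck z)) :=
  (exists_chart z).choose_spec.choose_spec.choose_spec

theorem proj_total_unitSec {w z : S.C} (k : w ⟶ z) (a : w ⟶ S.r₀) (v) :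
    (S.F.obj z).proj (Hom.total (S.F.map k) (unitSec a v)) = bs k v := by
  rw [Hom.proj_tot, proj_unitSec]

namespace Assoc

variable (A : S.Assoc E)

/-- The lifting given by an object of the gerbe. -/
abbrev lifting (z : S.C) : LiftDatum E where
  Q := S.F.obj z
  V := (S.F.obj (S.ch z)).base
  σ := unitSec (ca z) ≫ Hom.total (S.F.map (ck z))
  surj := by
    have : (unitSec (ca z) ≫ Hom.total (S.F.map (ck z))) ≫ (S.F.obj z).proj = bs (ck z) :=
      Mfd.hom_ext fun v => proj_total_unitSec (ck z) (ca z) v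
    rw [this]
    exact isSurjSubmersion_ck z
  c v v' := A.H (ck z) (ca z) (ck z) (ca z) v v'
  π_c v v' h := A.π_H ((proj_total_unitSec _ _ v).symm.trans (h.trans (proj_total_unitSec _ _ v')))
  c_c v v' v'' h h' :=
    A.H_m ((proj_total_unitSec _ _ v).symm.trans (h.trans (proj_total_unitSec _ _ v')))
      ((proj_total_unitSec _ _ v').symm.trans (h'.trans (proj_total_unitSec _ _ v'')))
  smooth_c T u u' h := A.smooth_H u u' fun x =>
    (proj_total_unitSec _ _ (u x)).symm.trans ((h x).trans (proj_total_unitSec _ _ (u' x)))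

theorem lifting_q (z : S.C) (v : (A.lifting z).V) : (A.lifting z).q v = bs (ck z) v :=
  proj_total_unitSec _ _ v

theorem lifting_w {z z' : S.C} {f : z ⟶ z'} {v : (A.lifting z).V} {v' : (A.lifting z').V}
    (h : bs f ((A.lifting z).q v) = (A.lifting z').q v') : bs (ck z ≫ f) v = bs (ck z') v' := by
  rw [comp_bs, ← A.lifting_q, ← A.lifting_q, h]

/-- The arrow of liftings given by an arrow of the gerbe. -/
def liftingMap {z z' : S.C} (f : z ⟶ z') : A.lifting z ⟶ A.lifting z' where
  φ := S.F.map f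
  h v v' _ := A.H (ck z ≫ f) (ca z) (ck z') (ca z') v v'
  π_h v v' h := by
    rw [A.π_H (A.lifting_w h), comp_total]; rfl
  c_h v₁ v v' h h₁ e := by
    have e' : bs (ck z) v₁ = bs (ck z) v := by rw [← A.lifting_q, ← A.lifting_q, e]
    refine (congrArg (E.grpd.m · _) (A.H_comp f e').symm).trans ?_
    exact A.H_m (by rw [comp_bs, comp_bs, e']) (A.lifting_w h)
  h_c v v' v₁' h h₁ e := by
    have e' : bs (ck z') v' = bs (ck z') v₁' := by rw [← A.lifting_q, ← A.lifting_q, e]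
    exact A.H_m (A.lifting_w h) e'
  smooth_h T u u' h := A.smooth_H u u' fun x => A.lifting_w (h x)

/-- The comparison of a gerbe with the gerbe of liftings. -/
abbrev functor : S.C ⥤ LiftDatum E where
  obj := A.lifting
  map f := A.liftingMap f
  map_id z := LiftDatum.hom_ext (S.F.map_id z) fun v v' h h' => by
    change A.H (ck z ≫ 𝟙 z) _ _ _ v v' = A.H (ck z) _ _ _ v v'
    rw [Category.comp_id]
  map_comp {z z' z''} f g := LiftDatum.hom_ext (S.F.map_comp f g) fun v v'' h h' => by
    obtain ⟨v', hv'⟩ := (A.lifting z').exists_q (bs f ((A.lifting z).q v))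
    have h₂ : bs g ((A.lifting z').q v') = (A.lifting z'').q v'' := by
      rw [hv', ← comp_bs]; exact h
    refine Eq.trans ?_ (LiftDatum.comp_h (A.liftingMap f) (A.liftingMap g) v' h' hv'.symm h₂).symm
    refine Eq.trans ?_ (congrArg (E.grpd.m · _) (A.H_comp g (A.lifting_w hv'.symm)))
    have h3 := A.lifting_w h
    have h4 := A.lifting_w h₂
    have h5 : bs (ck z ≫ f ≫ g) v = bs (ck z' ≫ g) v' := h3.trans h4.symm
    have := A.H_m (a := ca z) (a' := ca z') (a'' := ca z'') h5 h4
    rw [← Category.assoc] at this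
    exact (congrArg (fun k => A.H k _ _ _ _ _) (Category.assoc _ _ _).symm).trans this.symm

end Assoc
end StrictGerbe
end

noncomputable section

open TopologicalSpace Topology LieGroupoid LieTorsor CentralExtension

namespace StrictGerbe

variable {M : Mfd} {X : LieGroupoid M} {S : StrictGerbe X} {E : CentralExtension X}

/-! ### Comparison of the trivializations -/

section Charts

variable (S) (B : CostructuredArrow CircleBundle.toMfd M)

/-- The pullback of a circle bundle to its total space, trivialized. -/
abbrev bundleChart : CostructuredArrow CircleBundle.toMfd M :=
  CostructuredArrow.mk (S := CircleBundle.toMfd) (Y := CircleBundle.triv B.left.total)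
    (B.left.proj ≫ B.hom)

/-- The map of the trivialized pullback of a circle bundle to the bundle. -/
abbrev bundleChartMap : bundleChart B ⟶ B := secMap (𝟙 _) rfl

/-- The map of the trivialized pullback of a circle bundle to the trivial bundle. -/
abbrev bundleChartTriv : bundleChart B ⟶ trivialBundle M :=
  secMap (B := trivialBundle M) ((B.left.proj ≫ B.hom) ≫ sec M) rfl

/-- The covering of the object given by a circle bundle by the total space of the bundle. -/
abbrev bk : S.Θ (bundleChart B) ⟶ S.Θ B := S.Θmap (bundleChartMap B)

/-- The arrow of the covering by the total space of a circle bundle to `r₀`. -/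
abbrev ba : S.Θ (bundleChart B) ⟶ S.r₀ := S.Θmap (bundleChartTriv B)

/-- The point of the covering given by a point of a circle bundle. -/
abbrev bp (p : B.left.total) : (S.F.obj (S.Θ (bundleChart B))).base := (S.bb (bundleChart B)).inv p

theorem bb_bk (p : B.left.total) : (S.bb B).hom (bs (S.bk B) (S.bp B p)) = B.left.proj p := by
  refine (ConcreteCategory.congr_hom (S.bs_Θmap (bundleChartMap B)) _).trans ?_
  exact congrArg B.left.proj (iso_hom_inv (S.bb (bundleChart B)) p)

theorem bk_eq_iff {z : S.C} {k : z ⟶ S.Θ B} {v} {p : B.left.total} :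
    bs k v = bs (S.bk B) (S.bp B p) ↔ (S.bb B).hom (bs k v) = B.left.proj p := by
  rw [← bb_bk]
  exact ⟨fun h => congrArg _ h, fun h => (iso_inv_hom (S.bb B) _).symm.trans
    ((congrArg (S.bb B).inv h).trans (iso_inv_hom (S.bb B) _))⟩

theorem ob_ba (p : B.left.total) : ob (S.ba B) (S.bp B p) = B.hom (B.left.proj p) := by
  rw [ob_eq]
  refine (ConcreteCategory.congr_hom (S.bs_Θmap (bundleChartTriv B)) _).trans ?_
  exact congrArg (fun p => B.hom (B.left.proj p)) (iso_hom_inv (S.bb (bundleChart B)) p)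

theorem θ_unitSec (p : B.left.total) :
    Hom.total (S.θ B) (Hom.total (S.F.map (S.bk B)) (unitSec (S.ba B) (S.bp B p))) =
      X.one (B.hom (B.left.proj p)) := by
  have h := tor_unitSec (S.ba B) (S.bp B p)
  rw [ob_ba, tor, S.F_Θmap, ← S.F_Θmap (bundleChartMap B)] at h
  exact h

theorem exists_torsorMap : ∃ φ : S.F.obj (S.Θ B) ⟶ X.universalTorsor.pullback B.hom,
    Hom.base φ = (S.bb B).hom ∧ φ ≫ X.universalTorsor.pullbackHom B.hom = S.θ B :=
  LieTorsor.exists_lift (S.θ B) (X.universalTorsor.pullbackHom B.hom) (S.bb B).hom (S.bb_comp B).symm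

/-- The comparison of the torsors given by a circle bundle. -/
def torsorMap : S.F.obj (S.Θ B) ⟶ X.universalTorsor.pullback B.hom := (S.exists_torsorMap B).choose

theorem torsorMap_base : Hom.base (S.torsorMap B) = (S.bb B).hom :=
  (S.exists_torsorMap B).choose_spec.1

theorem torsorMap_comp : S.torsorMap B ≫ X.universalTorsor.pullbackHom B.hom = S.θ B :=
  (S.exists_torsorMap B).choose_spec.2

theorem torsorMap_unitSec (p : B.left.total) :
    Hom.total (S.torsorMap B) (Hom.total (S.F.map (S.bk B)) (unitSec (S.ba B) (S.bp B p))) =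
      (LiftDatum.ofBundle E X.universalTorsor X.one X.src_one B.left B.hom).σ p := by
  refine Hom.total_inj (X.universalTorsor.pullbackHom B.hom) ?_ ?_
  · refine (Hom.proj_tot _ _).trans ?_
    rw [proj_total_unitSec, torsorMap_base]
    exact S.bb_bk B p
  · refine Eq.trans ?_ (S.θ_unitSec B p)
    exact congrArg (fun φ => Hom.total φ _) (S.torsorMap_comp B)

end Charts

namespace Assoc

variable (A : S.Assoc E) {B B' : CostructuredArrow CircleBundle.toMfd M}

/-- This computes the transition functions of the objects given by circle bundles, and so identifies
their liftings with the standard ones. It is a calculation over one point, where everything comes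
from maps of trivial bundles. -/
theorem H_bundle (f : B ⟶ B') {p : B.left.total} {p' : B'.left.total}
    (h : CircleBundle.Hom.base f.left (B.left.proj p) = B'.left.proj p') :
    A.H (S.bk B ≫ S.Θmap f) (S.ba B) (S.bk B') (S.ba B') (S.bp B p) (S.bp B' p') =
      E.sm (B'.left.principal.quo (CircleBundle.Hom.total f.left p) p')
        (E.grpd.one (B.hom (B.left.proj p))) := by
  have h₀ : B'.left.proj p' = B'.left.proj (CircleBundle.Hom.total f.left p) :=
    h.symm.trans (CircleBundle.Hom.proj_total f.left p).symm
  have hm : B'.hom (B'.left.proj p') = B.hom (B.left.proj p) := by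
    rw [← h]; exact ConcreteCategory.congr_hom (CostructuredArrow.w f) (B.left.proj p)
  -- Rotation by `ζ` carries `p'` to the image of `p`. With it built into `d'`, the two legs agree
  -- in `B'`, while their maps to the trivial bundle over `M` differ by `ζ`; this difference is the
  -- transition function.
  let ζ := B'.left.principal.quo p' (CircleBundle.Hom.total f.left p)
  let P : CostructuredArrow CircleBundle.toMfd M := CostructuredArrow.mk (S := CircleBundle.toMfd)
    (Y := CircleBundle.triv pt) (ptHom (B.hom (B.left.proj p)))
  let d : P ⟶ bundleChart B := secMap (ptHom (sec B.left.total p)) rfl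
  let d' : P ⟶ bundleChart B' := secMap
    (ptHom ((bundleChart B').left.principal.smul ζ (sec B'.left.total p')))
    (Mfd.hom_ext fun _ => hm)
  let l : smoothCircle pt := ⟨fun _ => ζ, fun _ _ _ _ => contDiffAt_const⟩
  have e₁ (x) : CircleBundle.Hom.total d.left (sec pt x) = sec B.left.total p :=
    CircleBundle.ofSec_sec _ x
  have e₂ (x) : CircleBundle.Hom.total d'.left (sec pt x) =
      (bundleChart B').left.principal.smul ζ (sec B'.left.total p') := CircleBundle.ofSec_sec _ x
  have e₃ (B : CostructuredArrow CircleBundle.toMfd M) (p : B.left.total) :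
      CircleBundle.Hom.total (bundleChartMap B).left (sec B.left.total p) = p :=
    CircleBundle.ofSec_sec _ p
  have e₄ (B : CostructuredArrow CircleBundle.toMfd M) (p : B.left.total) :
      CircleBundle.Hom.total (bundleChartTriv B).left (sec B.left.total p) =
        sec M (B.hom (B.left.proj p)) := CircleBundle.ofSec_sec _ p
  have h1 : d ≫ bundleChartMap B ≫ f = d' ≫ bundleChartMap B' := by
    refine CommaMorphism.ext (CircleBundle.hom_ext_sec fun x => ?_) (Subsingleton.elim _ _)
    change CircleBundle.Hom.total f.left (CircleBundle.Hom.total (bundleChartMap B).left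
      (CircleBundle.Hom.total d.left (sec pt x))) = CircleBundle.Hom.total (bundleChartMap B').left
        (CircleBundle.Hom.total d'.left (sec pt x))
    refine (congrArg (fun y => CircleBundle.Hom.total f.left
      (CircleBundle.Hom.total (bundleChartMap B).left y)) (e₁ x)).trans ?_
    refine (congrArg (CircleBundle.Hom.total f.left) (e₃ B p)).trans ?_
    refine Eq.trans ?_ (congrArg (CircleBundle.Hom.total (bundleChartMap B').left) (e₂ x)).symm
    refine Eq.trans ?_ (CircleBundle.Hom.total_smul (bundleChartMap B').left _ _).symm
    refine Eq.trans ?_ (congrArg (B'.left.principal.smul ζ) (e₃ B' p')).symm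
    exact (B'.left.principal.quo_smul h₀).symm
  have h2 : d' ≫ bundleChartTriv B' = circleTimes.gauge P l ≫ d ≫ bundleChartTriv B := by
    refine CommaMorphism.ext (CircleBundle.hom_ext_sec fun x => ?_) (Subsingleton.elim _ _)
    change CircleBundle.Hom.total (bundleChartTriv B').left
      (CircleBundle.Hom.total d'.left (sec pt x)) = CircleBundle.Hom.total (d ≫ bundleChartTriv B).left
        ((CircleBundle.triv pt).principal.smul ζ (sec pt x))
    refine (congrArg (CircleBundle.Hom.total (bundleChartTriv B').left) (e₂ x)).trans ?_
    refine (CircleBundle.Hom.total_smul (bundleChartTriv B').left _ _).trans ?_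
    refine Eq.trans ?_ (CircleBundle.Hom.total_smul (d ≫ bundleChartTriv B).left _ _).symm
    refine congrArg ((CircleBundle.triv M).principal.smul ζ) ((e₄ B' p').trans ?_)
    refine Eq.trans (congrArg (sec M) hm) (Eq.trans (e₄ B p).symm ?_)
    exact congrArg (CircleBundle.Hom.total (bundleChartTriv B).left) (e₁ x).symm
  have k1 : S.Θmap d ≫ S.bk B ≫ S.Θmap f = S.Θmap d' ≫ S.bk B' := by
    rw [← S.Θmap_comp, ← S.Θmap_comp, ← S.Θmap_comp, h1]
  have k2 : S.Θmap d' ≫ S.ba B' =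
      gauge (S.Θ P) (smoothCircle.pullback (S.bb P).hom l) ≫ S.Θmap d ≫ S.ba B := by
    rw [← S.Θmap_gauge, ← S.Θmap_comp, ← S.Θmap_comp, ← S.Θmap_comp, h2]
  let x : (S.F.obj (S.Θ P)).base := (S.bb P).inv (0 : PUnit)
  have hx : bs (S.Θmap d) x = S.bp B p :=
    (iso_inv_hom (S.bb (bundleChart B)) _).symm.trans
      (congrArg (S.bb (bundleChart B)).inv (ConcreteCategory.congr_hom (S.bs_Θmap d) x))
  have hx' : bs (S.Θmap d') x = S.bp B' p' :=
    (iso_inv_hom (S.bb (bundleChart B')) _).symm.trans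
      (congrArg (S.bb (bundleChart B')).inv (ConcreteCategory.congr_hom (S.bs_Θmap d') x))
  rw [← A.Ψ_eq_H k1 hx hx', k2, A.Ψ_gauge, A.Ψ_self, ob_comp]
  have hζ : ζ⁻¹ = B'.left.principal.quo (CircleBundle.Hom.total f.left p) p' := by
    have := B'.left.principal.quo_mul_quo h₀ h₀.symm
    rw [B'.left.principal.quo_self] at this
    exact inv_eq_of_mul_eq_one_right this
  have ho : (bs (S.Θmap d) ≫ ob (S.ba B)) x = B.hom (B.left.proj p) :=
    (congrArg (ob (S.ba B)) hx).trans (S.ob_ba B p)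
  rw [ho, ← hζ]
  rfl

theorem trivMap_w {v : (A.lifting (S.Θ B)).V} {p : B.left.total}
    (h : Hom.base (S.torsorMap B) ((A.lifting (S.Θ B)).q v) = B.left.proj p) :
    bs (ck (S.Θ B)) v = bs (S.bk B) (S.bp B p) := by
  rw [bk_eq_iff, ← A.lifting_q, ← torsorMap_base]
  exact h

/-- The comparison of the liftings given by a circle bundle. -/
def trivMap (B : CostructuredArrow CircleBundle.toMfd M) :
    A.lifting (S.Θ B) ⟶ LiftDatum.ofBundle E X.universalTorsor X.one X.src_one B.left B.hom where
  φ := S.torsorMap B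
  h v p _ := A.H (ck (S.Θ B)) (ca (S.Θ B)) (S.bk B) (S.ba B) v (S.bp B p)
  π_h v p h := by
    have h' := A.trivMap_w h
    rw [A.π_H h', ← S.torsorMap_unitSec (E := E) B p]
    exact (Hom.div_total (S.torsorMap B)
      (by rw [proj_total_unitSec, proj_total_unitSec, h'])).symm
  c_h v₁ v p h h₁ e := by
    have e' : bs (ck (S.Θ B)) v₁ = bs (ck (S.Θ B)) v := by rw [← A.lifting_q, ← A.lifting_q, e]
    exact A.H_m e' (A.trivMap_w h)
  h_c v p p₁ h h₁ e := by
    have e' : CircleBundle.Hom.base (CommaMorphism.left (𝟙 B)) (B.left.proj p) = B.left.proj p₁ := e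
    have h1 := A.H_bundle (𝟙 B) e'
    have h2 : S.bk B ≫ S.Θmap (𝟙 B) = S.bk B := by
      rw [← S.Θmap_comp, Category.comp_id]
    rw [h2] at h1
    have h3 : bs (S.bk B) (S.bp B p) = bs (S.bk B) (S.bp B p₁) := by
      rw [bk_eq_iff, bb_bk]; exact e
    have h4 := A.H_m (a := ca (S.Θ B)) (a' := S.ba B) (a'' := S.ba B) (A.trivMap_w h) h3
    rw [h1] at h4
    refine Eq.trans ?_ h4
    exact congrArg (fun y => E.grpd.m _ (E.sm _ (E.grpd.one y))) (X.tgt_one _)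
  smooth_h T u u' h := A.smooth_H u (u' ≫ (S.bb (bundleChart B)).inv) fun x => A.trivMap_w (h x)

/-- Evaluated through suitable intermediate points, both composites are the transition function from
the chart of `S.Θ B`, followed by `S.Θmap f`, to the chart of the total space of `B'`. -/
theorem trivMap_natural (f : B ⟶ B') :
    A.liftingMap (S.Θmap f) ≫ A.trivMap B' = A.trivMap B ≫ LiftDatum.ofBundleMap E X.universalTorsor
      X.one X.src_one f.left (CostructuredArrow.w f) := by
  have hφ : S.F.map (S.Θmap f) ≫ S.torsorMap B' = S.torsorMap B ≫
      X.universalTorsor.pullbackMap B.hom B'.hom (CircleBundle.Hom.base f.left) (CostructuredArrow.w f) := by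
    refine LieTorsor.lift_unique (X.universalTorsor.pullbackHom B'.hom) ?_ ?_
    · rw [LieTorsor.comp_base, LieTorsor.comp_base, torsorMap_base, torsorMap_base]
      exact S.bs_Θmap f
    · rw [Category.assoc, torsorMap_comp, S.F_Θmap, ← S.torsorMap_comp B]
      exact LieTorsor.hom_ext
        (congrArg (Hom.base (S.torsorMap B) ≫ ·) (CostructuredArrow.w f).symm) rfl
  refine LiftDatum.hom_ext hφ fun v p' h h' => ?_
  obtain ⟨v', hv'⟩ := (A.lifting (S.Θ B')).exists_q (bs (S.Θmap f) ((A.lifting (S.Θ B)).q v))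
  obtain ⟨p, hp⟩ := B.left.principal.surjSubmersion.2 (Hom.base (S.torsorMap B) ((A.lifting (S.Θ B)).q v))
  have w₁ : Hom.base (S.torsorMap B') ((A.lifting (S.Θ B')).q v') = B'.left.proj p' :=
    (congrArg (Hom.base (S.torsorMap B')) hv').trans h
  have w₂ : CircleBundle.Hom.base f.left (B.left.proj p) = B'.left.proj p' :=
    (congrArg (CircleBundle.Hom.base f.left) hp).trans h'
  refine (LiftDatum.comp_h (A.liftingMap (S.Θmap f)) (A.trivMap B') v' h hv'.symm w₁).trans ?_
  refine Eq.trans ?_ (LiftDatum.comp_h (A.trivMap B) (LiftDatum.ofBundleMap E X.universalTorsor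
      X.one X.src_one f.left (CostructuredArrow.w f)) p h' hp.symm w₂).symm
  refine (A.H_m (A.lifting_w hv'.symm) (A.trivMap_w w₁)).trans ?_
  have h1 := A.trivMap_w hp.symm
  refine Eq.trans ?_ (congrArg₂ E.grpd.m (A.H_comp (S.Θmap f) h1)
    ((A.H_bundle f w₂).trans (congrArg (fun y => E.sm _ (E.grpd.one y)) (X.tgt_one _).symm)))
  refine (A.H_m ?_ ?_).symm
  · rw [comp_bs, comp_bs, h1]
  · rw [bk_eq_iff]
    refine (congrArg (S.bb B').hom (comp_bs _ _ _)).trans ?_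
    refine (ConcreteCategory.congr_hom (S.bs_Θmap f) _).trans ?_
    exact (congrArg (CircleBundle.Hom.base f.left) (S.bb_bk B p)).trans w₂

/-- The comparison of a gerbe with the gerbe of liftings, over manifolds. -/
abbrev basedFunctor : total.stk S.F ⥤ᵇ LiftDatum.stk E := ⟨A.functor, rfl⟩

theorem functor_gauge (z : S.C) (l : smoothCircle (S.F.obj z).base) :
    A.liftingMap (gauge z l) = LiftDatum.gauge (A.lifting z) l :=
  LiftDatum.hom_ext (F_gauge z l) fun v v' h h' => by
    have e : bs (ck z) v = bs (ck z) v' := by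
      rw [← A.lifting_q, ← A.lifting_q]; exact h'
    refine (A.H_gauge l e).trans ?_
    exact congrArg (fun y => E.sm (l.1 y)⁻¹ _) (A.lifting_q z v).symm

theorem functor_isEquivalence : A.functor.IsEquivalence :=
  isEquivalence_of_band (S := S) (S' := E.strict) (K := A.functor)
    (κ := NatIso.ofComponents (fun z => Iso.refl (S.F.obj z)) fun f =>
      (Category.comp_id _).trans (Category.id_comp _).symm)
    fun z l => A.functor_gauge z l

/-- The comparison lies over the stack of torsors. -/
def basedIso : A.basedFunctor.comp (LiftDatum.toTorsors E) ≅ total.map S.F :=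
  BasedNatIso.mkNatIso (NatIso.ofComponents (fun z => Iso.refl (S.F.obj z)) fun f =>
      (Category.comp_id _).trans (Category.id_comp _).symm)
    fun z => (isHomLift_iff (stack X).p _ _).2 rfl

theorem isIso_trivMap (B : CostructuredArrow CircleBundle.toMfd M) : IsIso (A.trivMap B) := by
  refine isIso_of_isIso_bs (S := E.strict) (A.trivMap B) ?_
  change IsIso (Hom.base (S.torsorMap B))
  rw [torsorMap_base]
  exact inferInstanceAs (IsIso (S.bb B).hom)

/-- A gerbe with its central extension is isomorphic to the gerbe of liftings. -/
def gerbeIso : S.toGerbe.Iso E.gerbe where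
  K := A.basedFunctor
  equivalence := A.functor_isEquivalence
  κ := A.basedIso
  band z l := A.functor_gauge z l
  δ := NatIso.ofComponents (fun B =>
    CostructuredArrow.isoMk (@asIso _ _ _ _ (A.trivMap B) (A.isIso_trivMap B))
      ((S.torsorMap_comp B).trans (Category.id_comp _).symm))
    fun {B B'} f => CommaMorphism.ext (A.trivMap_natural f) (Subsingleton.elim _ _)
  δ_base B := by
    refine IsHomLift.of_fac' (LiftDatum.stk E).p _ _
      (restriction_base_eq (F := total.map S.F) (x := X.universalTorsor) S.triv B) rfl ?_
    refine (S.torsorMap_base B).trans ?_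
    exact ((Category.id_comp _).trans (Category.comp_id _)).symm

end Assoc
end StrictGerbe
end

noncomputable section

open TopologicalSpace Topology LieGroupoid LieTorsor CentralExtension

namespace StrictGerbe

variable {M : Mfd} {X : LieGroupoid M}

/-! ### The central extension given by a representing object -/

/-- An object representing pairs of arrows to `r₀`, with its projection to the groupoid and its
action of the circle. -/
structure Rep (S : StrictGerbe X) where
  t : S.C
  a : t ⟶ S.r₀
  b : t ⟶ S.r₀
  univ : ∀ {z : S.C} (a' b' : z ⟶ S.r₀), ∃! c : z ⟶ t, c ≫ a = a' ∧ c ≫ b = b'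
  π : (S.F.obj t).base ⟶ X.arr
  tgt_π : ∀ x, X.tgt (π x) = ob b x
  m_π : ∀ q, X.m (π ((S.F.obj t).proj q)) (Hom.total (tor b) q) = Hom.total (tor a) q
  principal : PrincipalCircle π
  sm : ∀ {z : S.C} (c : z ⟶ t) (l : smoothCircle (S.F.obj z).base), ∃ c' : z ⟶ t,
    (∀ x, bs c' x = principal.smul (l.1 x) (bs c x)) ∧ c' ≫ a = gauge z l ≫ c ≫ a ∧ c' ≫ b = c ≫ b

namespace Rep

variable {S : StrictGerbe X} (D : S.Rep)

/-- The space of pairs of arrows to `r₀`. -/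
abbrev R : Mfd := (S.F.obj D.t).base

variable {z z' : S.C}

/-- The arrow to the representing object given by a pair of arrows to `r₀`. -/
def cls (a b : z ⟶ S.r₀) : z ⟶ D.t := (D.univ a b).choose

theorem cls_a (a b : z ⟶ S.r₀) : D.cls a b ≫ D.a = a := (D.univ a b).choose_spec.1.1

theorem cls_b (a b : z ⟶ S.r₀) : D.cls a b ≫ D.b = b := (D.univ a b).choose_spec.1.2

theorem eq_cls {a b : z ⟶ S.r₀} {c : z ⟶ D.t} (ha : c ≫ D.a = a) (hb : c ≫ D.b = b) :
    c = D.cls a b := (D.univ a b).choose_spec.2 c ⟨ha, hb⟩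

/-- The map to the space of pairs. -/
def Ψ (a b : z ⟶ S.r₀) : (S.F.obj z).base ⟶ D.R := bs (D.cls a b)

theorem Ψ_natural (c : z' ⟶ z) (a b : z ⟶ S.r₀) (x) :
    D.Ψ (c ≫ a) (c ≫ b) x = D.Ψ a b (bs c x) := by
  have : c ≫ D.cls a b = D.cls (c ≫ a) (c ≫ b) :=
    D.eq_cls (by rw [Category.assoc, cls_a]) (by rw [Category.assoc, cls_b])
  rw [Ψ, ← this, comp_bs]
  rfl

theorem src_Ψ (a b : z ⟶ S.r₀) (x) : ob D.a (D.Ψ a b x) = ob a x := by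
  have := ob_comp (D.cls a b) D.a
  rw [D.cls_a] at this
  exact (ConcreteCategory.congr_hom this x).symm

theorem tgt_Ψ (a b : z ⟶ S.r₀) (x) : ob D.b (D.Ψ a b x) = ob b x := by
  have := ob_comp (D.cls a b) D.b
  rw [D.cls_b] at this
  exact (ConcreteCategory.congr_hom this x).symm

/-- An arrow to the representing object is determined by its map of bases and its composite with the
first projection, because arrows are cartesian. -/
theorem existsUnique_Ψ (a : z ⟶ S.r₀) (g : (S.F.obj z).base ⟶ D.R) (h : ∀ x, ob D.a (g x) = ob a x) :
    ∃! b, D.Ψ a b = g := by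
  obtain ⟨c, hc, hca⟩ := exists_lift a D.a g (Assoc.ob_eq_iff.2 (Mfd.hom_ext fun x => (h x).symm))
  refine ⟨c ≫ D.b, ?_, fun b hb => ?_⟩
  · change D.Ψ a (c ≫ D.b) = g
    rw [Ψ, ← D.eq_cls hca rfl, hc]
  · have : D.cls a b = c := lift_unique D.a (hb.trans hc.symm) ((D.cls_a a b).trans hca.symm)
    rw [← this, D.cls_b]

theorem exists_Ψ {T : Mfd} (g : T ⟶ D.R) :
    ∃ (z : S.C) (e : (S.F.obj z).base ≅ T) (a b : z ⟶ S.r₀), D.Ψ a b = e.hom ≫ g := by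
  obtain ⟨z, d, e, hd⟩ := exists_restrict D.t g
  exact ⟨z, e, d ≫ D.a, d ≫ D.b, by rw [Ψ, ← D.eq_cls rfl rfl, hd]⟩

theorem exists_Ψ_Ψ {T : Mfd} (g h : T ⟶ D.R) (w : ∀ x, ob D.b (g x) = ob D.a (h x)) :
    ∃ (z : S.C) (e : (S.F.obj z).base ≅ T) (a b c : z ⟶ S.r₀), D.Ψ a b = e.hom ≫ g ∧
      D.Ψ b c = e.hom ≫ h := by
  obtain ⟨z, e, a, b, hab⟩ := D.exists_Ψ g
  obtain ⟨c, hc, -⟩ := D.existsUnique_Ψ b (e.hom ≫ h) fun x => by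
    rw [← D.tgt_Ψ a, hab]
    exact (w (e.hom x)).symm
  exact ⟨z, e, a, b, c, hab, hc⟩

/-- This makes the product of pairs well defined. Equality of the first values allows `(a, b)` and
`(a', b')` to be restricted to one pair over a point; there `c` and `c'` are determined by the
second value. -/
theorem Ψ_congr {a b c : z ⟶ S.r₀} {a' b' c' : z' ⟶ S.r₀} {x x'} (h : D.Ψ a b x = D.Ψ a' b' x')
    (h' : D.Ψ b c x = D.Ψ b' c' x') : D.Ψ a c x = D.Ψ a' c' x' := by
  obtain ⟨p, e, d, d', hd, hd', hdd⟩ := exists_span (D.cls a b) (D.cls a' b') (ptHom x) (ptHom x')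
    (Mfd.hom_ext fun _ => h)
  have ha : d ≫ a = d' ≫ a' := by
    have := congrArg (· ≫ D.a) hdd
    simpa only [Category.assoc, cls_a] using this
  have hb : d ≫ b = d' ≫ b' := by
    have := congrArg (· ≫ D.b) hdd
    simpa only [Category.assoc, cls_b] using this
  have hy (y) : bs d y = x := by rw [hd]; rfl
  have hy' (y) : bs d' y = x' := by rw [hd']; rfl
  have hc : d ≫ c = d' ≫ c' := by
    refine (D.existsUnique_Ψ (d ≫ b) (D.Ψ (d ≫ b) (d ≫ c)) fun x => D.src_Ψ _ _ x).unique rfl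
      (Mfd.hom_ext fun y => ?_)
    rw [D.Ψ_natural, hy, h', hb, D.Ψ_natural, hy']
  let y : (S.F.obj p).base := e.inv (0 : PUnit)
  rw [← hy y, ← hy' y, ← D.Ψ_natural, ← D.Ψ_natural, ha, hc]

theorem exists_pair {g h : D.R} (w : ob D.b g = ob D.a h) : ∃ (z : S.C) (a b c : z ⟶ S.r₀)
    (x : (S.F.obj z).base), D.Ψ a b x = g ∧ D.Ψ b c x = h := by
  obtain ⟨z, e, a, b, c, h1, h2⟩ := D.exists_Ψ_Ψ (ptHom g) (ptHom h) fun _ => w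
  exact ⟨z, a, b, c, e.inv (0 : PUnit), by rw [h1]; rfl, by rw [h2]; rfl⟩

theorem exists_triple {g h k : D.R} (w : ob D.b g = ob D.a h) (w' : ob D.b h = ob D.a k) :
    ∃ (z : S.C) (a b c d : z ⟶ S.r₀) (x : (S.F.obj z).base), D.Ψ a b x = g ∧ D.Ψ b c x = h ∧
      D.Ψ c d x = k := by
  obtain ⟨z, e, a, b, c, h1, h2⟩ := D.exists_Ψ_Ψ (ptHom g) (ptHom h) fun _ => w
  obtain ⟨d, hd, -⟩ := D.existsUnique_Ψ c (e.hom ≫ ptHom k) fun x => by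
    rw [← D.tgt_Ψ b, h2]
    exact w'.symm
  exact ⟨z, a, b, c, d, e.inv (0 : PUnit), by rw [h1]; rfl, by rw [h2]; rfl, by rw [hd]; rfl⟩

theorem exists_single (g : D.R) : ∃ (z : S.C) (a b : z ⟶ S.r₀) (x : (S.F.obj z).base),
    D.Ψ a b x = g := by
  obtain ⟨z, e, a, b, h1⟩ := D.exists_Ψ (ptHom g)
  exact ⟨z, a, b, e.inv (0 : PUnit), by rw [h1]; rfl⟩

theorem exists_mul (g h : D.R) (w : ob D.b g = ob D.a h) : ∃ k : D.R, ∀ (z : S.C)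
    (a b c : z ⟶ S.r₀) (x), D.Ψ a b x = g → D.Ψ b c x = h → D.Ψ a c x = k := by
  obtain ⟨z, a, b, c, x, rfl, rfl⟩ := D.exists_pair w
  exact ⟨D.Ψ a c x, fun z' a' b' c' x' h1 h2 => D.Ψ_congr h1 h2⟩

/-- The product of pairs. -/
def mul (g h : D.R) (w : ob D.b g = ob D.a h) : D.R := (D.exists_mul g h w).choose

theorem mul_eq {g h : D.R} (w : ob D.b g = ob D.a h) {a b c : z ⟶ S.r₀} {x} (hg : D.Ψ a b x = g)
    (hh : D.Ψ b c x = h) : D.mul g h w = D.Ψ a c x :=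
  ((D.exists_mul g h w).choose_spec z a b c x hg hh).symm

/-- The unit pairs. -/
def one : M ⟶ D.R := obIso.inv ≫ D.Ψ (𝟙 _) (𝟙 _)

theorem one_ob (a : z ⟶ S.r₀) (x) : D.one (ob a x) = D.Ψ a a x := by
  have h := D.Ψ_natural a (𝟙 _) (𝟙 _) x
  rw [Category.comp_id] at h
  rw [h, ob_eq]
  exact congrArg (D.Ψ (𝟙 _) (𝟙 _)) (iso_inv_hom obIso (bs a x))

theorem inv_Ψ (a b : z ⟶ S.r₀) (x) : D.Ψ D.b D.a (D.Ψ a b x) = D.Ψ b a x := by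
  have h := D.Ψ_natural (D.cls a b) D.b D.a x
  rw [cls_a, cls_b] at h
  exact h.symm

theorem m_π_Ψ (a b : z ⟶ S.r₀) (q) :
    X.m (D.π (D.Ψ a b ((S.F.obj z).proj q))) (Hom.total (tor b) q) = Hom.total (tor a) q := by
  have h := D.m_π (Hom.total (S.F.map (D.cls a b)) q)
  rw [Hom.proj_tot] at h
  have ht (u : D.t ⟶ S.r₀) : Hom.total (tor u) (Hom.total (S.F.map (D.cls a b)) q) =
      Hom.total (tor (D.cls a b ≫ u)) q := by rw [tor_comp]; rfl
  rw [ht, ht, cls_a, cls_b] at h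
  exact h

theorem tgt_π_Ψ (a b : z ⟶ S.r₀) (q) :
    X.tgt (D.π (D.Ψ a b ((S.F.obj z).proj q))) = X.src (Hom.total (tor b) q) := by
  rw [D.tgt_π, D.tgt_Ψ]
  exact (Hom.proj_tot (tor b) q).symm

theorem src_π (x) : X.src (D.π x) = ob D.a x := by
  obtain ⟨z, a, b, y, rfl⟩ := D.exists_single x
  obtain ⟨q, rfl⟩ := (S.F.obj z).proj_surjSubmersion.2 y
  rw [D.src_Ψ, ← src_m (D.tgt_π_Ψ a b q), m_π_Ψ]
  exact Hom.proj_tot (tor a) q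

theorem π_Ψ_m (a b c : z ⟶ S.r₀) (x) :
    X.m (D.π (D.Ψ a b x)) (D.π (D.Ψ b c x)) = D.π (D.Ψ a c x) := by
  obtain ⟨q, rfl⟩ := (S.F.obj z).proj_surjSubmersion.2 x
  have w : X.tgt (D.π (D.Ψ a b ((S.F.obj z).proj q))) = X.src (D.π (D.Ψ b c ((S.F.obj z).proj q))) := by
    rw [D.tgt_π, D.src_π, D.tgt_Ψ, D.src_Ψ]
  refine right_cancel (k := Hom.total (tor c) q) ?_ (D.tgt_π_Ψ a c q) ?_
  · rw [tgt_m w, D.tgt_π_Ψ]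
  · rw [m_assoc w (D.tgt_π_Ψ b c q), D.m_π_Ψ, D.m_π_Ψ, D.m_π_Ψ]

theorem Ψ_gauge_left (a b : z ⟶ S.r₀) (l : smoothCircle (S.F.obj z).base) (x) :
    D.Ψ (gauge z l ≫ a) b x = D.principal.smul (l.1 x) (D.Ψ a b x) := by
  obtain ⟨c', h1, h2, h3⟩ := D.sm (D.cls a b) l
  rw [D.cls_a] at h2
  rw [D.cls_b] at h3
  rw [Ψ, ← D.eq_cls h2 h3, h1]
  rfl

/-- The groupoid of pairs of arrows to `r₀`. -/
def grpd : LieGroupoid M where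
  arr := D.R
  src := ob D.a
  tgt := ob D.b
  one := D.one
  inv := D.Ψ D.b D.a
  mul := D.mul
  src_submersion := by
    have : ob D.a = D.π ≫ X.src := Mfd.hom_ext fun x => (D.src_π x).symm
    rw [this]
    exact D.principal.surjSubmersion.1.comp X.src_submersion
  tgt_submersion := by
    have : ob D.b = D.π ≫ X.tgt := Mfd.hom_ext fun x => (D.tgt_π x).symm
    rw [this]
    exact D.principal.surjSubmersion.1.comp X.tgt_submersion
  smooth_mul T g h w := by
    obtain ⟨z, e, a, b, c, h1, h2⟩ := D.exists_Ψ_Ψ g h w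
    have : (fun x => D.mul (g x) (h x) (w x)) = fun x => (e.inv ≫ D.Ψ a c) x := by
      funext x
      refine D.mul_eq (w x) (x := e.inv x) (b := b) ?_ ?_
      · rw [h1]; exact congrArg g (iso_hom_inv e x)
      · rw [h2]; exact congrArg h (iso_hom_inv e x)
    rw [this]
    exact smooth_coe _
  src_one x := by
    refine (D.src_Ψ _ _ _).trans ?_
    rw [ob_eq, bs, CategoryTheory.Functor.map_id]
    exact iso_hom_inv obIso x
  tgt_one x := by
    refine (D.tgt_Ψ _ _ _).trans ?_
    rw [ob_eq, bs, CategoryTheory.Functor.map_id]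
    exact iso_hom_inv obIso x
  src_inv g := D.src_Ψ _ _ _
  tgt_inv g := D.tgt_Ψ _ _ _
  src_mul g h w := by
    obtain ⟨z, a, b, c, x, rfl, rfl⟩ := D.exists_pair w
    rw [D.mul_eq w rfl rfl, D.src_Ψ, D.src_Ψ]
  tgt_mul g h w := by
    obtain ⟨z, a, b, c, x, rfl, rfl⟩ := D.exists_pair w
    rw [D.mul_eq w rfl rfl, D.tgt_Ψ, D.tgt_Ψ]
  one_mul g := by
    obtain ⟨z, a, b, x, rfl⟩ := D.exists_single g
    exact D.mul_eq _ (by rw [D.src_Ψ, one_ob]) rfl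
  mul_one g := by
    obtain ⟨z, a, b, x, rfl⟩ := D.exists_single g
    exact D.mul_eq _ rfl (by rw [D.tgt_Ψ, one_ob])
  mul_inv g := by
    obtain ⟨z, a, b, x, rfl⟩ := D.exists_single g
    exact (D.mul_eq _ rfl (D.inv_Ψ a b x).symm).trans
      ((D.one_ob a x).symm.trans (congrArg D.one (D.src_Ψ a b x).symm))
  inv_mul g := by
    obtain ⟨z, a, b, x, rfl⟩ := D.exists_single g
    exact (D.mul_eq _ (D.inv_Ψ a b x).symm rfl).trans
      ((D.one_ob b x).symm.trans (congrArg D.one (D.tgt_Ψ a b x).symm))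
  mul_assoc g h k w w' := by
    obtain ⟨z, a, b, c, d, x, rfl, rfl, rfl⟩ := D.exists_triple w w'
    rw [D.mul_eq _ (D.mul_eq w rfl rfl).symm rfl, D.mul_eq _ rfl (D.mul_eq w' rfl rfl).symm]

/-- The central extension given by a representing object. -/
def extension : CentralExtension X where
  grpd := D.grpd
  π := D.π
  src_π := D.src_π
  tgt_π := D.tgt_π
  π_mul g h w := by
    obtain ⟨z, a, b, c, x, rfl, rfl⟩ := D.exists_pair w
    refine (congrArg D.π (D.mul_eq w rfl rfl)).trans ?_
    rw [← D.π_Ψ_m a b c x]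
    exact m_eq _
  principal := D.principal
  smul_mul_smul l l' g h w w' := by
    obtain ⟨z, a, b, c, x, rfl, rfl⟩ := D.exists_pair w
    -- The circle acts through the first member only. To place `l'` on `(b, c)` without changing
    -- `b`, the inverse gauge is applied to `c`; applying the gauge of `l'` to the whole of the
    -- resulting pair `(a, c)` then moves it to `a`.
    let k (l : Circle) : smoothCircle (S.F.obj z).base := ⟨fun _ => l, fun _ _ _ _ => contDiffAt_const⟩
    have hk (l l') : gauge z (k l) ≫ gauge z (k l') = gauge z (k l' * k l) :=
      (congrArg (fun α : Aut z => α.hom) ((S.band z).map_mul (k l') (k l))).symm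
    have hk' : gauge z (k l') ≫ gauge z (k l'⁻¹) = 𝟙 z := by
      rw [hk, ← gauge_one]
      exact congrArg (gauge z) (Subtype.ext (funext fun _ => inv_mul_cancel l'))
    have h1 : D.Ψ (gauge z (k l) ≫ a) b x = D.principal.smul l (D.Ψ a b x) := D.Ψ_gauge_left a b (k l) x
    have h2 : D.Ψ b (gauge z (k l'⁻¹) ≫ c) x = D.principal.smul l' (D.Ψ b c x) := by
      have h3 := D.Ψ_natural (gauge z (k l')) b (gauge z (k l'⁻¹) ≫ c) x
      rw [← Category.assoc, hk', Category.id_comp, bs_gauge] at h3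
      exact h3.symm.trans (D.Ψ_gauge_left b c (k l') x)
    refine (D.mul_eq w' h1 h2).trans ?_
    refine Eq.trans ?_ (congrArg (D.principal.smul (l * l')) (D.mul_eq w rfl rfl).symm)
    have h4 := D.Ψ_natural (gauge z (k l')) (gauge z (k l) ≫ a) (gauge z (k l'⁻¹) ≫ c) x
    rw [← Category.assoc, ← Category.assoc, hk', Category.id_comp, bs_gauge, hk] at h4
    exact h4.symm.trans (D.Ψ_gauge_left a c _ x)

/-- The central extension given by a representing object is the one of the gerbe. -/
def assoc : S.Assoc D.extension where
  Ψ a b := D.Ψ a b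
  src_Ψ a b x := D.src_Ψ a b x
  tgt_Ψ a b x := D.tgt_Ψ a b x
  natural c a b x := D.Ψ_natural c a b x
  bijective a g h := D.existsUnique_Ψ a g h
  m_Ψ a b c x := by
    have w : D.grpd.tgt (D.Ψ a b x) = D.grpd.src (D.Ψ b c x) :=
      (D.tgt_Ψ a b x).trans (D.src_Ψ b c x).symm
    exact (m_eq (Γ := D.grpd) w).trans (D.mul_eq w rfl rfl)
  π_Ψ a b q := D.m_π_Ψ a b q
  sm_Ψ a b l x := D.Ψ_gauge_left a b l x

end Rep
end StrictGerbe
end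

noncomputable section

open TopologicalSpace Topology LieGroupoid LieTorsor CentralExtension

/-- Transport of a principal circle bundle along isomorphisms of its total space and base. -/
def PrincipalCircle.congr {P B P' B' : Mfd} {π : P ⟶ B} (C : PrincipalCircle π) (e : P' ≅ P)
    (e' : B ≅ B') {π' : P' ⟶ B'} (h : π' = e.hom ≫ π ≫ e'.hom) : PrincipalCircle π' where
  smul a p := e.inv (C.smul a (e.hom p))
  one_smul p := by rw [C.one_smul, iso_inv_hom]
  mul_smul a b p := by rw [C.mul_smul, iso_hom_inv]
  proj_smul a p := by
    rw [h]
    change e'.hom (π (e.hom (e.inv _))) = e'.hom (π (e.hom p))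
    rw [iso_hom_inv, C.proj_smul]
  surjSubmersion := by
    rw [h]
    exact (isSurjSubmersion_of_isIso _).comp (C.surjSubmersion.comp (isSurjSubmersion_of_isIso _))
  smooth_smul T l p := (smooth_coe e.inv).comp (C.smooth_smul T l (p ≫ e.hom))
  simply_transitive p p' hp := by
    rw [h] at hp
    have hp' : π (e.hom p) = π (e.hom p') :=
      (iso_inv_hom e' _).symm.trans ((congrArg e'.inv hp).trans (iso_inv_hom e' _))
    obtain ⟨a, ha, hu⟩ := C.simply_transitive _ _ hp'
    refine ⟨a, (congrArg e.inv ha).trans (iso_inv_hom e p'), fun b hb => hu b ?_⟩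
    exact (iso_hom_inv e _).symm.trans (congrArg e.hom hb)
  smooth_div T p p' l hl := C.smooth_div T (p ≫ e.hom) (p' ≫ e.hom) l fun x =>
    (iso_hom_inv e _).symm.trans (congrArg e.hom (hl x))

namespace StrictGerbe

variable {M : Mfd} {X : LieGroupoid M} {S : StrictGerbe X}

/-! ### Existence of a representing object -/

/-- Over the arrows of `X`, pull `r₀` back along the source map. Its torsor also has a
trivialization along the target, obtained by dividing by the tautological arrow. The equivalence
with circle bundles turns this second trivialization into a circle bundle `B` over the arrows of
`X`, which is to be the extension. -/
theorem exists_relative_bundle : ∃ (B : CostructuredArrow CircleBundle.toMfd M) (a : S.Θ B ⟶ S.r₀)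
    (g : (S.F.obj (S.Θ B)).base ≅ X.arr), (∀ x, X.tgt (g.hom x) = Hom.base (S.θ B) x) ∧
      ∀ q, X.m (g.hom ((S.F.obj (S.Θ B)).proj q)) (Hom.total (S.θ B) q) = Hom.total (tor a) q := by
  obtain ⟨z, a, e, ha⟩ := exists_restrict S.r₀ (X.src ≫ obIso.inv)
  have hob (x) : ob a x = X.src (e.hom x) := by
    rw [ob_eq, ha, Category.assoc, Category.assoc, Iso.inv_hom_id, Category.comp_id]; rfl
  have w (q) : X.tgt (X.inv (e.hom ((S.F.obj z).proj q))) = X.src (Hom.total (tor a) q) := by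
    rw [X.tgt_inv, ← hob]
    exact (Hom.proj_tot (tor a) q).symm
  -- Left multiplication by the inverse of the tautological arrow changes the trivialization by `a`,
  -- which lies over the source, into one over the target.
  let α : S.F.obj z ⟶ X.universalTorsor :=
    { base := e.hom ≫ X.tgt
      total := homMk (fun q => X.m (X.inv (e.hom ((S.F.obj z).proj q))) (Hom.total (tor a) q))
        (smooth_m (smooth_inv (smooth_coe ((S.F.obj z).proj ≫ e.hom)))
          (smooth_coe (Hom.total (tor a))) w)
      proj_total := fun q => (src_m (w q)).trans (X.src_inv _)
      anchor_total := fun q => (tgt_m (w q)).trans (Hom.anchor_tot (tor a) q)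
      total_act := fun q h v => by
        have w' : X.tgt (Hom.total (tor a) q) = X.src h := (Hom.anchor_tot (tor a) q).trans v
        refine Eq.trans (congrArg₂ X.m (congrArg (fun y => X.inv (e.hom y))
          ((S.F.obj z).proj_act q h v)) ((Hom.total_act (tor a) q h v).trans (m_eq w').symm)) ?_
        exact (m_assoc (w q) w').symm.trans (m_eq ((tgt_m (w q)).trans w')) }
  obtain ⟨B, ε, hε, hα⟩ := S.exists_Θ z α
  have : IsIso (bs ε) := inferInstanceAs (IsIso ((S.F ⋙ (stack X).p).map ε))
  refine ⟨B, ε ≫ a, asIso (bs ε) ≪≫ e, fun x => ?_, fun q => ?_⟩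
  · exact congrArg (fun φ => Hom.base φ x) hα
  · have h1 : Hom.total (S.θ B) q = X.m (X.inv (e.hom ((S.F.obj z).proj (Hom.total (S.F.map ε) q))))
        (Hom.total (tor a) (Hom.total (S.F.map ε) q)) := (congrArg (fun φ => Hom.total φ q) hα).symm
    have h2 : (asIso (bs ε) ≪≫ e).hom ((S.F.obj (S.Θ B)).proj q) =
        e.hom ((S.F.obj z).proj (Hom.total (S.F.map ε) q)) :=
      congrArg e.hom (Hom.proj_tot _ _).symm
    rw [h1, h2, tor_comp]
    refine m_inv_m ?_
    rw [← hob]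
    exact (Hom.proj_tot (tor a) _).symm

/-- A point of the trivial bundle over `T` is a pair of `t` and `ζ`. The map to the second trivial
bundle remembers `ζ`; after rotating back by `ζ`, the injective `u` recovers `t`. -/
theorem _root_.CircleBundle.eq_of_chart {P : CircleBundle} {T N : Mfd} {C : CircleBundle}
    (u : T ⟶ C.total) (hu : Function.Injective u) (v : T ⟶ N)
    {f g : P ⟶ CircleBundle.triv T} (h : f ≫ CircleBundle.ofSec u = g ≫ CircleBundle.ofSec u)
    (h' : f ≫ CircleBundle.ofSec (P := CircleBundle.triv N) (v ≫ sec N) =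
      g ≫ CircleBundle.ofSec (P := CircleBundle.triv N) (v ≫ sec N)) : f = g := by
  have key {y y' : (CircleBundle.triv T).total}
      (h : CircleBundle.Hom.total (CircleBundle.ofSec u) y =
        CircleBundle.Hom.total (CircleBundle.ofSec u) y')
      (h' : CircleBundle.Hom.total (CircleBundle.ofSec (P := CircleBundle.triv N) (v ≫ sec N)) y =
        CircleBundle.Hom.total (CircleBundle.ofSec (P := CircleBundle.triv N) (v ≫ sec N)) y') :
      y = y' := by
    have hy := (CircleBundle.triv T).principal.quo_smul (p := sec T ((CircleBundle.triv T).proj y))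
      (p' := y) rfl
    have hy' := (CircleBundle.triv T).principal.quo_smul
      (p := sec T ((CircleBundle.triv T).proj y')) (p' := y') rfl
    have hζ : (CircleBundle.triv T).principal.quo (sec T ((CircleBundle.triv T).proj y)) y =
        (CircleBundle.triv T).principal.quo (sec T ((CircleBundle.triv T).proj y')) y' :=
      mul_right_cancel (congrArg Prod.snd h')
    have hs : (CircleBundle.triv T).proj y = (CircleBundle.triv T).proj y' := by
      refine hu ?_
      have h1 : C.principal.smul _ (u ((CircleBundle.triv T).proj y)) =
        C.principal.smul _ (u ((CircleBundle.triv T).proj y')) := h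
      rw [hζ] at h1
      have h2 := congrArg (C.principal.smul
        ((CircleBundle.triv T).principal.quo (sec T ((CircleBundle.triv T).proj y')) y')⁻¹) h1
      rwa [← C.principal.mul_smul, ← C.principal.mul_smul, inv_mul_cancel, C.principal.one_smul,
        C.principal.one_smul] at h2
    rw [← hy, ← hy', hζ, hs]
  have ht : CircleBundle.Hom.total f = CircleBundle.Hom.total g := Mfd.hom_ext fun p =>
    key (congrArg (fun k => CircleBundle.Hom.total k p) h)
      (congrArg (fun k => CircleBundle.Hom.total k p) h')
  refine CircleBundle.Hom.ext (Mfd.hom_ext fun x => ?_) ht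
  obtain ⟨p, rfl⟩ := P.principal.surjSubmersion.2 x
  rw [← CircleBundle.Hom.proj_total f, ← CircleBundle.Hom.proj_total g, ht]

/-! ### Arrows to objects given by circle bundles, from an object with an arrow to `r₀` -/

section Chart

variable {z : S.C} (b : z ⟶ S.r₀)

/-- The trivial bundle over the base of an object, with its map to `M`. -/
abbrev trivOver : CostructuredArrow CircleBundle.toMfd M :=
  CostructuredArrow.mk (S := CircleBundle.toMfd) (Y := CircleBundle.triv (S.F.obj z).base) (ob b)

/-- The map of trivial bundles below an arrow to `r₀`. -/
abbrev trivOverMap : trivOver b ⟶ trivialBundle M := secMap (B := trivialBundle M) (ob b ≫ sec M) rfl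

theorem exists_trivOver_iso : ∃ i : S.Θ (trivOver b) ⟶ z, bs i = (S.bb (trivOver b)).hom ∧
    i ≫ b = S.Θmap (trivOverMap b) :=
  exists_lift (S.Θmap (trivOverMap b)) b (S.bb (trivOver b)).hom (by
    refine (cancel_mono obIso.hom).1 ?_
    rw [Category.assoc, ← ob_eq b]
    exact S.bs_Θmap (trivOverMap b))

/-- An object with an arrow to `r₀` is given by a trivial bundle. -/
def trivOverHom : S.Θ (trivOver b) ⟶ z := (exists_trivOver_iso b).choose

theorem bs_trivOverHom : bs (trivOverHom b) = (S.bb (trivOver b)).hom :=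
  (exists_trivOver_iso b).choose_spec.1

theorem trivOverHom_comp : trivOverHom b ≫ b = S.Θmap (trivOverMap b) :=
  (exists_trivOver_iso b).choose_spec.2

instance : IsIso (trivOverHom b) :=
  isIso_of_isIso_bs _ (by rw [bs_trivOverHom]; exact inferInstanceAs (IsIso (S.bb (trivOver b)).hom))

theorem F_trivOverHom : S.F.map (trivOverHom b) ≫ tor b = S.θ (trivOver b) := by
  rw [← tor_comp, trivOverHom_comp, tor, S.F_Θmap]

variable {b} {B : CostructuredArrow CircleBundle.toMfd M}

/-- The source is given by a trivial bundle and `γ` respects the trivializations, so by fullness `γ`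
comes from a map of bundles; a map from a trivial bundle is the same as its value on the unit
section. -/
theorem exists_secMap (γ : z ⟶ S.Θ B) (h : S.F.map γ ≫ S.θ B = tor b) :
    ∃ (ψ : (S.F.obj z).base ⟶ B.left.total) (w : (ψ ≫ B.left.proj) ≫ B.hom = ob b),
      trivOverHom b ≫ γ = S.Θmap (secMap ψ w : trivOver b ⟶ B) := by
  obtain ⟨f, hf⟩ := S.exists_Θmap (trivOverHom b ≫ γ) (by
    rw [S.F.map_comp, Category.assoc, h, F_trivOverHom])
  let ψ : (S.F.obj z).base ⟶ B.left.total := sec _ ≫ CircleBundle.Hom.total f.left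
  have hb : CircleBundle.Hom.base f.left = ψ ≫ B.left.proj :=
    Mfd.hom_ext fun x => (CircleBundle.Hom.proj_total f.left (sec _ x)).symm
  have w : (ψ ≫ B.left.proj) ≫ B.hom = ob b := by
    rw [← hb]; exact CostructuredArrow.w f
  refine ⟨ψ, w, hf.symm.trans (congrArg S.Θmap ?_)⟩
  exact CommaMorphism.ext (CircleBundle.hom_ext_sec fun x => (CircleBundle.ofSec_sec ψ x).symm)
    (Subsingleton.elim _ _)

/-- The arrow to the chart of a circle bundle given by a map to its total space. -/
def chartHom (ψ : (S.F.obj z).base ⟶ B.left.total) (w : (ψ ≫ B.left.proj) ≫ B.hom = ob b) :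
    z ⟶ S.Θ (bundleChart B) :=
  inv (trivOverHom b) ≫ S.Θmap (secMap (B := bundleChart B) (ψ ≫ sec _) w : trivOver b ⟶ _)

variable (ψ : (S.F.obj z).base ⟶ B.left.total) (w : (ψ ≫ B.left.proj) ≫ B.hom = ob b)

theorem bs_chartHom (x) : bs (chartHom ψ w) x = S.bp B (ψ x) := by
  obtain ⟨y, rfl⟩ : ∃ y, bs (trivOverHom b) y = x :=
    ⟨(S.bb (trivOver b)).inv x, by rw [bs_trivOverHom]; exact iso_hom_inv (S.bb (trivOver b)) x⟩
  rw [← comp_bs, chartHom, IsIso.hom_inv_id_assoc, bs_trivOverHom]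
  refine (iso_inv_hom (S.bb (bundleChart B)) _).symm.trans
    (congrArg (S.bb (bundleChart B)).inv ?_)
  exact ConcreteCategory.congr_hom
    (S.bs_Θmap (secMap (B := bundleChart B) (ψ ≫ sec _) w : trivOver b ⟶ _)) y

theorem chartHom_bk : trivOverHom b ≫ chartHom ψ w ≫ S.bk B = S.Θmap (secMap ψ w : trivOver b ⟶ B) := by
  rw [chartHom, Category.assoc, IsIso.hom_inv_id_assoc, ← S.Θmap_comp]
  refine congrArg S.Θmap (CommaMorphism.ext (CircleBundle.hom_ext_sec fun x => ?_)
    (Subsingleton.elim _ _))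
  refine (congrArg (CircleBundle.Hom.total (bundleChartMap B).left)
    (CircleBundle.ofSec_sec (P := (bundleChart B).left) (ψ ≫ sec _) x)).trans ?_
  exact (CircleBundle.ofSec_sec (𝟙 _) (ψ x)).trans (CircleBundle.ofSec_sec ψ x).symm

theorem chartHom_ba : chartHom ψ w ≫ S.ba B = b := by
  refine (cancel_epi (trivOverHom b)).1 ?_
  rw [chartHom, Category.assoc, IsIso.hom_inv_id_assoc, ← S.Θmap_comp, trivOverHom_comp]
  refine congrArg S.Θmap (CommaMorphism.ext (CircleBundle.hom_ext_sec fun x => ?_)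
    (Subsingleton.elim _ _))
  refine (congrArg (CircleBundle.Hom.total (bundleChartTriv B).left)
    (CircleBundle.ofSec_sec (P := (bundleChart B).left) (ψ ≫ sec _) x)).trans ?_
  refine (CircleBundle.ofSec_sec (P := CircleBundle.triv M) ((B.left.proj ≫ B.hom) ≫ sec M)
    (ψ x)).trans ?_
  refine Eq.trans ?_ (CircleBundle.ofSec_sec (P := CircleBundle.triv M) (ob b ≫ sec M) x).symm
  exact congrArg (sec M) (ConcreteCategory.congr_hom w x)

/-- Transported to the trivial bundle, the gauge becomes a rotation by compatibility of the
trivialization with the bands, and rotating the trivial bundle rotates the image `ψ` of its unit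
section. -/
theorem chartHom_gauge (l : smoothCircle (S.F.obj z).base)
    (w' : (homMk (fun x => B.left.principal.smul (l.1 x) (ψ x))
      (B.left.principal.smooth_smul _ l ψ) ≫ B.left.proj) ≫ B.hom = ob b) :
    chartHom _ w' ≫ S.bk B = gauge z l ≫ chartHom ψ w ≫ S.bk B := by
  refine (cancel_epi (trivOverHom b)).1 ?_
  rw [chartHom_bk]
  have h1 : trivOverHom b ≫ gauge z l =
      gauge _ (smoothCircle.pullback (S.bb (trivOver b)).hom l) ≫ trivOverHom b := by
    rw [← bs_trivOverHom]
    exact S.band_natural (trivOverHom b) l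
  rw [← Category.assoc, h1, Category.assoc, chartHom_bk]
  refine Eq.trans ?_ (congrArg (· ≫ _) (S.Θmap_gauge (B := trivOver b) l))
  rw [← S.Θmap_comp]
  refine congrArg S.Θmap (CommaMorphism.ext (CircleBundle.hom_ext_sec fun x => ?_)
    (Subsingleton.elim _ _))
  refine (CircleBundle.ofSec_sec _ x).trans ?_
  refine Eq.trans ?_ (CircleBundle.Hom.total_smul (CircleBundle.ofSec ψ) (l.1 x) (sec _ x)).symm
  exact congrArg (B.left.principal.smul (l.1 x)) (CircleBundle.ofSec_sec ψ x).symm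

end Chart

theorem tgt_tor_unitSec {z : S.C} (a b : z ⟶ S.r₀) (q : (S.F.obj z).total) :
    X.tgt (Hom.total (tor a) (unitSec b ((S.F.obj z).proj q))) = X.src (Hom.total (tor b) q) := by
  refine (Hom.anchor_tot (tor a) _).trans ((Hom.anchor_tot (tor b) _).symm.trans ?_)
  refine (congrArg X.tgt (tor_unitSec b _)).trans ((X.tgt_one _).trans ?_)
  exact (Hom.proj_tot (tor b) q).symm

/-- Measured from the point where `b` is a unit, every other point `q` of the fibre is reached by
the arrow `tor b q`; the equivariance of `tor a` gives the product. -/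
theorem m_tor_unitSec {z : S.C} (a b : z ⟶ S.r₀) (q : (S.F.obj z).total) :
    X.m (Hom.total (tor a) (unitSec b ((S.F.obj z).proj q))) (Hom.total (tor b) q) =
      Hom.total (tor a) q := by
  have e := proj_unitSec b ((S.F.obj z).proj q)
  have hd (c : z ⟶ S.r₀) : X.m (Hom.total (tor c) (unitSec b ((S.F.obj z).proj q)))
      ((S.F.obj z).div (unitSec b ((S.F.obj z).proj q)) q) = Hom.total (tor c) q := by
    have w : X.tgt (Hom.total (tor c) (unitSec b ((S.F.obj z).proj q))) =
        X.src ((S.F.obj z).div (unitSec b ((S.F.obj z).proj q)) q) :=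
      (Hom.anchor_tot (tor c) _).trans (src_div e).symm
    refine (m_eq w).trans ((a_eq (P := X.universalTorsor) w).symm.trans ?_)
    exact (Hom.total_a (tor c) _ _).symm.trans (congrArg (Hom.total (tor c)) (a_div e))
  have hb : (S.F.obj z).div (unitSec b ((S.F.obj z).proj q)) q = Hom.total (tor b) q := by
    refine Eq.trans ?_ (hd b)
    rw [tor_unitSec]
    refine (one_m ((src_div e).trans ?_)).symm
    refine (Hom.anchor_tot (tor b) _).symm.trans ?_
    exact (congrArg X.tgt (tor_unitSec b _)).trans (X.tgt_one _)
  rw [← hb]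
  exact hd a

/-- The two torsor maps to the universal torsor determine the arrow of `X` between them by
cancellation, hence the map of bases through `g`; the rest is uniqueness of cartesian lifts along
`a`. -/
theorem right_factor_unique {B : CostructuredArrow CircleBundle.toMfd M} {a : S.Θ B ⟶ S.r₀}
    {g : (S.F.obj (S.Θ B)).base ≅ X.arr} (hg : ∀ x, X.tgt (g.hom x) = Hom.base (S.θ B) x)
    (hm : ∀ q, X.m (g.hom ((S.F.obj (S.Θ B)).proj q)) (Hom.total (S.θ B) q) = Hom.total (tor a) q)
    {z : S.C} {γ γ' : z ⟶ S.Θ B} (h : γ ≫ a = γ' ≫ a)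
    (h' : S.F.map γ ≫ S.θ B = S.F.map γ' ≫ S.θ B) : γ = γ' := by
  refine lift_unique a (Mfd.hom_ext fun x => ?_) h
  obtain ⟨q, rfl⟩ := (S.F.obj z).proj_surjSubmersion.2 x
  have e (γ : z ⟶ S.Θ B) : X.m (g.hom (bs γ ((S.F.obj z).proj q)))
      (Hom.total (S.F.map γ ≫ S.θ B) q) = Hom.total (tor (γ ≫ a)) q := by
    rw [tor_comp, bs, ← Hom.proj_tot]
    exact hm _
  have w (γ : z ⟶ S.Θ B) : X.tgt (g.hom (bs γ ((S.F.obj z).proj q))) =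
      X.src (Hom.total (S.F.map γ ≫ S.θ B) q) := by
    rw [hg]
    exact (Hom.proj_tot (S.F.map γ ≫ S.θ B) q).symm
  have e' := (e γ).trans ((congrArg (fun a => Hom.total (tor a) q) h).trans (e γ').symm)
  have w' := w γ
  rw [h'] at e' w'
  have := right_cancel w' (w γ') e'
  exact (iso_inv_hom g _).symm.trans ((congrArg g.inv this).trans (iso_inv_hom g _))

/-- Pairs of arrows to `r₀` are representable. -/
theorem nonempty_rep (S : StrictGerbe X) : Nonempty S.Rep := by
  obtain ⟨B, a, g, hg, hm⟩ := exists_relative_bundle (S := S)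
  have hba : tor (S.ba B) = S.F.map (S.bk B) ≫ S.θ B := by
    rw [tor, S.F_Θmap, S.F_Θmap]
  have hFc {z : S.C} (c : z ⟶ S.Θ (bundleChart B)) : S.F.map (c ≫ S.bk B) ≫ S.θ B =
      tor (c ≫ S.ba B) := by
    rw [tor_comp, hba, S.F.map_comp, Category.assoc]
  -- The second projection presents both arrows by maps from a trivial bundle to the chart of `B`.
  -- Their images in `B` and in the trivial bundle over `M` are known, and `eq_of_chart` separates
  -- such maps.
  have huniq {z : S.C} {c c' : z ⟶ S.Θ (bundleChart B)} (h : c ≫ S.bk B ≫ a = c' ≫ S.bk B ≫ a)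
      (h' : c ≫ S.ba B = c' ≫ S.ba B) : c = c' := by
    have hk : c ≫ S.bk B = c' ≫ S.bk B := right_factor_unique hg hm
      (by rw [Category.assoc, h, Category.assoc]) (by rw [hFc, hFc, h'])
    refine (cancel_epi (trivOverHom (c ≫ S.ba B))).1 ?_
    have hex {c₁ : z ⟶ S.Θ (bundleChart B)} (h₁ : c ≫ S.ba B = c₁ ≫ S.ba B) :
        ∃ f, S.Θmap f = trivOverHom (c ≫ S.ba B) ≫ c₁ := S.exists_Θmap _ (by
      have : S.θ (bundleChart B) = tor (S.ba B) := (S.F_Θmap _).symm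
      rw [this, S.F.map_comp, Category.assoc, ← tor_comp, ← h₁, F_trivOverHom])
    obtain ⟨f, hf⟩ := hex rfl
    obtain ⟨f', hf'⟩ := hex h'
    rw [← hf, ← hf']
    refine congrArg S.Θmap (CommaMorphism.ext ?_ (Subsingleton.elim _ _))
    refine CircleBundle.eq_of_chart (𝟙 B.left.total) (fun _ _ e => e) (B.left.proj ≫ B.hom) ?_ ?_
    · refine congrArg CommaMorphism.left (?_ : f ≫ bundleChartMap B = f' ≫ bundleChartMap B)
      refine S.Θmap_injective ?_
      rw [S.Θmap_comp, S.Θmap_comp, hf, hf', Category.assoc, Category.assoc, hk]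
    · refine congrArg CommaMorphism.left (?_ : f ≫ bundleChartTriv B = f' ≫ bundleChartTriv B)
      refine S.Θmap_injective ?_
      rw [S.Θmap_comp, S.Θmap_comp, hf, hf', Category.assoc, Category.assoc, h']
  have hbk : bs (S.bk B) = (S.bb (bundleChart B)).hom ≫ B.left.proj ≫ (S.bb B).inv := by
    have := S.bs_Θmap (bundleChartMap B)
    refine ((Iso.eq_comp_inv _).2 this).trans ?_
    rfl
  -- The representing object lives over the total space of `B`: it is given by the tautologically
  -- trivialized pullback of `B`. Its second arrow to `r₀` is that trivialization, and its first is
  -- the projection to `S.Θ B` followed by `a`. Its projection to `X` is the bundle projection, up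
  -- to identification of bases.
  refine ⟨{
    t := S.Θ (bundleChart B)
    a := S.bk B ≫ a
    b := S.ba B
    univ := fun {z} a' b' => ?_
    π := bs (S.bk B) ≫ g.hom
    tgt_π := fun x => ?_
    m_π := fun q => ?_
    principal := B.left.principal.congr (S.bb (bundleChart B)) ((S.bb B).symm ≪≫ g) (by
      rw [hbk]; rfl)
    sm := fun {z} c l => ?_ }⟩
  -- The arrow of `X` between the torsor maps of `b'` and `a'` prescribes the point below. It gives
  -- a lift `γ` of `a'` through `a` which respects the trivialization by `b'`; such a `γ` is a map
  -- `ψ` to the total space of `B`, which determines the required arrow.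
  · let δ : (S.F.obj z).base ⟶ X.arr := unitSec b' ≫ Hom.total (tor a')
    have hsrc (x) : X.src (δ x) = ob a' x := by
      refine (Hom.proj_tot (tor a') _).trans ?_
      exact congrArg (ob a') (proj_unitSec b' x)
    have wg (x) (q : (S.F.obj (S.Θ B)).total) (hq : (S.F.obj (S.Θ B)).proj q = x) :
        X.tgt (g.hom x) = X.src (Hom.total (S.θ B) q) := by
      rw [hg, ← hq]
      exact (Hom.proj_tot (S.θ B) q).symm
    have hoba (x) : ob a x = X.src (g.hom x) := by
      obtain ⟨q, rfl⟩ := (S.F.obj (S.Θ B)).proj_surjSubmersion.2 x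
      exact (Hom.proj_tot (tor a) q).symm.trans
        ((congrArg X.src (hm q)).symm.trans (src_m (wg _ q rfl)))
    obtain ⟨γ, hγ, hγa⟩ := exists_lift a' a (δ ≫ g.inv) (Assoc.ob_eq_iff.2 (Mfd.hom_ext fun x =>
        (hsrc x).symm.trans (((hoba _).trans (congrArg X.src (iso_hom_inv g (δ x)))).symm)))
    obtain ⟨ψ, w, hψ⟩ := exists_secMap (b := b') γ (by
      have ht (q) : Hom.total (S.F.map γ ≫ S.θ B) q = Hom.total (tor b') q := by
        have e1 : g.hom ((S.F.obj (S.Θ B)).proj (Hom.total (S.F.map γ) q)) =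
            δ ((S.F.obj z).proj q) := by
          refine (congrArg g.hom ((Hom.proj_tot (S.F.map γ) q).trans
            (ConcreteCategory.congr_hom hγ _))).trans ?_
          exact iso_hom_inv g _
        have e2 := hm (Hom.total (S.F.map γ) q)
        have e3 : Hom.total (tor a) (Hom.total (S.F.map γ) q) = Hom.total (tor a') q := by
          rw [← hγa, tor_comp]; rfl
        have w1 := wg _ (Hom.total (S.F.map γ) q) rfl
        rw [e1] at e2 w1
        exact left_cancel w1 (tgt_tor_unitSec a' b' q)
          (e2.trans (e3.trans (m_tor_unitSec a' b' q).symm))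
      refine LieTorsor.hom_ext (Mfd.hom_ext fun x => ?_) (Mfd.hom_ext ht)
      obtain ⟨q, rfl⟩ := (S.F.obj z).proj_surjSubmersion.2 x
      exact (Hom.proj_tot (S.F.map γ ≫ S.θ B) q).symm.trans
        ((congrArg X.src (ht q)).trans (Hom.proj_tot (tor b') q)))
    have hc : chartHom ψ w ≫ S.bk B = γ := by
      refine (cancel_epi (trivOverHom b')).1 ?_
      rw [chartHom_bk, hψ]
    refine ⟨chartHom ψ w, ⟨?_, chartHom_ba ψ w⟩, fun c' ⟨h1, h2⟩ => huniq ?_ ?_⟩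
    · rw [← Category.assoc, hc, hγa]
    · rw [h1, ← Category.assoc, hc, hγa]
    · rw [h2, chartHom_ba]
  · rw [ConcreteCategory.comp_apply, hg]
    exact (congrArg (fun φ => Hom.base φ x) hba).symm
  · have h := hm (Hom.total (S.F.map (S.bk B)) q)
    rw [Hom.proj_tot] at h
    rw [hba, tor_comp]
    exact h
  -- Any arrow to the representing object has the form `chartHom ψ w`. Rotating `ψ` keeps the second
  -- arrow to `r₀` and gauges the first.
  · obtain ⟨ψ, w, hψ⟩ := exists_secMap (b := c ≫ S.ba B) (c ≫ S.bk B) (hFc c)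
    have hck : chartHom ψ w ≫ S.bk B = c ≫ S.bk B := by
      refine (cancel_epi (trivOverHom (c ≫ S.ba B))).1 ?_
      rw [chartHom_bk, hψ]
    have hc : chartHom ψ w = c := huniq (by rw [← Category.assoc, hck, Category.assoc])
      (chartHom_ba ψ w)
    have w' : (homMk (fun x => B.left.principal.smul (l.1 x) (ψ x))
        (B.left.principal.smooth_smul _ l ψ) ≫ B.left.proj) ≫ B.hom = ob (c ≫ S.ba B) := by
      rw [← w]
      exact Mfd.hom_ext fun x => congrArg B.hom (B.left.principal.proj_smul _ _)
    refine ⟨chartHom _ w', fun x => ?_, ?_, chartHom_ba _ w'⟩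
    · rw [bs_chartHom, ← hc, bs_chartHom]
      exact congrArg (fun y => S.bp B (B.left.principal.smul (l.1 x) y))
        (iso_hom_inv (S.bb (bundleChart B)) (ψ x)).symm
    · rw [← Category.assoc, chartHom_gauge ψ w l w', hc, Category.assoc, Category.assoc]

end StrictGerbe
end

/-! ### The bijection on isomorphism classes -/

noncomputable section

variable {M : Mfd} {X : LieGroupoid M}

theorem exists_association (G : TrivializedGerbe X) :
    ∃ E : CentralExtension X, Nonempty (Association E G) := by
  obtain ⟨S, rfl⟩ := G.exists_strict
  obtain ⟨D⟩ := S.nonempty_rep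
  exact ⟨D.extension, ⟨D.assoc.toAssociation⟩⟩

namespace Association

variable {E E' : CentralExtension X} {G G' : TrivializedGerbe X}

theorem nonempty_extensionIso (A : Association E G) (A' : Association E' G) :
    Nonempty (E.Iso E') := by
  obtain ⟨S, rfl⟩ := G.exists_strict
  obtain ⟨B⟩ := StrictGerbe.exists_assoc A
  obtain ⟨B'⟩ := StrictGerbe.exists_assoc A'
  exact B.nonempty_iso B'

theorem nonempty_gerbeIso (A : Association E G) : Nonempty (G.Iso E.gerbe) := by
  obtain ⟨S, rfl⟩ := G.exists_strict
  obtain ⟨B⟩ := StrictGerbe.exists_assoc A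
  exact ⟨B.gerbeIso⟩

theorem of_extensionIso (A : Association E G) (I : E.Iso E') : Nonempty (Association E' G) := by
  obtain ⟨S, rfl⟩ := G.exists_strict
  obtain ⟨B⟩ := StrictGerbe.exists_assoc A
  exact ⟨(B.ofIso I).toAssociation⟩

theorem of_gerbeIso (A : Association E G) (I : G.Iso G') : Nonempty (Association E G') := by
  obtain ⟨S, rfl⟩ := G.exists_strict
  obtain ⟨S', rfl⟩ := G'.exists_strict
  obtain ⟨B⟩ := StrictGerbe.exists_assoc A
  obtain ⟨B'⟩ := StrictGerbe.exists_assoc_of_iso I B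
  exact ⟨B'.toAssociation⟩

theorem iff_of_gerbeIso (E : CentralExtension X) (I : G.Iso G') :
    Nonempty (Association E G) ↔ Nonempty (Association E G') := by
  refine ⟨fun ⟨A⟩ => A.of_gerbeIso I, fun ⟨A⟩ => ?_⟩
  -- The isomorphism of gerbes is not inverted. Some extension `E'` is associated with `G`, hence
  -- also with `G'`, and uniqueness of the extension of `G'` identifies it with `E`.
  obtain ⟨E', ⟨A'⟩⟩ := exists_association G
  obtain ⟨A''⟩ := A'.of_gerbeIso I
  obtain ⟨J⟩ := A''.nonempty_extensionIso A
  exact A'.of_extensionIso J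

/-- Equality of classes means the equivalence relation generated by isomorphism. An equivalence of
propositions is reflexive, symmetric and transitive, so no such property of isomorphisms has to be
established. -/
theorem iff_of_mk_eq (E : CentralExtension X)
    (h : (Quot.mk _ G : GerbeClass X) = Quot.mk _ G') :
    Nonempty (Association E G) ↔ Nonempty (Association E G') := by
  have key : Relation.EqvGen (fun G G' : TrivializedGerbe X => Nonempty (G.Iso G')) G G' :=
    Quot.eqvGen_exact h
  clear h
  induction key with
  | rel _ _ h => exact iff_of_gerbeIso E h.some
  | refl _ => exact Iff.rfl
  | symm _ _ _ ih => exact ih.symm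
  | trans _ _ _ _ _ ih ih' => exact ih.trans ih'

theorem mk_gerbe_eq (A : Association E G) : (Quot.mk _ E.gerbe : GerbeClass X) = Quot.mk _ G :=
  (Quot.sound A.nonempty_gerbeIso).symm

end Association

/-- The class of the gerbe of an extension depends only on the class of the extension. -/
def gerbeClassOf : ExtensionClass X → GerbeClass X :=
  Quot.lift (fun E => Quot.mk _ E.gerbe) fun E E' ⟨I⟩ => by
    obtain ⟨A⟩ := E.association.of_extensionIso I
    exact A.mk_gerbe_eq.symm

theorem gerbeClassOf_eq_iff (E : CentralExtension X) (G : TrivializedGerbe X) :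
    gerbeClassOf (Quot.mk _ E) = Quot.mk _ G ↔ Nonempty (Association E G) :=
  ⟨fun h => (Association.iff_of_mk_eq E h).1 ⟨E.association⟩, fun ⟨A⟩ => A.mk_gerbe_eq⟩

/-- Injectivity is the uniqueness of the extension associated with a gerbe, and surjectivity is the
existence of one. -/
theorem gerbeClassOf_bijective : Function.Bijective (gerbeClassOf (X := X)) := by
  constructor
  · rintro ⟨E⟩ ⟨E'⟩ h
    obtain ⟨A⟩ := (gerbeClassOf_eq_iff E E'.gerbe).1 h
    exact Quot.sound (A.nonempty_extensionIso E'.association)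
  · rintro ⟨G⟩
    obtain ⟨E, hE⟩ := exists_association G
    exact ⟨Quot.mk _ E, (gerbeClassOf_eq_iff E G).2 hE⟩

end

theorem mainTheorem4 {M : Mfd} (X : LieGroupoid M) :
    ∃ Φ : ExtensionClass X ≃ GerbeClass X,
      ∀ (E : CentralExtension X) (G : TrivializedGerbe X),
        Φ (Quot.mk _ E) = Quot.mk _ G ↔ Nonempty (Association E G) :=
  ⟨Equiv.ofBijective gerbeClassOf gerbeClassOf_bijective, gerbeClassOf_eq_iff⟩
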